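/- Let $\mathbf k$ be a field and $I$ a finite set; let ${\rm dgvs}$ be the category of differential graded $\mathbf k$-vector spaces. Let $\mathcal T_I$ be the category whose objects are the (isomorphism classes of) rooted trees with leaves labelled bijectively by $I$, with at least one vertex and at least two incoming edges at each vertex, and with exactly one morphism $t\to s$ if $s=t/E$ is obtained from $t$ by contracting a (then unique) set $E$ of internal edges, and none otherwise. Left and right $\mathcal T_I$-modules are covariant and contravariant functors $\mathcal T_I\to{\rm dgvs}$; write $E_*$ and $E^*$ for the action of $E:t\to t/E$. For a right module $R$ and a left module $L$, the bar construction $B(R,\mathcal T_I,L)$ is the simplicial object of ${\rm dgvs}$ with $$B_n(R,\mathcal T_I,L)=\bigoplus_{t}\ \bigoplus_{E_1\sqcup\dots\sqcup E_n=E\subseteq E_t}R(t/E)\otimes(E_1,\dots,E_n)\otimes L(t),$$ where $E_t$ is the set of internal edges of $t$, the face $d_0$ lets $E_1$ act on $R$ by $(E_1)^*$, $d_n$ lets $E_n$ act on $L$ by $(E_n)_*$, $d_i$ for $0<i<n$ replaces $E_i,E_{i+1}$ by $E_i\sqcup E_{i+1}$, and degeneracies insert $\emptyset$. A connected species is a contravariant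 functor $M$ from finite sets and bijections to ${\rm dgvs}$ with $M(\emptyset)=0$ and $M(\{x\})=\mathbf k$ (morphisms are the identity on $M(\{x\})$); a connected operad is an operad (given by partial compositions $\circ_i$ and units, with Koszul signs) whose species is connected, with $\mathbf k=P(\{x\})$ given by the unit. For a species $M$ and $t\in\mathcal T_I$ put $M(t)=\bigotimes_{v}M({\rm In}(v))$, over the vertices $v$ of $t$, where ${\rm In}(v)$ is the set of incoming edges of $v$. Then: 1. For every connected operad $P$, there is exactly one left $\mathcal T_I$-module structure on $t\mapsto P(t)$ for which the contraction of a single internal edge $e$ acts by the partial composition $\circ_e$ on the two factors at the ends of $e$ and by the identity on the others. 2. The forgetful functor from connected operads to connected species has a left adjoint. Let $\mathcal F$ be the resulting monad (the free operad monad). For $t'\to t=t'/E$ in $\mathcal T_I$ let $m\mapsto(t',E,m)$ denote the map $M(t')\to(\mathcal F M)(t)$ that applies the unit $M\to\mathcal F M$ at each vertex and then composes along $E$ in the operad $\mathcal FM$. These maps induce an isomorphism $\bigoplus_{t'\to t}M(t')\cong(\mathcal FM)(t)$. 3. For every right $\mathcal T_I$-module $R$, the functor $\pi_I(R):M\mapsto\bigoplus_{t\in\mathcal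 T_I}M(t)\otimes R(t)$ is an $\mathcal F$-functor: there is a natural transformation $\lambda:\pi_I(R)\mathcal F\Rightarrow\pi_I(R)$, compatible with the unit and the multiplication of $\mathcal F$, with $\lambda_M((t',E,m)\otimes r)=m\otimes E^*(r)\in M(t')\otimes R(t')$ for $m\in M(t')$, $r\in R(t)$, $t=t'/E$. 4. For every such $R$ and every connected operad $P$, regarded as an $\mathcal F$-algebra through the counit of the adjunction and as a left $\mathcal T_I$-module through 1, the monadic two-sided bar construction $B(\pi_I(R),\mathcal F,P)$, equal to $\pi_I(R)\mathcal F^nP$ in degree $n$ with faces given by $\lambda$, the multiplication of $\mathcal F$ and the algebra structure of $P$, and degeneracies given by the unit of $\mathcal F$, coincides with $B(R,\mathcal T_I,P)$: the maps $$B_n(R,\mathcal T_I,P)\to\pi_I(R)\mathcal F^nP,\qquad r\otimes(E_1,\dots,E_n)\otimes p\mapsto(-1)^{|r||p|}(t;E_1,\dots,E_n,p)\otimes r$$ ($r\in R(t/(E_1\sqcup\dots\sqcup E_n))$, $p\in P(t)$) are isomorphisms of complexes commuting with all faces and degeneracies. Here $(t;E_1,\dots,E_n,p)\in(\mathcal F^nP)(t/(E_1\sqcup\dots\sqcup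 E_n))$ is obtained from $p$ by applying successively the maps $x\mapsto(t',E,x)$ of 2 for $E=E_n,E_{n-1},\dots,E_1$. -/

import Mathlib

open CategoryTheory MonoidalCategory Limits Opposite
open scoped TensorProduct DirectSum

noncomputable section

namespace TreeBar

universe u

/-! ## Differential graded vector spaces -/

/-- Differential graded vector spaces over `k`: unbounded complexes, with Mathlib's tensor
product (`d (x ⊗ y) = d x ⊗ y + (-1) ^ |x| x ⊗ d y`). -/
abbrev DGVS (k : Type u) [Field k] := CochainComplex (ModuleCat.{u} k) ℤ

variable {k : Type u} [Field k]

/-- The direct sum of all the components of a complex. -/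
abbrev Tot (X : DGVS k) : Type u := DirectSum ℤ (fun i => (X.X i : Type u))

/-- A homogeneous element of degree `i`, as an element of the total space. -/
def Tot.of (X : DGVS k) (i : ℤ) : X.X i →ₗ[k] Tot X := DirectSum.lof k ℤ (fun i => (X.X i : Type u)) i

/-- The map of total spaces induced by a morphism of complexes. -/
def Tot.map {X Y : DGVS k} (f : X ⟶ Y) : Tot X →ₗ[k] Tot Y :=
  DirectSum.toModule k ℤ _ (fun i => Tot.of Y i ∘ₗ (f.f i).hom)

/-- The differential on the total space. -/
def Tot.d (X : DGVS k) : Tot X →ₗ[k] Tot X :=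
  DirectSum.toModule k ℤ _ (fun i => Tot.of X (i + 1) ∘ₗ (X.d i (i + 1)).hom)

/-- The operator `x ↦ (-1) ^ |x| x` on the total space. -/
def Tot.parity (X : DGVS k) : Tot X →ₗ[k] Tot X :=
  DirectSum.toModule k ℤ _ (fun i => i.negOnePow • Tot.of X i)

/-- The bilinear map `(x, y) ↦ c (x ⊗ y)` of total spaces given by a morphism `c : X ⊗ Y ⟶ Z`. -/
def Tot.bil {X Y Z : DGVS k} (c : X ⊗ Y ⟶ Z) : Tot X →ₗ[k] Tot Y →ₗ[k] Tot Z :=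
  DirectSum.toModule k ℤ _ (fun p => LinearMap.flip (DirectSum.toModule k ℤ _ (fun q =>
    LinearMap.flip ((TensorProduct.mk k (X.X p) (Y.X q)).compr₂
      (Tot.of Z (p + q) ∘ₗ
        (HomologicalComplex.ιTensorObj X Y p q (p + q) rfl ≫ c.f (p + q)).hom)))))

/-- `f : X ⊗ Y ⟶ Z` is `g : Y ⊗ X ⟶ Z` precomposed with the symmetry
`x ⊗ y ↦ (-1) ^ (|x| |y|) y ⊗ x`. -/
def IsSwapOf {X Y Z : DGVS k} (f : X ⊗ Y ⟶ Z) (g : Y ⊗ X ⟶ Z) : Prop :=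
  ∀ (p q : ℤ) (x : X.X p) (y : Y.X q),
    Tot.bil f (Tot.of X p x) (Tot.of Y q y) =
      (p * q).negOnePow • Tot.bil g (Tot.of Y q y) (Tot.of X p x)

lemma Tot.map_of {X Y : DGVS k} (f : X ⟶ Y) (i : ℤ) (x : X.X i) :
    Tot.map f (Tot.of X i x) = Tot.of Y i ((f.f i).hom x) := by
  simp [Tot.map, Tot.of]

lemma Tot.d_of (X : DGVS k) (i : ℤ) (x : X.X i) :
    Tot.d X (Tot.of X i x) = Tot.of X (i + 1) ((X.d i (i + 1)).hom x) := by
  simp [Tot.d, Tot.of]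

lemma Tot.parity_of (X : DGVS k) (i : ℤ) (x : X.X i) :
    Tot.parity X (Tot.of X i x) = i.negOnePow • Tot.of X i x := by
  simp [Tot.parity, Tot.of]

lemma Tot.hom_ext {X : DGVS k} {N : Type*} [AddCommMonoid N] [Module k N]
    {f g : Tot X →ₗ[k] N} (h : ∀ i x, f (Tot.of X i x) = g (Tot.of X i x)) : f = g :=
  DirectSum.linearMap_ext k (fun i => LinearMap.ext (fun x => h i x))

lemma Tot.d_d (X : DGVS k) : Tot.d X ∘ₗ Tot.d X = 0 := by
  refine Tot.hom_ext (fun i x => ?_)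
  have h := X.d_comp_d i (i + 1) (i + 1 + 1)
  have h' := congrArg (fun φ => φ.hom x) h
  simp only [ModuleCat.hom_comp, LinearMap.comp_apply] at h'
  simp only [LinearMap.comp_apply, Tot.d_of]
  rw [h']
  simp

lemma Tot.parity_d (X : DGVS k) : Tot.parity X ∘ₗ Tot.d X = - (Tot.d X ∘ₗ Tot.parity X) := by
  refine Tot.hom_ext (fun i x => ?_)
  simp only [LinearMap.comp_apply, LinearMap.neg_apply, Tot.d_of, Tot.parity_of]
  rw [Int.negOnePow_succ, Units.smul_def, Units.smul_def, map_zsmul, Tot.d_of]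
  simp

lemma Tot.map_d {X Y : DGVS k} (f : X ⟶ Y) : Tot.map f ∘ₗ Tot.d X = Tot.d Y ∘ₗ Tot.map f := by
  refine Tot.hom_ext (fun i x => ?_)
  have h := congrArg (fun φ => φ.hom x) (f.comm i (i + 1))
  simp only [ModuleCat.hom_comp, LinearMap.comp_apply] at h
  simp only [LinearMap.comp_apply, Tot.d_of, Tot.map_of, h]

lemma Tot.map_parity {X Y : DGVS k} (f : X ⟶ Y) :
    Tot.map f ∘ₗ Tot.parity X = Tot.parity Y ∘ₗ Tot.map f := by
  refine Tot.hom_ext (fun i x => ?_)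
  simp only [LinearMap.comp_apply, Tot.parity_of, Tot.map_of]
  rw [Units.smul_def, Units.smul_def, map_zsmul, Tot.map_of]

lemma Tot.map_id (X : DGVS k) : Tot.map (𝟙 X) = LinearMap.id := by
  refine Tot.hom_ext (fun i x => ?_)
  simp [Tot.map_of]

lemma Tot.map_comp {X Y Z : DGVS k} (f : X ⟶ Y) (g : Y ⟶ Z) :
    Tot.map (f ≫ g) = Tot.map g ∘ₗ Tot.map f := by
  refine Tot.hom_ext (fun i x => ?_)
  simp [Tot.map_of]

/-! ## Tensor products of finite families of complexes

The factors are indexed by a finite subset `S` of some type `α`; the Koszul signs are taken with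
respect to a fixed (arbitrary) linear order of `α`. Another order gives a canonically isomorphic
complex. -/

section PiTensor

variable {α : Type} (S : Set α) (X : S → DGVS k)

/-- The `v`-th summand of the differential of the tensor product:
`⨂ x ↦ ± x₁ ⊗ ⋯ ⊗ d x_v ⊗ ⋯`, where the sign is `-1` to the sum of the degrees of the factors
before `v`. -/
def piDiffAt (v : S) : (⨂[k] w, Tot (X w)) →ₗ[k] (⨂[k] w, Tot (X w)) :=
  open Classical in
  PiTensorProduct.map (fun w =>
    if WellOrderingRel w.1 v.1 then Tot.parity (X w)
    else if w = v then Tot.d (X w) else LinearMap.id)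

/-- The differential of the tensor product. -/
def piDiff : (⨂[k] w, Tot (X w)) →ₗ[k] (⨂[k] w, Tot (X w)) :=
  ∑ᶠ v : S, piDiffAt S X v

/-- The tensor product of a family of homogeneous elements. -/
def piPure (deg : S → ℤ) (x : ∀ v, (X v).X (deg v)) : ⨂[k] w, Tot (X w) :=
  PiTensorProduct.tprod k (fun v => Tot.of (X v) (deg v) (x v))

/-- The component of degree `n`: the span of the tensor products of homogeneous elements of total
degree `n`. -/
def piHomog (n : ℤ) : Submodule k (⨂[k] w, Tot (X w)) :=
  Submodule.span k {z | ∃ (deg : S → ℤ) (x : ∀ v, (X v).X (deg v)),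
    ∑ᶠ v, deg v = n ∧ z = piPure S X deg x}

variable {S X}

lemma tprod_mem_piHomog (deg : S → ℤ) (z : ∀ v, Tot (X v))
    (hz : ∀ v, ∃ (j : ℤ) (x : (X v).X j), j = deg v ∧ z v = Tot.of (X v) j x) :
    PiTensorProduct.tprod k z ∈ piHomog S X (∑ᶠ v, deg v) := by
  choose j x hj hx using hz
  obtain rfl : j = deg := funext hj
  refine Submodule.subset_span ⟨j, x, rfl, ?_⟩
  rw [piPure]
  congr 1
  exact funext hx

lemma piDiffAt_pure (v : S) (deg : S → ℤ) (x : ∀ v, (X v).X (deg v)) [Finite S] :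
    piDiffAt S X v (piPure S X deg x) ∈ piHomog S X (∑ᶠ v, deg v + 1) := by
  classical
  have := Fintype.ofFinite S
  have hsum : ∑ᶠ w, deg w + 1 = ∑ᶠ w, (deg w + if w = v then 1 else 0) := by
    simp [finsum_eq_sum_of_fintype, Finset.sum_add_distrib]
  rw [hsum, piPure, piDiffAt, PiTensorProduct.map_tprod]
  refine tprod_mem_piHomog _ _ (fun w => ?_)
  by_cases h1 : w = v
  · subst h1
    have hirr : ¬ WellOrderingRel w.1 w.1 := irrefl _
    simp only [hirr, if_false, if_true]
    exact ⟨_, _, rfl, Tot.d_of _ _ _⟩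
  · simp only [h1, if_false]
    by_cases h2 : WellOrderingRel w.1 v.1
    · simp only [h2, if_true]
      exact ⟨_, (deg w).negOnePow • x w, (add_zero _).symm, by
        rw [Tot.parity_of, Units.smul_def, Units.smul_def, map_zsmul]⟩
    · simp only [h2, if_false]
      exact ⟨_, x w, (add_zero _).symm, rfl⟩

lemma piDiff_mem [Finite S] (n : ℤ) (z : ⨂[k] w, Tot (X w)) (hz : z ∈ piHomog S X n) :
    piDiff S X z ∈ piHomog S X (n + 1) := by
  have := Fintype.ofFinite S
  induction hz using Submodule.span_induction with
  | mem z hz =>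
    obtain ⟨deg, x, rfl, rfl⟩ := hz
    rw [piDiff, finsum_eq_sum_of_fintype (f := piDiffAt S X), LinearMap.sum_apply]
    exact Submodule.sum_mem _ (fun v _ => piDiffAt_pure v deg x)
  | zero => simp
  | add a b _ _ ha hb => rw [map_add]; exact add_mem ha hb
  | smul c a _ ha => rw [map_smul]; exact Submodule.smul_mem _ _ ha

lemma piDiffAt_self (v : S) : piDiffAt S X v ∘ₗ piDiffAt S X v = 0 := by
  classical
  refine PiTensorProduct.ext (MultilinearMap.ext (fun x => ?_))
  simp only [LinearMap.compMultilinearMap_apply, LinearMap.comp_apply, piDiffAt,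
    PiTensorProduct.map_tprod, LinearMap.zero_apply]
  refine MultilinearMap.map_coord_zero _ v ?_
  have hirr : ¬ WellOrderingRel v.1 v.1 := irrefl _
  simp only [hirr, if_false, if_true]
  exact LinearMap.congr_fun (Tot.d_d (X v)) (x v)

lemma piDiffAt_anticomm (u v : S) (h : WellOrderingRel u.1 v.1) :
    piDiffAt S X u ∘ₗ piDiffAt S X v + piDiffAt S X v ∘ₗ piDiffAt S X u = 0 := by
  classical
  have hne : u ≠ v := by rintro rfl; exact irrefl _ h
  have hnot : ¬ WellOrderingRel v.1 u.1 := fun h' => asymm h h'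
  have hirr : ∀ a : α, ¬ WellOrderingRel a a := fun a => irrefl a
  refine PiTensorProduct.ext (MultilinearMap.ext (fun x => ?_))
  simp only [LinearMap.compMultilinearMap_apply, LinearMap.comp_apply, LinearMap.add_apply,
    piDiffAt, PiTensorProduct.map_tprod, LinearMap.zero_apply]
  rw [add_eq_zero_iff_eq_neg, ← neg_one_smul k]
  have key := (PiTensorProduct.tprod k (s := fun w => Tot (X w))).map_update_smul
    (fun w => (if WellOrderingRel w.1 v.1 then Tot.parity (X w)
      else if w = v then Tot.d (X w) else LinearMap.id)
      ((if WellOrderingRel w.1 u.1 then Tot.parity (X w)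
      else if w = u then Tot.d (X w) else LinearMap.id) (x w))) u (-1)
      (Tot.parity (X u) (Tot.d (X u) (x u)))
  have hu : Function.update (fun w => (if WellOrderingRel w.1 v.1 then Tot.parity (X w)
      else if w = v then Tot.d (X w) else LinearMap.id)
      ((if WellOrderingRel w.1 u.1 then Tot.parity (X w)
      else if w = u then Tot.d (X w) else LinearMap.id) (x w))) u
      (Tot.parity (X u) (Tot.d (X u) (x u))) = (fun w =>
      (if WellOrderingRel w.1 v.1 then Tot.parity (X w)
      else if w = v then Tot.d (X w) else LinearMap.id)
      ((if WellOrderingRel w.1 u.1 then Tot.parity (X w)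
      else if w = u then Tot.d (X w) else LinearMap.id) (x w))) := by
    rw [Function.update_eq_self_iff]
    simp only [h, hirr, if_true, if_false]
  rw [hu] at key
  rw [← key]
  congr 1
  funext w
  by_cases hwu : w = u
  · subst hwu
    simp only [hirr, h, if_true, if_false, Function.update_self]
    have := LinearMap.congr_fun (Tot.parity_d (X w)) (x w)
    simp only [LinearMap.comp_apply, LinearMap.neg_apply] at this
    rw [this]
    simp
  · rw [Function.update_of_ne hwu]
    by_cases hwv : w = v
    · subst hwv
      simp only [hirr, hnot, if_true, if_false, hwu, LinearMap.id_apply]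
    · by_cases h1 : WellOrderingRel w.1 u.1
      · have h2 : WellOrderingRel w.1 v.1 := _root_.trans h1 h
        simp only [h1, h2, if_true]
      · by_cases h2 : WellOrderingRel w.1 v.1 <;>
          simp only [h1, h2, hwu, hwv, if_true, if_false, LinearMap.id_apply]

lemma piDiff_piDiff [Finite S] : piDiff S X ∘ₗ piDiff S X = 0 := by
  classical
  have := Fintype.ofFinite S
  have hsum : piDiff S X ∘ₗ piDiff S X =
      ∑ p : S × S, piDiffAt S X p.1 ∘ₗ piDiffAt S X p.2 := by
    refine LinearMap.ext (fun x => ?_)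
    rw [piDiff, finsum_eq_sum_of_fintype (f := piDiffAt S X), Fintype.sum_prod_type]
    simp only [LinearMap.comp_apply, LinearMap.sum_apply, map_sum]
    exact Finset.sum_comm
  rw [hsum]
  refine Finset.sum_involution (fun p _ => p.swap) ?_ ?_ (fun _ _ => Finset.mem_univ _)
    (fun p _ => Prod.swap_swap p)
  · rintro ⟨u, v⟩ -
    rcases trichotomous_of WellOrderingRel u.1 v.1 with h | h | h
    · exact piDiffAt_anticomm u v h
    · obtain rfl : u = v := Subtype.ext h
      simp only [Prod.swap_prod_mk, piDiffAt_self, add_zero]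
    · simp only [Prod.swap_prod_mk]
      rw [add_comm]
      exact piDiffAt_anticomm v u h
  · rintro ⟨u, v⟩ - h heq
    simp only [Prod.swap_prod_mk, Prod.mk.injEq] at heq
    obtain ⟨rfl, -⟩ := heq
    exact h (piDiffAt_self _)

variable (S X) in
/-- The tensor product `⨂_{v ∈ S} X v` of a finite family of complexes. -/
def piTensor [Finite S] : DGVS k where
  X n := ModuleCat.of k (piHomog S X n)
  d i j := if h : i + 1 = j then
      ModuleCat.ofHom ((piDiff S X).restrict (fun z hz => h ▸ piDiff_mem i z hz))
    else 0
  shape i j h := dif_neg h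
  d_comp_d' i j l hij hjl := by
    have hij' : i + 1 = j := hij
    have hjl' : j + 1 = l := hjl
    rw [dif_pos hij', dif_pos hjl']
    refine ModuleCat.hom_ext (LinearMap.ext (fun z => Subtype.ext ?_))
    exact LinearMap.congr_fun piDiff_piDiff z.1

variable (S X) in
/-- The inclusion of the component of degree `n` in the full tensor product. -/
def piTensorVal [Finite S] (n : ℤ) : (piTensor S X).X n →ₗ[k] ⨂[k] w, Tot (X w) :=
  (piHomog S X n).subtype

/-- The functoriality of the tensor product of a finite family. -/
def piTensorMap [Finite S] {Y : S → DGVS k} (f : ∀ v, X v ⟶ Y v) :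
    piTensor S X ⟶ piTensor S Y where
  f n := ModuleCat.ofHom
    ((PiTensorProduct.map (fun v => Tot.map (f v))).restrict (p := piHomog S X n)
      (q := piHomog S Y n) (fun z hz => by
        induction hz using Submodule.span_induction with
        | mem z hz =>
          obtain ⟨deg, x, rfl, rfl⟩ := hz
          rw [piPure, PiTensorProduct.map_tprod]
          exact tprod_mem_piHomog deg _ (fun v => ⟨_, _, rfl, Tot.map_of _ _ _⟩)
        | zero => simp
        | add a b _ _ ha hb => rw [map_add]; exact add_mem ha hb
        | smul c a _ ha => rw [map_smul]; exact Submodule.smul_mem _ _ ha))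
  comm' i j hij := by
    have hij' : i + 1 = j := hij
    have := Fintype.ofFinite S
    have hv : ∀ v, PiTensorProduct.map (fun v => Tot.map (f v)) ∘ₗ piDiffAt S X v =
        piDiffAt S Y v ∘ₗ PiTensorProduct.map (fun v => Tot.map (f v)) := by
      intro v
      rw [piDiffAt, piDiffAt, ← PiTensorProduct.map_comp, ← PiTensorProduct.map_comp]
      congr 1
      funext w
      split_ifs
      · exact (Tot.map_parity (f w)).symm ▸ rfl
      · exact (Tot.map_d (f w)).symm ▸ rfl
      · rfl
    have hd : PiTensorProduct.map (fun v => Tot.map (f v)) ∘ₗ piDiff S X =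
        piDiff S Y ∘ₗ PiTensorProduct.map (fun v => Tot.map (f v)) := by
      refine LinearMap.ext (fun x => ?_)
      rw [piDiff, piDiff, finsum_eq_sum_of_fintype (f := piDiffAt S X),
        finsum_eq_sum_of_fintype (f := piDiffAt S Y)]
      simp only [LinearMap.comp_apply, LinearMap.sum_apply, map_sum]
      exact Finset.sum_congr rfl (fun v _ => LinearMap.congr_fun (hv v) x)
    simp only [piTensor, dif_pos hij']
    refine ModuleCat.hom_ext (LinearMap.ext (fun z => Subtype.ext ?_))
    exact (LinearMap.congr_fun hd z.1).symm

lemma piTensorMap_id [Finite S] : piTensorMap (fun v => 𝟙 (X v)) = 𝟙 (piTensor S X) := by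
  ext n z
  refine Subtype.ext ?_
  change PiTensorProduct.map (fun v => Tot.map (𝟙 (X v))) z.1 = z.1
  simp only [Tot.map_id]
  exact LinearMap.congr_fun PiTensorProduct.map_id z.1

lemma piTensorMap_comp [Finite S] {Y Z : S → DGVS k} (f : ∀ v, X v ⟶ Y v) (g : ∀ v, Y v ⟶ Z v) :
    piTensorMap (fun v => f v ≫ g v) = piTensorMap f ≫ piTensorMap g := by
  ext n z
  refine Subtype.ext ?_
  change PiTensorProduct.map (fun v => Tot.map (f v ≫ g v)) z.1 =
    PiTensorProduct.map (fun v => Tot.map (g v)) (PiTensorProduct.map (fun v => Tot.map (f v)) z.1)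
  simp only [Tot.map_comp, PiTensorProduct.map_comp]
  rfl

end PiTensor
/-! ## Species and operads -/

/-- The category of finite sets and bijections. -/
structure Bij where
  /-- the underlying finite set -/
  carrier : Type
  [finite : Finite carrier]

attribute [instance] Bij.finite

instance : Category Bij where
  Hom A B := A.carrier ≃ B.carrier
  id A := Equiv.refl A.carrier
  comp f g := f.trans g

variable (k) in
/-- Vector species: contravariant functors from finite sets and bijections to complexes. -/
abbrev Species := Bijᵒᵖ ⥤ DGVS k

/-- The value `M(A)` of a species on a finite set `A`. -/
abbrev Species.on (M : Species k) (A : Type) [Finite A] : DGVS k := M.obj (op ⟨A⟩)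

/-- The map `M(B) ⟶ M(A)` given by a bijection `A ≃ B`. -/
abbrev Species.along (M : Species k) {A B : Type} [Finite A] [Finite B] (e : A ≃ B) :
    M.on B ⟶ M.on A :=
  M.map (Quiver.Hom.op (show (⟨A⟩ : Bij) ⟶ ⟨B⟩ from e))

/-- The component `M(A) ⟶ N(A)` of a morphism of species. -/
abbrev Species.app {M N : Species k} (f : M ⟶ N) (A : Type) [Finite A] : M.on A ⟶ N.on A :=
  NatTrans.app f (op ⟨A⟩)

variable (k) in
/-- Connected species: `M(∅) = 0` and `M({x}) = k`. -/
structure ConnSpecies where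
  /-- the underlying species -/
  toSpecies : Species k
  isZero_empty : ∀ (A : Type) [Finite A] [IsEmpty A], IsZero (toSpecies.on A)
  /-- the identification `k = M({x})`; here `𝟙_` is `k` placed in degree `0` -/
  point : ∀ (A : Type) [Finite A] [Unique A], 𝟙_ (DGVS k) ≅ toSpecies.on A
  point_along : ∀ (A B : Type) [Finite A] [Finite B] [Unique A] [Unique B] (e : A ≃ B),
    (point B).hom ≫ toSpecies.along e = (point A).hom

/-- Morphisms of connected species: morphisms of species that are the identity of `k` on
one-element sets. -/
@[ext]
structure ConnSpecies.Hom (M N : ConnSpecies k) where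
  /-- the underlying morphism of species -/
  hom : M.toSpecies ⟶ N.toSpecies
  point_comp : ∀ (A : Type) [Finite A] [Unique A],
    (M.point A).hom ≫ Species.app hom A = (N.point A).hom

instance : Category (ConnSpecies k) where
  Hom := ConnSpecies.Hom
  id M := ⟨𝟙 _, fun A _ _ => by simp⟩
  comp f g := ⟨f.hom ≫ g.hom, fun A _ _ => by
    simp only [Species.app, NatTrans.comp_app]
    rw [← Category.assoc, f.point_comp A, g.point_comp A]⟩

/-- The set `(A \ {i}) ⊔ B`. -/
abbrev Insert {A : Type} (i : A) (B : Type) : Type := {a : A // a ≠ i} ⊕ B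

/-- Functoriality of `(A \ {i}) ⊔ B` in bijections. -/
def Insert.congr {A A' B B' : Type} (e : A ≃ A') (f : B ≃ B') (i : A) :
    Insert i B ≃ Insert (e i) B' :=
  Equiv.sumCongr (e.subtypeEquiv (fun _ => e.injective.ne_iff.symm)) f

/-- `((A \ {i}) ⊔ B) \ {j} ⊔ C = (A \ {i}) ⊔ ((B \ {j}) ⊔ C)` for `j ∈ B`. -/
def Insert.nested {A B C : Type} (i : A) (j : B) :
    Insert (Sum.inr j : Insert i B) C ≃ Insert i (Insert j C) where
  toFun
    | Sum.inl ⟨Sum.inl a, _⟩ => Sum.inl a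
    | Sum.inl ⟨Sum.inr b, h⟩ => Sum.inr (Sum.inl ⟨b, fun h' => h (h' ▸ rfl)⟩)
    | Sum.inr c => Sum.inr (Sum.inr c)
  invFun
    | Sum.inl a => Sum.inl ⟨Sum.inl a, Sum.inl_ne_inr⟩
    | Sum.inr (Sum.inl b) => Sum.inl ⟨Sum.inr b.1, fun h => b.2 (Sum.inr_injective h)⟩
    | Sum.inr (Sum.inr c) => Sum.inr c
  left_inv := by rintro (⟨a | b, h⟩ | c) <;> rfl
  right_inv := by rintro (a | b | c) <;> rfl

/-- `((A \ {i}) ⊔ B) \ {j} ⊔ C = ((A \ {j}) ⊔ C) \ {i} ⊔ B` for distinct `i, j ∈ A`. -/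
def Insert.parallel {A B C : Type} (i j : A) (hij : i ≠ j) :
    Insert (Sum.inl ⟨j, hij.symm⟩ : Insert i B) C ≃ Insert (Sum.inl ⟨i, hij⟩ : Insert j C) B where
  toFun
    | Sum.inl ⟨Sum.inl a, h⟩ => Sum.inl ⟨Sum.inl ⟨a.1, fun h' => h (by
        congr 1; exact Subtype.ext h')⟩, fun h' => a.2 (congrArg Subtype.val (Sum.inl_injective h'))⟩
    | Sum.inl ⟨Sum.inr b, _⟩ => Sum.inr b
    | Sum.inr c => Sum.inl ⟨Sum.inr c, Sum.inr_ne_inl⟩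
  invFun
    | Sum.inl ⟨Sum.inl a, h⟩ => Sum.inl ⟨Sum.inl ⟨a.1, fun h' => h (by
        congr 1; exact Subtype.ext h')⟩, fun h' => a.2 (congrArg Subtype.val (Sum.inl_injective h'))⟩
    | Sum.inl ⟨Sum.inr c, _⟩ => Sum.inr c
    | Sum.inr b => Sum.inl ⟨Sum.inr b, Sum.inr_ne_inl⟩
  left_inv := by rintro (⟨a | b, h⟩ | c) <;> rfl
  right_inv := by rintro (⟨a | b, h⟩ | c) <;> rfl

/-- `(A \ {i}) ⊔ {x} = A`, with `x` in place of `i`. -/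
def Insert.rightUnit {A : Type} (i : A) (B : Type) [Unique B] : Insert i B ≃ A where
  toFun := Sum.elim Subtype.val (fun _ => i)
  invFun a := open Classical in if h : a = i then Sum.inr default else Sum.inl ⟨a, h⟩
  left_inv := by
    rintro (⟨a, h⟩ | b)
    · simp [h]
    · simp [Unique.eq_default b]
  right_inv a := by
    by_cases h : a = i <;> simp [h]

/-- `({x} \ {x}) ⊔ B = B`. -/
def Insert.leftUnit (A : Type) [Unique A] (B : Type) : Insert (default : A) B ≃ B where
  toFun := Sum.elim (fun a => (a.2 (Unique.eq_default a.1)).elim) id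
  invFun := Sum.inr
  left_inv := by
    rintro (⟨a, h⟩ | b)
    · exact (h (Unique.eq_default a)).elim
    · rfl
  right_inv _ := rfl

/-- The element of `X` of degree `0` that corresponds to a morphism `k ⟶ X`. -/
def Tot.elt {X : DGVS k} (f : 𝟙_ (DGVS k) ⟶ X) : Tot X :=
  Tot.of X 0 ((HomologicalComplex.singleObjXSelf (ComplexShape.up ℤ) 0 (𝟙_ (ModuleCat.{u} k))).inv ≫
    f.f 0 |>.hom (1 : k))

variable (k) in
/-- Operads: species with partial compositions and units. -/
structure Operad where
  /-- the underlying species -/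
  toSpecies : Species k
  /-- the partial composition `∘ᵢ : P(A) ⊗ P(B) ⟶ P((A \ {i}) ⊔ B)` -/
  comp : ∀ (A B : Type) [Finite A] [Finite B] (i : A),
    toSpecies.on A ⊗ toSpecies.on B ⟶ toSpecies.on (Insert i B)
  /-- the unit `k ⟶ P({x})` -/
  unit : ∀ (A : Type) [Finite A] [Unique A], 𝟙_ (DGVS k) ⟶ toSpecies.on A
  comp_along : ∀ (A A' B B' : Type) [Finite A] [Finite A'] [Finite B] [Finite B']
    (e : A ≃ A') (f : B ≃ B') (i : A),
    (toSpecies.along e ⊗ₘ toSpecies.along f) ≫ comp A B i =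
      comp A' B' (e i) ≫ toSpecies.along (Insert.congr e f i)
  unit_along : ∀ (A B : Type) [Finite A] [Finite B] [Unique A] [Unique B] (e : A ≃ B),
    unit B ≫ toSpecies.along e = unit A
  /-- `(a ∘ᵢ b) ∘ⱼ c = a ∘ᵢ (b ∘ⱼ c)` for `i ∈ A`, `j ∈ B` -/
  assoc_nested : ∀ (A B C : Type) [Finite A] [Finite B] [Finite C] (i : A) (j : B)
    (a : Tot (toSpecies.on A)) (b : Tot (toSpecies.on B)) (c : Tot (toSpecies.on C)),
    Tot.bil (comp _ C (Sum.inr j)) (Tot.bil (comp A B i) a b) c =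
      Tot.map (toSpecies.along (Insert.nested i j))
        (Tot.bil (comp A _ i) a (Tot.bil (comp B C j) b c))
  /-- `(a ∘ᵢ b) ∘ⱼ c = (-1) ^ (|b| |c|) (a ∘ⱼ c) ∘ᵢ b` for distinct `i, j ∈ A` -/
  assoc_parallel : ∀ (A B C : Type) [Finite A] [Finite B] [Finite C] (i j : A) (hij : i ≠ j)
    (a : Tot (toSpecies.on A)) (p q : ℤ) (b : (toSpecies.on B).X p) (c : (toSpecies.on C).X q),
    Tot.bil (comp _ C (Sum.inl ⟨j, hij.symm⟩))
        (Tot.bil (comp A B i) a (Tot.of _ p b)) (Tot.of _ q c) =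
      (p * q).negOnePow • Tot.map (toSpecies.along (Insert.parallel i j hij))
        (Tot.bil (comp _ B (Sum.inl ⟨i, hij⟩))
          (Tot.bil (comp A C j) a (Tot.of _ q c)) (Tot.of _ p b))
  comp_unit : ∀ (A B : Type) [Finite A] [Finite B] [Unique B] (i : A) (a : Tot (toSpecies.on A)),
    Tot.bil (comp A B i) a (Tot.elt (unit B)) =
      Tot.map (toSpecies.along (Insert.rightUnit i B)) a
  unit_comp : ∀ (A B : Type) [Finite A] [Finite B] [Unique A] (b : Tot (toSpecies.on B)),
    Tot.bil (comp A B default) (Tot.elt (unit A)) b =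
      Tot.map (toSpecies.along (Insert.leftUnit A B)) b

variable (k) in
/-- Connected operads: operads whose species is connected, `k = P({x})` being the unit. -/
structure ConnOperad extends Operad k where
  isZero_empty : ∀ (A : Type) [Finite A] [IsEmpty A], IsZero (toSpecies.on A)
  isIso_unit : ∀ (A : Type) [Finite A] [Unique A], IsIso (unit A)

/-- Morphisms of operads. -/
@[ext]
structure ConnOperad.Hom (P Q : ConnOperad k) where
  /-- the underlying morphism of species -/
  hom : P.toSpecies ⟶ Q.toSpecies
  comp_comm : ∀ (A B : Type) [Finite A] [Finite B] (i : A),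
    P.comp A B i ≫ Species.app hom (Insert i B) =
      (Species.app hom A ⊗ₘ Species.app hom B) ≫ Q.comp A B i
  unit_comm : ∀ (A : Type) [Finite A] [Unique A], P.unit A ≫ Species.app hom A = Q.unit A

instance : Category (ConnOperad k) where
  Hom := ConnOperad.Hom
  id P := ⟨𝟙 _, fun A B _ _ i => by simp, fun A _ _ => by simp⟩
  comp f g := ⟨f.hom ≫ g.hom, fun A B _ _ i => by
      simp only [Species.app, NatTrans.comp_app]
      have hf := f.comp_comm A B i
      have hg := g.comp_comm A B i
      simp only [Species.app] at hf hg
      rw [← Category.assoc, hf, Category.assoc, hg, ← Category.assoc,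
        MonoidalCategory.tensorHom_comp_tensorHom], fun A _ _ => by
      simp only [Species.app, NatTrans.comp_app]
      have hf := f.unit_comm A
      have hg := g.unit_comm A
      simp only [Species.app] at hf hg
      rw [← Category.assoc, hf, hg]⟩

variable (k) in
/-- The forgetful functor from connected operads to connected species. -/
def forgetOperad : ConnOperad k ⥤ ConnSpecies k where
  obj P :=
    { toSpecies := P.toSpecies
      isZero_empty := P.isZero_empty
      point := fun A _ _ => @asIso _ _ _ _ (P.unit A) (P.isIso_unit A)
      point_along := fun A B _ _ _ _ e => P.unit_along A B e }
  map f := ⟨f.hom, fun A _ _ => f.unit_comm A⟩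

/-! ## The category of trees -/

/-- Reduced `I`-trees with at least one vertex, up to isomorphism of trees that fixes the leaves.
A vertex is recorded by the set of the leaves that lie above it. Since every vertex has at least
two incoming edges, different vertices have different sets of leaves, and the families of subsets
of `I` that arise are those below. Every vertex other than the root vertex `I` is the source of
exactly one internal edge, so internal edges are recorded by the vertices other than `I`. -/
@[ext]
structure RTree (I : Type) where
  /-- the vertices -/
  verts : Set (Set I)
  root_mem : Set.univ ∈ verts
  nontrivial : ∀ A ∈ verts, A.Nontrivial
  nested : ∀ A ∈ verts, ∀ B ∈ verts, A ⊆ B ∨ B ⊆ A ∨ Disjoint A B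

namespace RTree

variable {I : Type}

/-- The category of trees is a poset: there is exactly one morphism `t ⟶ s` if `s` is obtained from
`t` by contracting a set of internal edges, that is by deleting a set of vertices other than the
root vertex, and none otherwise. -/
instance : PartialOrder (RTree I) where
  le t s := s.verts ⊆ t.verts
  le_refl t := subset_rfl
  le_trans _ _ _ h h' := h'.trans h
  le_antisymm _ _ h h' := RTree.ext (h'.antisymm h)

/-- The set `In(A)` of incoming edges at the vertex `A`, an edge being recorded by the set of the
leaves above it: the maximal ones among the vertices and the leaves strictly above `A`. -/
def In (t : RTree I) (A : Set I) : Set (Set I) :=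
  {B | (B ∈ t.verts ∨ ∃ i, B = {i}) ∧ B ⊂ A ∧ ∀ C ∈ t.verts, B ⊂ C → ¬ C ⊂ A}

/-- `s` is obtained from `t` by contracting the internal edge from `w` to `v`. -/
structure Contracts (t s : RTree I) (v w : Set I) : Prop where
  target_mem : v ∈ t.verts
  source_mem : w ∈ t.verts
  mem_In : w ∈ t.In v
  verts_eq : s.verts = t.verts \ {w}

namespace Contracts

variable {t s : RTree I} {v w : Set I}

lemma mem_iff (h : Contracts t s v w) (A : Set I) : A ∈ s.verts ↔ A ∈ t.verts ∧ A ≠ w := by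
  rw [h.verts_eq]; rfl

lemma le (h : Contracts t s v w) : t ≤ s := fun A hA => ((h.mem_iff A).1 hA).1

lemma nested_of_ssubset {t : RTree I} {A B C : Set I} (hA : A ∈ t.verts) (hB : B ∈ t.verts)
    (hC : C.Nonempty) (h1 : C ⊆ A) (h2 : C ⊆ B) (hne : A ≠ B) : A ⊂ B ∨ B ⊂ A := by
  rcases t.nested A hA B hB with h | h | h
  · exact Or.inl (h.ssubset_of_ne hne)
  · exact Or.inr (h.ssubset_of_ne hne.symm)
  · obtain ⟨x, hx⟩ := hC
    exact (Set.disjoint_left.1 h (h1 hx) (h2 hx)).elim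

lemma not_leaf (h : Contracts t s v w) (i : I) : ({i} : Set I) ≠ w := by
  rintro rfl
  exact Set.not_nontrivial_singleton (t.nontrivial _ h.source_mem)

lemma nonempty_of_mem_In {A B : Set I} (hB : B ∈ t.In A) : B.Nonempty := by
  rcases hB.1 with hB | ⟨i, rfl⟩
  · exact (t.nontrivial B hB).nonempty
  · exact Set.singleton_nonempty i

lemma In_of_ne (h : Contracts t s v w) {A : Set I} (hA : A ∈ s.verts) (hv : A ≠ v) :
    s.In A = t.In A := by
  have hAt := ((h.mem_iff A).1 hA).1
  have hvs : v ∈ s.verts := (h.mem_iff v).2 ⟨h.target_mem, h.mem_In.2.1.ne'⟩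
  have hw : w ⊆ A → A ⊂ v ∨ v ⊂ A := fun hwA => nested_of_ssubset hAt h.target_mem
    (t.nontrivial w h.source_mem).nonempty hwA h.mem_In.2.1.subset hv
  ext B
  constructor
  · intro hB
    refine ⟨hB.1.imp_left (fun hB => ((h.mem_iff B).1 hB).1), hB.2.1, fun C hC hBC hCA => ?_⟩
    by_cases hCw : C = w
    · subst hCw
      rcases hw hCA.subset with h' | h'
      · exact h.mem_In.2.2 A hAt hCA h'
      · exact hB.2.2 v hvs (hBC.trans h.mem_In.2.1) h'
    · exact hB.2.2 C ((h.mem_iff C).2 ⟨hC, hCw⟩) hBC hCA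
  · intro hB
    refine ⟨hB.1.imp_left (fun hBt => (h.mem_iff B).2 ⟨hBt, ?_⟩), hB.2.1,
      fun C hC => hB.2.2 C ((h.mem_iff C).1 hC).1⟩
    rintro rfl
    rcases hw hB.2.1.subset with h' | h'
    · exact h.mem_In.2.2 A hAt hB.2.1 h'
    · exact hB.2.2 v h.target_mem h.mem_In.2.1 h'

lemma In_target (h : Contracts t s v w) : s.In v = (t.In v \ {w}) ∪ t.In w := by
  ext B
  constructor
  · intro hB
    have hBt : B ∈ t.verts ∨ ∃ i, B = {i} := hB.1.imp_left (fun hB => ((h.mem_iff B).1 hB).1)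
    have hBw : B ≠ w := by
      rcases hB.1 with hB | ⟨i, rfl⟩
      · exact ((h.mem_iff B).1 hB).2
      · exact h.not_leaf i
    by_cases hlt : B ⊂ w
    · refine Or.inr ⟨hBt, hlt, fun C hC hBC hCw => ?_⟩
      exact hB.2.2 C ((h.mem_iff C).2 ⟨hC, hCw.ne⟩) hBC (hCw.trans h.mem_In.2.1)
    · refine Or.inl ⟨⟨hBt, hB.2.1, fun C hC hBC hCv => ?_⟩, hBw⟩
      exact hB.2.2 C ((h.mem_iff C).2 ⟨hC, fun hCw => hlt (hCw ▸ hBC)⟩) hBC hCv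
  · rintro (⟨hB, hBw⟩ | hB)
    · exact ⟨hB.1.imp_left (fun hBt => (h.mem_iff B).2 ⟨hBt, hBw⟩), hB.2.1,
        fun C hC => hB.2.2 C ((h.mem_iff C).1 hC).1⟩
    · refine ⟨hB.1.imp_left (fun hBt => (h.mem_iff B).2 ⟨hBt, hB.2.1.ne⟩),
        hB.2.1.trans h.mem_In.2.1, fun C hC hBC hCv => ?_⟩
      have hC' := (h.mem_iff C).1 hC
      rcases nested_of_ssubset hC'.1 h.source_mem (nonempty_of_mem_In hB) hBC.subset
        hB.2.1.subset hC'.2 with h' | h'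
      · exact hB.2.2 C hC'.1 hBC h'
      · exact h.mem_In.2.2 C hC'.1 h' hCv

lemma disjoint_In (h : Contracts t s v w) : Disjoint (t.In v \ {w}) (t.In w) :=
  Set.disjoint_left.2 (fun _ hB hB' => hB.1.2.2 w h.source_mem hB'.2.1 h.mem_In.2.1)

/-- The identification of the incoming edges at `v` after the contraction with
`(In(v) \ {w}) ⊔ In(w)`. -/
def inTarget (h : Contracts t s v w) :
    s.In v ≃ Insert (⟨w, h.mem_In⟩ : t.In v) (t.In w) :=
  open Classical in
  ((Equiv.setCongr h.In_target).trans (Equiv.Set.union h.disjoint_In)).trans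
    (Equiv.sumCongr
      { toFun := fun B => ⟨⟨B.1, B.2.1⟩, fun h' => B.2.2 (congrArg Subtype.val h')⟩
        invFun := fun B => ⟨B.1.1, B.1.2, fun h' => B.2 (Subtype.ext h')⟩
        left_inv := fun _ => rfl
        right_inv := fun _ => rfl }
      (Equiv.refl _))

end Contracts

end RTree

/-! ## The tensor product `M(t)` and the left module of an operad -/

section Modules

variable {I : Type} [Finite I]

/-- `M(t) = ⨂_v M(In(v))`, over the vertices `v` of `t`. -/
def treeTensor (M : Species k) (t : RTree I) : DGVS k :=
  piTensor t.verts (fun A => M.on (t.In A.1))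

/-- `M(t)` is functorial in `M`. -/
def treeTensorMap {M N : Species k} (f : M ⟶ N) (t : RTree I) :
    treeTensor M t ⟶ treeTensor N t :=
  piTensorMap (fun A => Species.app f (t.In A.1))

/-- The family of factors obtained from the family `x` by composing the factor at `w` into the
factor at `v` along the edge from `w` to `v`: `x_v ∘_w x_w` at `v`, and `x_A` at the other
vertices `A`. -/
def contractFamily (P : Operad k) {t s : RTree I} {v w : Set I} (h : t.Contracts s v w)
    (x : ∀ A : t.verts, Tot (P.toSpecies.on (t.In A.1))) (A : s.verts) :
    Tot (P.toSpecies.on (s.In A.1)) :=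
  open Classical in
  if hA : A.1 = v then
    Tot.map (P.toSpecies.along ((Equiv.setCongr (congrArg s.In hA)).trans h.inTarget))
      (Tot.bil (P.comp (t.In v) (t.In w) ⟨w, h.mem_In⟩)
        (x ⟨v, h.target_mem⟩) (x ⟨w, h.source_mem⟩))
  else
    Tot.map (P.toSpecies.along (Equiv.setCongr (h.In_of_ne A.2 hA))) (x ⟨A.1, h.le A.2⟩)

/-- The exponent of the Koszul sign for moving the factor at `w` to the place just behind the
factor at `v`: the degree of the factor at `w` times the sum of the degrees of the factors it
passes. -/
def moveExponent (t : RTree I) (v w : Set I) (hw : w ∈ t.verts) (deg : t.verts → ℤ) : ℤ :=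
  deg ⟨w, hw⟩ * ∑ᶠ A ∈ {A : t.verts |
    (WellOrderingRel v A.1 ∧ WellOrderingRel A.1 w) ∨
    (WellOrderingRel w A.1 ∧ (WellOrderingRel A.1 v ∨ A.1 = v))}, deg A

/-- A left module over the category of `I`-trees. -/
abbrev LeftModule (k : Type u) [Field k] (I : Type) := RTree I ⥤ DGVS k

/-- A right module over the category of `I`-trees. -/
abbrev RightModule (k : Type u) [Field k] (I : Type) := (RTree I)ᵒᵖ ⥤ DGVS k

/-- The structure of a left module on `t ↦ P(t)` that extends the partial compositions of the
operad `P`: contracting a single edge, from `w` to `v`, acts by `x_v ⊗ x_w ⊗ ⋯ ↦ (x_v ∘_w x_w) ⊗ ⋯`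
(after moving the factor `x_w` just behind `x_v`). -/
structure OperadAction (P : Operad k) (I : Type) [Finite I] where
  /-- the map `P(t) ⟶ P(s)` for a contraction `t ⟶ s` -/
  map : ∀ {t s : RTree I}, t ≤ s → (treeTensor P.toSpecies t ⟶ treeTensor P.toSpecies s)
  map_refl : ∀ t : RTree I, map (le_refl t) = 𝟙 _
  map_trans : ∀ {t s r : RTree I} (h : t ≤ s) (h' : s ≤ r), map (h.trans h') = map h ≫ map h'
  map_edge : ∀ {t s : RTree I} {v w : Set I} (h : t.Contracts s v w) (n : ℤ)
    (z : (treeTensor P.toSpecies t).X n) (deg : t.verts → ℤ)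
    (x : ∀ A, (P.toSpecies.on (t.In A.1)).X (deg A)),
    piTensorVal _ _ n z = piPure _ _ deg x →
    piTensorVal _ _ n (((map h.le).f n).hom z) =
      (moveExponent t v w h.source_mem deg).negOnePow •
        PiTensorProduct.tprod k (contractFamily P h (fun A => Tot.of _ (deg A) (x A)))

/-- The left module `t ↦ P(t)`. -/
def OperadAction.toLeftModule {P : Operad k} (L : OperadAction P I) : LeftModule k I where
  obj t := treeTensor P.toSpecies t
  map f := L.map (leOfHom f)
  map_id t := L.map_refl t
  map_comp f g := L.map_trans (leOfHom f) (leOfHom g)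

end Modules

/-! ## The bar construction of the category of trees -/

section CatBar

variable {I : Type}

/-- The chains of contractions `s₀ ← s₁ ← ⋯ ← s_n` of `I`-trees (that is, trees `s_n` with pairwise
disjoint sets `E₁, …, E_n` of internal edges, where `s_{i-1} = s_i / E_i`). -/
abbrev Chain (I : Type) (n : ℕ) := Fin (n + 1) →o (RTree I)ᵒᵈ

/-- The `i`-th tree of a chain. -/
def Chain.tree {n : ℕ} (c : Chain I n) (i : Fin (n + 1)) : RTree I := OrderDual.ofDual (c i)

lemma Chain.tree_le {n : ℕ} (c : Chain I n) {i j : Fin (n + 1)} (h : i ≤ j) :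
    c.tree j ≤ c.tree i := c.monotone h

/-- The chain `c ∘ f`. -/
def Chain.pull {n m : ℕ} (c : Chain I n) (f : Fin (m + 1) →o Fin (n + 1)) : Chain I m := c.comp f

lemma Chain.pull_le {n m : ℕ} (c : Chain I n) (f : Fin (m + 1) →o Fin (n + 1)) :
    (c.pull f).tree 0 ≤ c.tree 0 := c.tree_le (Fin.zero_le (f 0))

lemma Chain.le_pull {n m : ℕ} (c : Chain I n) (f : Fin (m + 1) →o Fin (n + 1)) :
    c.tree (Fin.last n) ≤ (c.pull f).tree (Fin.last m) := c.tree_le (Fin.le_last (f (Fin.last m)))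

variable (R : RightModule k I) (L : LeftModule k I)

/-- The summand `R(s₀) ⊗ L(s_n)` of the bar construction. -/
abbrev barTerm {n : ℕ} (c : Chain I n) : DGVS k :=
  R.obj (op (c.tree 0)) ⊗ L.obj (c.tree (Fin.last n))

/-- The map of summands given by the contractions `s'₀ ⟶ s₀` and `s_n ⟶ s'_m`. -/
def barTermMap {n m : ℕ} (c : Chain I n) (c' : Chain I m) (h : c'.tree 0 ≤ c.tree 0)
    (h' : c.tree (Fin.last n) ≤ c'.tree (Fin.last m)) : barTerm R L c ⟶ barTerm R L c' :=
  R.map (homOfLE h).op ⊗ₘ L.map (homOfLE h')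

lemma barTermMap_ι {n : ℕ} (c c' : Chain I n) (e : c' = c) (h : c'.tree 0 ≤ c.tree 0)
    (h' : c.tree (Fin.last n) ≤ c'.tree (Fin.last n)) :
    barTermMap R L c c' h h' ≫ Sigma.ι (barTerm R L) c' = Sigma.ι (barTerm R L) c := by
  subst e
  have h1 : R.map (homOfLE h).op = 𝟙 _ := R.map_id _
  have h2 : L.map (homOfLE h') = 𝟙 _ := L.map_id _
  rw [barTermMap, h1, h2]
  simp

lemma barTermMap_comp {n m l : ℕ} (c : Chain I n) (c' : Chain I m) (c'' : Chain I l)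
    (h₁ : c'.tree 0 ≤ c.tree 0) (h₁' : c.tree (Fin.last n) ≤ c'.tree (Fin.last m))
    (h₂ : c''.tree 0 ≤ c'.tree 0) (h₂' : c'.tree (Fin.last m) ≤ c''.tree (Fin.last l)) :
    barTermMap R L c c' h₁ h₁' ≫ barTermMap R L c' c'' h₂ h₂' =
      barTermMap R L c c'' (h₂.trans h₁) (h₁'.trans h₂') := by
  rw [barTermMap, barTermMap, barTermMap, MonoidalCategory.tensorHom_comp_tensorHom, ← R.map_comp,
    ← L.map_comp]
  rfl

/-- The two-sided bar construction `B(R, 𝒯_I, L)`. In degree `n` it is the direct sum of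
`R(s₀) ⊗ L(s_n)` over all chains. A monotone map `θ : [m] ⟶ [n]` sends the summand of `c` to that of
`c ∘ θ`: faces compose adjacent contractions, or let the first and the last contraction act on `R`
and on `L`, and degeneracies insert identities. -/
def catBar : SimplicialObject (DGVS k) where
  obj Δ := ∐ barTerm R L (n := Δ.unop.len)
  map θ := Sigma.desc fun c =>
    barTermMap R L c (c.pull θ.unop.toOrderHom) (c.pull_le _) (c.le_pull _) ≫
      Sigma.ι (barTerm R L) (c.pull θ.unop.toOrderHom)
  map_id Δ := by
    refine Sigma.hom_ext _ _ (fun c => ?_)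
    rw [Sigma.ι_desc, Category.comp_id]
    exact barTermMap_ι R L c _ rfl _ _
  map_comp θ θ' := by
    refine Sigma.hom_ext _ _ (fun c => ?_)
    rw [Sigma.ι_desc, Sigma.ι_desc_assoc, Category.assoc, Sigma.ι_desc, ← Category.assoc]
    exact congrArg (· ≫ Sigma.ι (barTerm R L)
      ((c.pull θ.unop.toOrderHom).pull θ'.unop.toOrderHom)) (barTermMap_comp R L c
        (c.pull θ.unop.toOrderHom) ((c.pull θ.unop.toOrderHom).pull θ'.unop.toOrderHom)
        (c.pull_le _) (c.le_pull _) (Chain.pull_le _ _) (Chain.le_pull _ _)).symm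

end CatBar

/-! ## The two-sided bar construction of a monad -/

section MonadBar

universe v₁ u₁ v₂ u₂

variable {𝒞 : Type u₁} [Category.{v₁} 𝒞] {𝒟 : Type u₂} [Category.{v₂} 𝒟]

/-- The structure of a `T`-functor on `G : 𝒞 ⥤ 𝒟`, for a monad `T` on `𝒞`. -/
structure MonadFunctor (T : Monad 𝒞) (G : 𝒞 ⥤ 𝒟) where
  /-- the structural map `G T ⟶ G` -/
  act : T.toFunctor ⋙ G ⟶ G
  act_unit : ∀ X : 𝒞, G.map (T.η.app X) ≫ act.app X = 𝟙 (G.obj X)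
  act_mul : ∀ X : 𝒞, G.map (T.μ.app X) ≫ act.app X = act.app (T.obj X) ≫ act.app X

variable {T : Monad 𝒞}

/-- The iterates `T ^ n A`. -/
def iter (A : T.Algebra) : ℕ → 𝒞
  | 0 => A.A
  | n + 1 => T.obj (iter A n)

/-- The maps `T ^ (n + 1) A ⟶ T ^ n A`: for `i < n` the multiplication of `T` after `i` copies of
`T`, and for `i = n` the structural map of `A`. -/
def iterFace (A : T.Algebra) : ∀ n : ℕ, Fin (n + 1) → (iter A (n + 1) ⟶ iter A n)
  | 0 => fun _ => A.a
  | n + 1 => Fin.cases (T.μ.app (iter A n)) (fun i => T.map (iterFace A n i))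

/-- The maps `T ^ n A ⟶ T ^ (n + 1) A`: the unit of `T` after `i` copies of `T`. -/
def iterDegen (A : T.Algebra) : ∀ n : ℕ, Fin (n + 1) → (iter A n ⟶ iter A (n + 1))
  | 0 => fun _ => T.η.app A.A
  | n + 1 => Fin.cases (T.η.app (iter A (n + 1))) (fun i => T.map (iterDegen A n i))

variable {G : 𝒞 ⥤ 𝒟} (Λ : MonadFunctor T G) (A : T.Algebra)

/-- The object `B_n(G, T, A) = G T ^ n A`. -/
def monadBar (_ : MonadFunctor T G) (A : T.Algebra) (n : ℕ) : 𝒟 := G.obj (iter A n)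

/-- The faces `B_{n+1}(G, T, A) ⟶ B_n(G, T, A)`: the face `d₀` is the action of `T` on `G`. -/
def monadBarFace (n : ℕ) : Fin (n + 2) → (monadBar Λ A (n + 1) ⟶ monadBar Λ A n) :=
  Fin.cases (Λ.act.app (iter A n)) (fun i => G.map (iterFace A n i))

/-- The degeneracies `B_n(G, T, A) ⟶ B_{n+1}(G, T, A)`. -/
def monadBarDegen (n : ℕ) (i : Fin (n + 1)) : monadBar Λ A n ⟶ monadBar Λ A (n + 1) :=
  G.map (iterDegen A n i)

end MonadBar

/-! ## The functor `π_I(R)` and the comparison maps -/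

section Comparison

variable {I : Type} [Finite I]

/-- The functor `π_I(R) : M ↦ ⨁_t M(t) ⊗ R(t)`. -/
def piFunctor (R : RightModule k I) : ConnSpecies k ⥤ DGVS k where
  obj M := ∐ fun t : RTree I => treeTensor M.toSpecies t ⊗ R.obj (op t)
  map f := Limits.Sigma.map (fun t => treeTensorMap f.hom t ▷ R.obj (op t))
  map_id M := by
    refine Sigma.hom_ext _ _ (fun t => ?_)
    have h : treeTensorMap (ConnSpecies.Hom.hom (𝟙 M)) t = 𝟙 (treeTensor M.toSpecies t) :=
      piTensorMap_id
    rw [Sigma.ι_map, h]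
    simp
  map_comp {M N P} f g := by
    refine Sigma.hom_ext _ _ (fun t => ?_)
    have h : treeTensorMap (ConnSpecies.Hom.hom (f ≫ g)) t =
        treeTensorMap f.hom t ≫ treeTensorMap g.hom t :=
      piTensorMap_comp _ _
    rw [Sigma.ι_map, h]
    simp

/-- The inclusion of the summand `M(t) ⊗ R(t)` in `π_I(R)(M)`. -/
def piι (R : RightModule k I) (M : ConnSpecies k) (t : RTree I) :
    treeTensor M.toSpecies t ⊗ R.obj (op t) ⟶ (piFunctor R).obj M :=
  Sigma.ι (fun t : RTree I => treeTensor M.toSpecies t ⊗ R.obj (op t)) t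

variable {Free : ConnSpecies k ⥤ ConnOperad k} (adj : Free ⊣ forgetOperad k)

/-- The free operad monad `ℱ` on connected species. -/
abbrev freeMonad : Monad (ConnSpecies k) := adj.toMonad

/-- An operad, as an algebra over the free operad monad: its structural map is the counit. -/
abbrev operadAlgebra (P : ConnOperad k) : (freeMonad adj).Algebra :=
  (Monad.comparison adj).obj P

variable (L : ∀ P : ConnOperad k, OperadAction P.toOperad I)

/-- For `E ⊆ E_{t'}` and `t = t' / E`, the map `M(t') ⟶ (ℱ M)(t)` that sends `m` to `(t', E, m)`:
apply the unit `M ⟶ ℱ M` at each vertex of `t'`, and then compose along the edges in `E` in the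
operad `ℱ M`. -/
def nestedι (M : ConnSpecies k) {t' t : RTree I} (h : t' ≤ t) :
    treeTensor M.toSpecies t' ⟶ treeTensor ((freeMonad adj).obj M).toSpecies t :=
  treeTensorMap ((freeMonad adj).η.app M).hom t' ≫ (L (Free.obj M)).map h

/-- For a chain of contractions `s₀ ← ⋯ ← s_n`, with `s_{i-1} = s_i / E_i`, the map
`P(s_n) ⟶ (ℱ ^ n P)(s₀)` that sends `p` to `(s_n; E₁, …, E_n, p)`. -/
def chainι (P : ConnOperad k) : ∀ (n : ℕ) (c : Chain I n),
    treeTensor P.toSpecies (c.tree (Fin.last n)) ⟶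
      treeTensor (iter (operadAlgebra adj P) n).toSpecies (c.tree 0)
  | 0, _ => 𝟙 _
  | n + 1, c =>
    chainι P n (c.pull (Fin.succOrderEmb (n + 1)).toOrderHom) ≫
      nestedι adj L (iter (operadAlgebra adj P) n) (c.tree_le (Fin.zero_le 1))

end Comparison

end TreeBar

end

/-!
The action of `𝒯_I` on `t ↦ P(t)` exists and is unique because every contraction is a sequence of
contractions of single edges (`EdgePath`), and because two such contractions commute
(`contractMap_comm`). If the two edges form a path, this is the nested associativity of `P`; if they
end at the same vertex, it is the parallel one; otherwise the two contractions concern different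
factors. The vertices of a tree have no natural order, so in each case the signs are compared through
parities of exponents, relative to a fixed order of all subsets of `I`.

The free operad is not built from trees. Let `fockOperad` be the operad whose elements of arity `A`
are the families of operators on a Fock space indexed by the labellings of `A` by sets of natural
numbers. Composition multiplies operators: a composition at `i` labels `i` by the union of the labels
that are grafted there. Operators generated by creation operators commute in the graded sense, so
this is an operad. A connected species `M` maps to it by `fockGen`. If `A` has several elements, this
map sends an element of `M(A)` to the creation operators of its copies, one for every injective
labelling of `A`; the unit is sent to the identity. The free operad is the suboperad generated by the
image.

This works since no information about trees is lost. Number the leaves, and label each edge of a tree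
by the numbers of the leaves above it. Then an element of `M(t)` acts on the vacuum as the product of
one creation operator for each vertex, each creating something in a place named by the labels of the
incoming edges, from which the tree and all its factors can be read off (`exists_retraction`). Hence
the images of the spaces `M(t')` for different `t'` are linearly independent
(`eq_zero_of_sum_genNested_fockGen`). On the other hand, every tensor product of elements of any operad
that are generated by `M` is a sum over trees, because a factor that is a composition can be split into
two by adding a vertex to the tree. This is proved for two operads at the same time
(`treeRel_tprod`): the same combination of trees represents two elements obtained by the same
operations. Thus a relation in the operad of families of operators is trivial at the level of trees and
holds everywhere (`Rel.eq_zero_of_fockGen`), which gives the universal property.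

For an arbitrary left adjoint, `ℱ M` is generated by `M` by a retraction argument (`rel_unit`), and it
maps to `fockOperad`. The two facts above then say that `⨁ M(t') ⟶ (ℱ M)(t)` is surjective and
injective (`isIso_desc_nestedι`). The rest is formal. The map `λ` is defined on the summands, and all
identities are checked there, by means of the compatibility of the maps `(t', E, m)` with morphisms of
species (`nestedι_naturality`), with the counit (`nestedι_counit`) and with the multiplication
(`nestedι_mul`). The comparison map of the bar constructions is an isomorphism since a chain of
contractions is a tree followed by a shorter chain, so that the decomposition of `(ℱ M)(t)` can be
applied `n` times.
-/

noncomputable section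

namespace TreeBar

set_option linter.unusedSectionVars false

universe u

variable {k : Type u} [Field k]

/-! ### Morphisms out of a tensor product of two complexes -/

section BinaryTensor

variable {X Y Z W : DGVS k}

lemma Tot.of_injective (X : DGVS k) (i : ℤ) : Function.Injective (Tot.of X i) :=
  DirectSum.of_injective i

/-- The pairing on components underlying `Tot.bil`. -/
def bilComp (c : X ⊗ Y ⟶ Z) (p q : ℤ) (x : X.X p) (y : Y.X q) : Z.X (p + q) :=
  (HomologicalComplex.ιTensorObj X Y p q (p + q) rfl ≫ c.f (p + q)).hom
    (TensorProduct.tmul k (x : (X.X p : Type u)) (y : (Y.X q : Type u)))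

lemma Tot.bil_of (c : X ⊗ Y ⟶ Z) (p q : ℤ) (x : X.X p) (y : Y.X q) :
    Tot.bil c (Tot.of X p x) (Tot.of Y q y) = Tot.of Z (p + q) (bilComp c p q x y) := by
  simp [Tot.bil, Tot.of, bilComp]

lemma Tot.hom_ext₂ {N : Type*} [AddCommMonoid N] [Module k N]
    {f g : Tot X →ₗ[k] Tot Y →ₗ[k] N}
    (h : ∀ p x q y, f (Tot.of X p x) (Tot.of Y q y) = g (Tot.of X p x) (Tot.of Y q y)) : f = g :=
  Tot.hom_ext fun p x => Tot.hom_ext fun q y => h p x q y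

lemma tensor_hom_ext {f g : X ⊗ Y ⟶ Z}
    (h : ∀ p x q y, Tot.bil f (Tot.of X p x) (Tot.of Y q y) =
      Tot.bil g (Tot.of X p x) (Tot.of Y q y)) : f = g := by
  ext n : 1
  refine HomologicalComplex.mapBifunctor.hom_ext ?_
  rintro p q hpq
  obtain rfl : p + q = n := hpq
  refine ModuleCat.hom_ext (TensorProduct.ext' fun x y => ?_)
  have := h p x q y
  rw [Tot.bil_of, Tot.bil_of] at this
  exact Tot.of_injective _ _ this

lemma Tot.bil_comp (c : X ⊗ Y ⟶ Z) (f : Z ⟶ W) (a : Tot X) (b : Tot Y) :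
    Tot.bil (c ≫ f) a b = Tot.map f (Tot.bil c a b) := by
  have : Tot.bil (c ≫ f) = (Tot.bil c).compr₂ (Tot.map f) := by
    refine Tot.hom_ext₂ fun p x q y => ?_
    rw [LinearMap.compr₂_apply, Tot.bil_of, Tot.bil_of, Tot.map_of]
    simp [bilComp]
  rw [this]; rfl

lemma Tot.bil_tensorHom {X' Y' : DGVS k} (f : X ⟶ X') (g : Y ⟶ Y') (c : X' ⊗ Y' ⟶ Z)
    (a : Tot X) (b : Tot Y) :
    Tot.bil ((f ⊗ₘ g) ≫ c) a b = Tot.bil c (Tot.map f a) (Tot.map g b) := by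
  have : Tot.bil ((f ⊗ₘ g) ≫ c) = (Tot.bil c).compl₁₂ (Tot.map f) (Tot.map g) := by
    refine Tot.hom_ext₂ fun p x q y => ?_
    rw [LinearMap.compl₁₂_apply, Tot.map_of, Tot.map_of, Tot.bil_of, Tot.bil_of]
    congr 1
    have key := HomologicalComplex.ι_mapBifunctorMap f g (curriedTensor (ModuleCat.{u} k))
      (ComplexShape.up ℤ) p q (p + q) rfl
    have h2 := congrArg (fun φ => (φ ≫ c.f (p + q)).hom
      (TensorProduct.tmul k (x : (X.X p : Type u)) (y : (Y.X q : Type u)))) key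
    simp only [Category.assoc] at h2
    exact h2
  rw [this]; rfl

lemma Tot.bil_whiskerRight {X' : DGVS k} (f : X ⟶ X') (c : X' ⊗ Y ⟶ Z)
    (a : Tot X) (b : Tot Y) :
    Tot.bil (f ▷ Y ≫ c) a b = Tot.bil c (Tot.map f a) b := by
  rw [← tensorHom_id, Tot.bil_tensorHom, Tot.map_id]; rfl

lemma ι_tensor_d (X Y : DGVS k) (p q : ℤ) (x : X.X p) (y : Y.X q) (n : ℤ) (hn : p + q + 1 = n) :
    ((X ⊗ Y).d (p + q) n).hom ((HomologicalComplex.ιTensorObj X Y p q (p + q) rfl).hom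
      (TensorProduct.tmul k (x : (X.X p : Type u)) (y : (Y.X q : Type u)))) =
    (HomologicalComplex.ιTensorObj X Y (p + 1) q n (by omega)).hom
      (TensorProduct.tmul k ((X.d p (p + 1)).hom x : (X.X (p + 1) : Type u)) (y : (Y.X q : Type u))) +
    p.negOnePow • (HomologicalComplex.ιTensorObj X Y p (q + 1) n (by omega)).hom
      (TensorProduct.tmul k (x : (X.X p : Type u)) ((Y.d q (q + 1)).hom y : (Y.X (q + 1) : Type u))) := by
  have h1 := HomologicalComplex.mapBifunctor.d₁_eq X Y (curriedTensor (ModuleCat.{u} k))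
    (ComplexShape.up ℤ) (i₁ := p) (i₁' := p + 1) rfl q n (by change p + 1 + q = n; omega)
  have h2 := HomologicalComplex.mapBifunctor.d₂_eq X Y (curriedTensor (ModuleCat.{u} k))
    (ComplexShape.up ℤ) p (i₂ := q) (i₂' := q + 1) rfl n (by change p + (q + 1) = n; omega)
  have h := HomologicalComplex.mapBifunctor.ι_D₁ X Y (curriedTensor (ModuleCat.{u} k))
    (ComplexShape.up ℤ) (p + q) n p q rfl
  have h' := HomologicalComplex.mapBifunctor.ι_D₂ X Y (curriedTensor (ModuleCat.{u} k))
    (ComplexShape.up ℤ) (p + q) n p q rfl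
  have e := HomologicalComplex.mapBifunctor.d_eq X Y (curriedTensor (ModuleCat.{u} k))
    (ComplexShape.up ℤ) (p + q) n
  have := congrArg (fun φ => φ.hom
      (TensorProduct.tmul k (x : (X.X p : Type u)) (y : (Y.X q : Type u))))
      (congrArg₂ (· + ·) (h.trans h1) (h'.trans h2))
  have e' : ComplexShape.ε₁ (ComplexShape.up ℤ) (ComplexShape.up ℤ) (ComplexShape.up ℤ) (p, q) = 1 := rfl
  have e'' : ComplexShape.ε₂ (ComplexShape.up ℤ) (ComplexShape.up ℤ) (ComplexShape.up ℤ) (p, q) =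
    p.negOnePow := rfl
  rw [← Preadditive.comp_add, ← e, e', e'', one_smul] at this
  exact this

lemma Tot.of_ι (c : X ⊗ Y ⟶ Z) (p q n : ℤ) (h : p + q = n) (x : X.X p) (y : Y.X q) :
    Tot.of Z n ((c.f n).hom ((HomologicalComplex.ιTensorObj X Y p q n h).hom
      (TensorProduct.tmul k (x : (X.X p : Type u)) (y : (Y.X q : Type u))))) =
    Tot.bil c (Tot.of X p x) (Tot.of Y q y) := by
  subst h
  rw [Tot.bil_of]
  rfl

/-- The Leibniz rule for the bilinear map given by a morphism out of a tensor product. -/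
lemma Tot.d_bil (c : X ⊗ Y ⟶ Z) (a : Tot X) (b : Tot Y) :
    Tot.d Z (Tot.bil c a b) = Tot.bil c (Tot.d X a) b + Tot.bil c (Tot.parity X a) (Tot.d Y b) := by
  have : (Tot.bil c).compr₂ (Tot.d Z) = (Tot.bil c) ∘ₗ (Tot.d X) +
      (Tot.bil c).compl₁₂ (Tot.parity X) (Tot.d Y) := by
    refine Tot.hom_ext₂ fun p x q y => ?_
    simp only [LinearMap.compr₂_apply, LinearMap.add_apply, LinearMap.comp_apply,
      LinearMap.compl₁₂_apply]
    rw [← Tot.of_ι c p q (p + q) rfl, Tot.d_of, Tot.d_of, Tot.d_of, Tot.parity_of]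
    have hc := congrArg (fun φ => φ.hom ((HomologicalComplex.ιTensorObj X Y p q (p + q) rfl).hom
      (TensorProduct.tmul k (x : (X.X p : Type u)) (y : (Y.X q : Type u)))))
      (c.comm (p + q) (p + q + 1))
    simp only [ModuleCat.hom_comp, LinearMap.comp_apply] at hc
    have hd := ι_tensor_d X Y p q x y (p + q + 1) rfl
    rw [hc]
    refine (congrArg (fun z => Tot.of Z (p + q + 1) ((c.f (p + q + 1)).hom z)) hd).trans ?_
    rw [Units.smul_def, Units.smul_def, map_add, map_add, map_zsmul, map_zsmul, map_zsmul,
      LinearMap.smul_apply]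
    rw [Tot.of_ι, Tot.of_ι]
  exact LinearMap.congr_fun (LinearMap.congr_fun this a) b

/-- The morphism out of a tensor product of complexes given by bilinear maps on the components that
satisfy the Leibniz rule. The index of the target is kept free to avoid transports. -/
def tensorDesc (β : ∀ p q n : ℤ, p + q = n → (X.X p →ₗ[k] Y.X q →ₗ[k] Z.X n))
    (hβ : ∀ (p q n n' : ℤ) (h : p + q = n) (h' : n + 1 = n') (x : X.X p) (y : Y.X q),
      (Z.d n n').hom (β p q n h x y) =
        β (p + 1) q n' (by omega) ((X.d p (p + 1)).hom x) y +
          p.negOnePow • β p (q + 1) n' (by omega) x ((Y.d q (q + 1)).hom y)) :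
    X ⊗ Y ⟶ Z where
  f n := HomologicalComplex.mapBifunctorDesc (F := curriedTensor (ModuleCat.{u} k))
    (fun p q h => ModuleCat.ofHom (TensorProduct.lift (β p q n h)))
  comm' n n' hn := by
    refine HomologicalComplex.mapBifunctor.hom_ext ?_
    rintro p q hpq
    obtain rfl : p + q = n := hpq
    have hn' : p + q + 1 = n' := hn
    have key : ∀ (p q n : ℤ) (h : p + q = n) (x : X.X p) (y : Y.X q),
        (HomologicalComplex.mapBifunctorDesc (F := curriedTensor (ModuleCat.{u} k))
          (fun p q h => ModuleCat.ofHom (TensorProduct.lift (β p q n h)))).hom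
          ((HomologicalComplex.ιTensorObj X Y p q n h).hom
          (TensorProduct.tmul k (x : (X.X p : Type u)) (y : (Y.X q : Type u)))) = β p q n h x y := by
      intro p q n h x y
      have := HomologicalComplex.ι_mapBifunctorDesc (K₁ := X) (K₂ := Y)
        (c := ComplexShape.up ℤ) (F := curriedTensor (ModuleCat.{u} k))
        (fun p q h => ModuleCat.ofHom (TensorProduct.lift (β p q n h))) p q h
      exact congrArg (fun φ => φ.hom
        (TensorProduct.tmul k (x : (X.X p : Type u)) (y : (Y.X q : Type u)))) this
    refine ModuleCat.hom_ext (TensorProduct.ext' fun x y => ?_)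
    refine (congrArg (Z.d (p + q) n').hom (key p q (p + q) rfl x y)).trans ?_
    refine (hβ p q (p + q) n' rfl hn' x y).trans ?_
    refine Eq.trans ?_ (congrArg (HomologicalComplex.mapBifunctorDesc
      (F := curriedTensor (ModuleCat.{u} k))
          (fun p q h => ModuleCat.ofHom (TensorProduct.lift (β p q n' h)))).hom
          (ι_tensor_d X Y p q x y n' hn').symm)
    rw [map_add, Units.smul_def, Units.smul_def, map_zsmul, key, key]

lemma bil_tensorDesc (β : ∀ p q n : ℤ, p + q = n → (X.X p →ₗ[k] Y.X q →ₗ[k] Z.X n)) (hβ)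
    (p q : ℤ) (x : X.X p) (y : Y.X q) :
    Tot.bil (tensorDesc (X := X) (Y := Y) (Z := Z) β hβ) (Tot.of X p x) (Tot.of Y q y) =
      Tot.of Z (p + q) (β p q (p + q) rfl x y) := by
  rw [Tot.bil_of]
  congr 1
  have := HomologicalComplex.ι_mapBifunctorDesc (K₁ := X) (K₂ := Y)
        (c := ComplexShape.up ℤ) (F := curriedTensor (ModuleCat.{u} k))
        (fun p' q' h => ModuleCat.ofHom (TensorProduct.lift (β p' q' (p + q) h))) p q rfl
  exact congrArg (fun φ => φ.hom
        (TensorProduct.tmul k (x : (X.X p : Type u)) (y : (Y.X q : Type u)))) this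

/-- The component in degree `n` of `c (x ⊗ y)`. -/
def pairing (c : X ⊗ Y ⟶ Z) (p q n : ℤ) (h : p + q = n) : X.X p →ₗ[k] Y.X q →ₗ[k] Z.X n :=
  TensorProduct.curry (HomologicalComplex.ιTensorObj X Y p q n h ≫ c.f n).hom

lemma of_pairing (c : X ⊗ Y ⟶ Z) (p q n : ℤ) (h : p + q = n) (x : X.X p) (y : Y.X q) :
    Tot.of Z n (pairing c p q n h x y) = Tot.bil c (Tot.of X p x) (Tot.of Y q y) :=
  Tot.of_ι c p q n h x y

lemma pairing_d (c : X ⊗ Y ⟶ Z) (p q n n' : ℤ) (h : p + q = n) (h' : n + 1 = n') (x : X.X p)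
    (y : Y.X q) : (Z.d n n').hom (pairing c p q n h x y) =
        pairing c (p + 1) q n' (by omega) ((X.d p (p + 1)).hom x) y +
          p.negOnePow • pairing c p (q + 1) n' (by omega) x ((Y.d q (q + 1)).hom y) := by
  subst h'
  apply Tot.of_injective Z
  rw [map_add, Units.smul_def, map_zsmul, of_pairing, of_pairing, ← Tot.d_of, of_pairing,
    Tot.d_bil, Tot.d_of, Tot.d_of, Tot.parity_of, Units.smul_def, map_zsmul, LinearMap.smul_apply]

/-- The morphism `Y ⊗ X ⟶ Z`, `y ⊗ x ↦ (-1) ^ (|x| |y|) c (x ⊗ y)`. -/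
def tensorSwap (c : X ⊗ Y ⟶ Z) : Y ⊗ X ⟶ Z :=
  tensorDesc (fun q p n h => (p * q).negOnePow • (pairing c p q n (by omega)).flip) (by
    intro q p n n' h h' y x
    simp only [Units.smul_def, LinearMap.smul_apply, LinearMap.flip_apply, map_zsmul]
    rw [pairing_d c p q n n' _ h', smul_add, add_comm, smul_smul, Units.smul_def, smul_smul]
    congr 2
    · rw [← Units.val_mul, ← Int.negOnePow_add]
      congr 2; ring
    · rw [← Units.val_mul, ← Int.negOnePow_add, Units.val_inj, add_mul, one_mul, add_comm,
        add_assoc, Int.negOnePow_add (p * q), ← two_mul, Int.negOnePow_even _ (even_two_mul _),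
        mul_one])

lemma bil_tensorSwap (c : X ⊗ Y ⟶ Z) (p q : ℤ) (x : X.X p) (y : Y.X q) :
    Tot.bil (tensorSwap c) (Tot.of Y q y) (Tot.of X p x) =
      (p * q).negOnePow • Tot.bil c (Tot.of X p x) (Tot.of Y q y) := by
  rw [tensorSwap, bil_tensorDesc, Units.smul_def, Units.smul_def, LinearMap.smul_apply,
    LinearMap.smul_apply, map_zsmul, LinearMap.flip_apply, of_pairing]

lemma isSwapOf_tensorSwap (c : X ⊗ Y ⟶ Z) : IsSwapOf (tensorSwap c) c := fun p q x y => by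
  rw [bil_tensorSwap, mul_comm]

lemma tensorSwap_tensorSwap (c : X ⊗ Y ⟶ Z) : tensorSwap (tensorSwap c) = c := by
  refine tensor_hom_ext fun p x q y => ?_
  rw [bil_tensorSwap, bil_tensorSwap, smul_smul, mul_comm q p, ← Int.negOnePow_add,
    ← two_mul, Int.negOnePow_even _ (even_two_mul _), one_smul]

lemma tensorSwap_comp (c : X ⊗ Y ⟶ Z) (f : Z ⟶ W) : tensorSwap (c ≫ f) = tensorSwap c ≫ f := by
  refine tensor_hom_ext fun p x q y => ?_
  rw [Tot.bil_comp, bil_tensorSwap, bil_tensorSwap, Units.smul_def, Units.smul_def, map_zsmul,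
    Tot.bil_comp]

lemma tensorSwap_tensorHom {X' Y' : DGVS k} (f : X ⟶ X') (g : Y ⟶ Y') (c : X' ⊗ Y' ⟶ Z) :
    tensorSwap ((f ⊗ₘ g) ≫ c) = (g ⊗ₘ f) ≫ tensorSwap c := by
  refine tensor_hom_ext fun p x q y => ?_
  rw [Tot.bil_tensorHom, bil_tensorSwap, Tot.bil_tensorHom, Tot.map_of, Tot.map_of, bil_tensorSwap]

/-! ### Tensor products and finite direct sums -/

lemma Tot.map_add {X Y : DGVS k} (f g : X ⟶ Y) : Tot.map (f + g) = Tot.map f + Tot.map g :=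
  Tot.hom_ext fun i x => by simp [Tot.map_of]

instance (Y : DGVS k) : (tensorRight Y).Additive where
  map_add {X X'} f g := by
    refine tensor_hom_ext fun p x q y => ?_
    have h : ∀ h : X ⟶ X', Tot.bil ((tensorRight Y).map h) (Tot.of X p x) (Tot.of Y q y) =
        Tot.bil (𝟙 (X' ⊗ Y)) (Tot.map h (Tot.of X p x)) (Tot.of Y q y) := fun h => by
      rw [← Tot.bil_whiskerRight, Category.comp_id]
      rfl
    have h' : ∀ a b : (tensorRight Y).obj X ⟶ (tensorRight Y).obj X',
        Tot.bil (X := X) (Y := Y) (a + b) (Tot.of X p x) (Tot.of Y q y) =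
          Tot.bil (X := X) (Y := Y) a (Tot.of X p x) (Tot.of Y q y) +
          Tot.bil (X := X) (Y := Y) b (Tot.of X p x) (Tot.of Y q y) := fun a b => by
      rw [Tot.bil_of, Tot.bil_of, Tot.bil_of, ← _root_.map_add]
      congr 1
    rw [h', h, h, h, Tot.map_add, LinearMap.add_apply, _root_.map_add, LinearMap.add_apply]

lemma isIso_desc_whiskerRight {J : Type} [Finite J] {X : J → DGVS k} {W : DGVS k}
    (a : ∀ j, X j ⟶ W) [IsIso (Sigma.desc a)] (Y : DGVS k) :
    IsIso (Sigma.desc fun j => a j ▷ Y) := by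
  have := Fintype.ofFinite J
  have : PreservesColimitsOfShape (Discrete J) (tensorRight Y) :=
    preservesCoproductsOfShape_of_preservesBiproductsOfShape _
  have h : Sigma.desc (fun j => a j ▷ Y) =
      sigmaComparison (tensorRight Y) X ≫ (tensorRight Y).map (Sigma.desc a) := by
    refine Sigma.hom_ext _ _ fun j => ?_
    rw [Sigma.ι_desc]
    refine Eq.symm ((ι_comp_sigmaComparison_assoc (tensorRight Y) X j _).trans ?_)
    rw [← Functor.map_comp, Sigma.ι_desc]
    rfl
  rw [h]
  infer_instance

end BinaryTensor

/-! ### Homogeneous tensors and signs -/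

lemma negOnePow_congr {m n : ℤ} (h : (m : ZMod 2) = n) : m.negOnePow = n.negOnePow := by
  rw [Int.negOnePow_eq_iff, ← ZMod.intCast_eq_zero_iff_even, Int.cast_sub, h, sub_self]

lemma map_negOnePow_smul {V W : Type*} [AddCommGroup V] [AddCommGroup W] [Module k V] [Module k W]
    (f : V →ₗ[k] W) (n : ℤˣ) (v : V) : f (n • v) = n • f v := by
  rw [Units.smul_def, Units.smul_def, map_zsmul]

lemma units_smul_add {V : Type*} [AddCommGroup V] (n : ℤˣ) (a b : V) :
    n • (a + b) = n • a + n • b := by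
  simp_rw [Units.smul_def]
  exact zsmul_add _ _ _

lemma units_smul_sum {V ι : Type*} [AddCommGroup V] (n : ℤˣ) (s : Finset ι) (f : ι → V) :
    n • ∑ i ∈ s, f i = ∑ i ∈ s, n • f i := by
  simp_rw [Units.smul_def]
  exact Finset.smul_sum

section Signs

variable {α : Type} {S : Set α} {X : S → DGVS k}

/-- The indicator function of the well-order on labels that fixes the order of the factors of a tensor
product. -/
def ltInd (a b : α) : ℤ := open Classical in if WellOrderingRel a b then 1 else 0

lemma ltInd_self (a : α) : ltInd a a = 0 := if_neg (irrefl a)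

lemma ltInd_add {a b : α} (h : a ≠ b) : ltInd a b + ltInd b a = 1 := by
  rcases trichotomous_of WellOrderingRel a b with h' | h' | h'
  · rw [ltInd, ltInd, if_pos h', if_neg (asymm h')]; rfl
  · exact (h h').elim
  · rw [ltInd, ltInd, if_pos h', if_neg (asymm h')]; rfl

/-- The sum of the degrees of the factors before `v`. -/
def degBefore (deg : S → ℤ) (v : α) : ℤ := ∑ᶠ u : S, ltInd u.1 v * deg u

/-- Every member of the family is homogeneous, of the given degree. -/
def HomogFam (deg : S → ℤ) (y : ∀ v, Tot (X v)) : Prop :=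
  ∀ v, ∃ x, y v = Tot.of (X v) (deg v) x

lemma homogFam_of (deg : S → ℤ) (x : ∀ v, (X v).X (deg v)) :
    HomogFam deg (fun v => Tot.of (X v) (deg v) (x v)) := fun v => ⟨x v, rfl⟩

lemma HomogFam.parity {deg : S → ℤ} {y : ∀ v, Tot (X v)} (h : HomogFam deg y) (v : S) :
    Tot.parity (X v) (y v) = (deg v).negOnePow • y v := by
  obtain ⟨x, hx⟩ := h v
  rw [hx, Tot.parity_of]

lemma HomogFam.exists_piPure {deg : S → ℤ} {y : ∀ v, Tot (X v)} (h : HomogFam deg y) :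
    ∃ x, PiTensorProduct.tprod k y = piPure S X deg x := by
  choose x hx using h
  exact ⟨x, by rw [piPure]; congr 1; exact funext hx⟩

lemma HomogFam.mem_piHomog {deg : S → ℤ} {y : ∀ v, Tot (X v)} (h : HomogFam deg y) :
    PiTensorProduct.tprod k y ∈ piHomog S X (∑ᶠ v, deg v) := by
  obtain ⟨x, hx⟩ := h.exists_piPure
  rw [hx]
  exact Submodule.subset_span ⟨deg, x, rfl, rfl⟩

lemma HomogFam.update_d [DecidableEq S] {deg : S → ℤ} {y : ∀ v, Tot (X v)} (h : HomogFam deg y) (v : S) :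
    HomogFam (Function.update deg v (deg v + 1)) (Function.update y v (Tot.d (X v) (y v))) := by
  intro w
  by_cases hw : w = v
  · subst hw
    obtain ⟨x, hx⟩ := h w
    rw [Function.update_self, Function.update_self, hx]
    exact ⟨_, Tot.d_of _ _ _⟩
  · rw [Function.update_of_ne hw, Function.update_of_ne hw]
    exact h w

lemma tprod_units_smul [Finite S] (c : S → ℤˣ) (y : ∀ v, Tot (X v)) :
    PiTensorProduct.tprod k (fun v => c v • y v) = (∏ᶠ v, c v) • PiTensorProduct.tprod k y := by
  have := Fintype.ofFinite S
  have h := (PiTensorProduct.tprod k (s := fun w => Tot (X w))).map_smul_univ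
    (fun v => (((c v : ℤ) : k))) y
  rw [finprod_eq_prod_of_fintype, Units.smul_def, ← Int.cast_smul_eq_zsmul k, Units.coe_prod,
    Int.cast_prod]
  rw [← h]
  congr 1
  funext v
  rw [Units.smul_def, ← Int.cast_smul_eq_zsmul k]

lemma negOnePow_sum {ι : Type*} (s : Finset ι) (f : ι → ℤ) :
    (∑ i ∈ s, f i).negOnePow = ∏ i ∈ s, (f i).negOnePow := by
  classical
  induction s using Finset.induction_on with
  | empty => simp
  | insert a s ha ih => rw [Finset.sum_insert ha, Finset.prod_insert ha, Int.negOnePow_add, ih]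

lemma piDiffAt_tprod [Finite S] [DecidableEq S] {deg : S → ℤ} {y : ∀ v, Tot (X v)} (h : HomogFam deg y) (v : S) :
    piDiffAt S X v (PiTensorProduct.tprod k y) = (degBefore deg v.1).negOnePow •
      PiTensorProduct.tprod k (Function.update y v (Tot.d (X v) (y v))) := by
  have := Fintype.ofFinite S
  rw [piDiffAt, PiTensorProduct.map_tprod, degBefore, finsum_eq_sum_of_fintype, negOnePow_sum,
    ← finprod_eq_prod_of_fintype, ← tprod_units_smul]
  congr 1
  funext w
  by_cases hw : w = v
  · subst hw
    have hirr : ¬ WellOrderingRel w.1 w.1 := irrefl _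
    simp [ltInd, hirr]
  · rw [Function.update_of_ne hw]
    by_cases h1 : WellOrderingRel w.1 v.1
    · rw [if_pos h1, ltInd, if_pos h1, one_mul, h.parity]
    · rw [if_neg h1, if_neg hw, ltInd, if_neg h1, zero_mul]; simp

lemma piDiff_tprod [Finite S] [DecidableEq S] {deg : S → ℤ} {y : ∀ v, Tot (X v)} (h : HomogFam deg y) :
    piDiff S X (PiTensorProduct.tprod k y) = ∑ᶠ v : S, (degBefore deg v.1).negOnePow •
      PiTensorProduct.tprod k (Function.update y v (Tot.d (X v) (y v))) := by
  have := Fintype.ofFinite S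
  rw [piDiff, finsum_eq_sum_of_fintype (f := piDiffAt S X), LinearMap.sum_apply,
    finsum_eq_sum_of_fintype]
  exact Finset.sum_congr rfl fun v _ => piDiffAt_tprod h v

/-- Linear maps on a tensor product of complexes agree if they agree on the tensor products of
homogeneous elements. -/
lemma piPure_ext [Finite S] {N : Type*} [AddCommMonoid N] [Module k N]
    {f g : (⨂[k] w, Tot (X w)) →ₗ[k] N}
    (h : ∀ deg x, f (piPure S X deg x) = g (piPure S X deg x)) : f = g := by
  refine PiTensorProduct.ext (MultilinearMap.dfinsupp_ext fun deg => ?_)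
  ext x
  exact h deg x

/-- The linear map given by multilinear maps on the homogeneous families of each degree. -/
def piLift [Finite S] {N : Type*} [AddCommMonoid N] [Module k N]
    (f : ∀ deg : S → ℤ, MultilinearMap k (fun v => ((X v).X (deg v) : Type u)) N) :
    (⨂[k] w, Tot (X w)) →ₗ[k] N :=
  open Classical in
  haveI := Fintype.ofFinite S
  PiTensorProduct.lift (MultilinearMap.fromDFinsuppEquiv (fun _ : S => ℤ) k
    (M := fun (v : S) (i : ℤ) => ((X v).X i : Type u)) f)

lemma piLift_piPure [Finite S] {N : Type*} [AddCommMonoid N] [Module k N]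
    (f : ∀ deg : S → ℤ, MultilinearMap k (fun v => ((X v).X (deg v) : Type u)) N)
    (deg : S → ℤ) (x : ∀ v, (X v).X (deg v)) : piLift f (piPure S X deg x) = f deg x := by
  classical
  let _ := Fintype.ofFinite S
  refine (PiTensorProduct.lift.tprod _).trans ?_
  have h := MultilinearMap.fromDFinsuppEquiv_single (κ := fun _ : S => ℤ) (R := k)
    (M := fun (v : S) (i : ℤ) => ((X v).X i : Type u)) f deg x
  exact h

/-- The operator that multiplies the homogeneous tensors by a sign depending on the degrees of the
factors. -/
def signMap [Finite S] (s : (S → ℤ) → ℤˣ) : (⨂[k] w, Tot (X w)) →ₗ[k] ⨂[k] w, Tot (X w) :=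
  piLift fun deg => ((s deg : ℤ) : k) •
    (PiTensorProduct.tprod k).compLinearMap (fun v => Tot.of (X v) (deg v))

lemma signMap_piPure [Finite S] (s : (S → ℤ) → ℤˣ) (deg : S → ℤ) (x : ∀ v, (X v).X (deg v)) :
    signMap s (piPure S X deg x) = s deg • piPure S X deg x := by
  rw [signMap, piLift_piPure, Units.smul_def, ← Int.cast_smul_eq_zsmul k]
  rfl

lemma signMap_tprod [Finite S] (s : (S → ℤ) → ℤˣ) {deg : S → ℤ} {y : ∀ v, Tot (X v)}
    (h : HomogFam deg y) :
    signMap s (PiTensorProduct.tprod k y) = s deg • PiTensorProduct.tprod k y := by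
  obtain ⟨x, hx⟩ := h.exists_piPure
  rw [hx, signMap_piPure]

end Signs

/-! ### Morphisms between tensor products of families -/

section PiTensorHom

variable {α β : Type} {S : Set α} {X : S → DGVS k} {T : Set β} {Y : T → DGVS k} [Finite S] [Finite T]

/-- A homogeneous tensor, as an element of the complex `piTensor S X`. -/
def piElt (deg : S → ℤ) (x : ∀ v, (X v).X (deg v)) : (piTensor S X).X (∑ᶠ v, deg v) :=
  (⟨piPure S X deg x, Submodule.subset_span ⟨deg, x, rfl, rfl⟩⟩ : piHomog S X (∑ᶠ v, deg v))

lemma piTensorVal_injective (n : ℤ) : Function.Injective (piTensorVal S X n) :=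
  Subtype.val_injective

lemma piTensor_hom_ext {Z : DGVS k} {f g : piTensor S X ⟶ Z}
    (h : ∀ n deg x (z : (piTensor S X).X n), piTensorVal S X n z = piPure S X deg x →
      (f.f n).hom z = (g.f n).hom z) : f = g := by
  ext n z
  obtain ⟨z, hz⟩ := z
  have : ∀ z (hz : z ∈ piHomog S X n), (f.f n).hom (⟨z, hz⟩ : piHomog S X n) =
      (g.f n).hom (⟨z, hz⟩ : piHomog S X n) := by
    intro z hz
    induction hz using Submodule.span_induction with
    | mem z hz =>
      obtain ⟨deg, x, rfl, rfl⟩ := hz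
      exact h _ deg x _ rfl
    | zero => exact (map_zero (f.f n).hom).trans (map_zero (g.f n).hom).symm
    | add a b ha hb iha ihb =>
      refine (map_add (f.f n).hom (⟨a, ha⟩ : piHomog S X n) ⟨b, hb⟩).trans ?_
      refine Eq.trans ?_ (map_add (g.f n).hom (⟨a, ha⟩ : piHomog S X n) ⟨b, hb⟩).symm
      exact congrArg₂ (· + ·) iha ihb
    | smul c a ha iha =>
      refine (map_smul (f.f n).hom c (⟨a, ha⟩ : piHomog S X n)).trans ?_
      refine Eq.trans ?_ (map_smul (g.f n).hom c (⟨a, ha⟩ : piHomog S X n)).symm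
      exact congrArg (c • ·) iha
  exact this z hz

/-- The morphism of complexes given by a linear map of the full tensor products that preserves the
degrees of homogeneous tensors and commutes with the differentials. -/
def piTensorHom (F : (⨂[k] w, Tot (X w)) →ₗ[k] ⨂[k] w, Tot (Y w))
    (hF : ∀ deg x, F (piPure S X deg x) ∈ piHomog T Y (∑ᶠ v, deg v))
    (hd : ∀ deg x, F (piDiff S X (piPure S X deg x)) = piDiff T Y (F (piPure S X deg x))) :
    piTensor S X ⟶ piTensor T Y where
  f n := ModuleCat.ofHom (F.restrict (p := piHomog S X n) (q := piHomog T Y n) (fun z hz => by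
        induction hz using Submodule.span_induction with
        | mem z hz =>
          obtain ⟨deg, x, rfl, rfl⟩ := hz
          exact hF deg x
        | zero => simp
        | add a b _ _ ha hb => rw [map_add]; exact add_mem ha hb
        | smul c a _ ha => rw [map_smul]; exact Submodule.smul_mem _ _ ha))
  comm' i j hij := by
    have hij' : i + 1 = j := hij
    have hd' : F ∘ₗ piDiff S X = piDiff T Y ∘ₗ F := piPure_ext hd
    simp only [piTensor, dif_pos hij']
    refine ModuleCat.hom_ext (LinearMap.ext (fun z => Subtype.ext ?_))
    exact (LinearMap.congr_fun hd' z.1).symm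

end PiTensorHom

/-! ### Partial compositions on sets of labels -/

section SetComp

/-- The map of total spaces given by a bijection. -/
abbrev Species.act (M : Species k) {A B : Type} [Finite A] [Finite B] (e : A ≃ B) :
    Tot (M.on B) →ₗ[k] Tot (M.on A) := Tot.map (M.along e)

lemma Species.act_refl (M : Species k) {A : Type} [Finite A] (a : Tot (M.on A)) :
    M.act (Equiv.refl A) a = a := by
  have : M.along (Equiv.refl A) = 𝟙 _ := M.map_id _
  rw [Species.act, this, Tot.map_id, LinearMap.id_apply]

lemma Species.act_act (M : Species k) {A B C : Type} [Finite A] [Finite B] [Finite C]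
    (e : A ≃ B) (f : B ≃ C) (c : Tot (M.on C)) : M.act e (M.act f c) = M.act (e.trans f) c := by
  have : M.along (e.trans f) = M.along f ≫ M.along e :=
    M.map_comp (Quiver.Hom.op (show (⟨B⟩ : Bij) ⟶ ⟨C⟩ from f))
      (Quiver.Hom.op (show (⟨A⟩ : Bij) ⟶ ⟨B⟩ from e))
  rw [Species.act, Species.act, Species.act, this, Tot.map_comp, LinearMap.comp_apply]

lemma Species.act_of (M : Species k) {A B : Type} [Finite A] [Finite B]
    (e : A ≃ B) (n : ℤ) (x : (M.on B).X n) :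
    M.act e (Tot.of _ n x) = Tot.of _ n (((M.along e).f n).hom x) := Tot.map_of _ _ _

lemma Species.d_act (M : Species k) {A B : Type} [Finite A] [Finite B]
    (e : A ≃ B) (x : Tot (M.on B)) : Tot.d _ (M.act e x) = M.act e (Tot.d _ x) :=
  (LinearMap.congr_fun (Tot.map_d (M.along e)) x).symm

lemma Species.act_setCongr_self (M : Species k) {β : Type} {S : Set β} [Finite S] (h : S = S)
    (a : Tot (M.on S)) : M.act (Equiv.setCongr h) a = a := by
  have : Equiv.setCongr h = Equiv.refl _ := by ext; rfl
  rw [this, Species.act_refl]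

/-- Functoriality of `(A \ {i}) ⊔ B`, with the image of `i` named. -/
def Insert.congr' {A A' B B' : Type} (e : A ≃ A') (f : B ≃ B') (i : A) (i' : A') (h : e i = i') :
    Insert i B ≃ Insert i' B' :=
  Equiv.sumCongr (e.subtypeEquiv (fun a => by rw [← h]; exact e.injective.ne_iff.symm)) f

variable (P : Operad k)

/-- The partial composition as a bilinear map of total spaces. -/
abbrev Operad.circ {A B : Type} [Finite A] [Finite B] (i : A) :
    Tot (P.toSpecies.on A) →ₗ[k] Tot (P.toSpecies.on B) →ₗ[k] Tot (P.toSpecies.on (Insert i B)) :=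
  Tot.bil (P.comp A B i)

lemma Operad.circ_act {A A' B B' : Type} [Finite A] [Finite A'] [Finite B] [Finite B']
    (e : A ≃ A') (f : B ≃ B') (i : A) (i' : A') (h : e i = i') (a : Tot (P.toSpecies.on A'))
    (b : Tot (P.toSpecies.on B')) :
    P.circ i (P.toSpecies.act e a) (P.toSpecies.act f b) =
      P.toSpecies.act (Insert.congr' e f i i' h) (P.circ i' a b) := by
  subst h
  rw [Operad.circ, ← Tot.bil_tensorHom, P.comp_along, Tot.bil_comp]
  rfl

variable {P}

/-- The label of an element of `(S \ {i}) ⊔ S'`. -/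
def insVal {β : Type} {S S' : Set β} {i : S} : Insert i S' → β :=
  Sum.elim (fun a => a.1.1) (fun b => b.1)

/-- The bijection `e` preserves labels. -/
def LabelEquiv {β : Type} {S S' U : Set β} {i : S} (e : U ≃ Insert i S') : Prop :=
  ∀ x, insVal (e x) = x.1

lemma injective_of_label {V Z β : Type} {l : V → β} (hl : Function.Injective l) {val : Z → β}
    (F : V ≃ Z) (hF : ∀ x, val (F x) = l x) : Function.Injective val := by
  intro x y hxy
  have hx := hF (F.symm x)
  have hy := hF (F.symm y)
  rw [F.apply_symm_apply] at hx hy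
  exact F.symm.injective (hl (hx.symm.trans (hxy.trans hy)))

/-- A bijection is determined by its effect on labels. -/
lemma equiv_eq_of_label {V Z β : Type} {l : V → β} (hl : Function.Injective l) {val : Z → β}
    {F G : V ≃ Z} (hF : ∀ x, val (F x) = l x) (hG : ∀ x, val (G x) = l x) : F = G := by
  ext1 x
  exact injective_of_label hl F hF ((hF x).trans (hG x).symm)

lemma LabelEquiv.eq {β : Type} {S S' U : Set β} {i : S} {e e' : U ≃ Insert i S'}
    (h : LabelEquiv e) (h' : LabelEquiv e') : e = e' :=
  equiv_eq_of_label Subtype.val_injective h h'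

variable {β : Type} {S₁ S₂ S₃ T₁ T₂ T₃ U₁ U₂ V V' : Set β} [Finite S₁] [Finite S₂] [Finite S₃]
  [Finite T₁] [Finite T₂] [Finite T₃] [Finite U₁] [Finite U₂] [Finite V] [Finite V']

/-- Partial composition only depends on the underlying labels. -/
lemma circ_label_congr (h₁ : T₁ = S₁) (h₂ : T₂ = S₂) (hV : V = V') (i : S₁) (j : T₁)
    (hij : i.1 = j.1) (e : V' ≃ Insert i S₂) (f : V ≃ Insert j T₂)
    (he : LabelEquiv e) (hf : LabelEquiv f)
    (a : Tot (P.toSpecies.on S₁)) (b : Tot (P.toSpecies.on S₂)) :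
    P.toSpecies.act (Equiv.setCongr hV) (P.toSpecies.act e (P.circ i a b)) =
    P.toSpecies.act f (P.circ j (P.toSpecies.act (Equiv.setCongr h₁) a)
        (P.toSpecies.act (Equiv.setCongr h₂) b)) := by
  subst h₁ h₂ hV
  obtain rfl : i = j := Subtype.ext hij
  rw [Species.act_setCongr_self, Species.act_setCongr_self, Species.act_setCongr_self, he.eq hf]

/-- `(a ∘ᵢ b) ∘ⱼ c = a ∘ᵢ (b ∘ⱼ c)`, on sets of labels. -/
lemma circ_label_nested (h₃ : T₃ = S₃) (h₁ : T₁ = S₁) (i : S₁) (j : S₂) (e₁ : U₁ ≃ Insert i S₂)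
    (j' : U₁) (hj : j'.1 = j.1) (e₂ : V ≃ Insert j' T₃) (e₃ : U₂ ≃ Insert j S₃)
    (i' : T₁) (hi : i'.1 = i.1) (e₄ : V ≃ Insert i' U₂)
    (he₁ : LabelEquiv e₁) (he₂ : LabelEquiv e₂) (he₃ : LabelEquiv e₃) (he₄ : LabelEquiv e₄)
    (a : Tot (P.toSpecies.on S₁)) (b : Tot (P.toSpecies.on S₂)) (c : Tot (P.toSpecies.on S₃)) :
    P.toSpecies.act e₂ (P.circ j' (P.toSpecies.act e₁ (P.circ i a b))
      (P.toSpecies.act (Equiv.setCongr h₃) c)) =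
    P.toSpecies.act e₄ (P.circ i' (P.toSpecies.act (Equiv.setCongr h₁) a)
      (P.toSpecies.act e₃ (P.circ j b c))) := by
  subst h₃ h₁
  obtain rfl : i' = i := Subtype.ext hi
  have hinj := injective_of_label Subtype.val_injective e₁ he₁
  have hj' : e₁ j' = Sum.inr j := hinj ((he₁ j').trans hj)
  rw [Species.act_setCongr_self, Species.act_setCongr_self]
  rw [← P.toSpecies.act_refl c, P.circ_act e₁ (Equiv.refl _) j' _ hj', P.assoc_nested,
    ← P.toSpecies.act_refl a, P.toSpecies.act_refl c,
    P.circ_act (Equiv.refl _) e₃ i' i' rfl, P.toSpecies.act_refl a, Species.act_act,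
    Species.act_act, Species.act_act]
  congr 2
  refine equiv_eq_of_label (val := (Sum.elim (fun a => a.1.1)
    (Sum.elim (fun b => b.1.1) (fun c => c.1)) : Insert i' (Insert j T₃) → β))
    Subtype.val_injective (fun x => ?_) (fun x => ?_)
  · have hval : ∀ y : Insert j' T₃, (Sum.elim (fun a => a.1.1)
        (Sum.elim (fun b => b.1.1) (fun c => c.1)) : Insert i' (Insert j T₃) → β)
        (Insert.nested i' j (Insert.congr' e₁ (Equiv.refl _) j' _ hj' y)) = insVal y := by
      rintro (⟨u, hu⟩ | c)
      · have h1 := he₁ u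
        have h2 : e₁ u ≠ Sum.inr j := fun h => hu (e₁.injective (h.trans hj'.symm))
        change _ = u.1
        rw [← h1]
        change Sum.elim _ _ (Insert.nested i' j (Sum.inl ⟨e₁ u, h2⟩)) = _
        generalize e₁ u = z at h2
        rcases z with a | b <;> rfl
      · rfl
    exact (hval (e₂ x)).trans (he₂ x)
  · have hval : ∀ y : Insert i' U₂, (Sum.elim (fun a => a.1.1)
        (Sum.elim (fun b => b.1.1) (fun c => c.1)) : Insert i' (Insert j T₃) → β)
        (Insert.congr' (Equiv.refl _) e₃ i' i' rfl y) = insVal y := by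
      rintro (a | u)
      · rfl
      · exact he₃ u
    exact (hval (e₄ x)).trans (he₄ x)

/-- `(a ∘ᵢ b) ∘ⱼ c = (-1) ^ (|b| |c|) (a ∘ⱼ c) ∘ᵢ b`, on sets of labels. -/
lemma circ_label_parallel (h₂ : T₂ = S₂) (h₃ : T₃ = S₃) (i j : S₁) (hij : i ≠ j)
    (e₁ : U₁ ≃ Insert i S₂) (j' : U₁) (hj : j'.1 = j.1) (e₂ : V ≃ Insert j' T₃)
    (e₃ : U₂ ≃ Insert j S₃) (i' : U₂) (hi : i'.1 = i.1) (e₄ : V ≃ Insert i' T₂)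
    (he₁ : LabelEquiv e₁) (he₂ : LabelEquiv e₂) (he₃ : LabelEquiv e₃) (he₄ : LabelEquiv e₄)
    (a : Tot (P.toSpecies.on S₁)) (p q : ℤ) (b : (P.toSpecies.on S₂).X p)
    (c : (P.toSpecies.on S₃).X q) :
    P.toSpecies.act e₂ (P.circ j' (P.toSpecies.act e₁ (P.circ i a (Tot.of _ p b)))
      (P.toSpecies.act (Equiv.setCongr h₃) (Tot.of _ q c))) =
    (p * q).negOnePow • P.toSpecies.act e₄ (P.circ i' (P.toSpecies.act e₃
      (P.circ j a (Tot.of _ q c))) (P.toSpecies.act (Equiv.setCongr h₂) (Tot.of _ p b))) := by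
  subst h₃ h₂
  have hj' : e₁ j' = Sum.inl ⟨j, hij.symm⟩ :=
    injective_of_label Subtype.val_injective e₁ he₁ ((he₁ j').trans hj)
  have hi' : e₃ i' = Sum.inl ⟨i, hij⟩ :=
    injective_of_label Subtype.val_injective e₃ he₃ ((he₃ i').trans hi)
  rw [Species.act_setCongr_self, Species.act_setCongr_self]
  rw [← P.toSpecies.act_refl (Tot.of _ q c), P.circ_act e₁ (Equiv.refl _) j' _ hj',
    P.toSpecies.act_refl (Tot.of _ q c), P.assoc_parallel _ _ _ i j hij]
  rw [← P.toSpecies.act_refl (Tot.of _ p b), P.circ_act e₃ (Equiv.refl _) i' _ hi',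
    P.toSpecies.act_refl (Tot.of _ p b), map_negOnePow_smul, map_negOnePow_smul,
    Species.act_act, Species.act_act, Species.act_act]
  congr 3
  refine equiv_eq_of_label (val := (Sum.elim (fun x => insVal x.1) (fun b => b.1) :
    Insert (Sum.inl ⟨i, hij⟩ : Insert j T₃) T₂ → β))
    Subtype.val_injective (fun x => ?_) (fun x => ?_)
  · have hval : ∀ y : Insert j' T₃, (Sum.elim (fun x => insVal x.1) (fun b => b.1) :
        Insert (Sum.inl ⟨i, hij⟩ : Insert j T₃) T₂ → β)
        (Insert.parallel i j hij (Insert.congr' e₁ (Equiv.refl _) j' _ hj' y)) = insVal y := by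
      rintro (⟨u, hu⟩ | c)
      · have h1 := he₁ u
        have h2 : e₁ u ≠ Sum.inl ⟨j, hij.symm⟩ := fun h => hu (e₁.injective (h.trans hj'.symm))
        change _ = u.1
        rw [← h1]
        change Sum.elim _ _ (Insert.parallel i j hij (Sum.inl ⟨e₁ u, h2⟩)) = _
        generalize e₁ u = z at h2
        rcases z with a | b <;> rfl
      · rfl
    exact (hval (e₂ x)).trans (he₂ x)
  · have hval : ∀ y : Insert i' T₂, (Sum.elim (fun x => insVal x.1) (fun b => b.1) :
        Insert (Sum.inl ⟨i, hij⟩ : Insert j T₃) T₂ → β)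
        (Insert.congr' e₃ (Equiv.refl _) i' _ hi' y) = insVal y := by
      rintro (⟨u, hu⟩ | c)
      · exact he₃ u
      · rfl
    exact (hval (e₄ x)).trans (he₄ x)

end SetComp

/-! ### Contraction of a single edge -/

section Contraction

variable {I : Type} [Finite I] {t s : RTree I} {v w : Set I}

namespace RTree.Contracts

lemma subset (h : t.Contracts s v w) {A : Set I} (hA : A ∈ s.verts) : A ∈ t.verts :=
  ((h.mem_iff A).1 hA).1

lemma target_mem' (h : t.Contracts s v w) : v ∈ s.verts :=
  (h.mem_iff v).2 ⟨h.target_mem, h.mem_In.2.1.ne'⟩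

lemma labelEquiv (h : t.Contracts s v w) {A : Set I} (hA : A = v) :
    LabelEquiv ((Equiv.setCongr (congrArg s.In hA)).trans h.inTarget) := by
  classical
  subst hA
  rintro ⟨x, hx⟩
  have hx' := hx
  rw [h.In_target] at hx'
  rw [Equiv.trans_apply]
  change insVal (h.inTarget ⟨x, hx⟩) = x
  by_cases h1 : x ∈ t.In A \ {w}
  · simp only [RTree.Contracts.inTarget, Equiv.trans_apply]
    have : (Equiv.setCongr h.In_target) ⟨x, hx⟩ = ⟨x, hx'⟩ := rfl
    rw [this, Equiv.Set.union_apply_left (a := ⟨x, hx'⟩) (h.disjoint_In) h1]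
    rfl
  · have h2 : x ∈ t.In w := hx'.resolve_left h1
    simp only [RTree.Contracts.inTarget, Equiv.trans_apply]
    have : (Equiv.setCongr h.In_target) ⟨x, hx⟩ = ⟨x, hx'⟩ := rfl
    rw [this, Equiv.Set.union_apply_right (a := ⟨x, hx'⟩) (h.disjoint_In) h2]
    rfl

/-- The vertices of `t` are those of `s` and `w`. -/
lemma finsum_verts {N : Type*} [AddCommMonoid N] (h : t.Contracts s v w) (G : t.verts → N) :
    ∑ᶠ A, G A = G ⟨w, h.source_mem⟩ + ∑ᶠ B : s.verts, G ⟨B.1, h.subset B.2⟩ := by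
  classical
  have := Fintype.ofFinite t.verts
  have := Fintype.ofFinite s.verts
  rw [finsum_eq_sum_of_fintype, finsum_eq_sum_of_fintype,
    ← Finset.add_sum_erase _ _ (Finset.mem_univ (⟨w, h.source_mem⟩ : t.verts))]
  congr 1
  symm
  refine Finset.sum_bij (fun B _ => ⟨B.1, h.subset B.2⟩) (fun B _ => ?_) (fun B _ B' _ hB => ?_)
    (fun A hA => ?_) (fun _ _ => rfl)
  · refine Finset.mem_erase.2 ⟨fun hB => ((h.mem_iff B.1).1 B.2).2 (congrArg Subtype.val hB),
      Finset.mem_univ _⟩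
  · exact Subtype.ext (Subtype.mk.inj hB)
  · exact ⟨⟨A.1, (h.mem_iff A.1).2 ⟨A.2, fun hA' => (Finset.mem_erase.1 hA).1 (Subtype.ext hA')⟩⟩,
      Finset.mem_univ _, rfl⟩

end RTree.Contracts

/-- The degrees of the factors after the contraction of an edge. -/
def contractDeg (h : t.Contracts s v w) (deg : t.verts → ℤ) (B : s.verts) : ℤ :=
  open Classical in
  if B.1 = v then deg ⟨v, h.target_mem⟩ + deg ⟨w, h.source_mem⟩ else deg ⟨B.1, h.subset B.2⟩

lemma contractDeg_eq (h : t.Contracts s v w) (deg : t.verts → ℤ) (B : s.verts) :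
    contractDeg h deg B = deg ⟨B.1, h.subset B.2⟩ +
      open Classical in if B = ⟨v, h.target_mem'⟩ then deg ⟨w, h.source_mem⟩ else 0 := by
  obtain ⟨B, hB⟩ := B
  by_cases hv : B = v
  · subst hv; simp [contractDeg]
  · simp [contractDeg, hv]

/-- Weighted sums of degrees before and after a contraction: the degree of the factor at `w` moves to
`v`. -/
lemma finsum_contractDeg_mul (h : t.Contracts s v w) (deg : t.verts → ℤ) (c : Set I → ℤ) :
    ∑ᶠ B : s.verts, c B.1 * contractDeg h deg B =
      ∑ᶠ A : t.verts, c A.1 * deg A + (c v - c w) * deg ⟨w, h.source_mem⟩ := by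
  classical
  have := Fintype.ofFinite s.verts
  rw [h.finsum_verts, finsum_eq_sum_of_fintype, finsum_eq_sum_of_fintype]
  simp_rw [contractDeg_eq, mul_add, Finset.sum_add_distrib, mul_ite, mul_zero]
  rw [Finset.sum_ite_eq' Finset.univ, if_pos (Finset.mem_univ _)]
  ring

lemma finsum_contractDeg (h : t.Contracts s v w) (deg : t.verts → ℤ) :
    ∑ᶠ B, contractDeg h deg B = ∑ᶠ A, deg A := by
  simpa using finsum_contractDeg_mul h deg (fun _ => 1)

lemma degBefore_contractDeg (h : t.Contracts s v w) (deg : t.verts → ℤ) (u : Set I) :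
    degBefore (contractDeg h deg) u =
      degBefore deg u + (ltInd v u - ltInd w u) * deg ⟨w, h.source_mem⟩ :=
  finsum_contractDeg_mul h deg (fun A => ltInd A u)

/-- The parity of the exponent of the sign of a contraction. It is expressed by the degrees in front of
the two factors, since these behave additively under a further contraction. -/
lemma moveExponent_cast (hv : v ∈ t.verts) (hw : w ∈ t.verts) (hne : v ≠ w) (deg : t.verts → ℤ) :
    (moveExponent t v w hw deg : ZMod 2) = deg ⟨w, hw⟩ *
      (degBefore deg v + degBefore deg w + deg ⟨v, hv⟩ + deg ⟨w, hw⟩ * ltInd w v) := by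
  classical
  have := Fintype.ofFinite t.verts
  rw [moveExponent, Int.cast_mul]
  congr 1
  have h1 : ∑ᶠ A ∈ {A : t.verts |
    (WellOrderingRel v A.1 ∧ WellOrderingRel A.1 w) ∨
    (WellOrderingRel w A.1 ∧ (WellOrderingRel A.1 v ∨ A.1 = v))}, deg A =
    ∑ A : t.verts, if (WellOrderingRel v A.1 ∧ WellOrderingRel A.1 w) ∨
    (WellOrderingRel w A.1 ∧ (WellOrderingRel A.1 v ∨ A.1 = v)) then deg A else 0 := by
    rw [finsum_eq_sum_of_fintype]
    refine Finset.sum_congr rfl fun A _ => ?_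
    rw [finsum_eq_if]
    rfl
  have h2 : deg ⟨v, hv⟩ = ∑ A : t.verts, if A = ⟨v, hv⟩ then deg A else 0 := by simp
  have h3 : deg ⟨w, hw⟩ * ltInd w v = ∑ A : t.verts, if A = ⟨w, hw⟩ then deg A * ltInd w v else 0 := by
    simp
  rw [h1, ← Int.cast_mul, h2, h3, degBefore, degBefore, finsum_eq_sum_of_fintype,
    finsum_eq_sum_of_fintype, ← Int.cast_add, ← Int.cast_add, ← Int.cast_add,
    ← Finset.sum_add_distrib, ← Finset.sum_add_distrib, ← Finset.sum_add_distrib,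
    Int.cast_sum, Int.cast_sum]
  refine Finset.sum_congr rfl fun A _ => ?_
  have two : ∀ x : ZMod 2, x + x = 0 := by decide
  obtain ⟨A, hA⟩ := A
  by_cases hAv : A = v
  · subst hAv
    have : ¬ (⟨A, hA⟩ : t.verts) = ⟨w, hw⟩ := fun h => hne (congrArg Subtype.val h)
    rcases trichotomous_of WellOrderingRel w A with h | h | h
    · simp [ltInd, h, asymm h, this, irrefl A]
    · exact (hne h.symm).elim
    · simp [ltInd, h, asymm h, this, irrefl A, two]
  · by_cases hAw : A = w
    · subst hAw
      rcases trichotomous_of WellOrderingRel A v with h | h | h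
      · simp [ltInd, h, asymm h, irrefl A, hAv, two]
      · exact (hAv h).elim
      · simp [ltInd, h, asymm h, irrefl A, hAv]
    · rcases trichotomous_of WellOrderingRel A v with h | h | h
      · rcases trichotomous_of WellOrderingRel A w with h' | h' | h'
        · simp [ltInd, h, h', asymm h, asymm h', hAv, hAw, two]
        · exact (hAw h').elim
        · simp [ltInd, h, h', asymm h, asymm h', hAv, hAw]
      · exact (hAv h).elim
      · rcases trichotomous_of WellOrderingRel A w with h' | h' | h'
        · simp [ltInd, h, h', asymm h, asymm h', hAv, hAw]
        · exact (hAw h').elim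
        · simp [ltInd, h, h', asymm h, asymm h', hAv, hAw]

variable (P : Operad k)

/-- If one member of the family `x` varies, then one member of the contracted family varies, and it
does so linearly. -/
lemma contractFamily_update_other [DecidableEq t.verts] [DecidableEq s.verts] (h : t.Contracts s v w)
    (x : ∀ A : t.verts, Tot (P.toSpecies.on (t.In A.1))) (A : t.verts) (hv : A.1 ≠ v)
    (hw : A.1 ≠ w) (y : Tot (P.toSpecies.on (t.In A.1))) :
    contractFamily P h (Function.update x A y) =
      Function.update (contractFamily P h x) ⟨A.1, (h.mem_iff A.1).2 ⟨A.2, hw⟩⟩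
        (P.toSpecies.act (Equiv.setCongr
          (h.In_of_ne ((h.mem_iff A.1).2 ⟨A.2, hw⟩) hv)) y) := by
  funext B
  by_cases hB : B = ⟨A.1, (h.mem_iff A.1).2 ⟨A.2, hw⟩⟩
  · subst hB
    rw [Function.update_self, contractFamily, dif_neg hv, Function.update_self]
  · have hB' : B.1 ≠ A.1 := fun e => hB (Subtype.ext e)
    rw [Function.update_of_ne hB, contractFamily, contractFamily,
      Function.update_of_ne (fun e => hv (congrArg Subtype.val e).symm),
      Function.update_of_ne (fun e => hw (congrArg Subtype.val e).symm),
      Function.update_of_ne (fun e => hB' (congrArg Subtype.val e))]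

/-- The incoming edges at the target of a contracted edge. -/
def RTree.Contracts.edgeEquiv (h : t.Contracts s v w) :
    s.In v ≃ Insert (⟨w, h.mem_In⟩ : t.In v) (t.In w) :=
  (Equiv.setCongr (congrArg s.In rfl)).trans h.inTarget

lemma RTree.Contracts.labelEquiv_edgeEquiv (h : t.Contracts s v w) : LabelEquiv h.edgeEquiv :=
  h.labelEquiv rfl

/-- The composition of the factors at the two ends of an edge. -/
def edgeComp (h : t.Contracts s v w) :
    Tot (P.toSpecies.on (t.In v)) →ₗ[k] Tot (P.toSpecies.on (t.In w)) →ₗ[k]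
      Tot (P.toSpecies.on (s.In v)) :=
  (P.circ (⟨w, h.mem_In⟩ : t.In v)).compr₂ (P.toSpecies.act h.edgeEquiv)

lemma edgeComp_apply (h : t.Contracts s v w) (a : Tot (P.toSpecies.on (t.In v)))
    (b : Tot (P.toSpecies.on (t.In w))) :
    edgeComp P h a b = P.toSpecies.act h.edgeEquiv (P.circ (⟨w, h.mem_In⟩ : t.In v) a b) := rfl

lemma contractFamily_target (h : t.Contracts s v w)
    (x : ∀ A : t.verts, Tot (P.toSpecies.on (t.In A.1))) :
    contractFamily P h x ⟨v, h.target_mem'⟩ =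
      edgeComp P h (x ⟨v, h.target_mem⟩) (x ⟨w, h.source_mem⟩) := by
  rw [contractFamily, dif_pos rfl]
  rfl

lemma contractFamily_other (h : t.Contracts s v w)
    (x : ∀ A : t.verts, Tot (P.toSpecies.on (t.In A.1))) (B : s.verts) (hB : B.1 ≠ v) :
    contractFamily P h x B = P.toSpecies.act (Equiv.setCongr (h.In_of_ne B.2 hB))
      (x ⟨B.1, h.subset B.2⟩) := by
  rw [contractFamily, dif_neg hB]

lemma contractFamily_update_target [DecidableEq t.verts] [DecidableEq s.verts] (h : t.Contracts s v w)
    (x : ∀ A : t.verts, Tot (P.toSpecies.on (t.In A.1))) (y : Tot (P.toSpecies.on (t.In v))) :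
    contractFamily P h (Function.update x ⟨v, h.target_mem⟩ y) =
      Function.update (contractFamily P h x) ⟨v, h.target_mem'⟩
        (edgeComp P h y (x ⟨w, h.source_mem⟩)) := by
  funext B
  by_cases hB : B = ⟨v, h.target_mem'⟩
  · subst hB
    rw [Function.update_self, contractFamily_target, Function.update_self,
      Function.update_of_ne (fun e => h.mem_In.2.1.ne (congrArg Subtype.val e))]
  · have hB' : B.1 ≠ v := fun e => hB (Subtype.ext e)
    rw [Function.update_of_ne hB, contractFamily_other _ _ _ _ hB', contractFamily_other _ _ _ _ hB',
      Function.update_of_ne (fun e => hB' (congrArg Subtype.val e))]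

lemma contractFamily_update_source [DecidableEq t.verts] [DecidableEq s.verts] (h : t.Contracts s v w)
    (x : ∀ A : t.verts, Tot (P.toSpecies.on (t.In A.1))) (y : Tot (P.toSpecies.on (t.In w))) :
    contractFamily P h (Function.update x ⟨w, h.source_mem⟩ y) =
      Function.update (contractFamily P h x) ⟨v, h.target_mem'⟩
        (edgeComp P h (x ⟨v, h.target_mem⟩) y) := by
  funext B
  by_cases hB : B = ⟨v, h.target_mem'⟩
  · subst hB
    rw [Function.update_self, contractFamily_target, Function.update_self,
      Function.update_of_ne (fun e => h.mem_In.2.1.ne (congrArg Subtype.val e).symm)]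
  · have hB' : B.1 ≠ v := fun e => hB (Subtype.ext e)
    rw [Function.update_of_ne hB, contractFamily_other _ _ _ _ hB', contractFamily_other _ _ _ _ hB',
      Function.update_of_ne (fun e => ((h.mem_iff B.1).1 B.2).2 (congrArg Subtype.val e))]

lemma contractFamily_update [DecidableEq t.verts] [DecidableEq s.verts] (h : t.Contracts s v w)
    (x : ∀ A : t.verts, Tot (P.toSpecies.on (t.In A.1))) (A : t.verts) :
    ∃ (B : s.verts) (φ : Tot (P.toSpecies.on (t.In A.1)) →ₗ[k] Tot (P.toSpecies.on (s.In B.1))),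
      ∀ y, contractFamily P h (Function.update x A y) =
        Function.update (contractFamily P h x) B (φ y) := by
  obtain ⟨A, hA⟩ := A
  by_cases hv : A = v
  · subst hv
    exact ⟨⟨A, h.target_mem'⟩, (edgeComp P h).flip (x ⟨w, h.source_mem⟩),
      contractFamily_update_target P h x⟩
  · by_cases hw : A = w
    · subst hw
      exact ⟨⟨v, h.target_mem'⟩, edgeComp P h (x ⟨v, h.target_mem⟩),
        contractFamily_update_source P h x⟩
    · exact ⟨_, _, contractFamily_update_other P h x ⟨A, hA⟩ hv hw⟩

/-- The tensor product of the contracted family, as a multilinear map. -/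
def contractMultilinear (h : t.Contracts s v w) :
    MultilinearMap k (fun A : t.verts => Tot (P.toSpecies.on (t.In A.1)))
      (⨂[k] B : s.verts, Tot (P.toSpecies.on (s.In B.1))) where
  toFun x := PiTensorProduct.tprod k (contractFamily P h x)
  map_update_add' {dec} x A y z := by
    classical
    obtain ⟨B, φ, hφ⟩ := contractFamily_update P h x A
    rw [hφ, hφ, hφ, map_add, MultilinearMap.map_update_add]
  map_update_smul' {dec} x A c y := by
    classical
    obtain ⟨B, φ, hφ⟩ := contractFamily_update P h x A
    rw [hφ, hφ, map_smul, MultilinearMap.map_update_smul]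

/-- The contraction of an edge, as a linear map of the full tensor products. -/
def contractMap (h : t.Contracts s v w) :
    (⨂[k] A : t.verts, Tot (P.toSpecies.on (t.In A.1))) →ₗ[k]
      ⨂[k] B : s.verts, Tot (P.toSpecies.on (s.In B.1)) :=
  PiTensorProduct.lift (contractMultilinear P h) ∘ₗ
    signMap (fun deg => (moveExponent t v w h.source_mem deg).negOnePow)

variable {P} in
lemma contractMap_tprod (h : t.Contracts s v w) {deg : t.verts → ℤ}
    {y : ∀ A : t.verts, Tot (P.toSpecies.on (t.In A.1))} (hy : HomogFam deg y) :
    contractMap P h (PiTensorProduct.tprod k y) =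
      (moveExponent t v w h.source_mem deg).negOnePow •
        PiTensorProduct.tprod k (contractFamily P h y) := by
  rw [contractMap, LinearMap.comp_apply, signMap_tprod _ hy, map_negOnePow_smul,
    PiTensorProduct.lift.tprod]
  rfl

variable {P} in
lemma HomogFam.contract (h : t.Contracts s v w) {deg : t.verts → ℤ}
    {y : ∀ A : t.verts, Tot (P.toSpecies.on (t.In A.1))} (hy : HomogFam deg y) :
    HomogFam (contractDeg h deg) (contractFamily P h y) := by
  rintro ⟨B, hB⟩
  by_cases hv : B = v
  · subst hv
    obtain ⟨a, ha⟩ := hy ⟨B, h.target_mem⟩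
    obtain ⟨b, hb⟩ := hy ⟨w, h.source_mem⟩
    rw [contractDeg, if_pos rfl, contractFamily_target, ha, hb, edgeComp, LinearMap.compr₂_apply,
      Operad.circ, Tot.bil_of, Species.act_of]
    exact ⟨_, rfl⟩
  · obtain ⟨a, ha⟩ := hy ⟨B, h.subset hB⟩
    rw [contractDeg, if_neg hv, contractFamily_other _ _ _ _ hv, ha, Species.act_of]
    exact ⟨_, rfl⟩

lemma d_edgeComp (h : t.Contracts s v w) (a : Tot (P.toSpecies.on (t.In v)))
    (b : Tot (P.toSpecies.on (t.In w))) :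
    Tot.d _ (edgeComp P h a b) = edgeComp P h (Tot.d _ a) b +
      edgeComp P h (Tot.parity _ a) (Tot.d _ b) := by
  simp only [edgeComp, LinearMap.compr₂_apply]
  rw [Species.d_act, Operad.circ, Tot.d_bil, map_add]

end Contraction

section Contraction

variable {I : Type} [Finite I] {t s : RTree I} {v w : Set I}

lemma degBefore_update {α : Type} {S : Set α} [Finite S] [DecidableEq S] (deg : S → ℤ) (A : S)
    (u : α) : degBefore (Function.update deg A (deg A + 1)) u = degBefore deg u + ltInd A.1 u := by
  have := Fintype.ofFinite S
  rw [degBefore, degBefore, finsum_eq_sum_of_fintype, finsum_eq_sum_of_fintype]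
  have : ∀ B : S, ltInd B.1 u * Function.update deg A (deg A + 1) B =
      ltInd B.1 u * deg B + if B = A then ltInd A.1 u else 0 := by
    intro B
    by_cases hB : B = A
    · subst hB; rw [Function.update_self, if_pos rfl]; ring
    · rw [Function.update_of_ne hB, if_neg hB, add_zero]
  simp_rw [this, Finset.sum_add_distrib]
  simp

lemma ltInd_cast_add {α : Type} {a b : α} (h : a ≠ b) :
    ((ltInd a b : ℤ) : ZMod 2) = ltInd b a + 1 := by
  have := ltInd_add h
  have h2 : ((ltInd a b + ltInd b a : ℤ) : ZMod 2) = 1 := by rw [this]; rfl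
  push_cast at h2
  generalize ((ltInd a b : ℤ) : ZMod 2) = x at *
  generalize ((ltInd b a : ℤ) : ZMod 2) = y at *
  revert x y; decide

/-- The sign for the differential of a factor that is not at the contracted edge. -/
lemma contract_sign_other [DecidableEq t.verts] (h : t.Contracts s v w) (deg : t.verts → ℤ)
    (A : t.verts) (hv : A.1 ≠ v) (hw : A.1 ≠ w) :
    (degBefore deg A.1 + moveExponent t v w h.source_mem
      (Function.update deg A (deg A + 1))).negOnePow =
    (moveExponent t v w h.source_mem deg + degBefore (contractDeg h deg) A.1).negOnePow := by
  refine negOnePow_congr ?_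
  have h1 := ltInd_cast_add hv
  have h2 := ltInd_cast_add hw
  push_cast
  rw [moveExponent_cast h.target_mem h.source_mem h.mem_In.2.1.ne',
    moveExponent_cast h.target_mem h.source_mem h.mem_In.2.1.ne', degBefore_contractDeg,
    degBefore_update, degBefore_update, Function.update_of_ne (a := (⟨w, h.source_mem⟩ : t.verts)) (fun e => hw (congrArg Subtype.val e).symm),
    Function.update_of_ne (fun e => hv (congrArg Subtype.val e).symm)]
  push_cast
  rw [h1, h2]
  generalize ((deg ⟨w, h.source_mem⟩ : ℤ) : ZMod 2) = dw
  generalize ((ltInd v A.1 : ℤ) : ZMod 2) = l1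
  generalize ((ltInd w A.1 : ℤ) : ZMod 2) = l2
  have two : (2 : ZMod 2) = 0 := rfl
  linear_combination (dw * l2 + dw) * two

/-- The sign for the differential of the factor at the target of the contracted edge. -/
lemma contract_sign_target [DecidableEq t.verts] (h : t.Contracts s v w) (deg : t.verts → ℤ) :
    (degBefore deg v + moveExponent t v w h.source_mem
      (Function.update deg ⟨v, h.target_mem⟩ (deg ⟨v, h.target_mem⟩ + 1))).negOnePow =
    (moveExponent t v w h.source_mem deg + degBefore (contractDeg h deg) v).negOnePow := by
  refine negOnePow_congr ?_
  have hne : v ≠ w := h.mem_In.2.1.ne'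
  have h1 := ltInd_cast_add hne
  push_cast
  rw [moveExponent_cast h.target_mem h.source_mem hne,
    moveExponent_cast h.target_mem h.source_mem hne, degBefore_contractDeg,
    degBefore_update, degBefore_update, Function.update_self,
    Function.update_of_ne (fun e => hne (congrArg Subtype.val e).symm)]
  push_cast
  rw [h1, ltInd_self]
  push_cast
  generalize ((deg ⟨w, h.source_mem⟩ : ℤ) : ZMod 2) = dw
  generalize ((ltInd w v : ℤ) : ZMod 2) = l1
  have two : (2 : ZMod 2) = 0 := rfl
  linear_combination (dw * l1 + dw) * two

/-- The sign for the differential of the factor at the source of the contracted edge. The additional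
degree of the factor at the target is the sign of the Leibniz rule. -/
lemma contract_sign_source [DecidableEq t.verts] (h : t.Contracts s v w) (deg : t.verts → ℤ) :
    (degBefore deg w + moveExponent t v w h.source_mem
      (Function.update deg ⟨w, h.source_mem⟩ (deg ⟨w, h.source_mem⟩ + 1))).negOnePow =
    (moveExponent t v w h.source_mem deg + degBefore (contractDeg h deg) v +
      deg ⟨v, h.target_mem⟩).negOnePow := by
  refine negOnePow_congr ?_
  have hne : v ≠ w := h.mem_In.2.1.ne'
  push_cast
  rw [moveExponent_cast h.target_mem h.source_mem hne,
    moveExponent_cast h.target_mem h.source_mem hne, degBefore_contractDeg,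
    degBefore_update, degBefore_update, Function.update_self,
    Function.update_of_ne (fun e => hne (congrArg Subtype.val e))]
  push_cast
  rw [ltInd_self, ltInd_self]
  push_cast
  have h1 := ltInd_cast_add hne
  generalize ((deg ⟨w, h.source_mem⟩ : ℤ) : ZMod 2) = dw
  generalize ((deg ⟨v, h.target_mem⟩ : ℤ) : ZMod 2) = dv
  generalize ((ltInd w v : ℤ) : ZMod 2) = l1
  generalize ((degBefore deg v : ℤ) : ZMod 2) = a
  generalize ((degBefore deg w : ℤ) : ZMod 2) = b
  revert dw dv l1 a b
  decide

variable (P : Operad k)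

lemma contractMap_piDiff (h : t.Contracts s v w) {deg : t.verts → ℤ}
    {y : ∀ A : t.verts, Tot (P.toSpecies.on (t.In A.1))} (hy : HomogFam deg y) :
    contractMap P h (piDiff t.verts (fun A => P.toSpecies.on (t.In A.1))
        (PiTensorProduct.tprod k y)) =
      piDiff s.verts (fun A => P.toSpecies.on (s.In A.1))
        (contractMap P h (PiTensorProduct.tprod k y)) := by
  classical
  have := Fintype.ofFinite t.verts
  have := Fintype.ofFinite s.verts
  rw [contractMap_tprod h hy, map_negOnePow_smul, piDiff_tprod hy, piDiff_tprod (hy.contract h)]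
  have hL : contractMap P h (∑ᶠ A : t.verts, (degBefore deg A.1).negOnePow •
      PiTensorProduct.tprod k (Function.update y A (Tot.d _ (y A)))) =
      ∑ᶠ A : t.verts, (degBefore deg A.1 + moveExponent t v w h.source_mem
      (Function.update deg A (deg A + 1))).negOnePow • PiTensorProduct.tprod k
        (contractFamily P h (Function.update y A (Tot.d _ (y A)))) := by
    rw [finsum_eq_sum_of_fintype, finsum_eq_sum_of_fintype, map_sum]
    refine Finset.sum_congr rfl fun A _ => ?_
    rw [map_negOnePow_smul, contractMap_tprod h (hy.update_d A), smul_smul, Int.negOnePow_add]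
  rw [hL, h.finsum_verts, finsum_eq_sum_of_fintype, finsum_eq_sum_of_fintype, units_smul_sum,
    ← Finset.add_sum_erase _ _ (Finset.mem_univ (⟨v, h.target_mem'⟩ : s.verts)),
    ← Finset.add_sum_erase _ _ (Finset.mem_univ (⟨v, h.target_mem'⟩ : s.verts)), ← add_assoc]
  congr 1
  · rw [contractFamily_update_source, contractFamily_update_target, contract_sign_source h,
      contract_sign_target h, contractFamily_target, d_edgeComp, hy.parity ⟨v, h.target_mem⟩,
      MultilinearMap.map_update_add, units_smul_add, units_smul_add, smul_smul, ← Int.negOnePow_add, add_comm]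
    congr 1
    rw [Units.smul_def (Int.negOnePow (deg _)), map_zsmul, LinearMap.smul_apply,
      ← Int.cast_smul_eq_zsmul k, MultilinearMap.map_update_smul, Int.cast_smul_eq_zsmul,
      ← Units.smul_def, smul_smul, ← Int.negOnePow_add, smul_smul, ← Int.negOnePow_add]
  · refine Finset.sum_congr rfl fun B hB => ?_
    have hv : B.1 ≠ v := fun e => (Finset.mem_erase.1 hB).1 (Subtype.ext e)
    have hw : B.1 ≠ w := ((h.mem_iff B.1).1 B.2).2
    rw [contractFamily_update_other P h y ⟨B.1, h.subset B.2⟩ hv hw,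
      contract_sign_other h deg ⟨B.1, h.subset B.2⟩ hv hw, smul_smul, ← Int.negOnePow_add,
      contractFamily_other _ _ _ _ hv, Species.d_act]

/-- The contraction of an edge, as a morphism of complexes. -/
def contractHom (h : t.Contracts s v w) : treeTensor P.toSpecies t ⟶ treeTensor P.toSpecies s :=
  piTensorHom (contractMap P h) (fun deg x => by
      rw [piPure, contractMap_tprod h (homogFam_of deg x), Units.smul_def]
      refine zsmul_mem ?_ _
      rw [← finsum_contractDeg h]
      exact ((homogFam_of deg x).contract h).mem_piHomog)
    (fun deg x => contractMap_piDiff P h (homogFam_of deg x))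

end Contraction

/-! ### Contractions of different edges commute -/

section Squares

variable {I : Type} [Finite I] {t s₁ s₂ r : RTree I} {v w w₁ w₂ : Set I}

lemma RTree.parent_unique {v' : Set I} (hv : v ∈ t.verts) (hv' : v' ∈ t.verts) (hw : w.Nonempty)
    (h : w ∈ t.In v) (h' : w ∈ t.In v') : v = v' := by
  by_contra hne
  rcases RTree.Contracts.nested_of_ssubset hv hv' hw h.2.1.subset h'.2.1.subset hne with h1 | h1
  · exact h'.2.2 v hv h.2.1 h1
  · exact h.2.2 v' hv' h'.2.1 h1

variable {P : Operad k}

lemma contractMap_contractMap_tprod {v' : Set I} (h : t.Contracts s₁ v w)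
    (h' : s₁.Contracts r v' w₁) {deg : t.verts → ℤ}
    {y : ∀ A : t.verts, Tot (P.toSpecies.on (t.In A.1))} (hy : HomogFam deg y) :
    contractMap P h' (contractMap P h (PiTensorProduct.tprod k y)) =
      (moveExponent t v w h.source_mem deg +
        moveExponent s₁ v' w₁ h'.source_mem (contractDeg h deg)).negOnePow •
        PiTensorProduct.tprod k (contractFamily P h' (contractFamily P h y)) := by
  rw [contractMap_tprod h hy, map_negOnePow_smul, contractMap_tprod h' (hy.contract h), smul_smul,
    Int.negOnePow_add]

lemma moveExponent_contract_cast {v' : Set I} (h : t.Contracts s₁ v w)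
    (h' : s₁.Contracts r v' w₁) (deg : t.verts → ℤ) :
    (moveExponent s₁ v' w₁ h'.source_mem (contractDeg h deg) : ZMod 2) =
      contractDeg h deg ⟨w₁, h'.source_mem⟩ * (degBefore deg v' +
        (ltInd v v' + ltInd w v') * deg ⟨w, h.source_mem⟩ + degBefore deg w₁ +
        (ltInd v w₁ + ltInd w w₁) * deg ⟨w, h.source_mem⟩ +
        contractDeg h deg ⟨v', h'.target_mem⟩ +
        contractDeg h deg ⟨w₁, h'.source_mem⟩ * ltInd w₁ v') := by
  rw [moveExponent_cast h'.target_mem h'.source_mem h'.mem_In.2.1.ne', degBefore_contractDeg,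
    degBefore_contractDeg]
  push_cast
  have two : (2 : ZMod 2) = 0 := rfl
  linear_combination -(contractDeg h deg ⟨w₁, h'.source_mem⟩ : ZMod 2) *
    (ltInd w v' * deg ⟨w, h.source_mem⟩ + ltInd w w₁ * deg ⟨w, h.source_mem⟩) * two

lemma contractDeg_target (h : t.Contracts s₁ v w) (deg : t.verts → ℤ) (hv : v ∈ s₁.verts) :
    contractDeg h deg ⟨v, hv⟩ = deg ⟨v, h.target_mem⟩ + deg ⟨w, h.source_mem⟩ := if_pos rfl

lemma contractDeg_other (h : t.Contracts s₁ v w) (deg : t.verts → ℤ) {A : Set I} (hA : A ∈ s₁.verts)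
    (hv : A ≠ v) : contractDeg h deg ⟨A, hA⟩ = deg ⟨A, h.subset hA⟩ := if_neg hv

/-- Contractions of two edges that form a path, from `w₂` to `w₁` and from `w₁` to `v`, commute by the
nested associativity of the partial compositions. -/
lemma contractMap_nested (h₁ : t.Contracts s₁ v w₁) (h₂ : t.Contracts s₂ w₁ w₂)
    (h₁' : s₁.Contracts r v w₂) (h₂' : s₂.Contracts r v w₁) :
    contractMap P h₁' ∘ₗ contractMap P h₁ = contractMap P h₂' ∘ₗ contractMap P h₂ := by
  have n₁ : v ≠ w₁ := h₁.mem_In.2.1.ne'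
  have n₂ : w₁ ≠ w₂ := h₂.mem_In.2.1.ne'
  have n₃ : v ≠ w₂ := h₁'.mem_In.2.1.ne'
  refine piPure_ext fun deg x => ?_
  have hy := homogFam_of deg x
  rw [LinearMap.comp_apply, LinearMap.comp_apply, piPure, contractMap_contractMap_tprod h₁ h₁' hy,
    contractMap_contractMap_tprod h₂ h₂' hy]
  generalize (fun v => Tot.of _ (deg v) (x v)) = y
  congr 1
  · refine negOnePow_congr ?_
    rw [Int.cast_add, Int.cast_add, moveExponent_contract_cast h₁ h₁', moveExponent_contract_cast h₂ h₂',
      moveExponent_cast h₁.target_mem h₁.source_mem n₁, moveExponent_cast h₂.target_mem h₂.source_mem n₂,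
      contractDeg_target, contractDeg_target, contractDeg_other h₁ deg _ n₃.symm,
      contractDeg_other h₂ deg _ n₁, ltInd_self, ltInd_self]
    push_cast
    rw [ltInd_cast_add n₂, ltInd_cast_add n₃]
    -- What remains is an identity of polynomials over `ZMod 2`.
    generalize ((deg ⟨w₁, _⟩ : ℤ) : ZMod 2) = d₁
    generalize ((deg ⟨w₂, _⟩ : ℤ) : ZMod 2) = d₂
    generalize ((deg ⟨v, _⟩ : ℤ) : ZMod 2) = d
    generalize ((ltInd w₁ v : ℤ) : ZMod 2) = a
    generalize ((ltInd w₂ v : ℤ) : ZMod 2) = b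
    generalize ((ltInd w₂ w₁ : ℤ) : ZMod 2) = c
    generalize ((degBefore deg v : ℤ) : ZMod 2) = e
    generalize ((degBefore deg w₁ : ℤ) : ZMod 2) = f
    generalize ((degBefore deg w₂ : ℤ) : ZMod 2) = g
    clear * -
    grind
  · congr 1
    funext B
    by_cases hB : B.1 = v
    · obtain ⟨B, hB'⟩ := B
      obtain rfl : B = v := hB
      rw [contractFamily_target P h₁', contractFamily_target P h₂', contractFamily_target P h₁,
        contractFamily_target P h₂, contractFamily_other P h₁ _ _ n₃.symm,
        contractFamily_other P h₂ _ _ n₁]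
      rw [edgeComp_apply, edgeComp_apply, edgeComp_apply, edgeComp_apply]
      exact circ_label_nested (S₁ := t.In B) (S₂ := t.In w₁) (S₃ := t.In w₂) (T₁ := s₂.In B)
        (T₃ := s₁.In w₂) (U₁ := s₁.In B) (U₂ := s₂.In w₁) (V := r.In B) _ _ ⟨w₁, h₁.mem_In⟩
        ⟨w₂, h₂.mem_In⟩ h₁.edgeEquiv ⟨w₂, h₁'.mem_In⟩ rfl h₁'.edgeEquiv h₂.edgeEquiv
        ⟨w₁, h₂'.mem_In⟩ rfl h₂'.edgeEquiv h₁.labelEquiv_edgeEquiv h₁'.labelEquiv_edgeEquiv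
        h₂.labelEquiv_edgeEquiv h₂'.labelEquiv_edgeEquiv _ _ _
    · have hB₂ : B.1 ≠ w₁ := (((h₂'.mem_iff B.1).1 B.2)).2
      rw [contractFamily_other P h₁' _ _ hB, contractFamily_other P h₂' _ _ hB,
        contractFamily_other P h₁ _ _ hB, contractFamily_other P h₂ _ _ hB₂, Species.act_act,
        Species.act_act]
      rfl


/-- Contractions of two edges that end at the same vertex commute by the parallel associativity of the
partial compositions. The sign of the latter accounts for the exchange of the factors at `w₁` and
`w₂`. -/
lemma contractMap_parallel (hne : w₁ ≠ w₂) (h₁ : t.Contracts s₁ v w₁) (h₂ : t.Contracts s₂ v w₂)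
    (h₁' : s₁.Contracts r v w₂) (h₂' : s₂.Contracts r v w₁) :
    contractMap P h₁' ∘ₗ contractMap P h₁ = contractMap P h₂' ∘ₗ contractMap P h₂ := by
  classical
  have n₁ : v ≠ w₁ := h₁.mem_In.2.1.ne'
  have n₂ : v ≠ w₂ := h₂.mem_In.2.1.ne'
  refine piPure_ext fun deg x => ?_
  have hy := homogFam_of deg x
  rw [LinearMap.comp_apply, LinearMap.comp_apply, piPure, contractMap_contractMap_tprod h₁ h₁' hy,
    contractMap_contractMap_tprod h₂ h₂' hy]
  set y := fun v => Tot.of _ (deg v) (x v) with hyd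
  have hfam : contractFamily P h₁' (contractFamily P h₁ y) =
      fun B => (if B = ⟨v, h₁'.target_mem'⟩ then
        (deg ⟨w₁, h₁.source_mem⟩ * deg ⟨w₂, h₂.source_mem⟩).negOnePow else 1) •
        contractFamily P h₂' (contractFamily P h₂ y) B := by
    funext B
    by_cases hB : B.1 = v
    · obtain ⟨B, hB'⟩ := B
      obtain rfl : B = v := hB
      rw [contractFamily_target P h₁', contractFamily_target P h₂', contractFamily_target P h₁,
        contractFamily_target P h₂, contractFamily_other P h₁ _ _ n₂.symm,
        contractFamily_other P h₂ _ _ n₁.symm]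
      rw [edgeComp_apply, edgeComp_apply, edgeComp_apply, edgeComp_apply, if_pos rfl]
      exact circ_label_parallel (S₁ := t.In B) (S₂ := t.In w₁) (S₃ := t.In w₂) (T₂ := s₂.In w₁)
        (T₃ := s₁.In w₂) (U₁ := s₁.In B) (U₂ := s₂.In B) (V := r.In B) _ _ ⟨w₁, h₁.mem_In⟩
        ⟨w₂, h₂.mem_In⟩ (fun e => hne (congrArg Subtype.val e)) h₁.edgeEquiv ⟨w₂, h₁'.mem_In⟩ rfl
        h₁'.edgeEquiv h₂.edgeEquiv ⟨w₁, h₂'.mem_In⟩ rfl h₂'.edgeEquiv h₁.labelEquiv_edgeEquiv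
        h₁'.labelEquiv_edgeEquiv h₂.labelEquiv_edgeEquiv h₂'.labelEquiv_edgeEquiv _ _ _ _ _
    · rw [contractFamily_other P h₁' _ _ hB, contractFamily_other P h₂' _ _ hB,
        contractFamily_other P h₁ _ _ hB, contractFamily_other P h₂ _ _ hB, Species.act_act,
        Species.act_act, if_neg (fun e => hB (congrArg Subtype.val e)), one_smul]
      rfl
  have := Fintype.ofFinite r.verts
  rw [hfam, tprod_units_smul, finprod_eq_prod_of_fintype, Finset.prod_ite_eq' Finset.univ, if_pos (Finset.mem_univ _), smul_smul,
    ← Int.negOnePow_add]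
  congr 1
  refine negOnePow_congr ?_
  rw [Int.cast_add, Int.cast_add, Int.cast_add, moveExponent_contract_cast h₁ h₁',
    moveExponent_contract_cast h₂ h₂',
    moveExponent_cast h₁.target_mem h₁.source_mem n₁, moveExponent_cast h₂.target_mem h₂.source_mem n₂,
    contractDeg_target, contractDeg_target, contractDeg_other h₁ deg _ n₂.symm,
    contractDeg_other h₂ deg _ n₁.symm, ltInd_self]
  push_cast
  rw [ltInd_cast_add n₁, ltInd_cast_add n₂, ltInd_cast_add hne]
  generalize ((deg ⟨w₁, _⟩ : ℤ) : ZMod 2) = d₁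
  generalize ((deg ⟨w₂, _⟩ : ℤ) : ZMod 2) = d₂
  generalize ((deg ⟨v, _⟩ : ℤ) : ZMod 2) = d
  generalize ((ltInd w₁ v : ℤ) : ZMod 2) = a
  generalize ((ltInd w₂ v : ℤ) : ZMod 2) = b
  generalize ((ltInd w₂ w₁ : ℤ) : ZMod 2) = c
  generalize ((degBefore deg v : ℤ) : ZMod 2) = e
  generalize ((degBefore deg w₁ : ℤ) : ZMod 2) = f
  generalize ((degBefore deg w₂ : ℤ) : ZMod 2) = g
  clear * -
  grind

/-- Contractions of two edges without common vertices commute since they concern different factors. -/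
lemma contractMap_disjoint {v₁ v₂ : Set I} (hv : v₁ ≠ v₂) (hw : w₁ ≠ w₂) (h₁₂ : v₁ ≠ w₂)
    (h₂₁ : v₂ ≠ w₁) (h₁ : t.Contracts s₁ v₁ w₁) (h₂ : t.Contracts s₂ v₂ w₂)
    (h₁' : s₁.Contracts r v₂ w₂) (h₂' : s₂.Contracts r v₁ w₁) :
    contractMap P h₁' ∘ₗ contractMap P h₁ = contractMap P h₂' ∘ₗ contractMap P h₂ := by
  have n₁ : v₁ ≠ w₁ := h₁.mem_In.2.1.ne'
  have n₂ : v₂ ≠ w₂ := h₂.mem_In.2.1.ne'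
  refine piPure_ext fun deg x => ?_
  have hy := homogFam_of deg x
  rw [LinearMap.comp_apply, LinearMap.comp_apply, piPure, contractMap_contractMap_tprod h₁ h₁' hy,
    contractMap_contractMap_tprod h₂ h₂' hy]
  generalize (fun v => Tot.of _ (deg v) (x v)) = y
  congr 1
  · refine negOnePow_congr ?_
    rw [Int.cast_add, Int.cast_add, moveExponent_contract_cast h₁ h₁', moveExponent_contract_cast h₂ h₂',
      moveExponent_cast h₁.target_mem h₁.source_mem n₁, moveExponent_cast h₂.target_mem h₂.source_mem n₂,
      contractDeg_other h₁ deg _ hv.symm, contractDeg_other h₁ deg _ h₁₂.symm,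
      contractDeg_other h₂ deg _ hv, contractDeg_other h₂ deg _ h₂₁.symm]
    rw [ltInd_cast_add hv, ltInd_cast_add hw, ltInd_cast_add h₁₂, ltInd_cast_add h₂₁]
    generalize ((deg ⟨w₁, _⟩ : ℤ) : ZMod 2) = d₁
    generalize ((deg ⟨w₂, _⟩ : ℤ) : ZMod 2) = d₂
    generalize ((deg ⟨v₁, _⟩ : ℤ) : ZMod 2) = d
    generalize ((deg ⟨v₂, _⟩ : ℤ) : ZMod 2) = d'
    generalize ((ltInd w₁ v₁ : ℤ) : ZMod 2) = a
    generalize ((ltInd w₂ v₂ : ℤ) : ZMod 2) = b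
    generalize ((ltInd w₂ w₁ : ℤ) : ZMod 2) = c
    generalize ((ltInd w₂ v₁ : ℤ) : ZMod 2) = c'
    generalize ((ltInd w₁ v₂ : ℤ) : ZMod 2) = c''
    generalize ((ltInd v₂ v₁ : ℤ) : ZMod 2) = c₃
    generalize ((degBefore deg v₁ : ℤ) : ZMod 2) = e
    generalize ((degBefore deg v₂ : ℤ) : ZMod 2) = e'
    generalize ((degBefore deg w₁ : ℤ) : ZMod 2) = f
    generalize ((degBefore deg w₂ : ℤ) : ZMod 2) = g
    clear * -
    grind
  · congr 1
    funext B
    by_cases hB : B.1 = v₁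
    · obtain ⟨B, hB'⟩ := B
      obtain rfl : B = v₁ := hB
      rw [contractFamily_other P h₁' _ _ hv, contractFamily_target P h₂', contractFamily_target P h₁,
        contractFamily_other P h₂ _ _ hv, contractFamily_other P h₂ _ _ h₂₁.symm]
      rw [edgeComp_apply, edgeComp_apply]
      exact circ_label_congr (h₂.In_of_ne h₂'.target_mem hv) (h₂.In_of_ne h₂'.source_mem h₂₁.symm)
        (h₁'.In_of_ne hB' hv) ⟨w₁, h₁.mem_In⟩ ⟨w₁, h₂'.mem_In⟩ rfl h₁.edgeEquiv h₂'.edgeEquiv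
        h₁.labelEquiv_edgeEquiv h₂'.labelEquiv_edgeEquiv _ _
    · by_cases hB₂ : B.1 = v₂
      · obtain ⟨B, hB'⟩ := B
        obtain rfl : B = v₂ := hB₂
        rw [contractFamily_other P h₂' _ _ hB, contractFamily_target P h₁', contractFamily_target P h₂,
          contractFamily_other P h₁ _ _ hB, contractFamily_other P h₁ _ _ h₁₂.symm]
        rw [edgeComp_apply, edgeComp_apply]
        exact (circ_label_congr (h₁.In_of_ne h₁'.target_mem hB) (h₁.In_of_ne h₁'.source_mem h₁₂.symm)
          (h₂'.In_of_ne hB' hB) ⟨w₂, h₂.mem_In⟩ ⟨w₂, h₁'.mem_In⟩ rfl h₂.edgeEquiv h₁'.edgeEquiv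
          h₂.labelEquiv_edgeEquiv h₁'.labelEquiv_edgeEquiv _ _).symm
      · rw [contractFamily_other P h₁' _ _ hB₂, contractFamily_other P h₂' _ _ hB,
          contractFamily_other P h₁ _ _ hB, contractFamily_other P h₂ _ _ hB₂, Species.act_act,
          Species.act_act]
        rfl

/-- The parent of a vertex after the contraction of another edge. -/
lemma RTree.Contracts.parent_eq {v₁ v₂ v₂' : Set I} (h₁ : t.Contracts s₁ v₁ w₁) (hw : w₁ ≠ w₂)
    (hne : w₂.Nonempty) (hv₂ : v₂ ∈ t.verts) (h₂ : w₂ ∈ t.In v₂)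
    (hv₂' : v₂' ∈ s₁.verts) (h₂' : w₂ ∈ s₁.In v₂') :
    (v₂ = w₁ → v₂' = v₁) ∧ (v₂ ≠ w₁ → v₂' = v₂) := by
  constructor
  · rintro rfl
    refine RTree.parent_unique hv₂' h₁.target_mem' hne h₂' ?_
    rw [h₁.In_target]
    exact Or.inr h₂
  · intro h
    have hmem : v₂ ∈ s₁.verts := (h₁.mem_iff _).2 ⟨hv₂, h⟩
    refine RTree.parent_unique hv₂' hmem hne h₂' ?_
    by_cases hv : v₂ = v₁
    · subst hv
      rw [h₁.In_target]
      exact Or.inl ⟨h₂, hw.symm⟩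
    · rwa [h₁.In_of_ne hmem hv]

/-- The contractions of two different edges commute. -/
lemma contractMap_comm {v₁ v₂ v₁' v₂' : Set I} (hw : w₁ ≠ w₂) (h₁ : t.Contracts s₁ v₁ w₁)
    (h₂ : t.Contracts s₂ v₂ w₂) (h₁' : s₁.Contracts r v₂' w₂) (h₂' : s₂.Contracts r v₁' w₁) :
    contractMap P h₁' ∘ₗ contractMap P h₁ = contractMap P h₂' ∘ₗ contractMap P h₂ := by
  have ne₁ := (t.nontrivial _ h₁.source_mem).nonempty
  have ne₂ := (t.nontrivial _ h₂.source_mem).nonempty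
  obtain ⟨a₁, a₂⟩ := h₁.parent_eq hw ne₂ h₂.target_mem h₂.mem_In h₁'.target_mem h₁'.mem_In
  obtain ⟨b₁, b₂⟩ := h₂.parent_eq hw.symm ne₁ h₁.target_mem h₁.mem_In h₂'.target_mem h₂'.mem_In
  have c₁ : w₁ ⊂ v₁ := h₁.mem_In.2.1
  have c₂ : w₂ ⊂ v₂ := h₂.mem_In.2.1
  by_cases h21 : v₂ = w₁
  · subst h21
    have h12 : v₁ ≠ w₂ := fun e => (c₂.trans (e ▸ c₁)).ne rfl
    obtain rfl := a₁ rfl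
    obtain rfl := b₂ h12
    exact contractMap_nested h₁ h₂ h₁' h₂'
  · by_cases h12 : v₁ = w₂
    · subst h12
      obtain rfl := a₂ h21
      obtain rfl := b₁ rfl
      exact (contractMap_nested h₂ h₁ h₂' h₁').symm
    · obtain rfl := a₂ h21
      obtain rfl := b₂ h12
      by_cases hv : v₁' = v₂'
      · subst hv
        exact contractMap_parallel hw h₁ h₂ h₁' h₂'
      · exact contractMap_disjoint hv hw h12 h21 h₁ h₂ h₁' h₂'

end Squares

/-! ### Factorization of contractions into contractions of edges -/

namespace RTree

variable {I : Type}

/-- The contraction of the internal edge whose source is the vertex `w`. -/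
def remove (t : RTree I) {w : Set I} (hw : w ≠ Set.univ) : RTree I where
  verts := t.verts \ {w}
  root_mem := ⟨t.root_mem, hw.symm⟩
  nontrivial A hA := t.nontrivial A hA.1
  nested A hA B hB := t.nested A hA.1 B hB.1

lemma exists_parent [Finite I] (t : RTree I) {w : Set I} (hw : w ∈ t.verts) (hne : w ≠ Set.univ) :
    ∃ v ∈ t.verts, w ∈ t.In v := by
  obtain ⟨v, hv⟩ := (Set.toFinite {C | C ∈ t.verts ∧ w ⊂ C}).exists_minimal
    ⟨Set.univ, t.root_mem, Set.ssubset_univ_iff.2 hne⟩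
  refine ⟨v, hv.1.1, Or.inl hw, hv.1.2, fun C hC hwC hCv => ?_⟩
  exact hCv.not_subset (hv.2 ⟨hC, hwC⟩ hCv.subset)

lemma exists_contracts [Finite I] {t s : RTree I} {w : Set I} (hw : w ∈ t.verts)
    (hs : s.verts = t.verts \ {w}) : ∃ v, t.Contracts s v w := by
  have hne : w ≠ Set.univ := by
    rintro rfl
    have := s.root_mem
    rw [hs] at this
    exact this.2 rfl
  obtain ⟨v, hv, hwv⟩ := t.exists_parent hw hne
  exact ⟨v, hv, hw, hwv, hs⟩

lemma exists_contracts_remove [Finite I] (t : RTree I) {w : Set I} (hw : w ∈ t.verts)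
    (hne : w ≠ Set.univ) : ∃ v, t.Contracts (t.remove hne) v w :=
  exists_contracts hw rfl

lemma ne_univ {s : RTree I} {w : Set I} (hw : w ∉ s.verts) : w ≠ Set.univ := by
  rintro rfl
  exact hw s.root_mem

lemma remove_le {t s : RTree I} (h : t ≤ s) {w : Set I} (hw : w ∉ s.verts) :
    t.remove (ne_univ hw) ≤ s :=
  fun _ hA => ⟨h hA, fun e => hw (e ▸ hA)⟩

variable [Finite I]

lemma Contracts.ncard {t s r : RTree I} {v w : Set I} (h : t.Contracts r v w) (hrs : r ≤ s) :
    (t.verts \ s.verts).ncard = (r.verts \ s.verts).ncard + 1 := by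
  have : t.verts \ s.verts = insert w (r.verts \ s.verts) := by
    ext A
    have := h.mem_iff A
    have hw : w ∉ s.verts := fun hw => ((h.mem_iff w).1 (hrs hw)).2 rfl
    by_cases hA : A = w
    · subst hA; simp [h.source_mem, hw]
    · simp [hA, this]
  rw [this, Set.ncard_insert_of_notMem (fun hw => ((h.mem_iff w).1 hw.1).2 rfl) (Set.toFinite _)]

/-- Induction over contractions, edge by edge. -/
lemma le_induction {motive : ∀ t s : RTree I, t ≤ s → Prop} (refl : ∀ t, motive t t le_rfl)
    (step : ∀ {t r s : RTree I} {v w : Set I} (h : t.Contracts r v w) (hrs : r ≤ s),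
      motive r s hrs → motive t s (h.le.trans hrs)) {t s : RTree I} (h : t ≤ s) : motive t s h := by
  obtain ⟨n, hn⟩ : ∃ n, (t.verts \ s.verts).ncard = n := ⟨_, rfl⟩
  induction n generalizing t with
  | zero =>
    rw [Set.ncard_eq_zero (Set.toFinite _), Set.sdiff_eq_empty] at hn
    obtain rfl : t = s := RTree.ext (hn.antisymm h)
    exact refl t
  | succ n ih =>
    have hne : (t.verts \ s.verts).Nonempty := by
      rw [← Set.ncard_pos (Set.toFinite _)]; omega
    obtain ⟨w, hw, hws⟩ := hne
    obtain ⟨v, hv⟩ := t.exists_contracts_remove hw (ne_univ hws)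
    have := remove_le h hws
    refine step hv this (ih this ?_)
    have := hv.ncard this
    omega

end RTree

section Path

universe v₁ u₁

variable {I : Type} [Finite I] {𝒞 : Type u₁} [Category.{v₁} 𝒞] {F : RTree I → 𝒞}
  (c : ∀ {t s : RTree I} {v w : Set I}, t.Contracts s v w → (F t ⟶ F s))

/-- The composites of the maps `c` along sequences of contractions of single edges. -/
inductive EdgePath : ∀ t s : RTree I, (F t ⟶ F s) → Prop
  | refl (t : RTree I) : EdgePath t t (𝟙 (F t))
  | step {t r s : RTree I} {v w : Set I} (h : t.Contracts r v w) {f : F r ⟶ F s}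
      (p : EdgePath r s f) : EdgePath t s (c h ≫ f)

variable {c}

lemma EdgePath.le {t s : RTree I} {f : F t ⟶ F s} (p : EdgePath c t s f) : t ≤ s := by
  induction p with
  | refl t => exact le_rfl
  | step h p ih => exact h.le.trans ih

lemma EdgePath.trans {t s r : RTree I} {f : F t ⟶ F s} {g : F s ⟶ F r} (p : EdgePath c t s f)
    (q : EdgePath c s r g) : EdgePath c t r (f ≫ g) := by
  induction p with
  | refl t => rwa [Category.id_comp]
  | step h p ih => rw [Category.assoc]; exact .step h (ih q)

lemma EdgePath.exists {t s : RTree I} (h : t ≤ s) : ∃ f, EdgePath c t s f := by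
  induction h using RTree.le_induction with
  | refl t => exact ⟨_, .refl t⟩
  | step h hrs ih =>
    obtain ⟨f, hf⟩ := ih
    exact ⟨_, .step h hf⟩

/-- The composite along a sequence of contractions of edges depends only on its ends: two sequences
that begin with different edges are both compared with sequences that begin with these two edges, in
either order. -/
lemma EdgePath.unique
    (hc : ∀ {t s₁ s₂ r : RTree I} {v₁ v₂ v₁' v₂' w₁ w₂ : Set I} (_ : w₁ ≠ w₂)
      (h₁ : t.Contracts s₁ v₁ w₁) (h₂ : t.Contracts s₂ v₂ w₂) (h₁' : s₁.Contracts r v₂' w₂)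
      (h₂' : s₂.Contracts r v₁' w₁), c h₁ ≫ c h₁' = c h₂ ≫ c h₂')
    {t s : RTree I} {f g : F t ⟶ F s} (p : EdgePath c t s f) (q : EdgePath c t s g) : f = g := by
  obtain ⟨n, hn⟩ : ∃ n, (t.verts \ s.verts).ncard = n := ⟨_, rfl⟩
  induction n generalizing t with
  | zero =>
    cases p with
    | refl =>
      cases q with
      | refl => rfl
      | step h q => have := h.ncard q.le; omega
    | step h p => have := h.ncard p.le; omega
  | succ n ih =>
    cases p with
    | refl => simp at hn
    | @step _ s₁ _ v₁ w₁ h₁ f p =>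
      cases q with
      | refl => simp at hn
      | @step _ s₂ _ v₂ w₂ h₂ g q =>
        have e₁ := h₁.ncard p.le
        have e₂ := h₂.ncard q.le
        by_cases hw : w₁ = w₂
        · subst hw
          obtain rfl : s₁ = s₂ := RTree.ext (h₁.verts_eq.trans h₂.verts_eq.symm)
          obtain rfl := RTree.parent_unique h₁.target_mem h₂.target_mem
            (t.nontrivial _ h₁.source_mem).nonempty h₁.mem_In h₂.mem_In
          rw [ih p q (by omega)]
        -- Both sequences are compared with sequences through the tree without `w₁` and `w₂`.
        · have hw₁ : w₁ ∉ s.verts := fun h => ((h₁.mem_iff _).1 (p.le h)).2 rfl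
          have hw₂ : w₂ ∉ s.verts := fun h => ((h₂.mem_iff _).1 (q.le h)).2 rfl
          have m₂ : w₂ ∈ s₁.verts := (h₁.mem_iff _).2 ⟨h₂.source_mem, fun e => hw e.symm⟩
          have m₁ : w₁ ∈ s₂.verts := (h₂.mem_iff _).2 ⟨h₁.source_mem, hw⟩
          obtain ⟨v₂', h₁'⟩ := s₁.exists_contracts_remove m₂ (RTree.ne_univ hw₂)
          have hr := RTree.remove_le p.le hw₂
          obtain ⟨v₁', h₂'⟩ := RTree.exists_contracts (s := s₁.remove (RTree.ne_univ hw₂)) m₁ (by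
            change s₁.verts \ {w₂} = s₂.verts \ {w₁}
            rw [h₁.verts_eq, h₂.verts_eq, Set.sdiff_sdiff_comm])
          obtain ⟨x, hx⟩ := EdgePath.exists (c := c) hr
          rw [ih p (.step h₁' hx) (by omega), ih q (.step h₂' hx) (by omega), ← Category.assoc,
            ← Category.assoc, hc hw h₁ h₂ h₁' h₂']

end Path

/-! ### The left module of an operad -/

section Action

variable {I : Type} [Finite I]

/-- The inclusion of the component of degree `n` of `M(t)` in the full tensor product. -/
def treeVal (M : Species k) (t : RTree I) (n : ℤ) : (treeTensor M t).X n →ₗ[k]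
    ⨂[k] A : t.verts, Tot (M.on (t.In A.1)) :=
  piTensorVal t.verts (fun A => M.on (t.In A.1)) n

lemma treeTensor_hom_ext {M : Species k} {t : RTree I} {Z : DGVS k} {f g : treeTensor M t ⟶ Z}
    (h : ∀ n (deg : t.verts → ℤ) (x : ∀ A, (M.on (t.In A.1)).X (deg A)) (z : (treeTensor M t).X n),
      treeVal M t n z = piPure _ _ deg x → (f.f n).hom z = (g.f n).hom z) : f = g :=
  piTensor_hom_ext h

lemma treeVal_injective (M : Species k) (t : RTree I) (n : ℤ) :
    Function.Injective (treeVal M t n) := piTensorVal_injective n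

lemma treeVal_treeTensorMap {M N : Species k} (f : M ⟶ N) (t : RTree I) (n : ℤ)
    (z : (treeTensor M t).X n) : treeVal N t n (((treeTensorMap f t).f n).hom z) =
      PiTensorProduct.map (fun A : t.verts => Tot.map (Species.app f (t.In A.1)))
        (treeVal M t n z) := rfl

lemma treeVal_contractHom (P : Operad k) {t s : RTree I} {v w : Set I} (h : t.Contracts s v w)
    (n : ℤ) (z : (treeTensor P.toSpecies t).X n) :
    treeVal P.toSpecies s n (((contractHom P h).f n).hom z) =
      contractMap P h (treeVal P.toSpecies t n z) := rfl

variable (P : Operad k)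

lemma contractHom_comm {t s₁ s₂ r : RTree I} {v₁ v₂ v₁' v₂' w₁ w₂ : Set I} (hw : w₁ ≠ w₂)
    (h₁ : t.Contracts s₁ v₁ w₁) (h₂ : t.Contracts s₂ v₂ w₂) (h₁' : s₁.Contracts r v₂' w₂)
    (h₂' : s₂.Contracts r v₁' w₁) :
    contractHom P h₁ ≫ contractHom P h₁' = contractHom P h₂ ≫ contractHom P h₂' := by
  ext n z
  exact treeVal_injective _ _ n (LinearMap.congr_fun (contractMap_comm hw h₁ h₂ h₁' h₂')
    (treeVal _ _ n z))

/-- The action of the contractions of trees on the tensor products `P(t)`. -/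
def operadAction (I : Type) [Finite I] : OperadAction P I where
  map h := (EdgePath.exists (c := contractHom P) h).choose
  map_refl t := EdgePath.unique (contractHom_comm P)
    (EdgePath.exists (c := contractHom P) (le_refl t)).choose_spec (.refl t)
  map_trans h h' := EdgePath.unique (contractHom_comm P)
    (EdgePath.exists (c := contractHom P) (h.trans h')).choose_spec
    ((EdgePath.exists (c := contractHom P) h).choose_spec.trans
      (EdgePath.exists (c := contractHom P) h').choose_spec)
  map_edge {t s v w} h n z deg x hz := by
    have : (EdgePath.exists (c := contractHom P) h.le).choose = contractHom P h :=
      (EdgePath.unique (contractHom_comm P)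
        (EdgePath.exists (c := contractHom P) h.le).choose_spec (.step h (.refl s))).trans
        (Category.comp_id _)
    rw [this]
    refine (treeVal_contractHom P h n z).trans ?_
    rw [show treeVal P.toSpecies t n z = _ from hz, piPure, contractMap_tprod h (homogFam_of deg x)]

variable {P}

lemma OperadAction.map_contracts (L : OperadAction P I) {t s : RTree I} {v w : Set I}
    (h : t.Contracts s v w) : L.map h.le = contractHom P h := by
  refine treeTensor_hom_ext fun n deg x z hz => treeVal_injective _ _ n ?_
  refine (L.map_edge h n z deg x hz).trans ?_
  refine Eq.trans ?_ (treeVal_contractHom P h n z).symm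
  rw [hz, piPure, contractMap_tprod h (homogFam_of deg x)]

instance : Subsingleton (OperadAction P I) where
  allEq L L' := by
    have : @OperadAction.map _ _ _ _ _ L = @OperadAction.map _ _ _ _ _ L' := by
      funext t s h
      induction h using RTree.le_induction with
      | refl t => rw [L.map_refl, L'.map_refl]
      | @step t r s v w h hrs ih =>
        rw [L.map_trans h.le hrs, L'.map_trans h.le hrs, L.map_contracts h, L'.map_contracts h, ih]
    cases L; cases L'; cases this; rfl

lemma Species.map_act {M N : Species k} (f : M ⟶ N) {A B : Type} [Finite A] [Finite B] (e : A ≃ B)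
    (x : Tot (M.on B)) : Tot.map (Species.app f A) (M.act e x) =
      N.act e (Tot.map (Species.app f B) x) := by
  have := f.naturality (Quiver.Hom.op (show (⟨A⟩ : Bij) ⟶ ⟨B⟩ from e))
  rw [Species.act, Species.act, ← LinearMap.comp_apply, ← LinearMap.comp_apply, ← Tot.map_comp,
    ← Tot.map_comp]
  exact congrArg (fun g => Tot.map g x) this

/-- A morphism of species commutes with the partial compositions. -/
def PreservesComp {P Q : Operad k} (f : P.toSpecies ⟶ Q.toSpecies) : Prop :=
  ∀ (A B : Type) [Finite A] [Finite B] (i : A),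
    P.comp A B i ≫ Species.app f (Insert i B) =
      (Species.app f A ⊗ₘ Species.app f B) ≫ Q.comp A B i

lemma PreservesComp.circ {P Q : Operad k} {f : P.toSpecies ⟶ Q.toSpecies} (hf : PreservesComp f)
    {A B : Type} [Finite A] [Finite B] (i : A) (a : Tot (P.toSpecies.on A))
    (b : Tot (P.toSpecies.on B)) : Tot.map (Species.app f (Insert i B)) (P.circ i a b) =
      Q.circ i (Tot.map (Species.app f A) a) (Tot.map (Species.app f B) b) := by
  rw [Operad.circ, Operad.circ, ← Tot.bil_tensorHom, ← hf, Tot.bil_comp]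

lemma PreservesComp.edgeComp {P Q : Operad k} {f : P.toSpecies ⟶ Q.toSpecies} (hf : PreservesComp f)
    {t s : RTree I} {v w : Set I} (h : t.Contracts s v w) (a : Tot (P.toSpecies.on (t.In v)))
    (b : Tot (P.toSpecies.on (t.In w))) :
    Tot.map (Species.app f (s.In v)) (edgeComp P h a b) =
      TreeBar.edgeComp Q h (Tot.map (Species.app f _) a) (Tot.map (Species.app f _) b) := by
  rw [edgeComp_apply, edgeComp_apply, Species.map_act, hf.circ]

lemma HomogFam.map {α : Type} {S : Set α} {X Y : S → DGVS k} {deg : S → ℤ} {y : ∀ v, Tot (X v)}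
    (h : HomogFam deg y) (f : ∀ v, X v ⟶ Y v) : HomogFam deg (fun v => Tot.map (f v) (y v)) := by
  intro v
  obtain ⟨x, hx⟩ := h v
  exact ⟨((f v).f (deg v)).hom x, by beta_reduce; rw [hx, Tot.map_of]⟩

lemma PreservesComp.contractMap {P Q : Operad k} {f : P.toSpecies ⟶ Q.toSpecies}
    (hf : PreservesComp f) {t s : RTree I} {v w : Set I} (h : t.Contracts s v w) :
    PiTensorProduct.map (fun A : s.verts => Tot.map (Species.app f (s.In A.1))) ∘ₗ
      contractMap P h = TreeBar.contractMap Q h ∘ₗ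
        PiTensorProduct.map (fun A : t.verts => Tot.map (Species.app f (t.In A.1))) := by
  refine piPure_ext fun deg x => ?_
  have hy := homogFam_of deg x
  rw [LinearMap.comp_apply, LinearMap.comp_apply, piPure, contractMap_tprod h hy,
    map_negOnePow_smul, PiTensorProduct.map_tprod, PiTensorProduct.map_tprod,
    contractMap_tprod h (hy.map _)]
  congr 2
  funext B
  by_cases hB : B.1 = v
  · obtain ⟨B, hB'⟩ := B
    obtain rfl : B = v := hB
    rw [contractFamily_target, contractFamily_target, hf.edgeComp]
  · rw [contractFamily_other _ _ _ _ hB, contractFamily_other _ _ _ _ hB, Species.map_act]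

/-- Morphisms of operads commute with the actions of the contractions. -/
lemma treeTensorMap_action {P Q : Operad k} {f : P.toSpecies ⟶ Q.toSpecies} (hf : PreservesComp f)
    (L : OperadAction P I) (L' : OperadAction Q I) {t s : RTree I} (h : t ≤ s) :
    L.map h ≫ treeTensorMap f s = treeTensorMap f t ≫ L'.map h := by
  induction h using RTree.le_induction with
  | refl t => rw [L.map_refl, L'.map_refl, Category.id_comp, Category.comp_id]
  | @step t r s v w h hrs ih =>
    rw [L.map_trans h.le hrs, L'.map_trans h.le hrs, Category.assoc, ih, ← Category.assoc,
      ← Category.assoc, L.map_contracts h, L'.map_contracts h]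
    congr 1
    ext n z
    exact treeVal_injective _ _ n (LinearMap.congr_fun (hf.contractMap h) (treeVal _ _ n z))

end Action

/-! ### Insertion of a factor into a tensor product -/

variable (k) in
/-- The sign `(-1) ^ n`, as a scalar. -/
def ksign (n : ℤ) : k := ((n.negOnePow : ℤ) : k)

lemma negOnePow_smul {V : Type*} [AddCommGroup V] [Module k V] (n : ℤ) (x : V) :
    n.negOnePow • x = ksign k n • x := by
  rw [ksign, Units.smul_def, Int.cast_smul_eq_zsmul]

lemma ksign_add (m n : ℤ) : ksign k (m + n) = ksign k m * ksign k n := by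
  rw [ksign, Int.negOnePow_add, Units.val_mul, Int.cast_mul]; rfl

lemma ksign_zero : ksign k 0 = 1 := by simp [ksign]

lemma ksign_succ (n : ℤ) : ksign k (n + 1) = -ksign k n := by simp [ksign, Int.negOnePow_succ]

section InsertFactor

variable {α : Type} {X : α → DGVS k} {S T : Set α} [Finite S] [Finite T] {σ : α}

lemma finsum_erase {N : Type*} [AddCommMonoid N] (hσ : σ ∈ T)
    (hS : ∀ u, u ∈ S ↔ u ∈ T ∧ u ≠ σ) (G : T → N) :
    ∑ᶠ A, G A = G ⟨σ, hσ⟩ + ∑ᶠ B : S, G ⟨B.1, ((hS B.1).1 B.2).1⟩ := by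
  classical
  have := Fintype.ofFinite S
  have := Fintype.ofFinite T
  rw [finsum_eq_sum_of_fintype, finsum_eq_sum_of_fintype,
    ← Finset.add_sum_erase _ _ (Finset.mem_univ (⟨σ, hσ⟩ : T))]
  congr 1
  symm
  refine Finset.sum_bij (fun B _ => ⟨B.1, ((hS B.1).1 B.2).1⟩) (fun B _ => ?_)
    (fun B _ B' _ hB => ?_) (fun A hA => ?_) (fun _ _ => rfl)
  · exact Finset.mem_erase.2 ⟨fun hB => ((hS B.1).1 B.2).2 (congrArg Subtype.val hB),
      Finset.mem_univ _⟩
  · exact Subtype.ext (Subtype.mk.inj hB)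
  · exact ⟨⟨A.1, (hS A.1).2 ⟨A.2, fun hA' => (Finset.mem_erase.1 hA).1 (Subtype.ext hA')⟩⟩,
      Finset.mem_univ _, rfl⟩

/-- The family on `T = S ∪ {σ}` that extends the family `y` on `S` by `x` at `σ`. -/
def insFam (V : α → Type*) (hS : ∀ u, u ∈ S ↔ u ∈ T ∧ u ≠ σ) (x : V σ) (y : ∀ u : S, V u.1)
    (u : T) : V u.1 :=
  open Classical in if h : u.1 = σ then h ▸ x else y ⟨u.1, (hS u.1).2 ⟨u.2, h⟩⟩

section

variable {V : α → Type*} (hσ : σ ∈ T) (hS : ∀ u, u ∈ S ↔ u ∈ T ∧ u ≠ σ)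

lemma insFam_self (x : V σ) (y : ∀ u : S, V u.1) : insFam V hS x y ⟨σ, hσ⟩ = x := dif_pos rfl

lemma insFam_other (x : V σ) (y : ∀ u : S, V u.1) (u : S) :
    insFam V hS x y ⟨u.1, ((hS u.1).1 u.2).1⟩ = y u := dif_neg ((hS u.1).1 u.2).2

include hσ hS in
/-- An element of `T` is `σ` or an element of `S`. -/
lemma eq_or_mem_erase (u : T) :
    u = ⟨σ, hσ⟩ ∨ ∃ a : S, u = ⟨a.1, ((hS a.1).1 a.2).1⟩ := by
  by_cases h : u.1 = σ
  · exact Or.inl (Subtype.ext h)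
  · exact Or.inr ⟨⟨u.1, (hS u.1).2 ⟨u.2, h⟩⟩, rfl⟩

lemma insFam_update [DecidableEq S] [DecidableEq T] (x : V σ) (y : ∀ u : S, V u.1) (a : S)
    (z : V a.1) : insFam V hS x (Function.update y a z) =
      Function.update (insFam V hS x y) ⟨a.1, ((hS a.1).1 a.2).1⟩ z := by
  funext u
  have ha := ((hS a.1).1 a.2).2
  by_cases h : u.1 = σ
  · obtain ⟨u, hu⟩ := u
    obtain rfl : u = σ := h
    rw [Function.update_of_ne (fun e => ha (congrArg Subtype.val e).symm), insFam_self,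
      insFam_self]
  · by_cases hua : u = ⟨a.1, ((hS a.1).1 a.2).1⟩
    · subst hua
      rw [Function.update_self, insFam_other, Function.update_self]
    · rw [Function.update_of_ne hua, insFam, insFam, dif_neg h, dif_neg h, Function.update_of_ne]
      exact fun e => hua (Subtype.ext (congrArg (fun w : S => w.1) e))

lemma insFam_eq_update [DecidableEq T] (x x' : V σ) (y : ∀ u : S, V u.1) :
    insFam V hS x y = Function.update (insFam V hS x' y) ⟨σ, hσ⟩ x := by
  funext u
  rcases eq_or_mem_erase hσ hS u with rfl | ⟨a, rfl⟩
  · rw [insFam_self, Function.update_self]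
  · rw [Function.update_of_ne (fun e => ((hS a.1).1 a.2).2 (congrArg Subtype.val e)), insFam_other,
      insFam_other]

end

variable (hσ : σ ∈ T) (hS : ∀ u, u ∈ S ↔ u ∈ T ∧ u ≠ σ)

include hσ in
lemma degBefore_insFam (p : ℤ) (deg : S → ℤ) (v : α) :
    degBefore (insFam (fun _ => ℤ) hS p deg : T → ℤ) v = ltInd σ v * p + degBefore deg v := by
  rw [degBefore, finsum_erase hσ hS, insFam_self]
  congr 1
  exact finsum_congr fun B => by rw [insFam_other]

variable (X) in
/-- The operator `y ↦ x ⊗ y`, with the factor `x ∈ X σ` moved to its place. -/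
def insMap (p : ℤ) (x : Tot (X σ)) :
    (⨂[k] w : S, Tot (X w.1)) →ₗ[k] ⨂[k] w : T, Tot (X w.1) :=
  PiTensorProduct.lift
    { toFun := fun y => PiTensorProduct.tprod k (insFam (fun s => Tot (X s)) hS x y)
      map_update_add' := fun {dec} y a z z' => by
        classical
        rw [insFam_update, insFam_update, insFam_update, MultilinearMap.map_update_add]
      map_update_smul' := fun {dec} y a r z => by
        classical
        rw [insFam_update, insFam_update, MultilinearMap.map_update_smul] } ∘ₗ
    signMap (fun deg => (p * degBefore deg σ).negOnePow)

lemma insMap_tprod (p : ℤ) (x : Tot (X σ)) {deg : S → ℤ} {y : ∀ u : S, Tot (X u.1)}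
    (hy : HomogFam deg y) : insMap X hS p x (PiTensorProduct.tprod k y) =
      (p * degBefore deg σ).negOnePow • PiTensorProduct.tprod k (insFam (fun s => Tot (X s)) hS x y) := by
  rw [insMap, LinearMap.comp_apply, signMap_tprod _ hy, map_negOnePow_smul,
    PiTensorProduct.lift.tprod]
  rfl

lemma HomogFam.ins {p : ℤ} (x : (X σ).X p) {deg : S → ℤ} {y : ∀ u : S, Tot (X u.1)}
    (hy : HomogFam deg y) :
    HomogFam (X := fun w : T => X w.1) (insFam (fun _ => ℤ) hS p deg)
      (insFam (fun s => Tot (X s)) hS (Tot.of _ p x) y) := by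
  intro u
  by_cases h : u.1 = σ
  · obtain ⟨u, hu⟩ := u
    obtain rfl : u = σ := h
    rw [insFam_self, insFam_self]
    exact ⟨x, rfl⟩
  · rw [insFam, insFam, dif_neg h, dif_neg h]
    exact hy ⟨u.1, (hS u.1).2 ⟨u.2, h⟩⟩

include hσ in
lemma insMap_add (p : ℤ) (x x' : Tot (X σ)) (z : ⨂[k] w : S, Tot (X w.1)) :
    insMap (T := T) X hS p (x + x') z = insMap X hS p x z + insMap X hS p x' z := by
  classical
  rw [← LinearMap.add_apply]
  refine LinearMap.congr_fun (piPure_ext fun deg y => ?_) z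
  have hy := homogFam_of deg y
  rw [LinearMap.add_apply, piPure, insMap_tprod hS _ _ hy, insMap_tprod hS _ _ hy,
    insMap_tprod hS _ _ hy, insFam_eq_update (V := fun s => Tot (X s)) hσ hS (x + x') 0, insFam_eq_update (V := fun s => Tot (X s)) hσ hS x 0,
    insFam_eq_update (V := fun s => Tot (X s)) hσ hS x' 0, MultilinearMap.map_update_add, units_smul_add]

include hσ in
lemma insMap_smul (p : ℤ) (r : k) (x : Tot (X σ)) (z : ⨂[k] w : S, Tot (X w.1)) :
    insMap (T := T) X hS p (r • x) z = r • insMap X hS p x z := by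
  classical
  rw [← LinearMap.smul_apply]
  refine LinearMap.congr_fun (piPure_ext fun deg y => ?_) z
  have hy := homogFam_of deg y
  rw [LinearMap.smul_apply, piPure, insMap_tprod hS _ _ hy, insMap_tprod hS _ _ hy,
    insFam_eq_update (V := fun s => Tot (X s)) hσ hS (r • x) 0, insFam_eq_update (V := fun s => Tot (X s)) hσ hS x 0, MultilinearMap.map_update_smul,
    smul_comm]

include hσ in
/-- The insertion of a factor is a derivation up to sign. -/
lemma piDiff_insMap (p : ℤ) (x : (X σ).X p) (z : ⨂[k] w : S, Tot (X w.1)) :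
    piDiff T (fun w => X w.1) (insMap X hS p (Tot.of _ p x) z) =
      insMap X hS (p + 1) (Tot.d _ (Tot.of _ p x)) z +
        ksign k p • insMap X hS p (Tot.of _ p x) (piDiff S (fun w => X w.1) z) := by
  classical
  have := Fintype.ofFinite S
  have := Fintype.ofFinite T
  have hlin : piDiff T (fun w => X w.1) ∘ₗ insMap X hS p (Tot.of _ p x) =
      insMap X hS (p + 1) (Tot.d _ (Tot.of _ p x)) +
        ((p.negOnePow : ℤ) : k) • insMap X hS p (Tot.of _ p x) ∘ₗ piDiff S (fun w => X w.1) := by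
    refine piPure_ext fun deg y => ?_
    have hy := homogFam_of deg y
    rw [LinearMap.add_apply, LinearMap.smul_apply, LinearMap.comp_apply, LinearMap.comp_apply, piPure,
      insMap_tprod hS _ _ hy, insMap_tprod hS _ _ hy, map_negOnePow_smul,
      piDiff_tprod (hy.ins hS x), piDiff_tprod hy, finsum_erase hσ hS, insFam_self,
      ← insFam_eq_update hσ hS, units_smul_add, smul_smul, ← Int.negOnePow_add,
      Int.cast_smul_eq_zsmul, ← Units.smul_def]
    congr 1
    · congr 1
      refine negOnePow_congr ?_
      rw [degBefore_insFam hσ hS, ltInd_self]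
      push_cast; ring
    · rw [finsum_eq_sum_of_fintype, finsum_eq_sum_of_fintype, map_sum, units_smul_sum, units_smul_sum]
      refine Finset.sum_congr rfl fun a _ => ?_
      rw [map_negOnePow_smul, insMap_tprod hS _ _ (hy.update_d a), insFam_update, smul_smul, smul_smul,
        smul_smul, insFam_other, ← Int.negOnePow_add, ← Int.negOnePow_add, ← Int.negOnePow_add]
      congr 1
      refine negOnePow_congr ?_
      rw [degBefore_insFam hσ hS, degBefore_update]
      push_cast
      rw [ltInd_cast_add ((hS a.1).1 a.2).2]
      generalize ((ltInd σ a.1 : ℤ) : ZMod 2) = l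
      generalize ((degBefore deg σ : ℤ) : ZMod 2) = b
      generalize ((degBefore deg a.1 : ℤ) : ZMod 2) = c
      generalize (p : ZMod 2) = p'
      clear * -
      grind
  exact LinearMap.congr_fun hlin z

variable {S' R : Set α} [Finite S'] [Finite R] {τ : α}

/-- Insertions of different factors commute up to sign. -/
lemma insMap_insMap (hστ : σ ≠ τ) (hσ : σ ∈ T) (hτ : τ ∈ T) (hS : ∀ u, u ∈ S ↔ u ∈ T ∧ u ≠ σ)
    (hS' : ∀ u, u ∈ S' ↔ u ∈ T ∧ u ≠ τ) (hR : ∀ u, u ∈ R ↔ u ∈ S ∧ u ≠ τ)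
    (hR' : ∀ u, u ∈ R ↔ u ∈ S' ∧ u ≠ σ) (p q : ℤ) (x : (X σ).X p) (y : (X τ).X q)
    (z : ⨂[k] w : R, Tot (X w.1)) :
    insMap X hS p (Tot.of _ p x) (insMap X hR q (Tot.of _ q y) z) =
      ksign k (p * q) • insMap X hS' q (Tot.of _ q y) (insMap X hR' p (Tot.of _ p x) z) := by
  have hlin : insMap X hS p (Tot.of _ p x) ∘ₗ insMap X hR q (Tot.of _ q y) =
      (((p * q).negOnePow : ℤ) : k) • insMap X hS' q (Tot.of _ q y) ∘ₗ
        insMap X hR' p (Tot.of _ p x) := by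
    refine piPure_ext fun deg z => ?_
    have hz := homogFam_of deg z
    have hσS' : σ ∈ S' := (hS' σ).2 ⟨hσ, hστ⟩
    have hτS : τ ∈ S := (hS τ).2 ⟨hτ, hστ.symm⟩
    rw [LinearMap.smul_apply, LinearMap.comp_apply, LinearMap.comp_apply, piPure,
      insMap_tprod hR _ _ hz, insMap_tprod hR' _ _ hz, map_negOnePow_smul, map_negOnePow_smul,
      insMap_tprod hS _ _ (hz.ins hR y), insMap_tprod hS' _ _ (hz.ins hR' x),
      Int.cast_smul_eq_zsmul, ← Units.smul_def, smul_smul, smul_smul, smul_smul,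
      ← Int.negOnePow_add, ← Int.negOnePow_add, ← Int.negOnePow_add]
    congr 1
    · refine negOnePow_congr ?_
      rw [degBefore_insFam hτS hR, degBefore_insFam hσS' hR']
      push_cast
      rw [ltInd_cast_add hστ]
      generalize ((ltInd τ σ : ℤ) : ZMod 2) = l
      generalize ((degBefore deg σ : ℤ) : ZMod 2) = b
      generalize ((degBefore deg τ : ℤ) : ZMod 2) = c
      generalize (p : ZMod 2) = p'
      generalize (q : ZMod 2) = q'
      clear * -
      grind
    · congr 1
      funext u
      obtain ⟨u, hu⟩ := u
      by_cases h1 : u = σ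
      · subst h1
        rw [insFam_self, insFam, dif_neg hστ, insFam_self]
      · by_cases h2 : u = τ
        · subst h2
          rw [insFam_self, insFam, dif_neg h1, insFam_self]
        · simp only [insFam, dif_neg h1, dif_neg h2]
  exact LinearMap.congr_fun hlin z

end InsertFactor

/-! ### Creation operators -/

section Fock

variable {α : Type} (X : α → DGVS k)

/-- The product, over the finite sets `T`, of the tensor products `⨂_{σ ∈ T} X σ`. -/
def Fock : Type u := ∀ T : Finset α, ⨂[k] w : (T : Set α), Tot (X w.1)

instance : AddCommGroup (Fock X) :=
  inferInstanceAs (AddCommGroup (∀ T : Finset α, ⨂[k] w : (T : Set α), Tot (X w.1)))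

instance : Module k (Fock X) :=
  inferInstanceAs (Module k (∀ T : Finset α, ⨂[k] w : (T : Set α), Tot (X w.1)))

/-- The component of an element of the Fock space at a finite set. -/
def fockProj (T : Finset α) : Fock X →ₗ[k] ⨂[k] w : (T : Set α), Tot (X w.1) where
  toFun f := f T
  map_add' _ _ := rfl
  map_smul' _ _ := rfl

variable {X} in
lemma Fock.ext {f g : Fock X} (h : ∀ T, fockProj X T f = fockProj X T g) : f = g := funext h

/-- The operator on the Fock space with given components. -/
def fockOp (F : ∀ T : Finset α, Fock X →ₗ[k] ⨂[k] w : (T : Set α), Tot (X w.1)) :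
    Module.End k (Fock X) where
  toFun f T := F T f
  map_add' f g := funext fun T => map_add (F T) f g
  map_smul' r f := funext fun T => map_smul (F T) r f

/-- The differential of the Fock space. -/
def fockD : Module.End k (Fock X) :=
  fockOp X fun T => piDiff (T : Set α) (fun w => X w.1) ∘ₗ fockProj X T

variable {X} in
lemma fockProj_fockOp (F T f) : fockProj X T (fockOp X F f) = F T f := rfl

variable {X} in
lemma fockProj_fockD (f : Fock X) (T : Finset α) :
    fockProj X T (fockD X f) = piDiff (T : Set α) (fun w => X w.1) (fockProj X T f) := rfl

lemma mem_coe_erase [DecidableEq α] (T : Finset α) (σ u : α) :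
    u ∈ ((T.erase σ : Finset α) : Set α) ↔ u ∈ (T : Set α) ∧ u ≠ σ := by
  simp [and_comm]

/-- The creation operator of `x ∈ X σ`. -/
def create (σ : α) (p : ℤ) (x : Tot (X σ)) : Module.End k (Fock X) :=
  open Classical in
  fockOp X fun T => if σ ∈ T then
    insMap X (mem_coe_erase T σ) p x ∘ₗ fockProj X (T.erase σ) else 0

variable {X}

lemma create_of_mem [dec : DecidableEq α] {σ : α} (p : ℤ) (x : Tot (X σ)) (f : Fock X) {T : Finset α}
    (h : σ ∈ T) :
    fockProj X T (create X σ p x f) =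
      insMap X (mem_coe_erase T σ) p x (fockProj X (T.erase σ) f) := by
  cases Subsingleton.elim dec (fun a b => Classical.propDecidable (a = b))
  rw [create, fockProj_fockOp, if_pos h]
  rfl

lemma create_of_notMem {σ : α} (p : ℤ) (x : Tot (X σ)) (f : Fock X) {T : Finset α}
    (h : σ ∉ T) : fockProj X T (create X σ p x f) = 0 := by
  rw [create, fockProj_fockOp, if_neg h, LinearMap.zero_apply]

lemma create_add (σ : α) (p : ℤ) (x y : Tot (X σ)) :
    create X σ p (x + y) = create X σ p x + create X σ p y := by
  classical
  refine LinearMap.ext fun f => Fock.ext fun T => ?_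
  rw [LinearMap.add_apply, map_add]
  by_cases h : σ ∈ T
  · rw [create_of_mem p _ f h, create_of_mem p _ f h, create_of_mem p _ f h, insMap_add h]
  · rw [create_of_notMem p _ f h, create_of_notMem p _ f h, create_of_notMem p _ f h, add_zero]

lemma create_smul (σ : α) (p : ℤ) (r : k) (x : Tot (X σ)) :
    create X σ p (r • x) = r • create X σ p x := by
  classical
  refine LinearMap.ext fun f => Fock.ext fun T => ?_
  rw [LinearMap.smul_apply, map_smul]
  by_cases h : σ ∈ T
  · rw [create_of_mem p _ f h, create_of_mem p _ f h, insMap_smul h]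
  · rw [create_of_notMem p _ f h, create_of_notMem p _ f h, smul_zero]

lemma fockD_fockD : fockD X * fockD X = 0 :=
  LinearMap.ext fun f => Fock.ext fun T => LinearMap.congr_fun piDiff_piDiff (fockProj X T f)

lemma fockD_create (σ : α) (p : ℤ) (x : (X σ).X p) :
    fockD X * create X σ p (Tot.of _ p x) = create X σ (p + 1) (Tot.d _ (Tot.of _ p x)) +
      ksign k p • (create X σ p (Tot.of _ p x) * fockD X) := by
  classical
  refine LinearMap.ext fun f => Fock.ext fun T => ?_
  rw [LinearMap.add_apply, LinearMap.smul_apply, map_add, map_smul, Module.End.mul_apply,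
    Module.End.mul_apply, fockProj_fockD]
  by_cases h : σ ∈ T
  · rw [create_of_mem (p + 1) _ f h, create_of_mem p _ (fockD X f) h, create_of_mem p _ f h,
      fockProj_fockD, piDiff_insMap (X := X) (T := T) h (mem_coe_erase T σ) p x]
  · rw [create_of_notMem (p + 1) _ f h, create_of_notMem p _ (fockD X f) h, smul_zero, add_zero,
      create_of_notMem p _ f h, map_zero]

/-- Creation operators commute in the graded sense. For `σ = τ` both products vanish, since a factor
that is present cannot be created. -/
lemma create_create (σ τ : α) (p q : ℤ) (x : (X σ).X p) (y : (X τ).X q) :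
    create X σ p (Tot.of _ p x) * create X τ q (Tot.of _ q y) =
      ksign k (p * q) • (create X τ q (Tot.of _ q y) * create X σ p (Tot.of _ p x)) := by
  classical
  refine LinearMap.ext fun f => Fock.ext fun T => ?_
  rw [LinearMap.smul_apply, map_smul, Module.End.mul_apply, Module.End.mul_apply]
  by_cases hστ : σ = τ
  · subst hστ
    have h : ∀ p' q' (x' y' : Tot (X σ)), fockProj X T (create X σ p' x' (create X σ q' y' f)) = 0 := by
      intro p' q' x' y'
      by_cases h : σ ∈ T
      · rw [create_of_mem _ _ _ h, create_of_notMem _ _ _ (Finset.notMem_erase σ T), map_zero]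
      · rw [create_of_notMem _ _ _ h]
    rw [h, h, smul_zero]
  · by_cases h : σ ∈ T
    · by_cases h' : τ ∈ T
      · rw [create_of_mem _ _ _ h, create_of_mem _ _ _ h',
          create_of_mem _ _ _ (Finset.mem_erase.2 ⟨Ne.symm hστ, h'⟩),
          create_of_mem _ _ _ (Finset.mem_erase.2 ⟨hστ, h⟩)]
        have key : ∀ (R R' : Finset α) (e : R = R')
            (hR : ∀ u, u ∈ (R : Set α) ↔ u ∈ ((T.erase σ : Finset α) : Set α) ∧ u ≠ τ)
            (hR' : ∀ u, u ∈ (R' : Set α) ↔ u ∈ ((T.erase τ : Finset α) : Set α) ∧ u ≠ σ),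
            insMap X (mem_coe_erase T σ) p (Tot.of _ p x) (insMap X hR q (Tot.of _ q y) (fockProj X R f)) =
            ksign k (p * q) • insMap X (mem_coe_erase T τ) q (Tot.of _ q y)
              (insMap X hR' p (Tot.of _ p x) (fockProj X R' f)) := by
          rintro R _ rfl hR hR'
          exact insMap_insMap hστ h h' _ _ _ _ p q x y (fockProj X R f)
        exact key _ _ Finset.erase_right_comm _ _
      · rw [create_of_mem _ _ _ h, create_of_notMem _ _ _ h', create_of_notMem _ _ _
          (fun e => h' (Finset.mem_of_mem_erase e)), map_zero, smul_zero]
    · by_cases h' : τ ∈ T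
      · rw [create_of_notMem _ _ _ h, create_of_mem _ _ _ h', create_of_notMem _ _ _
          (fun e => h (Finset.mem_of_mem_erase e)), map_zero, smul_zero]
      · rw [create_of_notMem _ _ _ h, create_of_notMem _ _ _ h', smul_zero]

variable (X)

/-- The graded algebra generated by the creation operators. -/
inductive FockAlg : ℤ → Module.End k (Fock X) → Prop
  | zero (n : ℤ) : FockAlg n 0
  | add {n : ℤ} {a b : Module.End k (Fock X)} (ha : FockAlg n a) (hb : FockAlg n b) :
    FockAlg n (a + b)
  | smul {n : ℤ} (r : k) {a : Module.End k (Fock X)} (ha : FockAlg n a) : FockAlg n (r • a)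
  | one : FockAlg 0 1
  | create_mul (σ : α) (p : ℤ) (x : (X σ).X p) {n : ℤ} {a : Module.End k (Fock X)}
      (ha : FockAlg n a) : FockAlg (p + n) (create X σ p (Tot.of _ p x) * a)

variable {X}

lemma FockAlg.create (σ : α) (p : ℤ) (x : (X σ).X p) :
    FockAlg X p (create X σ p (Tot.of _ p x)) := by
  have := FockAlg.create_mul σ p x .one
  rwa [add_zero, mul_one] at this

lemma FockAlg.mul {p q : ℤ} {a b : Module.End k (Fock X)} (ha : FockAlg X p a)
    (hb : FockAlg X q b) : FockAlg X (p + q) (a * b) := by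
  induction ha with
  | zero n => rw [zero_mul]; exact .zero _
  | add _ _ h h' => rw [add_mul]; exact .add h h'
  | smul r _ h => rw [smul_mul_assoc]; exact .smul r h
  | one => rwa [one_mul, zero_add]
  | create_mul σ p x _ h => rw [mul_assoc, add_assoc]; exact .create_mul σ p x h

lemma FockAlg.create_comm {q : ℤ} {b : Module.End k (Fock X)} (hb : FockAlg X q b) (σ : α)
    (p : ℤ) (x : (X σ).X p) : TreeBar.create X σ p (Tot.of _ p x) * b =
      ksign k (p * q) • (b * TreeBar.create X σ p (Tot.of _ p x)) := by
  induction hb with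
  | zero n => rw [zero_mul, mul_zero, smul_zero]
  | add _ _ h h' => rw [add_mul, mul_add, smul_add, h, h']
  | smul r _ h => rw [smul_mul_assoc, mul_smul_comm, h, smul_comm]
  | one => rw [mul_zero, ksign_zero, one_smul, mul_one, one_mul]
  | @create_mul τ q y n a _ h =>
    rw [← mul_assoc, create_create, smul_mul_assoc, mul_assoc, h, mul_add, ksign_add, mul_smul_comm,
      smul_smul, mul_assoc]

/-- The algebra generated by the creation operators is graded commutative. -/
lemma FockAlg.mul_comm {p q : ℤ} {a b : Module.End k (Fock X)} (ha : FockAlg X p a)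
    (hb : FockAlg X q b) : a * b = ksign k (p * q) • (b * a) := by
  induction ha with
  | zero n => rw [zero_mul, mul_zero, smul_zero]
  | add _ _ h h' => rw [add_mul, mul_add, smul_add, h, h']
  | smul r _ h => rw [smul_mul_assoc, mul_smul_comm, h, smul_comm]
  | one => rw [zero_mul, ksign_zero, one_smul, mul_one, one_mul]
  | @create_mul σ p x n a _ h =>
    rw [mul_assoc, h, mul_smul_comm, ← mul_assoc, hb.create_comm, smul_mul_assoc, smul_smul,
      mul_assoc, add_mul, ksign_add, _root_.mul_comm (ksign k (p * q))]

variable (X) in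
/-- The differential `a ↦ D a - (-1) ^ n a D` on operators of degree `n`. -/
def fockDiff (n : ℤ) : Module.End k (Fock X) →ₗ[k] Module.End k (Fock X) :=
  LinearMap.mulLeft k (fockD X) - ksign k n • LinearMap.mulRight k (fockD X)

lemma fockDiff_apply (n : ℤ) (a : Module.End k (Fock X)) :
    fockDiff X n a = fockD X * a - ksign k n • (a * fockD X) := rfl

lemma fockDiff_mul (p q : ℤ) (a b : Module.End k (Fock X)) :
    fockDiff X (p + q) (a * b) = fockDiff X p a * b + ksign k p • (a * fockDiff X q b) := by
  simp only [fockDiff_apply, mul_sub, sub_mul, smul_sub, ksign_add, mul_smul, smul_mul_assoc,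
    mul_smul_comm, mul_assoc]
  abel

lemma fockDiff_create (σ : α) (p : ℤ) (x : (X σ).X p) :
    fockDiff X p (create X σ p (Tot.of _ p x)) =
      create X σ (p + 1) (Tot.of _ (p + 1) (((X σ).d p (p + 1)).hom x)) := by
  rw [fockDiff_apply, fockD_create, add_sub_cancel_right, Tot.d_of]

lemma fockDiff_one : fockDiff X 0 1 = 0 := by
  rw [fockDiff_apply, mul_one, one_mul, ksign_zero, one_smul, sub_self]

lemma FockAlg.diff {n : ℤ} {a : Module.End k (Fock X)} (ha : FockAlg X n a) :
    FockAlg X (n + 1) (fockDiff X n a) := by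
  induction ha with
  | zero n => rw [map_zero]; exact .zero _
  | add _ _ h h' => rw [map_add]; exact .add h h'
  | smul r _ h => rw [map_smul]; exact .smul r h
  | one => rw [fockDiff_one]; exact .zero _
  | @create_mul σ p x n a ha h =>
    rw [fockDiff_mul, fockDiff_create]
    refine .add ?_ (FockAlg.smul _ ?_)
    · rw [show p + n + 1 = p + 1 + n by ring]
      exact .create_mul σ _ _ ha
    · rw [add_assoc]
      exact .create_mul σ _ _ h

lemma fockDiff_fockDiff (n : ℤ) (a : Module.End k (Fock X)) :
    fockDiff X (n + 1) (fockDiff X n a) = 0 := by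
  have h : ∀ b : Module.End k (Fock X), fockD X * (fockD X * b) = 0 := fun b => by
    rw [← mul_assoc, fockD_fockD, zero_mul]
  simp only [fockDiff_apply, ksign_succ, mul_sub, sub_mul, smul_sub,
    mul_smul_comm, smul_mul_assoc, mul_assoc, fockD_fockD, mul_zero, h, smul_zero, neg_smul]
  abel

variable (X) in
/-- The component of degree `n` of the algebra generated by the creation operators. -/
def fockSub (n : ℤ) : Submodule k (Module.End k (Fock X)) where
  carrier := {a | FockAlg X n a}
  zero_mem' := .zero n
  add_mem' := .add
  smul_mem' r _ := .smul r

end Fock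

/-! ### The operad of families of operators -/

section FockOperad

variable {α : Type} (X : α → DGVS k)

/-- The differential between the components of the algebra of operators. -/
def fockSubD (n m : ℤ) (h : n + 1 = m) : fockSub X n →ₗ[k] fockSub X m :=
  (fockDiff X n).restrict (fun _ ha => h ▸ FockAlg.diff ha)

/-- The families of operators indexed by the labellings of `A` by sets of natural numbers. The member
of an element of degree `n` at each labelling has degree `n`. -/
def fockFam (A : Type) : DGVS k where
  X n := ModuleCat.of k ((A → Set ℕ) → fockSub X n)
  d n m := if h : n + 1 = m then ModuleCat.ofHom ((fockSubD X n m h).compLeft (A → Set ℕ)) else 0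
  shape n m h := dif_neg h
  d_comp_d' n m l hnm hml := by
    have hnm' : n + 1 = m := hnm
    have hml' : m + 1 = l := hml
    subst hnm' hml'
    rw [dif_pos rfl, dif_pos rfl]
    refine ModuleCat.hom_ext (LinearMap.ext fun a => funext fun φ => Subtype.ext ?_)
    exact fockDiff_fockDiff n (a φ).1

variable {X}

/-- The member of a family at the labelling `φ`. -/
def fockAt {A : Type} {n : ℤ} (a : (fockFam X A).X n) (φ : A → Set ℕ) : fockSub X n := a φ

lemma fockAt_ext {A : Type} {n : ℤ} {a b : (fockFam X A).X n}
    (h : ∀ φ, (fockAt a φ).1 = (fockAt b φ).1) : a = b :=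
  funext fun φ => Subtype.ext (h φ)

lemma fockOf_ext {A : Type} {n m : ℤ} (hnm : n = m) {a : (fockFam X A).X n} {b : (fockFam X A).X m}
    (h : ∀ φ, (fockAt a φ).1 = (fockAt b φ).1) : Tot.of _ n a = Tot.of _ m b := by
  subst hnm
  rw [fockAt_ext h]

lemma fockAt_d {A : Type} {n m : ℤ} (h : n + 1 = m) (a : (fockFam X A).X n) (φ : A → Set ℕ) :
    (fockAt (((fockFam X A).d n m).hom a) φ).1 = fockDiff X n (fockAt a φ).1 := by
  subst h
  have : (fockFam X A).d n (n + 1) =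
      ModuleCat.ofHom ((fockSubD X n (n + 1) rfl).compLeft (A → Set ℕ)) := dif_pos rfl
  rw [this]
  rfl

/-- The family given by operators for all labellings. -/
def fockMk {A : Type} {n : ℤ} (F : (A → Set ℕ) → Module.End k (Fock X)) (hF : ∀ φ, FockAlg X n (F φ)) :
    (fockFam X A).X n := fun φ => (⟨F φ, hF φ⟩ : fockSub X n)

lemma fockAt_mk {A : Type} {n : ℤ} (F : (A → Set ℕ) → Module.End k (Fock X)) (hF) (φ) :
    (fockAt (fockMk (n := n) F hF) φ).1 = F φ := rfl

lemma fockAt_add {A : Type} {n : ℤ} (a b : (fockFam X A).X n) (φ : A → Set ℕ) :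
    (fockAt (a + b) φ).1 = (fockAt a φ).1 + (fockAt b φ).1 := rfl

lemma fockAt_smul {A : Type} {n : ℤ} (r : k) (a : (fockFam X A).X n) (φ : A → Set ℕ) :
    (fockAt (r • a) φ).1 = r • (fockAt a φ).1 := rfl

lemma fockAt_alg {A : Type} {n : ℤ} (a : (fockFam X A).X n) (φ : A → Set ℕ) :
    FockAlg X n (fockAt a φ).1 := (fockAt a φ).2

/-- The restriction of families along a map of the sets of labels. -/
def fockAlong {A B : Type} (e : B → A) : fockFam X B ⟶ fockFam X A where
  f n := ModuleCat.ofHom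
    { toFun := fun a => fockMk (fun φ => (fockAt a (φ ∘ e)).1) (fun φ => fockAt_alg a _)
      map_add' := fun _ _ => rfl
      map_smul' := fun _ _ => rfl }
  comm' n m h := by
    refine ModuleCat.hom_ext (LinearMap.ext fun a => fockAt_ext fun φ => ?_)
    refine (fockAt_d h _ φ).trans ?_
    exact (fockAt_d h a (φ ∘ e)).symm

lemma fockAt_along {A B : Type} (e : B → A) {n : ℤ} (a : (fockFam X B).X n) (φ : A → Set ℕ) :
    (fockAt (((fockAlong e).f n).hom a) φ).1 = (fockAt a (φ ∘ e)).1 := rfl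

variable (X) in
/-- The species of families of operators. -/
def fockSpecies : Species k where
  obj A := fockFam X A.unop.carrier
  map e := fockAlong e.unop.symm
  map_id _ := rfl
  map_comp _ _ := rfl

/-- The labelling of `A` induced by a labelling of `(A \ {i}) ⊔ B`: the label of `i` is the union of
the labels of `B`. -/
def outerLabel {A B : Type} (i : A) (ψ : Insert i B → Set ℕ) (a : A) : Set ℕ :=
  open Classical in if h : a = i then ⋃ b, ψ (Sum.inr b) else ψ (Sum.inl ⟨a, h⟩)

lemma outerLabel_self {A B : Type} (i : A) (ψ : Insert i B → Set ℕ) :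
    outerLabel i ψ i = ⋃ b, ψ (Sum.inr b) := dif_pos rfl

lemma outerLabel_other {A B : Type} (i : A) (ψ : Insert i B → Set ℕ) (a : {a // a ≠ i}) :
    outerLabel i ψ a.1 = ψ (Sum.inl a) := dif_neg a.2

/-- The composition of families of operators, on components. -/
def fockMul {A B : Type} (i : A) (p q n : ℤ) (h : p + q = n) :
    (fockFam X A).X p →ₗ[k] (fockFam X B).X q →ₗ[k] (fockFam X (Insert i B)).X n :=
  LinearMap.mk₂ k (fun a b => fockMk
      (fun ψ => (fockAt a (outerLabel i ψ)).1 * (fockAt b (ψ ∘ Sum.inr)).1)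
      (fun _ => h ▸ (fockAt_alg a _).mul (fockAt_alg b _)))
    (fun a a' b => fockAt_ext fun _ => add_mul (fockAt a _).1 (fockAt a' _).1 (fockAt b _).1)
    (fun r a b => fockAt_ext fun _ => smul_mul_assoc r (fockAt a _).1 (fockAt b _).1)
    (fun a b b' => fockAt_ext fun _ => mul_add (fockAt a _).1 (fockAt b _).1 (fockAt b' _).1)
    (fun r a b => fockAt_ext fun _ => mul_smul_comm r (fockAt a _).1 (fockAt b _).1)

lemma fockAt_mul {A B : Type} (i : A) (p q n : ℤ) (h : p + q = n) (a : (fockFam X A).X p)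
    (b : (fockFam X B).X q) (ψ : Insert i B → Set ℕ) :
    (fockAt (fockMul i p q n h a b) ψ).1 =
      (fockAt a (outerLabel i ψ)).1 * (fockAt b (ψ ∘ Sum.inr)).1 := rfl

/-- The partial composition of families of operators: the product of operators. -/
def fockComp (A B : Type) (i : A) : fockFam X A ⊗ fockFam X B ⟶ fockFam X (Insert i B) :=
  tensorDesc (fockMul i) (by
    intro p q n n' h h' a b
    refine fockAt_ext fun ψ => ?_
    rw [negOnePow_smul (k := k)]
    refine (fockAt_d h' _ ψ).trans ?_
    subst h
    refine (fockDiff_mul p q _ _).trans ?_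
    exact congrArg₂ (fun x y => x * (fockAt b (ψ ∘ Sum.inr)).1 +
      ksign k p • ((fockAt a (outerLabel i ψ)).1 * y)) (fockAt_d rfl a _).symm (fockAt_d rfl b _).symm)

lemma bil_fockComp {A B : Type} (i : A) (p q : ℤ) (a : (fockFam X A).X p) (b : (fockFam X B).X q) :
    Tot.bil (fockComp A B i) (Tot.of _ p a) (Tot.of _ q b) =
      Tot.of _ (p + q) (fockMul i p q (p + q) rfl a b) := bil_tensorDesc _ _ _ _ _ _

end FockOperad

section Unit

/-- The morphism `k ⟶ Z` that corresponds to a cycle of degree `0`. -/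
def unitHom {Z : DGVS k} (z : Z.X 0) (hz : (Z.d 0 1).hom z = 0) : 𝟙_ (DGVS k) ⟶ Z :=
  HomologicalComplex.mkHomFromSingle (ModuleCat.ofHom (LinearMap.toSpanSingleton k (Z.X 0) z)) (by
    intro j hj
    obtain rfl : 0 + 1 = j := hj
    refine ModuleCat.hom_ext (LinearMap.ext fun r => ?_)
    change (Z.d 0 1).hom (r • z) = 0
    rw [map_smul, hz, smul_zero])

lemma elt_unitHom {Z : DGVS k} (z : Z.X 0) (hz) : Tot.elt (unitHom z hz) = Tot.of Z 0 z := by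
  rw [Tot.elt, unitHom, HomologicalComplex.mkHomFromSingle_f]
  congr 1
  erw [Iso.inv_hom_id_assoc]
  exact one_smul k z

lemma elt_comp {Z W : DGVS k} (f : 𝟙_ (DGVS k) ⟶ Z) (g : Z ⟶ W) :
    Tot.elt (f ≫ g) = Tot.map g (Tot.elt f) := by
  rw [Tot.elt, Tot.elt, Tot.map_of]
  rfl

lemma unit_hom_ext {Z : DGVS k} {f g : 𝟙_ (DGVS k) ⟶ Z} (h : Tot.elt f = Tot.elt g) : f = g := by
  refine HomologicalComplex.from_single_hom_ext ?_
  rw [← cancel_epi (HomologicalComplex.singleObjXSelf (ComplexShape.up ℤ) 0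
    (𝟙_ (ModuleCat.{u} k))).inv]
  refine ModuleCat.hom_ext (LinearMap.ext_ring ?_)
  exact Tot.of_injective _ _ h

end Unit

section FockOperad

variable {α : Type} {X : α → DGVS k}

lemma Tot.induction {Z : DGVS k} {motive : Tot Z → Prop} (zero : motive 0)
    (of : ∀ n x, motive (Tot.of Z n x)) (add : ∀ a b, motive a → motive b → motive (a + b))
    (a : Tot Z) : motive a :=
  DirectSum.induction_on a zero of add

lemma iUnion_outerLabel {A B : Type} (i : A) (ψ : Insert i B → Set ℕ) :
    ⋃ a, outerLabel i ψ a = ⋃ x, ψ x := by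
  ext n
  simp only [Set.mem_iUnion]
  constructor
  · rintro ⟨a, ha⟩
    by_cases h : a = i
    · subst h
      rw [outerLabel_self, Set.mem_iUnion] at ha
      exact ⟨_, ha.choose_spec⟩
    · rw [show a = (⟨a, h⟩ : {a // a ≠ i}).1 from rfl, outerLabel_other] at ha
      exact ⟨_, ha⟩
  · rintro ⟨a | b, h⟩
    · exact ⟨a.1, by rwa [outerLabel_other]⟩
    · exact ⟨i, by rw [outerLabel_self]; exact Set.mem_iUnion.2 ⟨b, h⟩⟩

/-- A labelling is `outerLabel i ψ` if it takes the right values. -/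
lemma eq_outerLabel {A B : Type} {i : A} {ψ : Insert i B → Set ℕ} {φ : A → Set ℕ}
    (h : φ i = ⋃ b, ψ (Sum.inr b)) (h' : ∀ a : {a // a ≠ i}, φ a.1 = ψ (Sum.inl a)) :
    φ = outerLabel i ψ := by
  funext a
  by_cases ha : a = i
  · rw [ha, h, outerLabel_self]
  · exact (h' ⟨a, ha⟩).trans (outerLabel_other i ψ ⟨a, ha⟩).symm

lemma fockComp_along {A A' B B' : Type} (e : A ≃ A') (f : B ≃ B') (i : A) :
    (fockAlong (X := X) e.symm ⊗ₘ fockAlong f.symm) ≫ fockComp A B i =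
      fockComp A' B' (e i) ≫ fockAlong (Insert.congr e f i).symm := by
  refine tensor_hom_ext fun p a q b => ?_
  rw [Tot.bil_tensorHom, Tot.bil_comp, Tot.map_of, Tot.map_of, bil_fockComp, bil_fockComp,
    Tot.map_of]
  refine fockOf_ext rfl fun ψ => ?_
  refine congrArg₂ (· * ·) (congrArg (fun φ => (fockAt a φ).1) (eq_outerLabel ?_ ?_)) rfl
  · refine (congrArg _ (e.symm_apply_apply i)).trans ?_
    rw [outerLabel_self]
    exact (f.symm.surjective.iUnion_comp fun b => ψ (Sum.inr b)).symm
  · rintro ⟨x, hx⟩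
    exact outerLabel_other i ψ ⟨e.symm x, fun h => hx (by rw [← h, e.apply_symm_apply])⟩

lemma fockComp_nested {A B C : Type} (i : A) (j : B) (a : Tot (fockFam X A)) (b : Tot (fockFam X B))
    (c : Tot (fockFam X C)) :
    Tot.bil (fockComp _ C (Sum.inr j)) (Tot.bil (fockComp A B i) a b) c =
      Tot.map (fockAlong (Insert.nested i j).symm)
        (Tot.bil (fockComp A _ i) a (Tot.bil (fockComp B C j) b c)) := by
  induction a using Tot.induction with
  | zero => simp only [map_zero, LinearMap.zero_apply]
  | add a a' h h' => simp only [map_add, LinearMap.add_apply, h, h']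
  | of p a =>
  induction b using Tot.induction with
  | zero => simp only [map_zero, LinearMap.zero_apply]
  | add a a' h h' => simp only [map_add, LinearMap.add_apply, h, h']
  | of q b =>
  induction c using Tot.induction with
  | zero => simp only [map_zero]
  | add a a' h h' => simp only [map_add, h, h']
  | of r c =>
  rw [bil_fockComp, bil_fockComp, bil_fockComp, bil_fockComp, Tot.map_of]
  refine fockOf_ext (add_assoc p q r) fun ψ => ?_
  refine (mul_assoc _ _ _).trans ?_
  have h : outerLabel (Sum.inr j) ψ ∘ Sum.inr =
      outerLabel j ((ψ ∘ (Insert.nested i j).symm) ∘ Sum.inr) :=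
    eq_outerLabel (outerLabel_self _ _) fun b =>
      outerLabel_other (Sum.inr j : Insert i B) ψ
        ⟨Sum.inr b.1, fun h => b.2 (Sum.inr_injective h)⟩
  refine congrArg₂ (· * ·) (congrArg (fun φ => (fockAt a φ).1) (eq_outerLabel ?_ ?_))
    (congrArg (fun φ => (fockAt b φ).1 * _) h)
  · rw [outerLabel_self]
    refine Eq.trans ?_ (iUnion_outerLabel j ((ψ ∘ (Insert.nested i j).symm) ∘ Sum.inr))
    rw [← h]
    rfl
  · intro x
    exact (outerLabel_other i _ x).trans
      (outerLabel_other (Sum.inr j : Insert i B) ψ ⟨Sum.inl x, Sum.inl_ne_inr⟩)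

/-- The parallel associativity holds because the operators commute in the graded sense. -/
lemma fockComp_parallel {A B C : Type} (i j : A) (hij : i ≠ j) (a : Tot (fockFam X A)) (p q : ℤ)
    (b : (fockFam X B).X p) (c : (fockFam X C).X q) :
    Tot.bil (fockComp _ C (Sum.inl ⟨j, hij.symm⟩))
        (Tot.bil (fockComp A B i) a (Tot.of _ p b)) (Tot.of _ q c) =
      (p * q).negOnePow • Tot.map (fockAlong (Insert.parallel i j hij).symm)
        (Tot.bil (fockComp _ B (Sum.inl ⟨i, hij⟩))
          (Tot.bil (fockComp A C j) a (Tot.of _ q c)) (Tot.of _ p b)) := by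
  rw [negOnePow_smul (k := k)]
  induction a using Tot.induction with
  | zero => simp only [map_zero, LinearMap.zero_apply, smul_zero]
  | add a a' h h' => simp only [map_add, LinearMap.add_apply, h, h', smul_add]
  | of r a =>
  rw [bil_fockComp, bil_fockComp, bil_fockComp, bil_fockComp, Tot.map_of, ← map_smul]
  refine fockOf_ext (by ring) fun ψ => ?_
  have h : outerLabel (Sum.inl ⟨j, hij.symm⟩ : Insert i B) ψ ∘ Sum.inr =
      (ψ ∘ (Insert.parallel i j hij).symm) ∘ Sum.inr := funext fun b =>
    outerLabel_other (Sum.inl ⟨j, hij.symm⟩ : Insert i B) ψ ⟨Sum.inr b, Sum.inr_ne_inl⟩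
  have h' : outerLabel (Sum.inl ⟨i, hij⟩ : Insert j C) (ψ ∘ (Insert.parallel i j hij).symm) ∘ Sum.inr =
      ψ ∘ Sum.inr := funext fun c =>
    outerLabel_other (Sum.inl ⟨i, hij⟩ : Insert j C) _ ⟨Sum.inr c, Sum.inr_ne_inl⟩
  have h'' : outerLabel i (outerLabel (Sum.inl ⟨j, hij.symm⟩ : Insert i B) ψ) =
      outerLabel j (outerLabel (Sum.inl ⟨i, hij⟩ : Insert j C) (ψ ∘ (Insert.parallel i j hij).symm)) := by
    refine eq_outerLabel ?_ ?_
    · refine (outerLabel_other i _ ⟨j, hij.symm⟩).trans ((outerLabel_self _ _).trans ?_)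
      exact congrArg (fun f : C → Set ℕ => ⋃ c, f c) h'.symm
    · rintro ⟨x, hx⟩
      by_cases hxi : x = i
      · subst hxi
        refine (outerLabel_self _ _).trans ?_
        refine (congrArg (fun f : B → Set ℕ => ⋃ b, f b) h).trans ?_
        exact (outerLabel_self (Sum.inl ⟨x, hij⟩ : Insert j C) _).symm
      · refine (outerLabel_other i _ ⟨x, hxi⟩).trans ?_
        refine (outerLabel_other (Sum.inl ⟨j, hij.symm⟩ : Insert i B) ψ
          ⟨Sum.inl ⟨x, hxi⟩, fun e => hx (congrArg Subtype.val (Sum.inl_injective e))⟩).trans ?_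
        exact (outerLabel_other (Sum.inl ⟨i, hij⟩ : Insert j C)
          (ψ ∘ (Insert.parallel i j hij).symm)
          ⟨Sum.inl ⟨x, hx⟩, fun e => hxi (congrArg Subtype.val (Sum.inl_injective e))⟩).symm
  refine (mul_assoc _ _ _).trans ?_
  refine (congrArg _ ((fockAt_alg b _).mul_comm (fockAt_alg c _))).trans ?_
  refine (mul_smul_comm _ _ _).trans (congrArg _ ((mul_assoc _ _ _).symm.trans ?_))
  exact congrArg₂ (· * ·) (congrArg₂ (fun φ χ => (fockAt a φ).1 * (fockAt c χ).1) h'' h'.symm)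
    (congrArg (fun φ => (fockAt b φ).1) h)

variable (X) in
/-- The unit of the operad of families of operators: the identity operator. -/
def fockUnit (A : Type) : 𝟙_ (DGVS k) ⟶ fockFam X A :=
  unitHom (fockMk (fun _ => 1) (fun _ => .one)) (fockAt_ext fun φ =>
    (fockAt_d (zero_add 1) _ φ).trans fockDiff_one)

lemma elt_fockUnit (A : Type) : Tot.elt (fockUnit X A) =
    Tot.of _ 0 (fockMk (fun _ => 1) (fun _ => .one)) := elt_unitHom _ _

lemma fockComp_unit {A B : Type} [Unique B] (i : A) (a : Tot (fockFam X A)) :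
    Tot.bil (fockComp A B i) a (Tot.elt (fockUnit X B)) =
      Tot.map (fockAlong (Insert.rightUnit i B).symm) a := by
  rw [elt_fockUnit]
  induction a using Tot.induction with
  | zero => simp only [map_zero, LinearMap.zero_apply]
  | add a a' h h' => simp only [map_add, LinearMap.add_apply, h, h']
  | of p a =>
  rw [bil_fockComp, Tot.map_of]
  refine fockOf_ext (add_zero p) fun ψ => (mul_one _).trans ?_
  refine congrArg (fun φ => (fockAt a φ).1) (eq_outerLabel ?_ ?_).symm
  · change ψ ((Insert.rightUnit i B).symm i) = _
    rw [show (Insert.rightUnit i B).symm i = Sum.inr default from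
      (Insert.rightUnit i B).symm_apply_eq.2 rfl]
    exact (iSup_unique (f := fun b => ψ (Sum.inr b))).symm
  · rintro ⟨x, hx⟩
    exact congrArg ψ ((Insert.rightUnit i B).symm_apply_eq.2 rfl)

lemma fockUnit_comp {A B : Type} [Unique A] (b : Tot (fockFam X B)) :
    Tot.bil (fockComp A B default) (Tot.elt (fockUnit X A)) b =
      Tot.map (fockAlong (Insert.leftUnit A B).symm) b := by
  rw [elt_fockUnit]
  induction b using Tot.induction with
  | zero => simp only [map_zero]
  | add a a' h h' => simp only [map_add, h, h']
  | of p a =>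
  rw [bil_fockComp, Tot.map_of]
  exact fockOf_ext (zero_add p) fun ψ => one_mul _

variable (X) in
/-- The operad of families of operators. -/
def fockOperad : Operad k where
  toSpecies := fockSpecies X
  comp A B _ _ i := fockComp A B i
  unit A _ _ := fockUnit X A
  comp_along _ _ _ _ _ _ _ _ e f i := fockComp_along e f i
  unit_along A B _ _ _ _ e := by
    refine unit_hom_ext ((elt_comp _ _).trans ?_)
    refine (congrArg _ (elt_fockUnit B)).trans (Eq.trans ?_ (elt_fockUnit A).symm)
    exact Tot.map_of _ _ _
  assoc_nested _ _ _ _ _ _ i j a b c := fockComp_nested i j a b c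
  assoc_parallel _ _ _ _ _ _ i j hij a p q b c := fockComp_parallel i j hij a p q b c
  comp_unit _ _ _ _ _ i a := fockComp_unit i a
  unit_comp _ _ _ _ _ b := fockUnit_comp b

end FockOperad

/-! ### The generating operators of a species -/

section FockGen

variable (M : Species k)

/-- The complexes whose elements are created: the values of `M` on finite sets of labels. -/
abbrev labelFam (σ : Finset (Set ℕ)) : DGVS k := M.on {x // x ∈ σ}

/-- The set of the values of a labelling. -/
def labelSet {A : Type} [Finite A] (φ : A → Set ℕ) : Finset (Set ℕ) := (Set.finite_range φ).toFinset

lemma mem_labelSet {A : Type} [Finite A] (φ : A → Set ℕ) (x : Set ℕ) :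
    x ∈ labelSet φ ↔ ∃ a, φ a = x := by
  simp [labelSet]

/-- The values of an injective labelling correspond to the elements. -/
def labelSetEquiv {A : Type} [Finite A] (φ : A → Set ℕ) (h : Function.Injective φ) :
    {x // x ∈ labelSet φ} ≃ A :=
  (Equiv.ofBijective (fun a => (⟨φ a, (mem_labelSet φ _).2 ⟨a, rfl⟩⟩ : {x // x ∈ labelSet φ}))
    ⟨fun _ _ e => h (congrArg Subtype.val e), fun x => by
      obtain ⟨a, ha⟩ := (mem_labelSet φ x.1).1 x.2
      exact ⟨a, Subtype.ext ha⟩⟩).symm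

lemma apply_labelSetEquiv {A : Type} [Finite A] (φ : A → Set ℕ) (h : Function.Injective φ)
    (x : {x // x ∈ labelSet φ}) : φ (labelSetEquiv φ h x) = x.1 :=
  congrArg Subtype.val ((labelSetEquiv φ h).symm_apply_apply x)

variable {M} in
/-- The creation operator of an element of `M(A)`, for an identification of `A` with a set of
labels. -/
lemma create_along_congr {A : Type} [Finite A] {σ τ : Finset (Set ℕ)} (hστ : σ = τ)
    (e : {x // x ∈ σ} ≃ A) (f : {x // x ∈ τ} ≃ A) (hef : ∀ x hx hx', e ⟨x, hx⟩ = f ⟨x, hx'⟩)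
    (n : ℤ) (m : Tot (M.on A)) :
    create (labelFam M) σ n (M.act e m) = create (labelFam M) τ n (M.act f m) := by
  subst hστ
  obtain rfl : e = f := Equiv.ext fun x => hef x.1 x.2 x.2
  rfl

/-- The creation operators of the elements of `M(A)`, for a labelling of `A`. They are zero unless the
labelling is injective and so identifies `A` with a set of labels. -/
def genOp {A : Type} [Finite A] (n : ℤ) (φ : A → Set ℕ) :
    Tot (M.on A) →ₗ[k] Module.End k (Fock (labelFam M)) :=
  open Classical in
  if h : Function.Injective φ then
    { toFun := fun m => create (labelFam M) (labelSet φ) n (M.act (labelSetEquiv φ h) m)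
      map_add' := fun m m' => by rw [map_add, create_add]
      map_smul' := fun r m => by rw [map_smul, create_smul, RingHom.id_apply] }
  else 0

variable {M}

lemma genOp_of_injective {A : Type} [Finite A] (n : ℤ) {φ : A → Set ℕ} (h : Function.Injective φ)
    (m : Tot (M.on A)) :
    genOp M n φ m = create (labelFam M) (labelSet φ) n (M.act (labelSetEquiv φ h) m) := by
  rw [genOp, dif_pos h]
  rfl

lemma genOp_of_not_injective {A : Type} [Finite A] (n : ℤ) {φ : A → Set ℕ}
    (h : ¬ Function.Injective φ) (m : Tot (M.on A)) : genOp M n φ m = 0 := by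
  rw [genOp, dif_neg h]
  rfl

lemma fockAlg_genOp {A : Type} [Finite A] (n : ℤ) (φ : A → Set ℕ) (m : (M.on A).X n) :
    FockAlg (labelFam M) n (genOp M n φ (Tot.of _ n m)) := by
  by_cases h : Function.Injective φ
  · rw [genOp_of_injective n h, Species.act_of]; exact .create _ _ _
  · rw [genOp_of_not_injective n h]; exact .zero n

lemma fockDiff_genOp {A : Type} [Finite A] (n : ℤ) (φ : A → Set ℕ) (m : (M.on A).X n) :
    fockDiff _ n (genOp M n φ (Tot.of _ n m)) =
      genOp M (n + 1) φ (Tot.of _ (n + 1) (((M.on A).d n (n + 1)).hom m)) := by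
  by_cases h : Function.Injective φ
  · rw [genOp_of_injective n h, genOp_of_injective (n + 1) h, Species.act_of, fockDiff_create,
      ← Tot.d_of, ← Species.act_of, Species.d_act, Tot.d_of]
  · rw [genOp_of_not_injective n h, genOp_of_not_injective (n + 1) h, map_zero]

lemma genOp_act {A B : Type} [Finite A] [Finite B] (e : A ≃ B) (n : ℤ) (φ : A → Set ℕ)
    (m : Tot (M.on B)) : genOp M n φ (M.act e m) = genOp M n (φ ∘ e.symm) m := by
  by_cases h : Function.Injective φ
  · have h' : Function.Injective (φ ∘ e.symm) := h.comp e.symm.injective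
    rw [genOp_of_injective n h, genOp_of_injective n h', Species.act_act]
    refine create_along_congr ?_ _ _ (fun x hx hx' => h' ?_) n _
    · ext x
      simp only [mem_labelSet, Function.comp_apply]
      exact e.symm.surjective.exists
    · refine (congrArg φ (e.symm_apply_apply _)).trans ?_
      refine (apply_labelSetEquiv φ h ⟨x, hx⟩).trans ?_
      exact (apply_labelSetEquiv (φ ∘ e.symm) h' ⟨x, hx'⟩).symm
  · have h' : ¬ Function.Injective (φ ∘ e.symm) := fun h' => h (by
      have := h'.comp e.injective
      rwa [Function.comp_assoc, Equiv.symm_comp_self] at this)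
    rw [genOp_of_not_injective n h, genOp_of_not_injective n h']

variable (M)

/-- The families of creation operators of the elements of `M(A)`. -/
def genCreate (A : Type) [Finite A] : M.on A ⟶ fockFam (labelFam M) A where
  f n := ModuleCat.ofHom
    { toFun := fun m => fockMk (fun φ => genOp M n φ (Tot.of _ n m)) (fun φ => fockAlg_genOp n φ m)
      map_add' := fun m m' => fockAt_ext fun φ =>
        (congrArg (genOp M n φ) (map_add (Tot.of _ n) m m')).trans (map_add _ _ _)
      map_smul' := fun r m => fockAt_ext fun φ =>
        (congrArg (genOp M n φ) (map_smul (Tot.of _ n) r m)).trans (map_smul _ _ _) }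
  comm' n m hnm := by
    obtain rfl : n + 1 = m := hnm
    refine ModuleCat.hom_ext (LinearMap.ext fun x => fockAt_ext fun φ => ?_)
    exact (fockAt_d rfl _ φ).trans (fockDiff_genOp n φ x)

lemma genCreate_along {A B : Type} [Finite A] [Finite B] (e : A ≃ B) :
    M.along e ≫ genCreate M A = genCreate M B ≫ fockAlong e.symm := by
  ext n m
  refine fockAt_ext fun φ => ?_
  change genOp M n φ (Tot.of _ n (((M.along e).f n).hom m)) = genOp M n (φ ∘ e.symm) (Tot.of _ n m)
  rw [← Species.act_of, genOp_act]

end FockGen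

section FockGenConn

variable (M : ConnSpecies k)

/-- The generator that corresponds to an element of `M(A)`: a creation operator if `A` has several
elements, and a multiple of the unit if `A` has only one. -/
def fockGenApp (A : Type) [Finite A] : M.toSpecies.on A ⟶ fockFam (labelFam M.toSpecies) A :=
  open Classical in
  if h : Nonempty (Unique A) then (@ConnSpecies.point k _ M A _ h.some).inv ≫ fockUnit _ A
  else genCreate M.toSpecies A

lemma fockGenApp_unique (A : Type) [Finite A] [inst : Unique A] :
    fockGenApp M A = (M.point A).inv ≫ fockUnit _ A := by
  have h : Nonempty (Unique A) := ⟨inst⟩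
  rw [fockGenApp, dif_pos h, Subsingleton.elim h.some inst]

lemma fockGenApp_of_not (A : Type) [Finite A] (h : ¬ Nonempty (Unique A)) :
    fockGenApp M A = genCreate M.toSpecies A := dif_neg h

/-- The generators of the operad of families of operators. -/
def fockGen : M.toSpecies ⟶ (fockOperad (labelFam M.toSpecies)).toSpecies where
  app A := @fockGenApp k _ M A.unop.carrier _
  naturality B A e := by
    obtain ⟨⟨A⟩⟩ := A
    obtain ⟨⟨B⟩⟩ := B
    let f : A ≃ B := e.unop
    change M.toSpecies.along f ≫ fockGenApp M A = fockGenApp M B ≫ fockAlong f.symm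
    by_cases h : Nonempty (Unique A)
    · obtain ⟨_⟩ := h
      let _ : Unique B := f.symm.unique
      have h1 : M.toSpecies.along f ≫ (M.point A).inv = (M.point B).inv := by
        rw [Iso.comp_inv_eq, ← M.point_along A B f, Iso.inv_hom_id_assoc]
      have h2 : fockUnit (labelFam M.toSpecies) A = fockUnit _ B ≫ fockAlong f.symm :=
        ((fockOperad (labelFam M.toSpecies)).unit_along A B f).symm
      rw [fockGenApp_unique, fockGenApp_unique, Category.assoc, ← h2, ← Category.assoc, h1]
    · have h' : ¬ Nonempty (Unique B) := fun ⟨_⟩ => h ⟨f.unique⟩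
      rw [fockGenApp_of_not M A h, fockGenApp_of_not M B h', genCreate_along]

lemma point_fockGen (A : Type) [Finite A] [Unique A] :
    (M.point A).hom ≫ Species.app (fockGen M) A = (fockOperad _).unit A := by
  refine (congrArg (fun g => (M.point A).hom ≫ g) (fockGenApp_unique M A)).trans ?_
  exact Iso.hom_inv_id_assoc _ _

end FockGenConn

/-! ### Pairs of elements generated by pairs of generators -/

section Unit

lemma tot_unit_eq_smul {Z : DGVS k} (e : 𝟙_ (DGVS k) ≅ Z) (n : ℤ) (z : Z.X n) :
    ∃ c : k, (n ≠ 0 → c = 0) ∧ Tot.of Z n z = c • Tot.elt e.hom := by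
  have hz : z = (e.hom.f n).hom ((e.inv.f n).hom z) := by
    have := congrArg (fun g : Z ⟶ Z => (g.f n).hom z) e.inv_hom_id
    exact this.symm
  by_cases hn : n = 0
  · subst hn
    let i := HomologicalComplex.singleObjXSelf (ComplexShape.up ℤ) 0 (𝟙_ (ModuleCat.{u} k))
    have h1 : (e.inv.f 0).hom z = i.inv.hom (i.hom.hom ((e.inv.f 0).hom z)) := by
      have := congrArg (fun g => g.hom ((e.inv.f 0).hom z)) i.hom_inv_id
      exact this.symm
    rw [h1] at hz
    generalize i.hom.hom ((e.inv.f 0).hom z) = c at hz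
    refine ⟨c, fun h => (h rfl).elim, ?_⟩
    have h2 := map_smul (i.inv ≫ e.hom.f 0).hom c (1 : k)
    rw [smul_eq_mul, mul_one] at h2
    rw [Tot.elt, ← map_smul, hz]
    exact congrArg (Tot.of Z 0) h2
  · refine ⟨0, fun _ => rfl, ?_⟩
    have h0 : (e.inv.f n).hom z = 0 := by
      have := HomologicalComplex.isZero_single_obj_X (ComplexShape.up ℤ) 0 (𝟙_ (ModuleCat.{u} k)) n hn
      have := ModuleCat.subsingleton_of_isZero this
      exact this.elim _ _
    rw [hz, h0, map_zero, map_zero, zero_smul]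

lemma tot_eq_zero {Z : DGVS k} (hZ : IsZero Z) (z : Tot Z) : z = 0 := by
  have : Tot.map (𝟙 Z) z = Tot.map (0 : Z ⟶ Z) z := by rw [hZ.eq_of_src (𝟙 Z) 0]
  rw [Tot.map_id, LinearMap.id_apply] at this
  rw [this]
  have h0 : Tot.map (0 : Z ⟶ Z) = 0 := Tot.hom_ext fun i x => by
    rw [Tot.map_of]
    exact map_zero _
  rw [h0, LinearMap.zero_apply]

end Unit

section Rel

variable {M : ConnSpecies k} {Q Q' : Operad k} (f : M.toSpecies ⟶ Q.toSpecies)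
  (f' : M.toSpecies ⟶ Q'.toSpecies)

/-- The pairs of elements of degree `n` of `Q(A)` and `Q'(A)` that are obtained by the same
operations from the values of `f` and of `f'`. -/
inductive Rel : ∀ (A : Type) [Finite A], ℤ → Tot (Q.toSpecies.on A) → Tot (Q'.toSpecies.on A) → Prop
  | of (A : Type) [Finite A] (n : ℤ) (m : (M.toSpecies.on A).X n) :
    Rel A n (Tot.map (Species.app f A) (Tot.of _ n m)) (Tot.map (Species.app f' A) (Tot.of _ n m))
  | act {A B : Type} [Finite A] [Finite B] (e : A ≃ B) {n : ℤ} {x : Tot (Q.toSpecies.on B)}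
      {x' : Tot (Q'.toSpecies.on B)} (h : Rel B n x x') :
    Rel A n (Q.toSpecies.act e x) (Q'.toSpecies.act e x')
  | comp {A B : Type} [Finite A] [Finite B] (i : A) {p q : ℤ} {a : Tot (Q.toSpecies.on A)}
      {a' : Tot (Q'.toSpecies.on A)} {b : Tot (Q.toSpecies.on B)} {b' : Tot (Q'.toSpecies.on B)}
      (ha : Rel A p a a') (hb : Rel B q b b') :
    Rel (Insert i B) (p + q) (Q.circ i a b) (Q'.circ i a' b')
  | zero (A : Type) [Finite A] (n : ℤ) : Rel A n 0 0
  | add {A : Type} [Finite A] {n : ℤ} {x y : Tot (Q.toSpecies.on A)}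
      {x' y' : Tot (Q'.toSpecies.on A)} (h : Rel A n x x') (h' : Rel A n y y') :
    Rel A n (x + y) (x' + y')
  | smul {A : Type} [Finite A] {n : ℤ} (r : k) {x : Tot (Q.toSpecies.on A)}
      {x' : Tot (Q'.toSpecies.on A)} (h : Rel A n x x') : Rel A n (r • x) (r • x')

variable {f f'}

lemma Rel.swap {A : Type} [Finite A] {n : ℤ} {x : Tot (Q.toSpecies.on A)}
    {x' : Tot (Q'.toSpecies.on A)} (h : Rel f f' A n x x') : Rel f' f A n x' x := by
  induction h with
  | of A n m => exact .of A n m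
  | act e _ ih => exact .act e ih
  | comp i _ _ ih ih' => exact .comp i ih ih'
  | zero A n => exact .zero A n
  | add _ _ ih ih' => exact .add ih ih'
  | smul r _ ih => exact .smul r ih

variable (f') in
lemma Rel.exists {A : Type} [Finite A] {n : ℤ} {x y : Tot (Q.toSpecies.on A)}
    (h : Rel f f A n x y) : ∃ x', Rel f f' A n x x' := by
  induction h with
  | of A n m => exact ⟨_, .of A n m⟩
  | act e _ ih => exact ⟨_, .act e ih.choose_spec⟩
  | comp i _ _ ih ih' => exact ⟨_, .comp i ih.choose_spec ih'.choose_spec⟩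
  | zero A n => exact ⟨_, .zero A n⟩
  | add _ _ ih ih' => exact ⟨_, .add ih.choose_spec ih'.choose_spec⟩
  | smul r _ ih => exact ⟨_, .smul r ih.choose_spec⟩

lemma Rel.homog {A : Type} [Finite A] {n : ℤ} {x : Tot (Q.toSpecies.on A)}
    {x' : Tot (Q'.toSpecies.on A)} (h : Rel f f' A n x x') : ∃ y, x = Tot.of _ n y := by
  induction h with
  | of A n m => exact ⟨_, Tot.map_of _ _ _⟩
  | act e _ ih =>
    obtain ⟨y, rfl⟩ := ih
    exact ⟨_, Species.act_of _ _ _ _⟩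
  | comp i _ _ ih ih' =>
    obtain ⟨y, rfl⟩ := ih
    obtain ⟨z, rfl⟩ := ih'
    exact ⟨_, Tot.bil_of _ _ _ _ _⟩
  | zero A n => exact ⟨0, (map_zero _).symm⟩
  | add _ _ ih ih' =>
    obtain ⟨y, rfl⟩ := ih
    obtain ⟨z, rfl⟩ := ih'
    exact ⟨_, (map_add _ _ _).symm⟩
  | smul r _ ih =>
    obtain ⟨y, rfl⟩ := ih
    exact ⟨_, (map_smul _ _ _).symm⟩

lemma Tot.d_map {Z W : DGVS k} (g : Z ⟶ W) (x : Tot Z) :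
    Tot.d W (Tot.map g x) = Tot.map g (Tot.d Z x) := (LinearMap.congr_fun (Tot.map_d g) x).symm

lemma Rel.d {A : Type} [Finite A] {n : ℤ} {x : Tot (Q.toSpecies.on A)}
    {x' : Tot (Q'.toSpecies.on A)} (h : Rel f f' A n x x') :
    Rel f f' A (n + 1) (Tot.d _ x) (Tot.d _ x') := by
  induction h with
  | of A n m =>
    rw [Tot.d_map, Tot.d_map, Tot.d_of]
    exact .of A (n + 1) _
  | act e _ ih => rw [Species.d_act, Species.d_act]; exact .act e ih
  | @comp A B _ _ i p q a a' b b' ha hb ih ih' =>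
    rw [Operad.circ, Operad.circ, Tot.d_bil, Tot.d_bil]
    refine .add ?_ ?_
    · rw [add_right_comm]; exact .comp i ih hb
    · obtain ⟨y, rfl⟩ := ha.homog
      obtain ⟨y', rfl⟩ := ha.swap.homog
      rw [Tot.parity_of, Tot.parity_of, negOnePow_smul (k := k), negOnePow_smul (k := k), add_assoc]
      exact .comp i (.smul _ ha) ih'
  | zero A n => rw [map_zero, map_zero]; exact .zero A _
  | add _ _ ih ih' => rw [map_add, map_add]; exact .add ih ih'
  | smul r _ ih => rw [map_smul, map_smul]; exact .smul r ih

/-- A morphism of species that sends the unit of `M` to the unit of `Q`. -/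
def PreservesUnit {M : ConnSpecies k} {Q : Operad k} (f : M.toSpecies ⟶ Q.toSpecies) : Prop :=
  ∀ (A : Type) [Finite A] [Unique A], (M.point A).hom ≫ Species.app f A = Q.unit A

variable (hf : PreservesUnit f) (hf' : PreservesUnit f')

lemma Operad.act_unit (Q : Operad k) {A B : Type} [Finite A] [Finite B] [Unique A] [Unique B]
    (e : A ≃ B) : Q.toSpecies.act e (Tot.elt (Q.unit B)) = Tot.elt (Q.unit A) := by
  rw [Species.act, ← elt_comp, Q.unit_along]

lemma Rel.of_isEmpty {A : Type} [Finite A] {n : ℤ} {x : Tot (Q.toSpecies.on A)}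
    {x' : Tot (Q'.toSpecies.on A)} (h : Rel f f' A n x x') (hA : IsEmpty A) : x = 0 := by
  induction h with
  | of A n m => rw [tot_eq_zero (M.isZero_empty A) (Tot.of _ n m), map_zero]
  | act e _ ih => rw [ih e.symm.isEmpty, map_zero]
  | comp i _ _ ih ih' =>
    rw [isEmpty_sum] at hA
    rw [ih' hA.2, map_zero]
  | zero A n => rfl
  | add _ _ ih ih' => rw [ih hA, ih' hA, add_zero]
  | smul r _ ih => rw [ih hA, smul_zero]

include hf hf' in
/-- In arity one, generated pairs are multiples of the pair of units, by the same scalar. -/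
lemma Rel.of_unique {A : Type} [Finite A] {n : ℤ} {x : Tot (Q.toSpecies.on A)}
    {x' : Tot (Q'.toSpecies.on A)} (h : Rel f f' A n x x') (hA : Unique A) :
    ∃ c : k, (n ≠ 0 → c = 0) ∧ x = c • Tot.elt (Q.unit A) ∧ x' = c • Tot.elt (Q'.unit A) := by
  induction h with
  | of A n m =>
    obtain ⟨c, hc, hm⟩ := tot_unit_eq_smul (M.point A) n m
    refine ⟨c, hc, ?_, ?_⟩
    · rw [hm, map_smul, ← elt_comp, hf]
    · rw [hm, map_smul, ← elt_comp, hf']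
  | @act A B _ _ e _ _ _ _ ih =>
    let _ : Unique B := e.symm.unique
    obtain ⟨c, hc, hx, hx'⟩ := ih inferInstance
    exact ⟨c, hc, by rw [hx, map_smul, Operad.act_unit], by rw [hx', map_smul, Operad.act_unit]⟩
  | @comp A B _ _ i p q a a' b b' ha hb ih ih' =>
    rcases isEmpty_or_nonempty B with hB | ⟨⟨b₀⟩⟩
    · refine ⟨0, fun _ => rfl, ?_, ?_⟩
      · rw [hb.of_isEmpty hB, map_zero, zero_smul]
      · rw [hb.swap.of_isEmpty hB, map_zero, zero_smul]
    · let _ : Unique B := ⟨⟨b₀⟩, fun b => Sum.inr_injective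
        ((hA.eq_default (Sum.inr b)).trans (hA.eq_default (Sum.inr b₀)).symm)⟩
      let _ : Unique A := ⟨⟨i⟩, fun a => by
        by_contra h
        exact Sum.inl_ne_inr ((hA.eq_default (Sum.inl ⟨a, h⟩)).trans
          (hA.eq_default (Sum.inr b₀)).symm)⟩
      obtain ⟨c, hc, rfl, rfl⟩ := ih inferInstance
      obtain ⟨d, hd, rfl, rfl⟩ := ih' inferInstance
      have key : ∀ Q : Operad k, Q.circ i (c • Tot.elt (Q.unit A)) (d • Tot.elt (Q.unit B)) =
          (c * d) • Tot.elt (Q.unit (Insert i B)) := fun Q => by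
        rw [map_smul, map_smul, LinearMap.smul_apply, Operad.circ, Q.comp_unit, smul_smul, mul_comm d]
        exact congrArg _ (Q.act_unit _)
      refine ⟨c * d, fun h => ?_, key Q, key Q'⟩
      by_cases hp : p = 0
      · rw [hd (fun hq => h (by rw [hp, hq, add_zero])), mul_zero]
      · rw [hc hp, zero_mul]
  | zero A n => exact ⟨0, fun _ => rfl, by rw [zero_smul], by rw [zero_smul]⟩
  | add _ _ ih ih' =>
    obtain ⟨c, hc, rfl, rfl⟩ := ih hA
    obtain ⟨d, hd, rfl, rfl⟩ := ih' hA
    exact ⟨c + d, fun h => by rw [hc h, hd h, add_zero], (add_smul _ _ _).symm,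
      (add_smul _ _ _).symm⟩
  | smul r _ ih =>
    obtain ⟨c, hc, rfl, rfl⟩ := ih hA
    exact ⟨r * c, fun h => by rw [hc h, mul_zero], (mul_smul _ _ _).symm, (mul_smul _ _ _).symm⟩

variable (f f') in
/-- The pairs that are linear combinations of pairs of generators and of pairs of compositions of
elements of arity at least two. -/
inductive TopRel (A : Type) [Finite A] (n : ℤ) :
    Tot (Q.toSpecies.on A) → Tot (Q'.toSpecies.on A) → Prop
  | of (m : (M.toSpecies.on A).X n) : TopRel A n (Tot.map (Species.app f A) (Tot.of _ n m))
      (Tot.map (Species.app f' A) (Tot.of _ n m))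
  | comp {B C : Type} [Finite B] [Finite C] [Nontrivial B] [Nontrivial C] (i : B)
      (e : A ≃ Insert i C) {p q : ℤ} (hn : p + q = n) {b : Tot (Q.toSpecies.on B)}
      {b' : Tot (Q'.toSpecies.on B)} {c : Tot (Q.toSpecies.on C)} {c' : Tot (Q'.toSpecies.on C)}
      (hb : Rel f f' B p b b') (hc : Rel f f' C q c c') :
    TopRel A n (Q.toSpecies.act e (Q.circ i b c)) (Q'.toSpecies.act e (Q'.circ i b' c'))
  | zero : TopRel A n 0 0
  | add {x y : Tot (Q.toSpecies.on A)} {x' y' : Tot (Q'.toSpecies.on A)} (h : TopRel A n x x')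
      (h' : TopRel A n y y') : TopRel A n (x + y) (x' + y')
  | smul (r : k) {x : Tot (Q.toSpecies.on A)} {x' : Tot (Q'.toSpecies.on A)}
      (h : TopRel A n x x') : TopRel A n (r • x) (r • x')

lemma TopRel.act {A B : Type} [Finite A] [Finite B] (e : A ≃ B) {n : ℤ}
    {x : Tot (Q.toSpecies.on B)} {x' : Tot (Q'.toSpecies.on B)} (h : TopRel f f' B n x x') :
    TopRel f f' A n (Q.toSpecies.act e x) (Q'.toSpecies.act e x') := by
  induction h with
  | of m =>
    rw [← Species.map_act, ← Species.map_act, Species.act_of]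
    exact .of _
  | comp i e' hn hb hc =>
    rw [Species.act_act, Species.act_act]
    exact .comp i (e.trans e') hn hb hc
  | zero => rw [map_zero, map_zero]; exact .zero
  | add _ _ ih ih' => rw [map_add, map_add]; exact .add ih ih'
  | smul r _ ih => rw [map_smul, map_smul]; exact .smul r ih

include hf hf' in
/-- In arity at least two, units and elements of arity zero are not needed as factors. -/
lemma Rel.top {A : Type} [Finite A] {n : ℤ} {x : Tot (Q.toSpecies.on A)}
    {x' : Tot (Q'.toSpecies.on A)} (h : Rel f f' A n x x') (hA : Nontrivial A) :
    TopRel f f' A n x x' := by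
  induction h with
  | of A n m => exact .of m
  | act e _ ih => exact (ih e.symm.nontrivial).act e
  | zero A n => exact .zero
  | add _ _ ih ih' => exact .add (ih hA) (ih' hA)
  | smul r _ ih => exact .smul r (ih hA)
  | @comp A B _ _ i p q a a' b b' ha hb ih ih' =>
    rcases subsingleton_or_nontrivial B with hB | hB
    · rcases isEmpty_or_nonempty B with hB' | ⟨⟨b₀⟩⟩
      · rw [hb.of_isEmpty hB', hb.swap.of_isEmpty hB', map_zero, map_zero]
        exact .zero
      · let _ : Unique B := ⟨⟨b₀⟩, fun b => hB.elim _ _⟩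
        obtain ⟨c, hc, rfl, rfl⟩ := hb.of_unique hf hf' inferInstance
        rw [map_smul, map_smul, Operad.circ, Operad.circ, Q.comp_unit, Q'.comp_unit]
        by_cases hq : q = 0
        · subst hq
          rw [add_zero]
          exact .smul c ((ih (Insert.rightUnit i B).symm.nontrivial).act _)
        · rw [hc hq, zero_smul, zero_smul]; exact .zero
    · rcases subsingleton_or_nontrivial A with hA' | hA'
      · let _ : Unique A := ⟨⟨i⟩, fun b => hA'.elim _ _⟩
        obtain ⟨c, hc, rfl, rfl⟩ := ha.of_unique hf hf' inferInstance
        rw [map_smul, map_smul, LinearMap.smul_apply, LinearMap.smul_apply, Operad.circ, Operad.circ]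
        have h1 := Q.unit_comp A B b
        have h2 := Q'.unit_comp A B b'
        change Tot.bil (Q.comp A B i) _ _ = _ at h1
        change Tot.bil (Q'.comp A B i) _ _ = _ at h2
        rw [h1, h2]
        by_cases hp : p = 0
        · subst hp
          rw [zero_add]
          exact .smul c ((ih' hB).act _)
        · rw [hc hp, zero_smul, zero_smul]; exact .zero
      · have := TopRel.comp (f := f) (f' := f') i (Equiv.refl _) rfl ha hb
        rwa [Species.act_refl, Species.act_refl] at this

end Rel

/-! ### Subcomplexes -/

section Subcomplex

variable {Z : DGVS k} (S : ∀ n, Submodule k (Z.X n))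
  (hS : ∀ n, ∀ x ∈ S n, (Z.d n (n + 1)).hom x ∈ S (n + 1))

include hS in
lemma subcomplex_d_mem (n m : ℤ) (x : Z.X n) (hx : x ∈ S n) : (Z.d n m).hom x ∈ S m := by
  by_cases h : n + 1 = m
  · subst h; exact hS n x hx
  · rw [Z.shape n m h]; exact zero_mem _

/-- The subcomplex with the components `S n`. -/
def subcomplex : DGVS k where
  X n := ModuleCat.of k (S n)
  d n m := ModuleCat.ofHom ((Z.d n m).hom.restrict (subcomplex_d_mem S hS n m))
  shape n m h := by
    refine ModuleCat.hom_ext (LinearMap.ext fun x => Subtype.ext ?_)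
    change (Z.d n m).hom x.1 = 0
    rw [Z.shape n m h]
    rfl
  d_comp_d' n m l _ _ := by
    refine ModuleCat.hom_ext (LinearMap.ext fun x => Subtype.ext ?_)
    exact congrArg (fun g => g.hom x.1) (Z.d_comp_d n m l)

/-- The inclusion of a subcomplex. -/
def subcomplexι : subcomplex S hS ⟶ Z where
  f n := ModuleCat.ofHom (S n).subtype
  comm' _ _ _ := rfl

variable {S hS}

lemma subcomplexι_injective (n : ℤ) : Function.Injective ((subcomplexι S hS).f n).hom :=
  Subtype.val_injective

instance : Mono (subcomplexι S hS) := by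
  refine ⟨fun f g h => ?_⟩
  ext n x
  exact subcomplexι_injective n (congrArg (fun φ : _ ⟶ Z => (φ.f n).hom x) h)

variable {W : DGVS k} (g : W ⟶ Z) (hg : ∀ n x, (g.f n).hom x ∈ S n)

variable (hS) in
/-- The factorization of a morphism through a subcomplex. -/
def subcomplexLift : W ⟶ subcomplex S hS where
  f n := ModuleCat.ofHom ((g.f n).hom.codRestrict (S n) (hg n))
  comm' n m _ := by
    refine ModuleCat.hom_ext (LinearMap.ext fun x => Subtype.ext ?_)
    exact congrArg (fun φ => φ.hom x) (g.comm n m)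

lemma Tot.map_injective {Y Z : DGVS k} (f : Y ⟶ Z) (hf : ∀ n, Function.Injective (f.f n).hom) :
    Function.Injective (Tot.map f) := by
  have key : ∀ n, DirectSum.component k ℤ (fun i => (Z.X i : Type u)) n ∘ₗ Tot.map f =
      (f.f n).hom ∘ₗ DirectSum.component k ℤ (fun i => (Y.X i : Type u)) n := fun n => by
    refine Tot.hom_ext fun m x => ?_
    rw [LinearMap.comp_apply, LinearMap.comp_apply, Tot.map_of, Tot.of, Tot.of]
    by_cases h : m = n
    · subst h
      rw [DirectSum.component.lof_self, DirectSum.component.lof_self]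
    · rw [DirectSum.component.of, DirectSum.component.of, dif_neg h, dif_neg h, map_zero]
  intro y y' h
  refine DFinsupp.ext fun n => hf n ?_
  exact (LinearMap.congr_fun (key n) y).symm.trans
    ((congrArg (DirectSum.component k ℤ (fun i => (Z.X i : Type u)) n) h).trans
      (LinearMap.congr_fun (key n) y'))

lemma isIso_of_bijective {Y Z : DGVS k} (f : Y ⟶ Z) (hf : ∀ n, Function.Bijective (f.f n).hom) :
    IsIso f := by
  have : ∀ n, IsIso (f.f n) := fun n => (ConcreteCategory.isIso_iff_bijective (f.f n)).2 (hf n)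
  exact HomologicalComplex.Hom.isIso_of_components f

end Subcomplex

/-! ### The suboperad generated by a species -/

section GenOperad

variable {M : ConnSpecies k} {Q : Operad k} (f : M.toSpecies ⟶ Q.toSpecies)

/-- The homogeneous elements of `Q(A)` that are generated by the values of `f`. -/
def genSub (A : Type) [Finite A] (n : ℤ) : Submodule k ((Q.toSpecies.on A).X n) where
  carrier := {x | Rel f f A n (Tot.of _ n x) (Tot.of _ n x)}
  zero_mem' := by
    change Rel f f A n (Tot.of _ n 0) (Tot.of _ n 0)
    rw [map_zero]; exact .zero A n
  add_mem' {x y} hx hy := by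
    change Rel f f A n (Tot.of _ n (x + y)) (Tot.of _ n (x + y))
    rw [map_add]; exact .add hx hy
  smul_mem' r x hx := by
    change Rel f f A n (Tot.of _ n (r • x)) (Tot.of _ n (r • x))
    rw [map_smul]; exact .smul r hx

variable {f} in
lemma mem_genSub {A : Type} [Finite A] {n : ℤ} {x : (Q.toSpecies.on A).X n} :
    x ∈ genSub f A n ↔ Rel f f A n (Tot.of _ n x) (Tot.of _ n x) := Iff.rfl

lemma genSub_d (A : Type) [Finite A] (n : ℤ) (x : (Q.toSpecies.on A).X n) (hx : x ∈ genSub f A n) :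
    ((Q.toSpecies.on A).d n (n + 1)).hom x ∈ genSub f A (n + 1) := by
  rw [mem_genSub, ← Tot.d_of]
  exact Rel.d hx

/-- The complex of the elements of `Q(A)` that are generated by the values of `f`. -/
def genOn (A : Type) [Finite A] : DGVS k := subcomplex (genSub f A) (genSub_d f A)

/-- The inclusion of the generated elements. -/
def genOnι (A : Type) [Finite A] : genOn f A ⟶ Q.toSpecies.on A :=
  subcomplexι (genSub f A) (genSub_d f A)

instance (A : Type) [Finite A] : Mono (genOnι f A) := inferInstanceAs (Mono (subcomplexι _ _))

lemma genOnι_injective (A : Type) [Finite A] : Function.Injective (Tot.map (genOnι f A)) :=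
  Tot.map_injective _ subcomplexι_injective

lemma rel_genOnι {A : Type} [Finite A] (n : ℤ) (x : (genOn f A).X n) :
    Rel f f A n (Tot.of _ n (((genOnι f A).f n).hom x)) (Tot.of _ n (((genOnι f A).f n).hom x)) := x.2

/-- The action of a bijection on the generated elements. -/
def genAlong {A B : Type} [Finite A] [Finite B] (e : A ≃ B) : genOn f B ⟶ genOn f A :=
  subcomplexLift (genSub_d f A) (genOnι f B ≫ Q.toSpecies.along e) fun n x => by
    have := Rel.act e (rel_genOnι f n x)
    rw [Species.act_of] at this
    exact this

lemma genAlong_ι {A B : Type} [Finite A] [Finite B] (e : A ≃ B) :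
    genAlong f e ≫ genOnι f A = genOnι f B ≫ Q.toSpecies.along e := rfl

/-- The species of the generated elements. -/
def genSpecies : Species k where
  obj A := genOn f A.unop.carrier
  map e := genAlong f e.unop
  map_id A := by
    rw [← cancel_mono (genOnι f A.unop.carrier)]
    refine (genAlong_ι f _).trans ?_
    refine (congrArg (fun g => genOnι f A.unop.carrier ≫ g) (Q.toSpecies.map_id A)).trans ?_
    rw [Category.comp_id, Category.id_comp]
  map_comp {A B C} e e' := by
    rw [← cancel_mono (genOnι f C.unop.carrier)]
    refine (genAlong_ι f _).trans ?_
    refine (congrArg (fun g => genOnι f A.unop.carrier ≫ g) (Q.toSpecies.map_comp e e')).trans ?_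
    rw [Category.assoc]
    refine Eq.trans ?_ (congrArg (genAlong f e.unop ≫ ·) (genAlong_ι f e'.unop)).symm
    rw [← Category.assoc, ← Category.assoc]
    rfl

/-- The inclusion of the species of the generated elements. -/
def genSpeciesι : genSpecies f ⟶ Q.toSpecies where
  app A := genOnι f A.unop.carrier
  naturality _ _ _ := rfl

lemma pairing_mem (A B : Type) [Finite A] [Finite B] (i : A) (p q n : ℤ) (h : p + q = n)
    (x : (genOn f A).X p) (y : (genOn f B).X q) :
    pairing ((genOnι f A ⊗ₘ genOnι f B) ≫ Q.comp A B i) p q n h x y ∈ genSub f (Insert i B) n := by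
  subst h
  rw [mem_genSub, of_pairing, Tot.bil_tensorHom, Tot.map_of, Tot.map_of]
  exact .comp i (rel_genOnι f p x) (rel_genOnι f q y)

/-- The partial composition of generated elements, on components. -/
def genMul {A B : Type} [Finite A] [Finite B] (i : A) (p q n : ℤ) (h : p + q = n) :
    (genOn f A).X p →ₗ[k] (genOn f B).X q →ₗ[k] (genOn f (Insert i B)).X n :=
  LinearMap.mk₂ k
      (fun x y => (⟨pairing ((genOnι f A ⊗ₘ genOnι f B) ≫ Q.comp A B i) p q n h x y,
        pairing_mem f A B i p q n h x y⟩ : genSub f (Insert i B) n))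
      (fun _ _ _ => Subtype.ext (LinearMap.map_add₂ _ _ _ _))
      (fun _ _ _ => Subtype.ext (LinearMap.map_smul₂ _ _ _ _))
      (fun _ _ _ => Subtype.ext (map_add _ _ _))
      (fun _ _ _ => Subtype.ext (map_smul _ _ _))

/-- The partial composition of generated elements. -/
def genComp (A B : Type) [Finite A] [Finite B] (i : A) :
    genOn f A ⊗ genOn f B ⟶ genOn f (Insert i B) :=
  tensorDesc (genMul f i) (by
    intro p q n n' h h' x y
    rw [negOnePow_smul (k := k)]
    refine Subtype.ext ?_
    have := pairing_d ((genOnι f A ⊗ₘ genOnι f B) ≫ Q.comp A B i) p q n n' h h' x y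
    rw [negOnePow_smul (k := k)] at this
    exact this)

lemma genComp_ι (A B : Type) [Finite A] [Finite B] (i : A) :
    genComp f A B i ≫ genOnι f (Insert i B) = (genOnι f A ⊗ₘ genOnι f B) ≫ Q.comp A B i := by
  refine tensor_hom_ext fun p x q y => ?_
  rw [Tot.bil_comp, genComp, bil_tensorDesc, Tot.map_of, ← of_pairing _ p q _ rfl]
  rfl

lemma bil_genComp {A B : Type} [Finite A] [Finite B] (i : A) (x : Tot (genOn f A))
    (y : Tot (genOn f B)) : Tot.map (genOnι f (Insert i B)) (Tot.bil (genComp f A B i) x y) =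
      Q.circ i (Tot.map (genOnι f A) x) (Tot.map (genOnι f B) y) := by
  rw [← Tot.bil_comp, genComp_ι, Tot.bil_tensorHom]

variable (hf : PreservesUnit f)

/-- The values of `f` are generated elements. -/
def genApp (A : Type) [Finite A] : M.toSpecies.on A ⟶ genOn f A :=
  subcomplexLift (genSub_d f A) (Species.app f A) fun n x => by
    have := Rel.of (f := f) (f' := f) A n x
    rw [Tot.map_of] at this
    exact this

lemma genApp_ι (A : Type) [Finite A] : genApp f A ≫ genOnι f A = Species.app f A := rfl

/-- The unit of `Q` is a generated element. -/
def genUnit (A : Type) [Finite A] [Unique A] : 𝟙_ (DGVS k) ⟶ genOn f A :=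
  (M.point A).hom ≫ genApp f A

include hf in
lemma genUnit_ι (A : Type) [Finite A] [Unique A] : genUnit f A ≫ genOnι f A = Q.unit A := by
  rw [genUnit, Category.assoc, genApp_ι, hf]

include hf in
lemma map_elt_genUnit (A : Type) [Finite A] [Unique A] :
    Tot.map (genOnι f A) (Tot.elt (genUnit f A)) = Tot.elt (Q.unit A) := by
  rw [← elt_comp, genUnit_ι f hf]

lemma map_genAlong {A B : Type} [Finite A] [Finite B] (e : A ≃ B) (x : Tot (genOn f B)) :
    Tot.map (genOnι f A) (Tot.map (genAlong f e) x) =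
      Q.toSpecies.act e (Tot.map (genOnι f B) x) := by
  have := LinearMap.congr_fun (congrArg Tot.map (genAlong_ι f e)) x
  rwa [Tot.map_comp, Tot.map_comp] at this

include hf in
lemma bijective_genUnit (hQ : ∀ (A : Type) [Finite A] [Unique A], Mono (Q.unit A)) (A : Type)
    [Finite A] [Unique A] (n : ℤ) : Function.Bijective ((genUnit f A).f n).hom := by
  have hinj : Function.Injective ((Q.unit A).f n).hom := by
    have := hQ A
    exact (ModuleCat.mono_iff_injective _).1 inferInstance
  rw [← genUnit_ι f hf] at hinj
  refine ⟨fun x y h => hinj (congrArg ((genOnι f A).f n).hom h), fun z => ?_⟩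
  obtain ⟨c, hc, hz, -⟩ := (rel_genOnι f n z).of_unique hf hf inferInstance
  have hz' : Tot.of _ n z = c • Tot.elt (genUnit f A) := by
    refine genOnι_injective f A ?_
    rw [Tot.map_of, map_smul, map_elt_genUnit f hf, hz]
  by_cases hn : n = 0
  · subst hn
    rw [Tot.elt, ← map_smul] at hz'
    have := Tot.of_injective _ _ hz'
    rw [this]
    exact ⟨c • _, map_smul _ _ _⟩
  · rw [hc hn, zero_smul, ← map_zero (Tot.of (genOn f A) n)] at hz'
    rw [Tot.of_injective _ _ hz']
    exact ⟨0, map_zero _⟩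

section Axioms

lemma genComp_along {A A' B B' : Type} [Finite A] [Finite A'] [Finite B] [Finite B'] (e : A ≃ A')
    (e' : B ≃ B') (i : A) : (genAlong f e ⊗ₘ genAlong f e') ≫ genComp f A B i =
      genComp f A' B' (e i) ≫ genAlong f (Insert.congr e e' i) := by
  refine tensor_hom_ext fun p x q y => genOnι_injective f _ ?_
  rw [Tot.bil_tensorHom, Tot.bil_comp, bil_genComp, map_genAlong, map_genAlong, map_genAlong,
    bil_genComp]
  exact Q.circ_act e e' i (e i) rfl _ _

include hf in
lemma genUnit_along {A B : Type} [Finite A] [Finite B] [Unique A] [Unique B] (e : A ≃ B) :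
    genUnit f B ≫ genAlong f e = genUnit f A := by
  rw [← cancel_mono (genOnι f A), genUnit_ι f hf, Category.assoc, genAlong_ι, ← Category.assoc,
    genUnit_ι f hf, Q.unit_along]

variable {A B C : Type} [Finite A] [Finite B] [Finite C]

lemma genComp_nested (i : A) (j : B) (a : Tot (genOn f A)) (b : Tot (genOn f B))
    (c : Tot (genOn f C)) :
    Tot.bil (genComp f _ C (Sum.inr j)) (Tot.bil (genComp f A B i) a b) c =
      Tot.map (genAlong f (Insert.nested i j))
        (Tot.bil (genComp f A _ i) a (Tot.bil (genComp f B C j) b c)) := by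
  refine genOnι_injective f _ ?_
  rw [map_genAlong, bil_genComp, bil_genComp, bil_genComp, bil_genComp]
  exact Q.assoc_nested A B C i j _ _ _

lemma genComp_parallel (i j : A) (hij : i ≠ j) (a : Tot (genOn f A)) (p q : ℤ)
    (b : (genOn f B).X p) (c : (genOn f C).X q) :
    Tot.bil (genComp f _ C (Sum.inl ⟨j, hij.symm⟩))
        (Tot.bil (genComp f A B i) a (Tot.of _ p b)) (Tot.of _ q c) =
      (p * q).negOnePow • Tot.map (genAlong f (Insert.parallel i j hij))
        (Tot.bil (genComp f _ B (Sum.inl ⟨i, hij⟩))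
          (Tot.bil (genComp f A C j) a (Tot.of _ q c)) (Tot.of _ p b)) := by
  refine genOnι_injective f _ ?_
  rw [map_negOnePow_smul, map_genAlong, bil_genComp, bil_genComp, bil_genComp, bil_genComp,
    Tot.map_of, Tot.map_of]
  exact Q.assoc_parallel A B C i j hij _ p q _ _

include hf in
lemma genComp_unit [Unique B] (i : A) (a : Tot (genOn f A)) :
    Tot.bil (genComp f A B i) a (Tot.elt (genUnit f B)) =
      Tot.map (genAlong f (Insert.rightUnit i B)) a := by
  refine genOnι_injective f _ ?_
  rw [map_genAlong, bil_genComp, map_elt_genUnit f hf]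
  exact Q.comp_unit A B i _

include hf in
lemma genUnit_comp [Unique A] (b : Tot (genOn f B)) :
    Tot.bil (genComp f A B default) (Tot.elt (genUnit f A)) b =
      Tot.map (genAlong f (Insert.leftUnit A B)) b := by
  refine genOnι_injective f _ ?_
  rw [map_genAlong, bil_genComp, map_elt_genUnit f hf]
  exact Q.unit_comp A B _

lemma isZero_genOn [IsEmpty A] : IsZero (genOn f A) := by
  rw [IsZero.iff_id_eq_zero, ← cancel_mono (genOnι f A)]
  refine HomologicalComplex.hom_ext _ _ fun n => ModuleCat.hom_ext (LinearMap.ext fun x => ?_)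
  have := (rel_genOnι f n x).of_isEmpty inferInstance
  rw [← map_zero (Tot.of (Q.toSpecies.on A) n)] at this
  exact Tot.of_injective _ _ this

end Axioms

/-- The connected suboperad generated by a species. -/
def genOperad (hQ : ∀ (A : Type) [Finite A] [Unique A], Mono (Q.unit A)) : ConnOperad k where
  toSpecies := genSpecies f
  comp A B _ _ i := genComp f A B i
  unit A _ _ := genUnit f A
  comp_along _ _ _ _ _ _ _ _ e e' i := genComp_along f e e' i
  unit_along _ _ _ _ _ _ e := genUnit_along f hf e
  assoc_nested _ _ _ _ _ _ i j a b c := genComp_nested f i j a b c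
  assoc_parallel _ _ _ _ _ _ i j hij a p q b c := genComp_parallel f i j hij a p q b c
  comp_unit _ _ _ _ _ i a := genComp_unit f hf i a
  unit_comp _ _ _ _ _ b := genUnit_comp f hf b
  isZero_empty _ _ _ := isZero_genOn f
  isIso_unit A _ _ := isIso_of_bijective _ (bijective_genUnit f hf hQ A)

variable {f} (hQ : ∀ (A : Type) [Finite A] [Unique A], Mono (Q.unit A))

/-- A species maps to the connected operad that it generates. -/
def toGenOperad : M ⟶ (forgetOperad k).obj (genOperad f hf hQ) where
  hom :=
    { app := fun A => genApp f A.unop.carrier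
      naturality := fun A B e => by
        refine (cancel_mono (genOnι f B.unop.carrier)).1 ?_
        exact f.naturality e }
  point_comp A _ _ := rfl

/-- The inclusion of the connected operad that is generated in an operad preserves compositions. -/
lemma preservesComp_genSpeciesι : PreservesComp (P := (genOperad f hf hQ).toOperad) (Q := Q)
    (genSpeciesι f) := fun A B _ _ i => genComp_ι f A B i

end GenOperad

/-! ### Adding a vertex to a tree -/

namespace RTree

variable {I : Type}

instance [Finite I] : Finite (RTree I) :=
  Finite.of_injective RTree.verts fun _ _ h => RTree.ext h

lemma In_subset_or_eq {t : RTree I} {A D : Set I} [Finite I]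
    (hD : D ∈ t.verts ∨ ∃ i, D = {i}) (hDA : D ⊂ A) : ∃ E ∈ t.In A, D ⊆ E := by
  obtain ⟨E, hE⟩ := (Set.toFinite {E | (E ∈ t.verts ∨ ∃ i, E = {i}) ∧ D ⊆ E ∧ E ⊂ A}).exists_maximal
    ⟨D, hD, subset_rfl, hDA⟩
  refine ⟨E, ⟨hE.1.1, hE.1.2.2, fun C hC hEC hCA => ?_⟩, hE.1.2.1⟩
  exact hEC.not_subset (hE.2 ⟨Or.inl hC, hE.1.2.1.trans hEC.subset, hCA⟩ hEC.subset)

lemma nested_or {t : RTree I} {C D : Set I} (hC : C ∈ t.verts ∨ ∃ i, C = {i})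
    (hD : D ∈ t.verts ∨ ∃ i, D = {i}) : C ⊆ D ∨ D ⊆ C ∨ Disjoint C D := by
  rcases hC with hC | ⟨i, rfl⟩
  · rcases hD with hD | ⟨j, rfl⟩
    · exact t.nested C hC D hD
    · by_cases h : j ∈ C
      · exact Or.inr (Or.inl (Set.singleton_subset_iff.2 h))
      · exact Or.inr (Or.inr (Set.disjoint_singleton_right.2 h))
  · by_cases h : i ∈ D
    · exact Or.inl (Set.singleton_subset_iff.2 h)
    · exact Or.inr (Or.inr (Set.disjoint_singleton_left.2 h))

lemma In_disjoint {t : RTree I} {A C D : Set I} (hC : C ∈ t.In A) (hD : D ∈ t.In A)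
    (hne : C ≠ D) : Disjoint C D := by
  have aux : ∀ {C D : Set I}, C ∈ t.In A → D ∈ t.In A → C ≠ D → ¬ C ⊆ D := by
    intro C D hC hD hne h
    rcases hD.1 with hD' | ⟨i, rfl⟩
    · exact hC.2.2 D hD' (h.ssubset_of_ne hne) hD.2.1
    · rcases Set.subset_singleton_iff_eq.1 h with h' | h'
      · exact (Contracts.nonempty_of_mem_In hC).ne_empty h'
      · exact hne h'
  rcases nested_or hC.1 hD.1 with h | h | h
  · exact (aux hC hD hne h).elim
  · exact (aux hD hC hne.symm h).elim
  · exact h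

lemma nontrivial_In [Finite I] {t : RTree I} {A : Set I} (hA : A ∈ t.verts) : Nontrivial (t.In A) := by
  have hlt : ∀ i ∈ A, ({i} : Set I) ⊂ A := fun i hi =>
    (Set.singleton_subset_iff.2 hi).ssubset_of_ne fun h =>
      Set.not_nontrivial_singleton (h ▸ t.nontrivial A hA)
  obtain ⟨i, hi⟩ := (t.nontrivial A hA).nonempty
  obtain ⟨E, hE, -⟩ := In_subset_or_eq (t := t) (Or.inr ⟨i, rfl⟩) (hlt i hi)
  obtain ⟨j, hj, hjE⟩ := Set.exists_of_ssubset hE.2.1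
  obtain ⟨E', hE', hjE'⟩ := In_subset_or_eq (t := t) (Or.inr ⟨j, rfl⟩) (hlt j hj)
  refine ⟨⟨E, hE⟩, ⟨E', hE'⟩, fun h => hjE ?_⟩
  have h' : E = E' := congrArg Subtype.val h
  exact h' ▸ Set.singleton_subset_iff.1 hjE'

end RTree

/-- A bijection `(S \ {j}) ⊔ T ≃ (B \ {i}) ⊔ C` that respects the summands. -/
lemma exists_insert_congr {S T B C : Type} (j : S) (i : B) (g : Insert j T ≃ Insert i C)
    (hg : ∀ x, (g x).isRight = x.isRight) :
    ∃ (e₁ : S ≃ B) (e₂ : T ≃ C) (h : e₁ j = i), g = Insert.congr' e₁ e₂ j i h := by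
  classical
  have hg' : ∀ y, (g.symm y).isRight = y.isRight := fun y => by
    rw [← hg, g.apply_symm_apply]
  have h1 : ∀ x : {a : S // a ≠ j}, ∃ y, g (Sum.inl x) = Sum.inl y := fun x => by
    have := hg (Sum.inl x)
    rcases h : g (Sum.inl x) with y | y
    · exact ⟨y, rfl⟩
    · simp [h] at this
  have h2 : ∀ x : T, ∃ y, g (Sum.inr x) = Sum.inr y := fun x => by
    have := hg (Sum.inr x)
    rcases h : g (Sum.inr x) with y | y
    · simp [h] at this
    · exact ⟨y, rfl⟩
  choose l hl using h1
  choose r hr using h2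
  have hlb : Function.Bijective l := by
    refine ⟨fun x x' h => Sum.inl_injective (g.injective (by rw [hl, hl, h])), fun y => ?_⟩
    have := hg' (Sum.inl y)
    rcases h : g.symm (Sum.inl y) with x | x
    · exact ⟨x, Sum.inl_injective (by rw [← hl, ← h, g.apply_symm_apply])⟩
    · simp [h] at this
  have hrb : Function.Bijective r := by
    refine ⟨fun x x' h => Sum.inr_injective (g.injective (by rw [hr, hr, h])), fun y => ?_⟩
    have := hg' (Sum.inr y)
    rcases h : g.symm (Sum.inr y) with x | x
    · simp [h] at this
    · exact ⟨x, Sum.inr_injective (by rw [← hr, ← h, g.apply_symm_apply])⟩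
  let e₁ : S ≃ B := (Equiv.sumCompl (· = j)).symm.trans
    ((Equiv.sumCongr (Equiv.ofUnique {a // a = j} {b // b = i}) (Equiv.ofBijective l hlb)).trans
      (Equiv.sumCompl (· = i)))
  have he : e₁ j = i := by
    have : (Equiv.sumCompl (· = j)).symm j = Sum.inl ⟨j, rfl⟩ := (Equiv.symm_apply_eq _).2 rfl
    simp only [e₁, Equiv.trans_apply, this]
    exact (Equiv.ofUnique {a // a = j} {b // b = i} ⟨j, rfl⟩).2
  have he' : ∀ x : {a : S // a ≠ j}, e₁ x.1 = (l x).1 := fun x => by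
    simp [e₁, Equiv.sumCompl_symm_apply_of_neg, x.2]
  refine ⟨e₁, Equiv.ofBijective r hrb, he, Equiv.ext fun x => ?_⟩
  rcases x with x | x
  · rw [hl]
    exact congrArg Sum.inl (Subtype.ext (he' x).symm)
  · rw [hr]
    rfl

/-- Every decomposition of the set of incoming edges of a vertex is realized by the contraction of
an edge. -/
lemma RTree.exists_contracts_of_equiv {I : Type} [Finite I] (t : RTree I) {A : Set I}
    (hA : A ∈ t.verts) {B C : Type} [Nontrivial B] [Nontrivial C] (i : B) (e : t.In A ≃ Insert i C) :
    ∃ (s : RTree I) (w : Set I) (h : s.Contracts t A w) (e₁ : s.In A ≃ B) (e₂ : s.In w ≃ C)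
      (h' : e₁ ⟨w, h.mem_In⟩ = i), h.edgeEquiv.trans (Insert.congr' e₁ e₂ _ i h') = e := by
  -- The new vertex `w` is the union of the incoming edges that correspond to `C`.
  let E : C → Set I := fun c => (e.symm (Sum.inr c)).1
  have hE : ∀ c, E c ∈ t.In A := fun c => (e.symm (Sum.inr c)).2
  let w : Set I := ⋃ c, E c
  have hEw : ∀ c, E c ⊆ w := Set.subset_iUnion E
  have hEinj : ∀ {c c'}, E c = E c' → c = c' := fun h =>
    Sum.inr_injective (e.symm.injective (Subtype.ext h))
  have hEdisj : ∀ {c c'}, c ≠ c' → Disjoint (E c) (E c') := fun h =>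
    RTree.In_disjoint (hE _) (hE _) fun h' => h (hEinj h')
  have hEssub : ∀ c, E c ⊂ w := fun c => by
    refine (hEw c).ssubset_of_ne fun h => ?_
    obtain ⟨c', hc'⟩ := exists_ne c
    obtain ⟨x, hx⟩ := RTree.Contracts.nonempty_of_mem_In (hE c')
    exact Set.disjoint_left.1 (hEdisj hc') hx (h ▸ hEw c' hx)
  have hL : ∀ (b : {b // b ≠ i}), Disjoint (e.symm (Sum.inl b)).1 w := fun b => by
    refine Set.disjoint_iUnion_right.2 fun c => ?_
    refine RTree.In_disjoint (e.symm (Sum.inl b)).2 (hE c) fun h => ?_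
    exact Sum.inl_ne_inr (e.symm.injective (Subtype.ext h))
  have hwA : w ⊂ A := by
    refine (Set.iUnion_subset fun c => (hE c).2.1.subset).ssubset_of_ne fun h => ?_
    obtain ⟨b, hb⟩ := exists_ne i
    obtain ⟨x, hx⟩ := RTree.Contracts.nonempty_of_mem_In (e.symm (Sum.inl ⟨b, hb⟩)).2
    refine Set.disjoint_left.1 (hL ⟨b, hb⟩) hx ?_
    change x ∈ ⋃ c, E c
    rw [h]
    exact (e.symm (Sum.inl ⟨b, hb⟩)).2.2.1.subset hx
  have hcover : ∀ F ∈ t.In A, F ⊂ w ∨ Disjoint F w := fun F hF => by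
    obtain ⟨x, hx⟩ := e.symm.surjective ⟨F, hF⟩
    rcases x with b | c
    · have := hL b
      rw [hx] at this
      exact Or.inr this
    · have h : E c = F := congrArg Subtype.val hx
      exact Or.inl (h ▸ hEssub c)
  have hwt : w ∉ t.verts := fun h => by
    obtain ⟨c⟩ := (inferInstance : Nonempty C)
    exact (hE c).2.2 w h (hEssub c) hwA
  have hwne : w.Nontrivial := by
    obtain ⟨c, c', hcc⟩ := exists_pair_ne C
    obtain ⟨x, hx⟩ := RTree.Contracts.nonempty_of_mem_In (hE c)
    obtain ⟨y, hy⟩ := RTree.Contracts.nonempty_of_mem_In (hE c')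
    exact ⟨x, hEw c hx, y, hEw c' hy, fun h => Set.disjoint_left.1 (hEdisj hcc) hx (h ▸ hy)⟩
  have hnest : ∀ D ∈ t.verts, D ⊆ w ∨ w ⊆ D ∨ Disjoint D w := fun D hD => by
    by_cases hDA : D ⊂ A
    · obtain ⟨F, hF, hDF⟩ := RTree.In_subset_or_eq (Or.inl hD) hDA
      rcases hcover F hF with h | h
      · exact Or.inl (hDF.trans h.subset)
      · exact Or.inr (Or.inr (h.mono_left hDF))
    · rcases t.nested D hD A hA with h | h | h
      · have : D = A := by
          by_contra hne
          exact hDA (h.ssubset_of_ne hne)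
        exact Or.inr (Or.inl (this ▸ hwA.subset))
      · exact Or.inr (Or.inl (hwA.subset.trans h))
      · exact Or.inr (Or.inr (h.mono_right hwA.subset))
  let s : RTree I :=
    { verts := insert w t.verts
      root_mem := Or.inr t.root_mem
      nontrivial := by
        rintro D (rfl | hD)
        · exact hwne
        · exact t.nontrivial D hD
      nested := by
        rintro D (rfl | hD) D' (rfl | hD')
        · exact Or.inl subset_rfl
        · rcases hnest D' hD' with h | h | h
          · exact Or.inr (Or.inl h)
          · exact Or.inl h
          · exact Or.inr (Or.inr h.symm)
        · exact hnest D hD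
        · exact t.nested D hD D' hD' }
  have h : s.Contracts t A w :=
    { target_mem := Or.inr hA
      source_mem := Or.inl rfl
      mem_In := by
        refine ⟨Or.inl (Or.inl rfl), hwA, ?_⟩
        rintro D (rfl | hD) hwD hDA
        · exact hwD.ne rfl
        · obtain ⟨F, hF, hDF⟩ := RTree.In_subset_or_eq (Or.inl hD) hDA
          obtain ⟨x, hx⟩ := hwne.nonempty
          rcases hcover F hF with h' | h'
          · exact (hwD.trans_subset hDF).not_subset h'.subset
          · exact Set.disjoint_right.1 h' hx (hDF (hwD.subset hx))
      verts_eq := by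
        change t.verts = insert w t.verts \ {w}
        rw [Set.insert_sdiff_of_mem _ (Set.mem_singleton w), Set.sdiff_singleton_eq_self hwt] }
  obtain ⟨e₁, e₂, h', he⟩ := exists_insert_congr (⟨w, h.mem_In⟩ : s.In A) i (h.edgeEquiv.symm.trans e) (by
    intro x
    obtain ⟨⟨F, hF⟩, rfl⟩ := h.edgeEquiv.surjective x
    rw [Equiv.trans_apply, Equiv.symm_apply_apply]
    have hl := h.labelEquiv_edgeEquiv ⟨F, hF⟩
    rcases hx : h.edgeEquiv ⟨F, hF⟩ with ⟨⟨G, hG⟩, hGw⟩ | ⟨G, hG⟩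
    · obtain rfl : G = F := by rw [hx] at hl; exact hl
      rcases hy : e ⟨G, hF⟩ with b | c
      · rfl
      · have hGc : E c = G := by
          change (e.symm (Sum.inr c)).1 = G
          rw [← hy, e.symm_apply_apply]
        exact (hG.2.2 w (Or.inl rfl) (hGc ▸ hEssub c) hwA).elim
    · obtain rfl : G = F := by rw [hx] at hl; exact hl
      rcases hy : e ⟨G, hF⟩ with b | c
      · have hb := hL b
        rw [← hy, e.symm_apply_apply] at hb
        obtain ⟨y, hy'⟩ := RTree.Contracts.nonempty_of_mem_In hF
        exact (Set.disjoint_left.1 hb hy' (hG.2.1.subset hy')).elim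
      · rfl)
  refine ⟨s, w, h, e₁, e₂, h', ?_⟩
  rw [← he]
  ext1 x
  simp only [Equiv.trans_apply, Equiv.symm_apply_apply]

/-! ### Generated elements as sums over trees -/

section Expand

variable {I : Type} [Finite I] (P : Operad k) {t s : RTree I} {v w : Set I}

/-- The family of factors with given factors at the two ends of an edge, that is obtained from a
family for the contracted tree. -/
def expandFamily (h : t.Contracts s v w) (x : ∀ B : s.verts, Tot (P.toSpecies.on (s.In B.1)))
    (a : Tot (P.toSpecies.on (t.In v))) (b : Tot (P.toSpecies.on (t.In w))) (A : t.verts) :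
    Tot (P.toSpecies.on (t.In A.1)) :=
  open Classical in
  if hw : A.1 = w then P.toSpecies.act (Equiv.setCongr (congrArg t.In hw)) b
  else if hv : A.1 = v then P.toSpecies.act (Equiv.setCongr (congrArg t.In hv)) a
  else P.toSpecies.act (Equiv.setCongr (h.In_of_ne ((h.mem_iff A.1).2 ⟨A.2, hw⟩) hv).symm)
    (x ⟨A.1, (h.mem_iff A.1).2 ⟨A.2, hw⟩⟩)

/-- The degrees of an expanded family. -/
def expandDeg (h : t.Contracts s v w) (deg : s.verts → ℤ) (p q : ℤ) (A : t.verts) : ℤ :=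
  open Classical in
  if hw : A.1 = w then q else if A.1 = v then p else deg ⟨A.1, (h.mem_iff A.1).2 ⟨A.2, hw⟩⟩

lemma contractDeg_expandDeg (h : t.Contracts s v w) (deg : s.verts → ℤ) (p q : ℤ)
    (hpq : p + q = deg ⟨v, h.target_mem'⟩) : contractDeg h (expandDeg h deg p q) = deg := by
  funext ⟨B, hB⟩
  have hvw : v ≠ w := h.mem_In.2.1.ne'
  by_cases hv : B = v
  · subst hv
    rw [contractDeg, if_pos rfl, expandDeg, expandDeg, dif_neg hvw, if_pos rfl, dif_pos rfl, hpq]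
  · rw [contractDeg, if_neg hv, expandDeg, dif_neg ((h.mem_iff B).1 hB).2, if_neg hv]

lemma contractFamily_expandFamily (h : t.Contracts s v w)
    (x : ∀ B : s.verts, Tot (P.toSpecies.on (s.In B.1)))
    (a : Tot (P.toSpecies.on (t.In v))) (b : Tot (P.toSpecies.on (t.In w)))
    (hab : edgeComp P h a b = x ⟨v, h.target_mem'⟩) :
    contractFamily P h (expandFamily P h x a b) = x := by
  funext ⟨B, hB⟩
  have hvw : v ≠ w := h.mem_In.2.1.ne'
  by_cases hv : B = v
  · subst hv
    rw [contractFamily_target, expandFamily, expandFamily, dif_neg hvw, dif_pos rfl, dif_pos rfl,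
      Species.act_setCongr_self, Species.act_setCongr_self, hab]
  · rw [contractFamily_other _ _ _ _ hv, expandFamily, dif_neg ((h.mem_iff B).1 hB).2, dif_neg hv,
      Species.act_act]
    exact Species.act_setCongr_self _ rfl _

variable {M : ConnSpecies k} {Q Q' : Operad k} {f : M.toSpecies ⟶ Q.toSpecies}
  {f' : M.toSpecies ⟶ Q'.toSpecies}

lemma rel_expandFamily (h : t.Contracts s v w) {deg : s.verts → ℤ}
    {x : ∀ B : s.verts, Tot (Q.toSpecies.on (s.In B.1))}
    {x' : ∀ B : s.verts, Tot (Q'.toSpecies.on (s.In B.1))}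
    (hx : ∀ B : s.verts, Rel f f' (s.In B.1) (deg B) (x B) (x' B)) {p q : ℤ}
    {a : Tot (Q.toSpecies.on (t.In v))} {a' : Tot (Q'.toSpecies.on (t.In v))}
    (ha : Rel f f' (t.In v) p a a') {b : Tot (Q.toSpecies.on (t.In w))}
    {b' : Tot (Q'.toSpecies.on (t.In w))} (hb : Rel f f' (t.In w) q b b') (A : t.verts) :
    Rel f f' (t.In A.1) (expandDeg h deg p q A) (expandFamily Q h x a b A)
      (expandFamily Q' h x' a' b' A) := by
  by_cases hw : A.1 = w
  · rw [expandDeg, dif_pos hw, expandFamily, dif_pos hw, expandFamily, dif_pos hw]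
    exact .act _ hb
  · by_cases hv : A.1 = v
    · rw [expandDeg, dif_neg hw, if_pos hv, expandFamily, dif_neg hw, dif_pos hv, expandFamily,
        dif_neg hw, dif_pos hv]
      exact .act _ ha
    · rw [expandDeg, dif_neg hw, if_neg hv, expandFamily, dif_neg hw, dif_neg hv, expandFamily,
        dif_neg hw, dif_neg hv]
      exact .act _ (hx ⟨A.1, (h.mem_iff A.1).2 ⟨A.2, hw⟩⟩)

end Expand

lemma ksign_mul_self (n : ℤ) : ksign k n * ksign k n = 1 := by
  rw [← ksign_add, ksign, Int.negOnePow_even _ (Even.add_self n), Units.val_one, Int.cast_one]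

section TreeRel

variable {I : Type} [Finite I] {M : ConnSpecies k} {Q Q' : Operad k}
  (f : M.toSpecies ⟶ Q.toSpecies) (f' : M.toSpecies ⟶ Q'.toSpecies)
  (L : OperadAction Q I) (L' : OperadAction Q' I)

/-- The map `M(t') ⟶ Q(t)` that applies `f` at each vertex of `t'` and composes. -/
def genNested {t' t : RTree I} (h : t' ≤ t) :
    treeTensor M.toSpecies t' ⟶ treeTensor Q.toSpecies t := treeTensorMap f t' ≫ L.map h

/-- The linear combinations of the pairs of elements of `Q(t)` and `Q'(t)` obtained from the same
element of some `M(t')`. -/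
inductive TreeRel (t : RTree I) (n : ℤ) : (⨂[k] A : t.verts, Tot (Q.toSpecies.on (t.In A.1))) →
    (⨂[k] A : t.verts, Tot (Q'.toSpecies.on (t.In A.1))) → Prop
  | of {t' : RTree I} (h : t' ≤ t) (z : (treeTensor M.toSpecies t').X n) :
    TreeRel t n (treeVal _ t n (((genNested f L h).f n).hom z))
      (treeVal _ t n (((genNested f' L' h).f n).hom z))
  | zero : TreeRel t n 0 0
  | add {x y x' y'} (h : TreeRel t n x x') (h' : TreeRel t n y y') : TreeRel t n (x + y) (x' + y')
  | smul (r : k) {x x'} (h : TreeRel t n x x') : TreeRel t n (r • x) (r • x')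

variable {f f' L L'}

lemma TreeRel.contract {t s : RTree I} {v w : Set I} (h : t.Contracts s v w) {n : ℤ} {x x'}
    (hx : TreeRel f f' L L' t n x x') :
    TreeRel f f' L L' s n (contractMap Q h x) (contractMap Q' h x') := by
  induction hx with
  | of h' z =>
    have key : ∀ {Q : Operad k} (f : M.toSpecies ⟶ Q.toSpecies) (L : OperadAction Q I),
        contractMap Q h (treeVal _ _ n (((genNested f L h').f n).hom z)) =
          treeVal _ _ n (((genNested f L (h'.trans h.le)).f n).hom z) := by
      intro Q f L
      rw [genNested, genNested, L.map_trans h' h.le, L.map_contracts h, ← Category.assoc]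
      exact (treeVal_contractHom Q h n _).symm
    rw [key f L, key f' L']
    exact .of _ z
  | zero => rw [map_zero, map_zero]; exact .zero
  | add _ _ ih ih' => rw [map_add, map_add]; exact .add ih ih'
  | smul r _ ih => rw [map_smul, map_smul]; exact .smul r ih

lemma treeRel_of_generators {t : RTree I} {deg : t.verts → ℤ}
    (m : ∀ A : t.verts, (M.toSpecies.on (t.In A.1)).X (deg A)) :
    TreeRel f f' L L' t (∑ᶠ A, deg A)
      (PiTensorProduct.tprod k fun A => Tot.map (Species.app f _) (Tot.of _ (deg A) (m A)))
      (PiTensorProduct.tprod k fun A => Tot.map (Species.app f' _) (Tot.of _ (deg A) (m A))) := by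
  have key : ∀ {Q : Operad k} (f : M.toSpecies ⟶ Q.toSpecies) (L : OperadAction Q I),
      treeVal _ t _ (((genNested f L (le_refl t)).f _).hom (piElt deg m)) =
      PiTensorProduct.tprod k fun A => Tot.map (Species.app f _) (Tot.of _ (deg A) (m A)) := by
    intro Q f L
    rw [genNested, L.map_refl, Category.comp_id]
    refine (treeVal_treeTensorMap f t _ (piElt deg m)).trans ?_
    exact PiTensorProduct.map_tprod _ _
  rw [← key f L, ← key f' L']
  exact .of _ _

variable (hf : PreservesUnit f) (hf' : PreservesUnit f')

include hf hf' in
/-- Tensor products of generated elements are sums over the trees that contract to `t`. One after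
the other the factors are decomposed; each factor that is a proper composition is split into two, by
adding a vertex to the tree. -/
lemma treeRel_tprod {t : RTree I} {deg : t.verts → ℤ}
    {x : ∀ A : t.verts, Tot (Q.toSpecies.on (t.In A.1))}
    {x' : ∀ A : t.verts, Tot (Q'.toSpecies.on (t.In A.1))}
    (hx : ∀ A : t.verts, Rel f f' (t.In A.1) (deg A) (x A) (x' A)) :
    TreeRel f f' L L' t (∑ᶠ A, deg A) (PiTensorProduct.tprod k x) (PiTensorProduct.tprod k x') := by
  classical
  induction t using WellFoundedLT.induction with
  | ind t IH =>
  have := Fintype.ofFinite t.verts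
  -- Outside `F`, the factors are assumed to be generators.
  suffices H : ∀ (F : Finset t.verts) (x : ∀ A : t.verts, Tot (Q.toSpecies.on (t.In A.1)))
      (x' : ∀ A : t.verts, Tot (Q'.toSpecies.on (t.In A.1))),
      (∀ A : t.verts, Rel f f' (t.In A.1) (deg A) (x A) (x' A)) →
      (∀ A ∉ F, ∃ m, x A = Tot.map (Species.app f _) (Tot.of _ (deg A) m) ∧
        x' A = Tot.map (Species.app f' _) (Tot.of _ (deg A) m)) →
      TreeRel f f' L L' t (∑ᶠ A, deg A) (PiTensorProduct.tprod k x) (PiTensorProduct.tprod k x') from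
    H Finset.univ x x' hx fun A hA => (hA (Finset.mem_univ A)).elim
  clear hx x x'
  intro F
  induction F using Finset.induction_on with
  | empty =>
    intro x x' _ hm
    choose m hm hm' using fun A => hm A (Finset.notMem_empty A)
    obtain rfl := funext hm
    obtain rfl := funext hm'
    exact treeRel_of_generators m
  | insert A F hA ih =>
    intro x x' hx hm
    have htop := (hx A).top hf hf' (RTree.nontrivial_In A.2)
    suffices H : ∀ y y', TopRel f f' (t.In A.1) (deg A) y y' → TreeRel f f' L L' t (∑ᶠ A, deg A)
        (PiTensorProduct.tprod k (Function.update x A y))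
        (PiTensorProduct.tprod k (Function.update x' A y')) by
      have := H _ _ htop
      rwa [Function.update_eq_self, Function.update_eq_self] at this
    intro y y' hy
    have hrel : ∀ {y y'}, Rel f f' (t.In A.1) (deg A) y y' → ∀ B : t.verts,
        Rel f f' (t.In B.1) (deg B) (Function.update x A y B) (Function.update x' A y' B) := by
      intro y y' hy B
      by_cases hB : B = A
      · subst hB
        rwa [Function.update_self, Function.update_self]
      · rw [Function.update_of_ne hB, Function.update_of_ne hB]
        exact hx B
    induction hy with
    | zero =>
      rw [MultilinearMap.map_update_zero, MultilinearMap.map_update_zero]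
      exact .zero
    | add _ _ h h' =>
      rw [MultilinearMap.map_update_add, MultilinearMap.map_update_add]
      exact .add h h'
    | smul r _ h =>
      rw [MultilinearMap.map_update_smul, MultilinearMap.map_update_smul]
      exact .smul r h
    | of m =>
      refine ih _ _ (hrel (.of _ _ m)) fun B hB => ?_
      by_cases hBA : B = A
      · subst hBA
        rw [Function.update_self, Function.update_self]
        exact ⟨m, rfl, rfl⟩
      · rw [Function.update_of_ne hBA, Function.update_of_ne hBA]
        exact hm B fun h => (Finset.mem_insert.1 h).elim hBA hB
    | @comp B C _ _ _ _ i e p q hn b b' c c' hb hc =>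
      -- The factor at `A` is a composition: it is split into two factors, for a tree `s` with one more
      -- vertex. The assertion for `s` is known, and the contraction of the new edge yields it for `t`.
      obtain ⟨s, w, h, e₁, e₂, h', he⟩ := t.exists_contracts_of_equiv A.2 i e
      have hr := hrel (y := Q.toSpecies.act e (Q.circ i b c))
        (y' := Q'.toSpecies.act e (Q'.circ i b' c')) (hn ▸ .act e (.comp i hb hc))
      have hfam := rel_expandFamily h hr (.act e₁ hb) (.act e₂ hc)
      have hlt : s < t := lt_of_le_of_ne h.le fun e => ((h.mem_iff w).1 (e ▸ h.source_mem)).2 rfl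
      have hs := IH s hlt hfam
      have hdeg := contractDeg_expandDeg h deg p q hn
      have key : ∀ {Q : Operad k} (x : ∀ A : t.verts, Tot (Q.toSpecies.on (t.In A.1)))
          (b : Tot (Q.toSpecies.on B)) (c : Tot (Q.toSpecies.on C)),
          HomogFam (expandDeg h deg p q) (expandFamily Q h
            (Function.update x A (Q.toSpecies.act e (Q.circ i b c))) (Q.toSpecies.act e₁ b)
            (Q.toSpecies.act e₂ c)) →
          contractMap Q h (PiTensorProduct.tprod k (expandFamily Q h
            (Function.update x A (Q.toSpecies.act e (Q.circ i b c))) (Q.toSpecies.act e₁ b)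
            (Q.toSpecies.act e₂ c))) =
          ksign k (moveExponent s A.1 w h.source_mem (expandDeg h deg p q)) •
            PiTensorProduct.tprod k (Function.update x A (Q.toSpecies.act e (Q.circ i b c))) := by
        intro Q x b c hh
        rw [contractMap_tprod h hh, contractFamily_expandFamily, negOnePow_smul (k := k)]
        refine Eq.trans ?_ (Function.update_self (f := x) A _).symm
        rw [edgeComp_apply, Q.circ_act e₁ e₂ _ i h', Species.act_act, he]
      have hc := hs.contract h
      rw [key x b c fun A => (hfam A).homog, key x' b' c' fun A => (hfam A).swap.homog,
        ← finsum_contractDeg h, hdeg] at hc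
      have hc' := TreeRel.smul (ksign k (moveExponent s A.1 w h.source_mem (expandDeg h deg p q))) hc
      rwa [smul_smul, smul_smul, ksign_mul_self, one_smul, one_smul] at hc'

end TreeRel

/-! ### Products of creation operators -/

section Vacuum

variable {α : Type} (X : α → DGVS k)

/-- The generator of the component of the Fock space at the empty set. -/
def vacuum : Fock X := fun T =>
  open Classical in
  if h : T = ∅ then PiTensorProduct.tprod k fun w => (Finset.notMem_empty w.1 (h ▸ w.2)).elim else 0

variable {X}

lemma fockProj_vacuum_empty (x : ∀ a, Tot (X a)) :
    fockProj X ∅ (vacuum X) =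
      PiTensorProduct.tprod k fun w : ((∅ : Finset α) : Set α) => x w.1 := by
  have h : fockProj X ∅ (vacuum X) = PiTensorProduct.tprod k
      fun w : ((∅ : Finset α) : Set α) => (Finset.notMem_empty w.1 w.2).elim := by
    change vacuum X ∅ = _
    rw [vacuum, dif_pos rfl]
  rw [h]
  exact congrArg _ (funext fun w => (Finset.notMem_empty w.1 w.2).elim)

lemma fockProj_vacuum_of_ne {T : Finset α} (h : T ≠ ∅) : fockProj X T (vacuum X) = 0 := dif_neg h

lemma vacuum_ne_zero : vacuum X ≠ 0 := fun h => by
  have h1 : fockProj X ∅ (vacuum X) = 0 := by rw [h, map_zero]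
  rw [fockProj_vacuum_empty fun _ => 0] at h1
  have : IsEmpty ((∅ : Finset α) : Set α) := ⟨fun w => Finset.notMem_empty w.1 w.2⟩
  have h2 := congrArg (PiTensorProduct.isEmptyEquiv _) h1
  rw [PiTensorProduct.isEmptyEquiv_apply_tprod, map_zero] at h2
  exact one_ne_zero h2

/-- The product of creation operators, applied to the vacuum. -/
def createList (deg : α → ℤ) (x : ∀ a, Tot (X a)) (l : List α) : Fock X :=
  (l.map fun a => create X a (deg a) (x a)).prod (vacuum X)

lemma createList_cons (deg : α → ℤ) (x : ∀ a, Tot (X a)) (a : α) (l : List α) :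
    createList deg x (a :: l) = create X a (deg a) (x a) (createList deg x l) := by
  rw [createList, List.map_cons, List.prod_cons]
  rfl

lemma fockProj_createList_of_ne [DecidableEq α] (deg : α → ℤ) (x : ∀ a, Tot (X a)) (l : List α)
    (hl : l.Nodup) {T : Finset α} (hT : T ≠ l.toFinset) : fockProj X T (createList deg x l) = 0 := by
  induction l generalizing T with
  | nil => exact fockProj_vacuum_of_ne hT
  | cons a l ih =>
    rw [createList_cons]
    by_cases h : a ∈ T
    · rw [create_of_mem _ _ _ h, ih (List.nodup_cons.1 hl).2, map_zero]
      intro h'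
      refine hT ?_
      rw [List.toFinset_cons, ← h', Finset.insert_erase h]
    · rw [create_of_notMem _ _ _ h]

/-- The exponent of the sign of a product of creation operators, relative to the tensor product of
the elements created. -/
def listExponent [DecidableEq α] (deg : α → ℤ) : List α → ℤ
  | [] => 0
  | a :: l => deg a * degBefore (S := (l.toFinset : Set α)) (fun u => deg u.1) a + listExponent deg l

lemma fockProj_createList [DecidableEq α] {deg : α → ℤ} {x : ∀ a, Tot (X a)}
    (hx : ∀ a, ∃ y, x a = Tot.of _ (deg a) y) (l : List α)
    (hl : l.Nodup) : fockProj X l.toFinset (createList deg x l) =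
      ksign k (listExponent deg l) •
        PiTensorProduct.tprod k fun w : (l.toFinset : Set α) => x w.1 := by
  induction l with
  | nil => rw [listExponent, ksign_zero, one_smul]; exact fockProj_vacuum_empty x
  | cons a l ih =>
    have ha : a ∈ (a :: l).toFinset := by simp
    have hl' : (a :: l).toFinset.erase a = l.toFinset := by
      rw [List.toFinset_cons, Finset.erase_insert (by simpa using (List.nodup_cons.1 hl).1)]
    rw [createList_cons, create_of_mem _ _ _ ha]
    have key : ∀ (R : Finset α) (_ : R = l.toFinset)
        (hR : ∀ u, u ∈ (R : Set α) ↔ u ∈ ((a :: l).toFinset : Set α) ∧ u ≠ a),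
        insMap X hR (deg a) (x a) (fockProj X R (createList deg x l)) =
          ksign k (listExponent deg (a :: l)) •
            PiTensorProduct.tprod k fun w : ((a :: l).toFinset : Set α) => x w.1 := by
      rintro R rfl hR
      have hins : insFam (fun s => Tot (X s)) hR (x a) (fun w : (l.toFinset : Set α) => x w.1) =
          fun w : ((a :: l).toFinset : Set α) => x w.1 := by
        funext w
        rcases eq_or_mem_erase ha hR w with rfl | ⟨b, rfl⟩
        · exact insFam_self (V := fun s => Tot (X s)) ha hR _ _
        · exact insFam_other (V := fun s => Tot (X s)) hR _ _ b
      rw [ih (List.nodup_cons.1 hl).2, map_smul,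
        insMap_tprod hR (deg a) (x a) (deg := fun u => deg u.1) (fun u => hx u.1), hins,
        negOnePow_smul (k := k), listExponent, ksign_add, mul_comm, mul_smul,
        smul_comm]
    exact key _ hl' _

end Vacuum

/-! ### Values of families of operators -/

section Values

variable {α : Type} {X : α → DGVS k}

/-- The value at a labelling of a family of operators that need not be homogeneous. -/
def fockVal {A : Type} (φ : A → Set ℕ) : Tot (fockFam X A) →ₗ[k] Module.End k (Fock X) :=
  DirectSum.toModule k ℤ _ fun n =>
    { toFun := fun a : (fockFam X A).X n => (fockAt a φ).1
      map_add' := fun a b => fockAt_add a b φ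
      map_smul' := fun r a => fockAt_smul r a φ }

lemma fockVal_of {A : Type} (φ : A → Set ℕ) (n : ℤ) (a : (fockFam X A).X n) :
    fockVal φ (Tot.of _ n a) = (fockAt a φ).1 := by
  rw [fockVal, Tot.of, DirectSum.toModule_lof]
  rfl

lemma fockVal_along {A B : Type} (e : B → A) (φ : A → Set ℕ) (a : Tot (fockFam X B)) :
    fockVal φ (Tot.map (fockAlong e) a) = fockVal (φ ∘ e) a := by
  induction a using Tot.induction with
  | zero => rw [map_zero, map_zero, map_zero]
  | add a b ha hb => rw [map_add, map_add, ha, hb, map_add]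
  | of n a => rw [Tot.map_of, fockVal_of, fockVal_of, fockAt_along]

lemma fockVal_comp {A B : Type} (i : A) (ψ : Insert i B → Set ℕ) (a : Tot (fockFam X A))
    (b : Tot (fockFam X B)) : fockVal ψ (Tot.bil (fockComp A B i) a b) =
      fockVal (outerLabel i ψ) a * fockVal (ψ ∘ Sum.inr) b := by
  induction a using Tot.induction with
  | zero => simp only [map_zero, LinearMap.zero_apply, zero_mul]
  | add a a' h h' => simp only [map_add, LinearMap.add_apply, h, h', add_mul]
  | of p a =>
  induction b using Tot.induction with
  | zero => simp only [map_zero, mul_zero]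
  | add a a' h h' => simp only [map_add, h, h', mul_add]
  | of q b => rw [bil_fockComp, fockVal_of, fockVal_of, fockVal_of, fockAt_mul]

lemma fockUnit_ne_zero (A : Type) : Tot.elt (fockUnit X A) ≠ 0 := fun h => by
  have h1 := congrArg (fockVal fun _ => ∅) h
  rw [elt_fockUnit, fockVal_of, fockAt_mk, map_zero] at h1
  exact vacuum_ne_zero (LinearMap.congr_fun h1 (vacuum X))

lemma mono_of_elt_ne_zero {Z : DGVS k} (u : 𝟙_ (DGVS k) ⟶ Z) (hu : Tot.elt u ≠ 0) : Mono u := by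
  have hinj : ∀ n, Function.Injective (u.f n).hom := fun n => by
    rw [injective_iff_map_eq_zero]
    intro z hz
    obtain ⟨c, -, hc⟩ := tot_unit_eq_smul (Iso.refl _) n z
    have h1 : Tot.map u (Tot.of _ n z) = 0 := by rw [Tot.map_of, hz, map_zero]
    rw [hc, map_smul, ← elt_comp, Iso.refl_hom, Category.id_comp] at h1
    rw [(smul_eq_zero.1 h1).resolve_right hu, zero_smul, ← map_zero (Tot.of (𝟙_ (DGVS k)) n)] at hc
    exact Tot.of_injective _ _ hc
  refine ⟨fun f g h => ?_⟩
  refine HomologicalComplex.hom_ext _ _ fun n => ModuleCat.hom_ext (LinearMap.ext fun x => ?_)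
  exact hinj n (congrArg (fun φ : _ ⟶ Z => (φ.f n).hom x) h)

instance (A : Type) : Mono (fockUnit X A) := mono_of_elt_ne_zero _ (fockUnit_ne_zero A)

end Values

/-! ### Labelled trees -/

section Labels

variable {I : Type} [Finite I]

lemma RTree.iUnion_In {t : RTree I} {A : Set I} (hA : A ∈ t.verts) : ⋃ B : t.In A, B.1 = A := by
  refine subset_antisymm (Set.iUnion_subset fun B => B.2.2.1.subset) fun i hi => ?_
  obtain ⟨E, hE, hiE⟩ := RTree.In_subset_or_eq (t := t) (A := A) (Or.inr ⟨i, rfl⟩)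
    ((Set.singleton_subset_iff.2 hi).ssubset_of_ne fun h =>
      Set.not_nontrivial_singleton (h ▸ t.nontrivial A hA))
  exact Set.mem_iUnion.2 ⟨⟨E, hE⟩, Set.singleton_subset_iff.1 hiE⟩

variable (j : I → ℕ) (hj : Function.Injective j)

/-- The labelling of a set of edges given by numbers for the leaves. -/
def edgeLabel (S : Set (Set I)) (B : S) : Set ℕ := j '' B.1

variable {j}

include hj in
lemma edgeLabel_injective (S : Set (Set I)) : Function.Injective (edgeLabel j S) :=
  fun _ _ h => Subtype.ext (hj.image_injective h)

include hj in
lemma labelSet_edgeLabel_injective {t s : RTree I} {A B : Set I} (hA : A ∈ t.verts)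
    (hB : B ∈ s.verts) (h : labelSet (edgeLabel j (t.In A)) = labelSet (edgeLabel j (s.In B))) :
    A = B := by
  have key : ∀ {t : RTree I} {A : Set I}, A ∈ t.verts →
      j '' A = ⋃ x ∈ labelSet (edgeLabel j (t.In A)), x := by
    intro t A hA
    conv_lhs => rw [← RTree.iUnion_In hA, Set.image_iUnion]
    ext n
    simp only [Set.mem_iUnion, mem_labelSet]
    constructor
    · rintro ⟨B, hB⟩
      exact ⟨_, ⟨B, rfl⟩, hB⟩
    · rintro ⟨_, ⟨B, rfl⟩, hn⟩
      exact ⟨B, hn⟩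
  refine hj.image_injective ?_
  rw [key hA, key hB, h]

lemma outerLabel_edgeLabel {t s : RTree I} {v w : Set I} (h : t.Contracts s v w) :
    outerLabel ⟨w, h.mem_In⟩ (edgeLabel j (s.In v) ∘ h.edgeEquiv.symm) = edgeLabel j (t.In v) := by
  have hlab : ∀ x, (h.edgeEquiv.symm x).1 = insVal x := fun x => by
    have := h.labelEquiv_edgeEquiv (h.edgeEquiv.symm x)
    rw [← this, Equiv.apply_symm_apply]
  refine (eq_outerLabel ?_ fun a => ?_).symm
  · change j '' w = ⋃ b : t.In w, j '' (h.edgeEquiv.symm (Sum.inr b)).1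
    conv_lhs => rw [← RTree.iUnion_In h.source_mem, Set.image_iUnion]
    exact Set.iUnion_congr fun b => by rw [hlab]; rfl
  · change j '' a.1.1 = j '' (h.edgeEquiv.symm (Sum.inl a)).1
    rw [hlab]
    rfl

lemma edgeLabel_inr {t s : RTree I} {v w : Set I} (h : t.Contracts s v w) :
    (edgeLabel j (s.In v) ∘ h.edgeEquiv.symm) ∘ Sum.inr = edgeLabel j (t.In w) := by
  funext b
  change j '' (h.edgeEquiv.symm (Sum.inr b)).1 = j '' b.1
  have := h.labelEquiv_edgeEquiv (h.edgeEquiv.symm (Sum.inr b))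
  rw [← this, Equiv.apply_symm_apply]
  rfl

variable {α : Type} {X : α → DGVS k}

lemma fockVal_edgeComp {t s : RTree I} {v w : Set I} (h : t.Contracts s v w)
    (a : Tot (fockFam X (t.In v))) (b : Tot (fockFam X (t.In w))) :
    fockVal (edgeLabel j (s.In v)) (edgeComp (fockOperad X) h a b) =
      fockVal (edgeLabel j (t.In v)) a * fockVal (edgeLabel j (t.In w)) b := by
  refine (congrArg (fockVal _) (edgeComp_apply (fockOperad X) h a b)).trans ?_
  refine (fockVal_along _ _ _).trans ?_
  refine (fockVal_comp _ _ _ _).trans ?_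
  exact congrArg₂ (fun φ χ => fockVal φ a * fockVal χ b) (outerLabel_edgeLabel h) (edgeLabel_inr h)

end Labels

/-! ### Trees are detected by the operad of families of operators -/

section Detect

variable {I : Type} [Finite I]

lemma prod_map_flatMap {β γ N : Type*} [Monoid N] (l : List β) (f : β → List γ) (g : γ → N) :
    ((l.flatMap f).map g).prod = (l.map fun b => ((f b).map g).prod).prod := by
  induction l with
  | nil => rfl
  | cons b l ih => rw [List.flatMap_cons, List.map_append, List.prod_append, ih, List.map_cons,
      List.prod_cons]

/-- The list of vertices of `t`, given one of a tree obtained by the contraction of an edge. -/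
def expandList {t s : RTree I} {v w : Set I} (h : t.Contracts s v w) (l : List s.verts) :
    List t.verts :=
  open Classical in
  l.flatMap fun B => if B.1 = v then [⟨v, h.target_mem⟩, ⟨w, h.source_mem⟩]
    else [⟨B.1, h.subset B.2⟩]

lemma mem_expandList {t s : RTree I} {v w : Set I} (h : t.Contracts s v w) {l : List s.verts}
    (hl : ∀ B, B ∈ l) (A : t.verts) : A ∈ expandList h l := by
  rw [expandList, List.mem_flatMap]
  by_cases hw : A.1 = w
  · refine ⟨⟨v, h.target_mem'⟩, hl _, ?_⟩
    rw [if_pos rfl]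
    exact List.mem_cons_of_mem _ (List.mem_singleton.2 (Subtype.ext hw))
  · refine ⟨⟨A.1, (h.mem_iff A.1).2 ⟨A.2, hw⟩⟩, hl _, ?_⟩
    by_cases hv : A.1 = v
    · rw [if_pos hv]
      exact List.mem_cons.2 (Or.inl (Subtype.ext hv))
    · rw [if_neg hv]
      exact List.mem_singleton.2 rfl

lemma nodup_expandList {t s : RTree I} {v w : Set I} (h : t.Contracts s v w) {l : List s.verts}
    (hl : l.Nodup) : (expandList h l).Nodup := by
  have hvw : v ≠ w := h.mem_In.2.1.ne'
  have hne : ∀ B : s.verts, B.1 ≠ w := fun B => ((h.mem_iff B.1).1 B.2).2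
  rw [expandList, List.nodup_flatMap]
  refine ⟨fun B _ => ?_, hl.imp fun {B C} hBC => ?_⟩
  · by_cases hv : B.1 = v
    · rw [if_pos hv]; simpa using hvw
    · rw [if_neg hv]; simp
  · have hBC' : B.1 ≠ C.1 := fun e => hBC (Subtype.ext e)
    simp only [Function.onFun]
    by_cases hv : B.1 = v
    · rw [if_pos hv, if_neg fun h => hBC' (hv.trans h.symm)]
      intro A hA hA'
      obtain rfl := List.mem_singleton.1 hA'
      rcases List.mem_cons.1 hA with e | e
      · exact hBC' (hv.trans (congrArg Subtype.val e).symm)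
      · exact hne C (congrArg Subtype.val (List.mem_singleton.1 e))
    · rw [if_neg hv]
      intro A hA hA'
      obtain rfl := List.mem_singleton.1 hA
      by_cases hv' : C.1 = v
      · rw [if_pos hv'] at hA'
        rcases List.mem_cons.1 hA' with e | e
        · exact hv (congrArg Subtype.val e)
        · exact hne B (congrArg Subtype.val (List.mem_singleton.1 e))
      · rw [if_neg hv'] at hA'
        have e := List.mem_singleton.1 hA'
        exact hBC' (Subtype.mk.inj e)

variable {α : Type} {X : α → DGVS k} (j : I → ℕ)

/-- The operator that belongs to an element of the operad at a vertex of a tree. -/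
def vertVal (t : RTree I) (A : Set I) :
    Tot ((fockOperad X).toSpecies.on (t.In A)) →ₗ[k] Module.End k (Fock X) :=
  fockVal (edgeLabel j (t.In A))

/-- The operator that belongs to an element of the operad at a tree with only one vertex. -/
def corollaVal {c : RTree I} (hc : c.verts = {Set.univ}) :
    (⨂[k] A : c.verts, Tot ((fockOperad X).toSpecies.on (c.In A.1))) →ₗ[k]
      Module.End k (Fock X) :=
  have : Subsingleton c.verts := by rw [hc]; infer_instance
  vertVal j c Set.univ ∘ₗ
    (PiTensorProduct.subsingletonEquiv (⟨Set.univ, c.root_mem⟩ : c.verts)).toLinearMap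

lemma corollaVal_tprod {c : RTree I} (hc : c.verts = {Set.univ})
    (y : ∀ A : c.verts, Tot ((fockOperad X).toSpecies.on (c.In A.1))) :
    corollaVal j hc (PiTensorProduct.tprod k y) =
      vertVal j c Set.univ (y ⟨Set.univ, c.root_mem⟩) := by
  have : Subsingleton c.verts := by rw [hc]; infer_instance
  rw [corollaVal, LinearMap.comp_apply]
  exact congrArg _ (PiTensorProduct.subsingletonEquiv_apply_tprod _ _)

/-- After the contraction of all edges, the product of the operators at the vertices remains, up to
a sign that depends on the degrees only. -/
lemma exists_corollaVal (L : OperadAction (fockOperad X) I) {t c : RTree I} (h : t ≤ c)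
    (hc : c.verts = {Set.univ}) :
    ∃ (l : List t.verts) (s : (t.verts → ℤ) → ℤ), l.Nodup ∧ (∀ A, A ∈ l) ∧
      ∀ (deg : t.verts → ℤ)
        (y : ∀ A : t.verts, Tot ((fockOperad X).toSpecies.on (t.In A.1))), HomogFam deg y →
      ∀ n (z : (treeTensor (fockOperad X).toSpecies t).X n),
      treeVal _ t n z = PiTensorProduct.tprod k y →
        corollaVal j hc (treeVal _ c n (((L.map h).f n).hom z)) =
          ksign k (s deg) • (l.map fun A : t.verts => vertVal j t A.1 (y A)).prod := by
  induction h using RTree.le_induction with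
  | refl c =>
    refine ⟨[⟨Set.univ, c.root_mem⟩], fun _ => 0, List.nodup_singleton _, fun A => ?_,
      fun deg y hy n z hz => ?_⟩
    · have : Subsingleton c.verts := by rw [hc]; infer_instance
      exact List.mem_singleton.2 (Subsingleton.elim _ _)
    · rw [L.map_refl, ksign_zero, one_smul, List.map_singleton, List.prod_singleton]
      exact (congrArg (corollaVal j hc) hz).trans (corollaVal_tprod j hc y)
  | @step t r c v w h hrs ih =>
    obtain ⟨l, s, hl, hl', H⟩ := ih hc
    refine ⟨expandList h l, fun deg => moveExponent t v w h.source_mem deg + s (contractDeg h deg),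
      nodup_expandList h hl, mem_expandList h hl', fun deg y hy n z hz => ?_⟩
    -- The sign of the contraction is absorbed in `z`, so that its image is a pure tensor.
    have hz' : treeVal _ r n ((contractHom (fockOperad X) h).f n |>.hom
        (ksign k (moveExponent t v w h.source_mem deg) • z)) =
        PiTensorProduct.tprod k (contractFamily (fockOperad X) h y) := by
      rw [treeVal_contractHom, map_smul, map_smul, hz, contractMap_tprod h hy,
        negOnePow_smul (k := k), smul_smul, ksign_mul_self, one_smul]
    have key := H _ _ (hy.contract h) n _ hz'
    have hval : ∀ B : r.verts, vertVal j r B.1 (contractFamily (fockOperad X) h y B) = ((if B.1 = v then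
          [(⟨v, h.target_mem⟩ : t.verts), ⟨w, h.source_mem⟩] else [⟨B.1, h.subset B.2⟩]).map
          fun A : t.verts => vertVal j t A.1 (y A)).prod := by
      rintro ⟨B, hB⟩
      by_cases hv : B = v
      · subst hv
        rw [if_pos rfl, List.map_cons, List.map_singleton, List.prod_cons, List.prod_singleton]
        refine (congrArg (vertVal j r _) (contractFamily_target (fockOperad X) h y)).trans ?_
        exact fockVal_edgeComp h _ _
      · rw [if_neg hv, List.map_singleton, List.prod_singleton]
        refine (congrArg (vertVal j r _) (contractFamily_other (fockOperad X) h y ⟨B, hB⟩ hv)).trans ?_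
        exact fockVal_along _ _ _
    rw [L.map_trans h.le hrs, L.map_contracts h, expandList, prod_map_flatMap, ksign_add, mul_smul]
    have e := congrArg (fun l : List (Module.End k (Fock X)) =>
      ksign k (moveExponent t v w h.source_mem deg) • ksign k (s (contractDeg h deg)) • l.prod)
      (List.map_congr_left fun B (_ : B ∈ l) => hval B)
    refine Eq.trans ?_ e
    refine Eq.trans ?_ (congrArg (ksign k (moveExponent t v w h.source_mem deg) • ·) key)
    rw [map_smul, map_smul, map_smul, map_smul, smul_smul, ksign_mul_self, one_smul]
    rfl

variable (M : ConnSpecies k) {j} (hj : Function.Injective j)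

include hj in
lemma vertVal_fockGen (t : RTree I) {A : Set I} (hA : A ∈ t.verts) (n : ℤ)
    (m : (M.toSpecies.on (t.In A)).X n) :
    vertVal j t A (Tot.map (Species.app (fockGen M) (t.In A)) (Tot.of _ n m)) =
      create (labelFam M.toSpecies) (labelSet (edgeLabel j (t.In A))) n
        (M.toSpecies.act (labelSetEquiv _ (edgeLabel_injective hj (t.In A))) (Tot.of _ n m)) := by
  have := RTree.nontrivial_In hA
  have h : ¬ Nonempty (Unique (t.In A)) := fun ⟨h⟩ =>
    not_subsingleton (t.In A) ⟨fun a b => (h.uniq a).trans (h.uniq b).symm⟩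
  have h1 : Species.app (fockGen M) (t.In A) = genCreate M.toSpecies (t.In A) :=
    fockGenApp_of_not M (t.In A) h
  refine (congrArg (fun g => vertVal j t A (Tot.map g (Tot.of _ n m))) h1).trans ?_
  rw [← genOp_of_injective]
  refine (congrArg (vertVal j t A) (Tot.map_of (genCreate M.toSpecies (t.In A)) n m)).trans ?_
  exact fockVal_of _ _ _

/-- A family over a subset of `α`, extended by zero. -/
lemma exists_extend {ι : Type*} {σ : ι → α} (hσ : Function.Injective σ) (deg : ι → ℤ)
    (z : ∀ i, Tot (X (σ i))) (hz : ∀ i, ∃ y, z i = Tot.of _ (deg i) y) :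
    ∃ x : ∀ a, Tot (X a), (∀ i, x (σ i) = z i) ∧
      ∀ a, ∃ y, x a = Tot.of _ (Function.extend σ deg 0 a) y := by
  classical
  refine ⟨fun a => if h : ∃ i, σ i = a then h.choose_spec ▸ z h.choose else 0, fun i => ?_,
    fun a => ?_⟩
  · have h : ∃ i', σ i' = σ i := ⟨i, rfl⟩
    beta_reduce
    rw [dif_pos h]
    have key : ∀ (i') (e : σ i' = σ i), (e ▸ z i' : Tot (X (σ i))) = z i := fun i' e => by
      obtain rfl := hσ e
      rfl
    exact key _ h.choose_spec
  · by_cases h : ∃ i, σ i = a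
    · obtain ⟨i, rfl⟩ := h
      have h : ∃ i', σ i' = σ i := ⟨i, rfl⟩
      beta_reduce
      rw [dif_pos h, hσ.extend_apply]
      have key : ∀ (i') (e : σ i' = σ i), ∃ y, (e ▸ z i' : Tot (X (σ i))) = Tot.of _ (deg i) y :=
        fun i' e => by
          obtain rfl := hσ e
          exact hz i'
      exact key _ h.choose_spec
    · beta_reduce
      rw [dif_neg h]
      exact ⟨0, (map_zero _).symm⟩

lemma treeTensor_linearMap_ext {M : Species k} {t : RTree I} {n : ℤ} {N : Type*} [AddCommMonoid N]
    [Module k N] {f g : (treeTensor M t).X n →ₗ[k] N}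
    (h : ∀ (deg : t.verts → ℤ) (x : ∀ A, (M.on (t.In A.1)).X (deg A)) (z : (treeTensor M t).X n),
      treeVal M t n z = piPure _ _ deg x → f z = g z) : f = g := by
  refine LinearMap.ext fun z => ?_
  obtain ⟨z, hz⟩ := z
  induction hz using Submodule.span_induction with
  | mem z hz =>
    obtain ⟨deg, x, rfl, rfl⟩ := hz
    exact h deg x _ rfl
  | zero => exact (map_zero f).trans (map_zero g).symm
  | add a b ha hb iha ihb =>
    exact (map_add f (⟨a, ha⟩ : piHomog _ _ n) ⟨b, hb⟩).trans
      ((congrArg₂ (· + ·) iha ihb).trans (map_add g (⟨a, ha⟩ : piHomog _ _ n) ⟨b, hb⟩).symm)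
  | smul r a ha iha =>
    exact (map_smul f r (⟨a, ha⟩ : piHomog _ _ n)).trans
      ((congrArg (r • ·) iha).trans (map_smul g r (⟨a, ha⟩ : piHomog _ _ n)).symm)

/-- The labels of the incoming edges at a vertex. -/
def vertLabels (j : I → ℕ) (t : RTree I) (A : t.verts) : Finset (Set ℕ) :=
  labelSet (edgeLabel j (t.In A.1))

include hj in
lemma vertLabels_injective (t : RTree I) : Function.Injective (vertLabels j t) := fun A B h =>
  Subtype.ext (labelSet_edgeLabel_injective hj A.2 B.2 h)

include hj in
/-- A tree is determined by the labels of the incoming edges at its vertices. -/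
lemma eq_of_vertLabels {t s : RTree I} (h : ∀ a, (∃ A, vertLabels j t A = a) ↔
    ∃ B, vertLabels j s B = a) : t = s := by
  have key : ∀ {t s : RTree I}, (∀ a, (∃ A, vertLabels j t A = a) → ∃ B, vertLabels j s B = a) →
      t.verts ⊆ s.verts := by
    intro t s h A hA
    obtain ⟨B, hB⟩ := h _ ⟨⟨A, hA⟩, rfl⟩
    exact labelSet_edgeLabel_injective hj B.2 hA hB ▸ B.2
  exact RTree.ext ((key fun a => (h a).1).antisymm (key fun a => (h a).2))

variable (j) in
/-- The elements of the set of labels at a vertex correspond to the incoming edges. -/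
def vertLabelEquiv (hj : Function.Injective j) (t : RTree I) (A : t.verts) :
    {x // x ∈ vertLabels j t A} ≃ t.In A.1 :=
  labelSetEquiv (edgeLabel j (t.In A.1)) (edgeLabel_injective hj (t.In A.1))

variable (j) in
/-- The identification of the factor of `M(t)` at a vertex with a space of created elements. -/
def relabel (hj : Function.Injective j) (t : RTree I) (A : t.verts) :
    Tot (M.toSpecies.on (t.In A.1)) →ₗ[k] Tot (labelFam M.toSpecies (vertLabels j t A)) :=
  M.toSpecies.act (vertLabelEquiv j hj t A)

lemma relabel_of (t : RTree I) (A : t.verts) (n : ℤ) (m : (M.toSpecies.on (t.In A.1)).X n) :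
    ∃ y, relabel j M hj t A (Tot.of _ n m) = Tot.of _ n y :=
  ⟨_, Species.act_of _ _ _ _⟩

lemma act_symm_relabel (t : RTree I) (A : t.verts) (m : Tot (M.toSpecies.on (t.In A.1))) :
    M.toSpecies.act (vertLabelEquiv j hj t A).symm (relabel j M hj t A m) = m := by
  refine (Species.act_act M.toSpecies (vertLabelEquiv j hj t A).symm (vertLabelEquiv j hj t A) m).trans ?_
  rw [Equiv.symm_trans_self, Species.act_refl]

/-- The operator that belongs to a generator at a vertex is the creation operator of the corresponding
element, in the place given by the labels of the vertex. -/
lemma vertVal_fockGen' (t : RTree I) (A : t.verts) (n : ℤ)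
    (m : (M.toSpecies.on (t.In A.1)).X n) :
    vertVal j t A.1 (Tot.map (Species.app (fockGen M) (t.In A.1)) (Tot.of _ n m)) =
      create (labelFam M.toSpecies) (vertLabels j t A) n (relabel j M hj t A (Tot.of _ n m)) :=
  vertVal_fockGen M hj t A.2 n m

/-- The product of the operators of a tree, applied to the vacuum. -/
lemma prod_vertVal_vacuum (t : RTree I) (l : List t.verts) (deg : t.verts → ℤ)
    (m : ∀ A : t.verts, (M.toSpecies.on (t.In A.1)).X (deg A))
    (x : ∀ a, Tot (labelFam M.toSpecies a))
    (hx : ∀ A, x (vertLabels j t A) = relabel j M hj t A (Tot.of _ (deg A) (m A))) :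
    (l.map fun A : t.verts => vertVal j t A.1 (Tot.map (Species.app (fockGen M) (t.In A.1))
      (Tot.of _ (deg A) (m A)))).prod (vacuum _) =
      createList (Function.extend (vertLabels j t) deg 0) x (l.map (vertLabels j t)) := by
  have hσ := vertLabels_injective hj t
  have e : (l.map fun A : t.verts => vertVal j t A.1 (Tot.map (Species.app (fockGen M) (t.In A.1))
      (Tot.of _ (deg A) (m A)))) = (l.map (vertLabels j t)).map fun a =>
        create (labelFam M.toSpecies) a (Function.extend (vertLabels j t) deg 0 a) (x a) := by
    rw [List.map_map]
    refine List.map_congr_left fun A _ => ?_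
    rw [Function.comp_apply, hσ.extend_apply, hx]
    exact vertVal_fockGen' M hj t A (deg A) (m A)
  rw [e]
  rfl

/-- The operator of a tree, applied to the vacuum. -/
lemma corollaVal_genNested_vacuum (L : OperadAction (fockOperad (labelFam M.toSpecies)) I)
    {t c : RTree I} (h : t ≤ c) (hc : c.verts = {Set.univ}) (l : List t.verts)
    (s : (t.verts → ℤ) → ℤ)
    (H : ∀ (deg : t.verts → ℤ)
        (y : ∀ A : t.verts, Tot ((fockOperad (labelFam M.toSpecies)).toSpecies.on (t.In A.1))),
        HomogFam deg y →
      ∀ n (z : (treeTensor (fockOperad (labelFam M.toSpecies)).toSpecies t).X n),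
      treeVal _ t n z = PiTensorProduct.tprod k y →
        corollaVal j hc (treeVal _ c n (((L.map h).f n).hom z)) =
          ksign k (s deg) • (l.map fun A : t.verts => vertVal j t A.1 (y A)).prod)
    (deg : t.verts → ℤ) (m : ∀ A : t.verts, (M.toSpecies.on (t.In A.1)).X (deg A)) (n : ℤ)
    (z : (treeTensor M.toSpecies t).X n) (hz : treeVal _ t n z = piPure _ _ deg m)
    (x : ∀ a, Tot (labelFam M.toSpecies a))
    (hx : ∀ A, x (vertLabels j t A) = relabel j M hj t A (Tot.of _ (deg A) (m A))) :
    corollaVal j hc (treeVal _ c n (((genNested (fockGen M) L h).f n).hom z)) (vacuum _) =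
      ksign k (s deg) •
        createList (Function.extend (vertLabels j t) deg 0) x (l.map (vertLabels j t)) := by
  have hy : HomogFam deg fun A : t.verts =>
      Tot.map (Species.app (fockGen M) (t.In A.1)) (Tot.of (M.toSpecies.on (t.In A.1)) _ (m A)) :=
    (homogFam_of deg m).map fun A : t.verts => Species.app (fockGen M) (t.In A.1)
  have hz' : treeVal _ t n (((treeTensorMap (fockGen M) t).f n).hom z) =
      PiTensorProduct.tprod k fun A : t.verts => Tot.map (Species.app (fockGen M) (t.In A.1))
        (Tot.of (M.toSpecies.on (t.In A.1)) _ (m A)) := by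
    refine (treeVal_treeTensorMap (fockGen M) t n z).trans ?_
    rw [hz]
    exact PiTensorProduct.map_tprod _ _
  have h1 := H deg _ hy n _ hz'
  refine (congrArg (fun g : Module.End k (Fock (labelFam M.toSpecies)) => g (vacuum _)) h1).trans ?_
  exact congrArg (ksign k (s deg) • ·) (prod_vertVal_vacuum M hj t l deg m x hx)

include hj in
/-- The operator of a tree, applied to the vacuum, is up to sign the tensor product of the elements
at the vertices, in the component given by the labels of the vertices. -/
lemma exists_corollaVal_vacuum (L : OperadAction (fockOperad (labelFam M.toSpecies)) I)
    {t c : RTree I} (h : t ≤ c) (hc : c.verts = {Set.univ}) :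
    ∃ (T : Finset (Finset (Set ℕ))) (s : (t.verts → ℤ) → ℤ),
      (∀ a, a ∈ T ↔ ∃ A, vertLabels j t A = a) ∧
      ∀ (deg : t.verts → ℤ) (m : ∀ A : t.verts, (M.toSpecies.on (t.In A.1)).X (deg A)) (n : ℤ)
        (z : (treeTensor M.toSpecies t).X n), treeVal _ t n z = piPure _ _ deg m →
        ∃ x : ∀ a, Tot (labelFam M.toSpecies a),
          (∀ A, x (vertLabels j t A) = relabel j M hj t A (Tot.of _ (deg A) (m A))) ∧
          ∀ T', fockProj _ T' (corollaVal j hc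
            (treeVal _ c n (((genNested (fockGen M) L h).f n).hom z)) (vacuum _)) =
              if T' = T then ksign k (s deg) • PiTensorProduct.tprod k
                fun w : (T' : Set (Finset (Set ℕ))) => x w.1 else 0 := by
  classical
  obtain ⟨l, s, hl, hl', H⟩ := exists_corollaVal j L h hc
  have hσ := vertLabels_injective hj t
  refine ⟨(l.map (vertLabels j t)).toFinset, fun deg => s deg + listExponent
    (Function.extend (vertLabels j t) deg 0) (l.map (vertLabels j t)), fun a => by simp [hl'],
    fun deg m n z hz => ?_⟩
  obtain ⟨x, hx, hx'⟩ := exists_extend (X := labelFam M.toSpecies) hσ deg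
    (fun A => relabel j M hj t A (Tot.of _ (deg A) (m A))) (fun A => relabel_of M hj t A _ _)
  refine ⟨x, hx, fun T' => ?_⟩
  refine (congrArg (fockProj _ T')
    (corollaVal_genNested_vacuum M hj L h hc l s H deg m n z hz x hx)).trans ?_
  rw [map_smul]
  split_ifs with hT
  · subst hT
    rw [fockProj_createList hx' _ (hl.map hσ), smul_smul, ← ksign_add]
  · rw [fockProj_createList_of_ne _ _ _ (hl.map hσ) hT, smul_zero]

include hj in
/-- The elements of `M(t)` are recovered from the operators that they define, and these differ from
the operators of other trees. -/
lemma exists_retraction (L : OperadAction (fockOperad (labelFam M.toSpecies)) I)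
    {t c : RTree I} (h : t ≤ c) (hc : c.verts = {Set.univ}) :
    ∃ ρ : (⨂[k] A : c.verts, Tot ((fockOperad (labelFam M.toSpecies)).toSpecies.on (c.In A.1))) →ₗ[k]
        ⨂[k] A : t.verts, Tot (M.toSpecies.on (t.In A.1)),
      (∀ n (z : (treeTensor M.toSpecies t).X n),
        ρ (treeVal _ c n (((genNested (fockGen M) L h).f n).hom z)) = treeVal _ t n z) ∧
      ∀ t' (h' : t' ≤ c), t' ≠ t → ∀ n (z : (treeTensor M.toSpecies t').X n),
        ρ (treeVal _ c n (((genNested (fockGen M) L h').f n).hom z)) = 0 := by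
  classical
  obtain ⟨T, s, hT, H⟩ := exists_corollaVal_vacuum M hj L h hc
  let e : (T : Set (Finset (Set ℕ))) ≃ t.verts :=
    (Equiv.ofBijective (fun A => (⟨vertLabels j t A, (hT _).2 ⟨A, rfl⟩⟩ :
      (T : Set (Finset (Set ℕ))))) ⟨fun A B h => vertLabels_injective hj t (congrArg Subtype.val h),
        fun a => by
          obtain ⟨A, hA⟩ := (hT a.1).1 a.2
          exact ⟨A, Subtype.ext hA⟩⟩).symm
  let Ψ : (⨂[k] w : (T : Set (Finset (Set ℕ))), Tot (labelFam M.toSpecies w.1)) →ₗ[k]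
      ⨂[k] A : t.verts, Tot (M.toSpecies.on (t.In A.1)) :=
    PiTensorProduct.map (fun A : t.verts => M.toSpecies.act
      (vertLabelEquiv j hj t A).symm) ∘ₗ
      (PiTensorProduct.reindex k (fun w => Tot (labelFam M.toSpecies w.1)) e).toLinearMap
  let ev : Module.End k (Fock (labelFam M.toSpecies)) →ₗ[k]
      ⨂[k] w : (T : Set (Finset (Set ℕ))), Tot (labelFam M.toSpecies w.1) :=
    fockProj _ T ∘ₗ LinearMap.applyₗ (vacuum _)
  -- The operator is applied to the vacuum, and the component that belongs to the labels of `t` is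
  -- identified with the tensor product over the vertices of `t`, with a correction of the sign.
  refine ⟨signMap (fun deg => (s deg).negOnePow) ∘ₗ Ψ ∘ₗ ev ∘ₗ corollaVal j hc, fun n z => ?_,
    fun t' h' hne n z => ?_⟩
  · refine LinearMap.congr_fun (f := (signMap (fun deg => (s deg).negOnePow) ∘ₗ Ψ ∘ₗ ev ∘ₗ
      corollaVal j hc) ∘ₗ treeVal _ c n ∘ₗ ((genNested (fockGen M) L h).f n).hom)
      (treeTensor_linearMap_ext fun deg m z hz => ?_) z
    obtain ⟨x, hx, hx'⟩ := H deg m n z hz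
    have h1 := hx' T
    rw [if_pos rfl] at h1
    have h2 : Ψ (PiTensorProduct.tprod k fun w : (T : Set (Finset (Set ℕ))) => x w.1) =
        piPure _ _ deg m := by
      refine (congrArg (PiTensorProduct.map _) (PiTensorProduct.reindex_tprod e _)).trans ?_
      refine (PiTensorProduct.map_tprod _ _).trans (congrArg (PiTensorProduct.tprod k) ?_)
      funext A
      refine (congrArg (M.toSpecies.act _) (hx A)).trans ?_
      exact act_symm_relabel M hj t A _
    refine (congrArg (fun y => signMap (fun deg => (s deg).negOnePow) (Ψ y)) h1).trans ?_
    rw [map_smul, h2, map_smul, signMap_piPure, negOnePow_smul (k := k), smul_smul, ksign_mul_self,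
      one_smul, hz]
  · refine LinearMap.congr_fun (f := (signMap (fun deg => (s deg).negOnePow) ∘ₗ Ψ ∘ₗ ev ∘ₗ
      corollaVal j hc) ∘ₗ treeVal _ c n ∘ₗ ((genNested (fockGen M) L h').f n).hom) (g := 0)
      (treeTensor_linearMap_ext fun deg m z hz => ?_) z
    obtain ⟨T', s', hT', H'⟩ := exists_corollaVal_vacuum M hj L h' hc
    obtain ⟨x, -, hx'⟩ := H' deg m n z hz
    have h1 := hx' T
    rw [if_neg fun e => hne (eq_of_vertLabels hj fun a => by rw [← hT, ← hT', e])] at h1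
    refine (congrArg (fun y => signMap (fun deg => (s deg).negOnePow) (Ψ y)) h1).trans ?_
    rw [map_zero, map_zero]
    rfl

end Detect

/-! ### Relations among the generators of the operad of families of operators -/

/-- The tree with only one vertex. -/
def RTree.corolla (I : Type) [Nontrivial I] : RTree I where
  verts := {Set.univ}
  root_mem := rfl
  nontrivial := by rintro A rfl; exact Set.nontrivial_univ
  nested := by rintro A rfl B rfl; exact Or.inl subset_rfl

lemma RTree.le_corolla {I : Type} [Nontrivial I] (t : RTree I) : t ≤ RTree.corolla I := by
  rintro A rfl
  exact t.root_mem

/-- The incoming edges at the vertex of the tree with only one vertex are the leaves. -/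
def RTree.corollaIn {I : Type} [Nontrivial I] (A : (RTree.corolla I).verts) :
    (RTree.corolla I).In A.1 ≃ I :=
  (Equiv.ofBijective (fun i => (⟨{i}, Or.inr ⟨i, rfl⟩, by
      rw [show A.1 = Set.univ from A.2]
      exact (Set.ssubset_univ_iff).2 (Set.singleton_ne_univ i), by
      rw [show A.1 = Set.univ from A.2]
      rintro C rfl _ h
      exact h.ne rfl⟩ : (RTree.corolla I).In A.1))
    ⟨fun i j h => Set.singleton_injective (congrArg Subtype.val h), fun B => by
      rcases B.2.1 with h | ⟨i, hi⟩
      · exact (B.2.2.1.ne (h.trans A.2.symm)).elim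
      · exact ⟨i, Subtype.ext hi.symm⟩⟩).symm

instance {I : Type} [Nontrivial I] : Unique (RTree.corolla I).verts :=
  inferInstanceAs (Unique ({Set.univ} : Set (Set I)))

section Sum

variable {M : ConnSpecies k} {Q Q' : Operad k} {f : M.toSpecies ⟶ Q.toSpecies}
  {f' : M.toSpecies ⟶ Q'.toSpecies} {I : Type} [Finite I] {L : OperadAction Q I}
  {L' : OperadAction Q' I}

open Classical in
instance (t : RTree I) : Fintype {t' : RTree I // t' ≤ t} := Fintype.ofFinite _

/-- The terms of a linear combination can be collected tree by tree. -/
lemma TreeRel.exists_sum {t : RTree I} {n : ℤ} {x x'} (h : TreeRel f f' L L' t n x x') :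
    ∃ ζ : ∀ t' : {t' : RTree I // t' ≤ t}, (treeTensor M.toSpecies t'.1).X n,
      x = ∑ t', treeVal _ t n (((genNested f L t'.2).f n).hom (ζ t')) ∧
      x' = ∑ t', treeVal _ t n (((genNested f' L' t'.2).f n).hom (ζ t')) := by
  classical
  induction h with
  | @of t' h z =>
    have key : ∀ {Q : Operad k} (f : M.toSpecies ⟶ Q.toSpecies) (L : OperadAction Q I),
        treeVal _ t n (((genNested f L h).f n).hom z) = ∑ s : {t' : RTree I // t' ≤ t},
          treeVal _ t n (((genNested f L s.2).f n).hom ((Pi.single (⟨t', h⟩ : {t' // t' ≤ t}) z :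
            ∀ t' : {t' : RTree I // t' ≤ t}, (treeTensor M.toSpecies t'.1).X n) s)) := by
      intro Q f L
      rw [Finset.sum_eq_single (⟨t', h⟩ : {t' : RTree I // t' ≤ t})]
      · rw [Pi.single_eq_same]
      · intro s _ hs
        rw [Pi.single_eq_of_ne hs, map_zero, map_zero]
      · exact fun h => (h (Finset.mem_univ _)).elim
    exact ⟨_, key f L, key f' L'⟩
  | zero => exact ⟨fun _ => 0, by simp only [map_zero, Finset.sum_const_zero, and_self]⟩
  | add _ _ ih ih' =>
    obtain ⟨ζ, rfl, rfl⟩ := ih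
    obtain ⟨ξ, rfl, rfl⟩ := ih'
    refine ⟨fun t' => ζ t' + ξ t', ?_, ?_⟩ <;>
      simp only [map_add, Finset.sum_add_distrib]
  | smul r _ ih =>
    obtain ⟨ζ, rfl, rfl⟩ := ih
    refine ⟨fun t' => r • ζ t', ?_, ?_⟩ <;> simp only [map_smul, Finset.smul_sum]

/-- The images of the different `M(t')` in the operad of families of operators are linearly
independent. -/
lemma eq_zero_of_sum_genNested_fockGen (M : ConnSpecies k)
    (L : OperadAction (fockOperad (labelFam M.toSpecies)) I) {t : RTree I} {n : ℤ}
    (ζ : ∀ t' : {t' : RTree I // t' ≤ t}, (treeTensor M.toSpecies t'.1).X n)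
    (h : ∑ t', ((genNested (fockGen M) L t'.2).f n).hom (ζ t') = 0) (t') : ζ t' = 0 := by
  obtain ⟨j, hj⟩ := exists_injective_nat I
  have : Nontrivial I := by
    obtain ⟨x, -, y, -, hxy⟩ := t.nontrivial _ t.root_mem
    exact ⟨x, y, hxy⟩
  have hc := t.le_corolla
  -- After the contraction to a single vertex, the retraction that belongs to `t'` isolates one term.
  obtain ⟨ρ, hρ, hρ'⟩ := exists_retraction M hj L (t'.2.trans hc) rfl
  have e : ∀ s : {t' : RTree I // t' ≤ t},
      ((L.map hc).f n).hom (((genNested (fockGen M) L s.2).f n).hom (ζ s)) =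
        ((genNested (fockGen M) L (s.2.trans hc)).f n).hom (ζ s) := fun s => by
    rw [genNested, genNested, L.map_trans s.2 hc]
    rfl
  have h1 := congrArg (fun z => ρ (treeVal _ _ n (((L.map hc).f n).hom z))) h
  beta_reduce at h1
  rw [map_sum, map_sum, map_sum, map_zero, map_zero, map_zero, Finset.sum_eq_single t', e] at h1
  · exact treeVal_injective _ _ _ (((hρ n (ζ t')).symm.trans h1).trans (map_zero _).symm)
  · intro s _ hs
    rw [e]
    exact hρ' _ _ (fun e => hs (Subtype.ext e)) n (ζ s)
  · exact fun h => (h (Finset.mem_univ _)).elim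

end Sum

/-- In the operad generated by the creation operators, the only relations are those that hold in
every operad. -/
lemma Rel.eq_zero_of_fockGen {M : ConnSpecies k} {Q : Operad k} {f : M.toSpecies ⟶ Q.toSpecies}
    (hf : PreservesUnit f) {A : Type} [Finite A] {n : ℤ} {x' : Tot (Q.toSpecies.on A)}
    (h : Rel (fockGen M) f A n 0 x') : x' = 0 := by
  rcases subsingleton_or_nontrivial A with hA | hA
  · rcases isEmpty_or_nonempty A with hA' | ⟨⟨a⟩⟩
    · exact h.swap.of_isEmpty hA'
    · let _ : Unique A := ⟨⟨a⟩, fun b => hA.elim _ _⟩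
      obtain ⟨c, -, hc, hc'⟩ := h.of_unique (fun A _ _ => point_fockGen M A) hf inferInstance
      rcases smul_eq_zero.1 hc.symm with h0 | h0
      · rw [hc', h0, zero_smul]
      · exact (fockUnit_ne_zero A h0).elim
  · let c := RTree.corolla A
    have h1 : ∀ B : c.verts, Rel (fockGen M) f (c.In B.1) n 0
        (Q.toSpecies.act (RTree.corollaIn B) x') := fun B => by
      have := Rel.act (RTree.corollaIn B) h
      rwa [map_zero] at this
    -- The same sum over trees represents `0` in the operad of families of operators and `x'` in `Q`.
    have h2 := treeRel_tprod (L := operadAction _ A) (L' := operadAction Q A)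
      (fun B _ _ => point_fockGen M B) hf (deg := fun _ => n) h1
    obtain ⟨ζ, hζ, hζ'⟩ := h2.exists_sum
    have h0 : (PiTensorProduct.tprod k fun A_1 : c.verts =>
        (0 : Tot ((fockOperad (labelFam M.toSpecies)).toSpecies.on (c.In A_1.1)))) = 0 :=
      (PiTensorProduct.tprod k).map_coord_zero (default : c.verts) rfl
    rw [h0, ← map_sum, eq_comm] at hζ
    have h3 := eq_zero_of_sum_genNested_fockGen M _ ζ
      (treeVal_injective _ _ _ (hζ.trans (map_zero _).symm))
    simp only [h3, map_zero, Finset.sum_const_zero] at hζ'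
    have h4 := congrArg (PiTensorProduct.subsingletonEquiv (default : c.verts)) hζ'
    rw [map_zero] at h4
    have h5 := (PiTensorProduct.subsingletonEquiv_apply_tprod (R := k) (default : c.verts) _).symm.trans h4
    have h6 := congrArg (Q.toSpecies.act (RTree.corollaIn (default : c.verts)).symm) h5
    rw [map_zero] at h6
    refine Eq.trans ?_ h6
    refine Eq.trans ?_ (Species.act_act _ _ _ x').symm
    rw [Equiv.symm_trans_self, Species.act_refl]

/-! ### The universal property of the operad generated by the creation operators -/

section Lift

variable {M : ConnSpecies k} {Q : Operad k} {f : M.toSpecies ⟶ Q.toSpecies} (hf : PreservesUnit f)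
  (hQ : ∀ (A : Type) [Finite A] [Unique A], Mono (Q.unit A)) {P : ConnOperad k}

/-- Morphisms out of the operad generated by a species are determined by the generators. -/
lemma Rel.exists_eq {φ ψ : genOperad f hf hQ ⟶ P}
    (h : toGenOperad hf hQ ≫ (forgetOperad k).map φ = toGenOperad hf hQ ≫ (forgetOperad k).map ψ)
    {A : Type} [Finite A] {n : ℤ} {x y : Tot (Q.toSpecies.on A)} (hx : Rel f f A n x y) :
    ∃ z : Tot (genOn f A), Tot.map (genOnι f A) z = x ∧
      Tot.map (Species.app φ.hom A) z = Tot.map (Species.app ψ.hom A) z := by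
  induction hx with
  | of A n m =>
    refine ⟨Tot.map (genApp f A) (Tot.of _ n m), ?_, ?_⟩
    · rw [← LinearMap.comp_apply, ← Tot.map_comp, genApp_ι]
    · have h1 := congrArg (fun g => Tot.map (Species.app (ConnSpecies.Hom.hom g) A) (Tot.of _ n m)) h
      have key : ∀ φ : genOperad f hf hQ ⟶ P, Tot.map (Species.app (ConnSpecies.Hom.hom
          (toGenOperad hf hQ ≫ (forgetOperad k).map φ)) A) (Tot.of _ n m) =
            Tot.map (Species.app φ.hom A) (Tot.map (genApp f A) (Tot.of _ n m)) := fun φ =>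
        LinearMap.congr_fun (Tot.map_comp (genApp f A) (Species.app φ.hom A)) _
      exact (key φ).symm.trans (h1.trans (key ψ))
  | @act A B _ _ e n x x' _ ih =>
    obtain ⟨z, rfl, hz⟩ := ih
    refine ⟨(genSpecies f).act e z, map_genAlong f e z, ?_⟩
    have key : ∀ φ : genOperad f hf hQ ⟶ P, Tot.map (Species.app φ.hom A)
        ((genSpecies f).act e z) = P.toSpecies.act e (Tot.map (Species.app φ.hom B) z) := fun φ =>
      Species.map_act φ.hom e z
    rw [key, key, hz]
  | @comp A B _ _ i p q a a' b b' _ _ ih ih' =>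
    obtain ⟨z, rfl, hz⟩ := ih
    obtain ⟨z', rfl, hz'⟩ := ih'
    refine ⟨Tot.bil (genComp f A B i) z z', bil_genComp f i z z', ?_⟩
    have key : ∀ φ : genOperad f hf hQ ⟶ P, Tot.map (Species.app φ.hom (Insert i B))
        (Tot.bil (genComp f A B i) z z') = P.circ i (Tot.map (Species.app φ.hom A) z)
          (Tot.map (Species.app φ.hom B) z') := fun φ =>
      PreservesComp.circ (P := (genOperad f hf hQ).toOperad) (Q := P.toOperad) (f := φ.hom)
        (fun A B _ _ i => φ.comp_comm A B i) i z z'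
    rw [key, key, hz, hz']
  | zero A n => exact ⟨0, map_zero _, (map_zero (Tot.map (Species.app φ.hom A))).trans
      (map_zero (Tot.map (Species.app ψ.hom A))).symm⟩
  | @add A _ _ _ _ _ _ _ _ ih ih' =>
    obtain ⟨z, rfl, hz⟩ := ih
    obtain ⟨z', rfl, hz'⟩ := ih'
    exact ⟨z + z', map_add _ _ _, (map_add (Tot.map (Species.app φ.hom A)) z z').trans
      ((congrArg₂ (· + ·) hz hz').trans (map_add (Tot.map (Species.app ψ.hom A)) z z').symm)⟩
  | @smul A _ _ r _ _ _ ih =>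
    obtain ⟨z, rfl, hz⟩ := ih
    exact ⟨r • z, map_smul _ _ _, (map_smul (Tot.map (Species.app φ.hom A)) r z).trans
      ((congrArg (r • ·) hz).trans (map_smul (Tot.map (Species.app ψ.hom A)) r z).symm)⟩

lemma Species.hom_ext_tot {M N : Species k} {f g : M ⟶ N}
    (h : ∀ (A : Type) [Finite A] (n : ℤ) (x : (M.on A).X n),
      Tot.map (Species.app f A) (Tot.of _ n x) = Tot.map (Species.app g A) (Tot.of _ n x)) :
    f = g := by
  refine NatTrans.ext (funext fun A => ?_)
  obtain ⟨⟨A⟩⟩ := A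
  refine HomologicalComplex.hom_ext _ _ fun n => ModuleCat.hom_ext (LinearMap.ext fun x => ?_)
  have := h A n x
  rw [Tot.map_of, Tot.map_of] at this
  exact Tot.of_injective _ _ this

lemma genOperad_hom_ext {φ ψ : genOperad f hf hQ ⟶ P}
    (h : toGenOperad hf hQ ≫ (forgetOperad k).map φ = toGenOperad hf hQ ≫ (forgetOperad k).map ψ) :
    φ = ψ := by
  refine ConnOperad.Hom.ext (Species.hom_ext_tot fun A _ n x => ?_)
  obtain ⟨z, hz, hz'⟩ := (rel_genOnι f n x).exists_eq hf hQ h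
  have : z = Tot.of (genOn f A) n x := genOnι_injective f A
    (hz.trans (Tot.map_of (genOnι f A) n x).symm)
  rw [this] at hz'
  exact hz'

variable {f' : M.toSpecies ⟶ P.toSpecies}
  (H : ∀ (A : Type) [Finite A] (n : ℤ) (x : Tot (P.toSpecies.on A)), Rel f f' A n 0 x → x = 0)

include H in
lemma Rel.unique {A : Type} [Finite A] {n : ℤ} {x : Tot (Q.toSpecies.on A)}
    {y z : Tot (P.toSpecies.on A)} (hy : Rel f f' A n x y) (hz : Rel f f' A n x z) : y = z := by
  have h := Rel.add hy (Rel.smul (-1) hz)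
  rw [neg_one_smul, neg_one_smul, add_neg_cancel] at h
  exact add_neg_eq_zero.1 (H A n _ h)

lemma exists_rel_genOn (f' : M.toSpecies ⟶ P.toSpecies) {A : Type} [Finite A] (n : ℤ)
    (x : (genOn f A).X n) :
    ∃ y : (P.toSpecies.on A).X n, Rel f f' A n (Tot.map (genOnι f A) (Tot.of _ n x)) (Tot.of _ n y) := by
  obtain ⟨y, hy⟩ := (rel_genOnι f n x).exists f'
  obtain ⟨z, rfl⟩ := hy.swap.homog
  rw [Tot.map_of]
  exact ⟨z, hy⟩

/-- The value at `x` of the operad map that extends `f'`. -/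
def genLiftVal (f' : M.toSpecies ⟶ P.toSpecies) {A : Type} [Finite A] (n : ℤ)
    (x : (genOn f A).X n) : (P.toSpecies.on A).X n := (exists_rel_genOn f' n x).choose

lemma rel_genLiftVal (f' : M.toSpecies ⟶ P.toSpecies) {A : Type} [Finite A] (n : ℤ)
    (x : (genOn f A).X n) :
    Rel f f' A n (Tot.map (genOnι f A) (Tot.of _ n x)) (Tot.of _ n (genLiftVal f' n x)) :=
  (exists_rel_genOn f' n x).choose_spec

include H in
lemma eq_genLiftVal {A : Type} [Finite A] {n : ℤ} {x : (genOn f A).X n}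
    {y : (P.toSpecies.on A).X n}
    (h : Rel f f' A n (Tot.map (genOnι f A) (Tot.of _ n x)) (Tot.of _ n y)) :
    genLiftVal f' n x = y :=
  Tot.of_injective _ _ (Rel.unique H (rel_genLiftVal f' n x) h)

include H in
lemma genLiftVal_add {A : Type} [Finite A] {n : ℤ} (x y : (genOn f A).X n) :
    genLiftVal f' n (x + y) = genLiftVal f' n x + genLiftVal f' n y :=
  eq_genLiftVal H (by
    rw [map_add, map_add, map_add]
    exact .add (rel_genLiftVal f' n x) (rel_genLiftVal f' n y))

include H in
lemma genLiftVal_smul {A : Type} [Finite A] {n : ℤ} (r : k) (x : (genOn f A).X n) :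
    genLiftVal f' n (r • x) = r • genLiftVal f' n x :=
  eq_genLiftVal H (by
    rw [map_smul, map_smul, map_smul]
    exact .smul r (rel_genLiftVal f' n x))

/-- The components of the operad map that extends `f'`. -/
def genLiftApp (A : Type) [Finite A] : genOn f A ⟶ P.toSpecies.on A where
  f n := ModuleCat.ofHom
    { toFun := genLiftVal f' n
      map_add' := genLiftVal_add H
      map_smul' := genLiftVal_smul H }
  comm' n m hnm := by
    obtain rfl : n + 1 = m := hnm
    refine ModuleCat.hom_ext (LinearMap.ext fun x => (eq_genLiftVal H ?_).symm)
    have := (rel_genLiftVal f' n x).d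
    rw [Tot.d_map, Tot.d_of, Tot.d_of] at this
    exact this

lemma rel_genLiftApp {A : Type} [Finite A] (n : ℤ) (x : (genOn f A).X n) :
    Rel f f' A n (Tot.map (genOnι f A) (Tot.of _ n x)) (Tot.map (genLiftApp H A) (Tot.of _ n x)) := by
  rw [Tot.map_of (genLiftApp H A)]
  exact rel_genLiftVal f' n x

lemma genLiftApp_eq {A : Type} [Finite A] {n : ℤ} {x : (genOn f A).X n}
    {y : Tot (P.toSpecies.on A)} (h : Rel f f' A n (Tot.map (genOnι f A) (Tot.of _ n x)) y) :
    Tot.map (genLiftApp H A) (Tot.of _ n x) = y :=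
  Rel.unique H (rel_genLiftApp H n x) h

lemma genLiftApp_along {A B : Type} [Finite A] [Finite B] (e : A ≃ B) :
    genAlong f e ≫ genLiftApp H A = genLiftApp H B ≫ P.toSpecies.along e := by
  refine HomologicalComplex.hom_ext _ _ fun n => ModuleCat.hom_ext (LinearMap.ext fun x => ?_)
  refine Tot.of_injective _ _ ((Tot.map_of (genLiftApp H A) n _).symm.trans
    ((genLiftApp_eq H ?_).trans (Species.act_of P.toSpecies e n _)))
  have h := Rel.act e (rel_genLiftApp H n x)
  rw [← map_genAlong, Tot.map_of (genAlong f e), Tot.map_of (genLiftApp H B)] at h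
  exact h

lemma genLiftApp_comp (A B : Type) [Finite A] [Finite B] (i : A) :
    genComp f A B i ≫ genLiftApp H (Insert i B) =
      (genLiftApp H A ⊗ₘ genLiftApp H B) ≫ P.comp A B i := by
  refine tensor_hom_ext fun p x q y => ?_
  rw [Tot.bil_comp, Tot.bil_tensorHom]
  have h := Rel.comp i (rel_genLiftApp H p x) (rel_genLiftApp H q y)
  rw [← bil_genComp, Tot.bil_of] at h
  rw [Tot.bil_of]
  exact genLiftApp_eq H h

lemma genApp_genLiftApp (A : Type) [Finite A] :
    genApp f A ≫ genLiftApp H A = Species.app f' A := by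
  refine HomologicalComplex.hom_ext _ _ fun n => ModuleCat.hom_ext (LinearMap.ext fun x => ?_)
  refine Tot.of_injective _ _ ((Tot.map_of (genLiftApp H A) n _).symm.trans
    ((genLiftApp_eq H ?_).trans (Tot.map_of (Species.app f' A) n x)))
  have h := Rel.of (f := f) (f' := f') A n x
  rw [← genApp_ι, Tot.map_comp, LinearMap.comp_apply, Tot.map_of (genApp f A)] at h
  exact h

/-- The operad map that extends `f'`, if all relations between the values of `f` hold between the
values of `f'`. -/
def genLift (hf' : PreservesUnit (Q := P.toOperad) f') : genOperad f hf hQ ⟶ P where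
  hom :=
    { app := fun A => genLiftApp H A.unop.carrier
      naturality := fun A B e => genLiftApp_along H e.unop }
  comp_comm A B _ _ i := genLiftApp_comp H A B i
  unit_comm A _ _ := by
    refine (Category.assoc _ _ _).trans ?_
    exact (congrArg ((M.point A).hom ≫ ·) (genApp_genLiftApp H A)).trans (hf' A)

lemma toGenOperad_genLift (hf' : PreservesUnit (Q := P.toOperad) f') :
    (toGenOperad hf hQ ≫ (forgetOperad k).map (genLift hf hQ H hf')).hom = f' :=
  NatTrans.ext (funext fun A => genApp_genLiftApp H A.unop.carrier)

end Lift

section Free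

variable (M : ConnSpecies k)

lemma preservesUnit_fockGen : PreservesUnit (fockGen M) := fun A _ _ => point_fockGen M A

/-- The free operad of a connected species: the operad generated by the creation operators. -/
def freeOperad : ConnOperad k :=
  genOperad (fockGen M) (preservesUnit_fockGen M) fun A _ _ =>
    inferInstanceAs (Mono (fockUnit (labelFam M.toSpecies) A))

/-- The inclusion of the generators in the free operad. -/
def freeOperadUnit : M ⟶ (forgetOperad k).obj (freeOperad M) := toGenOperad _ _

variable {M} in
/-- The operad map that extends a map of species to an operad. -/
def freeOperadDesc {P : ConnOperad k} (g : M ⟶ (forgetOperad k).obj P) : freeOperad M ⟶ P :=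
  genLift (f' := g.hom) _ _ (fun _ _ _ _ h => h.eq_zero_of_fockGen (Q := P.toOperad)
    fun A _ _ => g.point_comp A) fun A _ _ => g.point_comp A

variable {M} in
lemma freeOperadUnit_desc {P : ConnOperad k} (g : M ⟶ (forgetOperad k).obj P) :
    freeOperadUnit M ≫ (forgetOperad k).map (freeOperadDesc g) = g :=
  ConnSpecies.Hom.ext (toGenOperad_genLift _ _ _ _)

/-- The free operad has the universal property. -/
def freeOperadIsInitial :
    IsInitial (StructuredArrow.mk (freeOperadUnit M) : StructuredArrow M (forgetOperad k)) :=
  IsInitial.ofUniqueHom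
    (fun Y => StructuredArrow.homMk (freeOperadDesc Y.hom) (freeOperadUnit_desc Y.hom))
    fun Y m => StructuredArrow.ext _ _ (genOperad_hom_ext _ _
      ((StructuredArrow.w m).trans (freeOperadUnit_desc Y.hom).symm))

lemma isRightAdjoint_forgetOperad : (forgetOperad k).IsRightAdjoint := by
  have : ∀ M : ConnSpecies k, HasInitial (StructuredArrow M (forgetOperad k)) := fun M =>
    (freeOperadIsInitial M).hasInitial
  exact isRightAdjointOfStructuredArrowInitials _

end Free

/-! ### Trees with vertices labelled by free operads -/

/-- Every element of a finite direct sum is the sum of its components. -/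
lemma exists_sigma_components {J : Type} [Fintype J] {X : J → DGVS k} (n : ℤ) (z : (∐ X).X n) :
    ∃ y : ∀ j, (X j).X n, ∀ {W : DGVS k} (a : ∐ X ⟶ W),
      (a.f n).hom z = ∑ j, ((Sigma.ι X j ≫ a).f n).hom (y j) := by
  classical
  refine ⟨fun j => ((Sigma.π X j).f n).hom z, fun {W} a => ?_⟩
  have h : a = ∑ j, Sigma.π X j ≫ Sigma.ι X j ≫ a := by
    refine Sigma.hom_ext _ _ fun i => ?_
    rw [Preadditive.comp_sum, Finset.sum_eq_single i]
    · rw [Sigma.ι_π_eq_id_assoc]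
    · intro j _ hj
      rw [← Category.assoc, Sigma.ι_π_of_ne X hj.symm, zero_comp]
    · exact fun h => (h (Finset.mem_univ i)).elim
  have h1 : ∀ (s : Finset J) (g : J → (∐ X ⟶ W)), ((∑ j ∈ s, g j).f n).hom z =
      ∑ j ∈ s, ((g j).f n).hom z := fun s g => by
    induction s using Finset.induction_on with
    | empty => simp
    | insert i s hi ih =>
      rw [Finset.sum_insert hi, Finset.sum_insert hi, ← ih]
      rfl
  conv_lhs => rw [h]
  rw [h1]
  rfl

lemma PreservesComp.comp {P Q R : Operad k} {f : P.toSpecies ⟶ Q.toSpecies}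
    {g : Q.toSpecies ⟶ R.toSpecies} (hf : PreservesComp f) (hg : PreservesComp g) :
    PreservesComp (f ≫ g) := fun A B _ _ i => by
  have hf := hf A B i
  have hg := hg A B i
  simp only [Species.app, NatTrans.comp_app] at hf hg ⊢
  rw [← Category.assoc, hf, Category.assoc, hg, ← Category.assoc,
    MonoidalCategory.tensorHom_comp_tensorHom]

section Iso

variable {I : Type} [Finite I]

/-- If an operad `Q` is generated by `M`, and if the generators of the operad of families of operators
are images of those of `Q`, then `Q(t)` is the direct sum of the `M(t')`. -/
lemma isIso_desc_genNested {M : ConnSpecies k} {Q : Operad k} {f : M.toSpecies ⟶ Q.toSpecies}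
    (hf : PreservesUnit f) (L : OperadAction Q I)
    (hs : ∀ (A : Type) [Finite A] (n : ℤ) (x : (Q.toSpecies.on A).X n),
      Rel f f A n (Tot.of _ n x) (Tot.of _ n x))
    {g : Q.toSpecies ⟶ (fockOperad (labelFam M.toSpecies)).toSpecies} (hg : PreservesComp g)
    (hfg : f ≫ g = fockGen M) (t : RTree I) :
    IsIso (Sigma.desc fun t' : {t' : RTree I // t' ≤ t} => genNested f L t'.2) := by
  refine isIso_of_bijective _ fun n => ⟨?_, fun w => ?_⟩
  · rw [injective_iff_map_eq_zero]
    intro z hz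
    obtain ⟨y, hy⟩ := exists_sigma_components n z
    rw [hy] at hz
    simp only [Sigma.ι_desc] at hz
    let L' := operadAction (fockOperad (labelFam M.toSpecies)) I
    have key : ∀ {t' : RTree I} (h : t' ≤ t),
        genNested f L h ≫ treeTensorMap g t = genNested (fockGen M) L' h := by
      intro t' h
      rw [genNested, genNested, Category.assoc, treeTensorMap_action hg L L' h, ← Category.assoc]
      refine congrArg (· ≫ L'.map h) ?_
      rw [← hfg]
      exact (piTensorMap_comp _ _).symm
    have hz' := congrArg ((treeTensorMap g t).f n).hom hz
    rw [map_sum, map_zero] at hz'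
    have h0 := eq_zero_of_sum_genNested_fockGen M L' y (by
        refine Eq.trans (Finset.sum_congr rfl fun t' _ => ?_) hz'
        rw [← key]
        rfl)
    refine (hy (𝟙 _)).trans (Finset.sum_eq_zero fun t' _ => ?_)
    rw [h0 t', map_zero]
  · have hw : TreeRel f f L L t n (treeVal _ t n w) (treeVal _ t n w) := by
      obtain ⟨w, hw⟩ := w
      change TreeRel f f L L t n w w
      induction hw using Submodule.span_induction with
      | mem z hz =>
        obtain ⟨deg, x, rfl, rfl⟩ := hz
        exact treeRel_tprod hf hf fun A => hs _ _ _
      | zero => exact .zero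
      | add a b _ _ ih ih' => exact .add ih ih'
      | smul r a _ ih => exact .smul r ih
    obtain ⟨ζ, hζ, -⟩ := hw.exists_sum
    refine ⟨∑ t', ((Sigma.ι (fun t' : {t' : RTree I // t' ≤ t} =>
        treeTensor M.toSpecies t'.1) t').f n).hom (ζ t'), ?_⟩
    rw [map_sum]
    refine treeVal_injective _ _ _ (Eq.trans ?_ hζ.symm)
    rw [map_sum]
    refine Finset.sum_congr rfl fun t' _ => congrArg _ ?_
    exact congrArg (fun g : treeTensor M.toSpecies t'.1 ⟶ treeTensor Q.toSpecies t => (g.f n).hom (ζ t')) (Sigma.ι_desc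
      (fun t' : {t' : RTree I // t' ≤ t} => genNested f L t'.2) t')

variable {Free : ConnSpecies k ⥤ ConnOperad k} (adj : Free ⊣ forgetOperad k)

lemma preservesUnit_hom {M : ConnSpecies k} {P : ConnOperad k} (g : M ⟶ (forgetOperad k).obj P) :
    PreservesUnit (Q := P.toOperad) g.hom := fun A _ _ => g.point_comp A

/-- A free operad is generated by the underlying species. -/
lemma rel_unit (M : ConnSpecies k) (A : Type) [Finite A] (n : ℤ)
    (x : ((Free.obj M).toSpecies.on A).X n) :
    Rel (Q := (Free.obj M).toOperad) (Q' := (Free.obj M).toOperad) (adj.unit.app M).hom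
      (adj.unit.app M).hom A n (Tot.of _ n x) (Tot.of _ n x) := by
  let η := adj.unit.app M
  have hη := preservesUnit_hom η
  have hQ : ∀ (A : Type) [Finite A] [Unique A], Mono ((Free.obj M).unit A) := fun A _ _ => by
    have := (Free.obj M).isIso_unit A
    infer_instance
  let G := genOperad (Q := (Free.obj M).toOperad) η.hom hη hQ
  let ι : G ⟶ Free.obj M :=
    ⟨genSpeciesι (Q := (Free.obj M).toOperad) η.hom, preservesComp_genSpeciesι hη hQ,
      fun A _ _ => genUnit_ι (Q := (Free.obj M).toOperad) η.hom hη A⟩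
  -- The universal property gives a section of the inclusion of the suboperad generated by `M`.
  let s : Free.obj M ⟶ G := (adj.homEquiv M G).symm (toGenOperad hη hQ)
  have hs : s ≫ ι = 𝟙 _ := by
    refine (adj.homEquiv _ _).injective ?_
    rw [adj.homEquiv_naturality_right, Equiv.apply_symm_apply, adj.homEquiv_id]
    exact ConnSpecies.Hom.ext rfl
  have hx : ((genOnι (Q := (Free.obj M).toOperad) η.hom A).f n).hom
      (((Species.app s.hom A).f n).hom x) = x :=
    congrArg (fun g => ((Species.app (ConnOperad.Hom.hom g) A).f n).hom x) hs
  have := rel_genOnι (Q := (Free.obj M).toOperad) η.hom n (((Species.app s.hom A).f n).hom x)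
  rw [hx] at this
  exact this

/-- `(ℱ M)(t)` is the direct sum of the `M(t')`. -/
lemma isIso_desc_nestedι (L : ∀ P : ConnOperad k, OperadAction P.toOperad I) (M : ConnSpecies k)
    (t : RTree I) :
    IsIso (Sigma.desc fun t' : {t' : RTree I // t' ≤ t} => nestedι adj L M t'.2) := by
  let G : Free.obj M ⟶ freeOperad M := (adj.homEquiv M _).symm (freeOperadUnit M)
  have hG : adj.unit.app M ≫ (forgetOperad k).map G = freeOperadUnit M := by
    exact (adj.homEquiv_unit ..).symm.trans ((adj.homEquiv M _).apply_symm_apply _)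
  refine isIso_desc_genNested (Q := (Free.obj M).toOperad) (f := (adj.unit.app M).hom)
    (preservesUnit_hom (adj.unit.app M)) (L (Free.obj M)) (rel_unit adj M)
    (g := G.hom ≫ genSpeciesι (fockGen M)) ?_ ?_ t
  · exact PreservesComp.comp (Q := (freeOperad M).toOperad) (fun A B _ _ i => G.comp_comm A B i)
      (preservesComp_genSpeciesι _ _)
  · exact congrArg (fun g => ConnSpecies.Hom.hom g ≫ genSpeciesι (fockGen M)) hG

end Iso

/-! ### The action of the free operad monad -/

section Lambda

variable {I : Type} [Finite I] {Free : ConnSpecies k ⥤ ConnOperad k}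
  (adj : Free ⊣ forgetOperad k) (L : ∀ P : ConnOperad k, OperadAction P.toOperad I)

lemma treeTensorMap_id (M : Species k) (t : RTree I) :
    treeTensorMap (𝟙 M) t = 𝟙 (treeTensor M t) := piTensorMap_id

lemma treeTensorMap_comp {M N P : Species k} (f : M ⟶ N) (g : N ⟶ P) (t : RTree I) :
    treeTensorMap (f ≫ g) t = treeTensorMap f t ≫ treeTensorMap g t := piTensorMap_comp _ _

lemma treeTensorMap_comp_cancel {M N : Species k} {f : M ⟶ N} {g : N ⟶ M} (h : f ≫ g = 𝟙 M)
    (t : RTree I) {Z : DGVS k} (c : treeTensor M t ⟶ Z) :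
    treeTensorMap f t ≫ treeTensorMap g t ≫ c = c := by
  rw [← Category.assoc, ← treeTensorMap_comp, h, treeTensorMap_id, Category.id_comp]

lemma treeTensorMap_operadHom {P Q : ConnOperad k} (g : P ⟶ Q) {t s : RTree I} (h : t ≤ s) :
    (L P).map h ≫ treeTensorMap g.hom s = treeTensorMap g.hom t ≫ (L Q).map h :=
  treeTensorMap_action (fun A B _ _ i => g.comp_comm A B i) (L P) (L Q) h

/-- The maps `m ↦ (t', E, m)` are natural in the species. -/
lemma nestedι_naturality {M N : ConnSpecies k} (f : M ⟶ N) {t' t : RTree I} (h : t' ≤ t) :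
    nestedι adj L M h ≫ treeTensorMap ((freeMonad adj).map f).hom t =
      treeTensorMap f.hom t' ≫ nestedι adj L N h := by
  have h1 : f.hom ≫ ((freeMonad adj).η.app N).hom =
      ((freeMonad adj).η.app M).hom ≫ (Free.map f).hom :=
    congrArg ConnSpecies.Hom.hom ((freeMonad adj).η.naturality f)
  refine (Category.assoc (treeTensorMap ((freeMonad adj).η.app M).hom t')
    ((L (Free.obj M)).map h) (treeTensorMap (Free.map f).hom t)).trans ?_
  refine (congrArg (treeTensorMap ((freeMonad adj).η.app M).hom t' ≫ ·)
    (treeTensorMap_operadHom L (Free.map f) h)).trans ?_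
  refine (Category.assoc _ _ _).symm.trans (Eq.trans ?_ (Category.assoc _ _ _))
  refine congrArg (· ≫ (L (Free.obj N)).map h) ?_
  refine (treeTensorMap_comp _ _ t').symm.trans (Eq.trans ?_ (treeTensorMap_comp _ _ t'))
  exact congrArg (fun g => treeTensorMap g t') h1.symm

lemma nestedι_refl (M : ConnSpecies k) (t : RTree I) :
    nestedι adj L M (le_refl t) = treeTensorMap ((freeMonad adj).η.app M).hom t := by
  rw [nestedι, OperadAction.map_refl]
  exact Category.comp_id _

/-- The counit evaluates `(t', E, p)` to the action of the contraction of `E` on `p`. -/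
lemma nestedι_counit (P : ConnOperad k) {t' t : RTree I} (h : t' ≤ t) :
    nestedι adj L ((forgetOperad k).obj P) h ≫ treeTensorMap (adj.counit.app P).hom t =
      (L P).map h := by
  refine (Category.assoc (treeTensorMap ((freeMonad adj).η.app _).hom t')
    ((L (Free.obj ((forgetOperad k).obj P))).map h)
    (treeTensorMap (adj.counit.app P).hom t)).trans ?_
  refine (congrArg (treeTensorMap ((freeMonad adj).η.app _).hom t' ≫ ·)
    (treeTensorMap_operadHom L (adj.counit.app P) h)).trans ?_
  have h1 : ((freeMonad adj).η.app ((forgetOperad k).obj P)).hom ≫ (adj.counit.app P).hom =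
      𝟙 P.toSpecies := congrArg ConnSpecies.Hom.hom (adj.right_triangle_components P)
  exact treeTensorMap_comp_cancel (N := (Free.obj ((forgetOperad k).obj P)).toSpecies) h1 t' _

/-- The multiplication of the monad composes nested trees: `(t', E', (t'', E'', m))` is sent to
`(t'', E' ⊔ E'', m)`. -/
lemma nestedι_mul (M : ConnSpecies k) {t'' t' t : RTree I} (h' : t'' ≤ t') (h : t' ≤ t) :
    nestedι adj L M h' ≫ nestedι adj L ((freeMonad adj).obj M) h ≫
      treeTensorMap ((freeMonad adj).μ.app M).hom t = nestedι adj L M (h'.trans h) := by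
  refine (congrArg (nestedι adj L M h' ≫ ·) (nestedι_counit adj L (Free.obj M) h)).trans ?_
  rw [nestedι, nestedι, (L (Free.obj M)).map_trans h' h]
  exact Category.assoc _ _ _

lemma nested_hom_ext {M : ConnSpecies k} {t : RTree I} {Y Z : DGVS k}
    {a b : treeTensor ((freeMonad adj).obj M).toSpecies t ⊗ Y ⟶ Z}
    (h : ∀ (t' : RTree I) (h : t' ≤ t), nestedι adj L M h ▷ Y ≫ a = nestedι adj L M h ▷ Y ≫ b) :
    a = b := by
  have := isIso_desc_nestedι adj L M t
  have := isIso_desc_whiskerRight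
    (fun t' : {t' : RTree I // t' ≤ t} => nestedι adj L M t'.2) Y
  rw [← cancel_epi (Sigma.desc fun t' : {t' : RTree I // t' ≤ t} => nestedι adj L M t'.2 ▷ Y)]
  refine Sigma.hom_ext _ _ fun t' => ?_
  rw [Sigma.ι_desc_assoc, Sigma.ι_desc_assoc]
  exact h t'.1 t'.2

/-- The morphism from `(ℱ M)(t) ⊗ Y` with given restrictions to the summands `M(t') ⊗ Y`. -/
def nestedDesc {M : ConnSpecies k} {t : RTree I} {Y Z : DGVS k}
    (a : ∀ t', t' ≤ t → (treeTensor M.toSpecies t' ⊗ Y ⟶ Z)) :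
    treeTensor ((freeMonad adj).obj M).toSpecies t ⊗ Y ⟶ Z :=
  have := isIso_desc_nestedι adj L M t
  have := isIso_desc_whiskerRight
    (fun t' : {t' : RTree I // t' ≤ t} => nestedι adj L M t'.2) Y
  inv (Sigma.desc fun t' : {t' : RTree I // t' ≤ t} => nestedι adj L M t'.2 ▷ Y) ≫
    Sigma.desc fun t' : {t' : RTree I // t' ≤ t} => a t'.1 t'.2

lemma nestedι_desc {M : ConnSpecies k} {t : RTree I} {Y Z : DGVS k}
    (a : ∀ t', t' ≤ t → (treeTensor M.toSpecies t' ⊗ Y ⟶ Z)) {t' : RTree I} (h : t' ≤ t) :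
    nestedι adj L M h ▷ Y ≫ nestedDesc adj L a = a t' h := by
  have := isIso_desc_nestedι adj L M t
  have := isIso_desc_whiskerRight
    (fun t' : {t' : RTree I // t' ≤ t} => nestedι adj L M t'.2) Y
  have e : nestedι adj L M h ▷ Y = Sigma.ι (fun t' : {t' : RTree I // t' ≤ t} =>
      treeTensor M.toSpecies t'.1 ⊗ Y) ⟨t', h⟩ ≫
        Sigma.desc fun t' : {t' : RTree I // t' ≤ t} => nestedι adj L M t'.2 ▷ Y :=
    (Sigma.ι_desc (fun t' : {t' : RTree I // t' ≤ t} => nestedι adj L M t'.2 ▷ Y) ⟨t', h⟩).symm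
  rw [e, nestedDesc, Category.assoc, IsIso.hom_inv_id_assoc, Sigma.ι_desc]

variable (R : RightModule k I)

lemma pi_hom_ext {M : ConnSpecies k} {Z : DGVS k} {a b : (piFunctor R).obj M ⟶ Z}
    (h : ∀ t, piι R M t ≫ a = piι R M t ≫ b) : a = b := Sigma.hom_ext _ _ h

lemma piι_map {M N : ConnSpecies k} (f : M ⟶ N) (t : RTree I) :
    piι R M t ≫ (piFunctor R).map f = treeTensorMap f.hom t ▷ R.obj (op t) ≫ piι R N t :=
  Limits.Sigma.ι_map (fun t => treeTensorMap f.hom t ▷ R.obj (op t)) t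

/-- The structural map of `π_I(R)`: `(t', E, m) ⊗ r ↦ m ⊗ E^* r`. -/
def lambdaApp (M : ConnSpecies k) :
    (piFunctor R).obj ((freeMonad adj).obj M) ⟶ (piFunctor R).obj M :=
  Sigma.desc fun _ => nestedDesc adj L fun t' h =>
    treeTensor M.toSpecies t' ◁ R.map (homOfLE h).op ≫ piι R M t'

lemma nestedι_lambdaApp (M : ConnSpecies k) {t' t : RTree I} (h : t' ≤ t) :
    nestedι adj L M h ▷ R.obj (op t) ≫ piι R ((freeMonad adj).obj M) t ≫ lambdaApp adj L R M =
      treeTensor M.toSpecies t' ◁ R.map (homOfLE h).op ≫ piι R M t' := by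
  have e : piι R ((freeMonad adj).obj M) t ≫ lambdaApp adj L R M = nestedDesc adj L fun t' h =>
      treeTensor M.toSpecies t' ◁ R.map (homOfLE h).op ≫ piι R M t' := Sigma.ι_desc _ _
  rw [e, nestedι_desc]

/-- The functor `π_I(R)` is a functor over the free operad monad. -/
def lambda : MonadFunctor (freeMonad adj) (piFunctor R) where
  act :=
    { app := lambdaApp adj L R
      naturality := fun M N f => by
        refine pi_hom_ext R fun t => nested_hom_ext adj L fun t' h => ?_
        refine Eq.trans (congrArg (nestedι adj L M h ▷ R.obj (op t) ≫ ·)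
          ((Category.assoc _ _ _).symm.trans ((congrArg (· ≫ lambdaApp adj L R N)
            (piι_map R ((freeMonad adj).map f) t)).trans (Category.assoc _ _ _)))) ?_
        rw [← Category.assoc, ← comp_whiskerRight, nestedι_naturality, comp_whiskerRight,
          Category.assoc, nestedι_lambdaApp, ← Category.assoc (piι R _ t)]
        have h1 := congrArg (· ≫ (piFunctor R).map f) (nestedι_lambdaApp adj L R M h)
        simp only [Category.assoc] at h1 ⊢
        refine Eq.trans ?_ h1.symm
        rw [piι_map, whisker_exchange_assoc] }
  act_unit M := by
    refine pi_hom_ext R fun t => ?_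
    rw [← Category.assoc, piι_map, ← nestedι_refl adj L, Category.assoc]
    refine (nestedι_lambdaApp adj L R M (le_refl t)).trans ?_
    have h1 : R.map (homOfLE (le_refl t)).op = 𝟙 _ := R.map_id _
    rw [h1, whiskerLeft_id, Category.id_comp]
    exact (Category.comp_id (piι R M t)).symm
  act_mul M := by
    refine pi_hom_ext R fun t => nested_hom_ext adj L fun t' h => nested_hom_ext adj L
      fun t'' h' => ?_
    have h1 : R.map (homOfLE (h'.trans h)).op = R.map (homOfLE h).op ≫ R.map (homOfLE h').op :=
      R.map_comp _ _
    refine Eq.trans (b := treeTensor M.toSpecies t'' ◁ R.map (homOfLE (h'.trans h)).op ≫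
      piι R M t'') ?_ (Eq.symm ?_)
    · rw [← Category.assoc (piι R _ t), piι_map, Category.assoc, ← comp_whiskerRight_assoc,
        ← comp_whiskerRight_assoc, Category.assoc, nestedι_mul]
      exact nestedι_lambdaApp adj L R M (h'.trans h)
    · have h2 := congrArg (· ≫ lambdaApp adj L R M)
        (nestedι_lambdaApp adj L R ((freeMonad adj).obj M) h)
      simp only [Category.assoc] at h2
      refine (congrArg (nestedι adj L M h' ▷ R.obj (op t) ≫ ·) h2).trans ?_
      rw [← whisker_exchange_assoc, nestedι_lambdaApp, h1, whiskerLeft_comp, Category.assoc]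

end Lambda

/-! ### Chains of contractions -/

section Chains

variable {I : Type}

/-- The chain obtained by the insertion of a tree in front. -/
def Chain.cons {n : ℕ} (t : RTree I) (c : Chain I n) (h : c.tree 0 ≤ t) : Chain I (n + 1) where
  toFun := Fin.cons (OrderDual.toDual t) c
  monotone' i j hij := by
    induction i using Fin.cases with
    | zero =>
      induction j using Fin.cases with
      | zero => exact le_rfl
      | succ j => exact le_trans (show OrderDual.toDual t ≤ c 0 from h) (c.monotone (Fin.zero_le j))
    | succ i =>
      induction j using Fin.cases with
      | zero => exact ((Fin.succ_pos i).not_ge hij).elim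
      | succ j => exact c.monotone (Fin.succ_le_succ_iff.1 hij)

/-- The chain that consists of a single tree. -/
def Chain.single (t : RTree I) : Chain I 0 := ⟨fun _ => OrderDual.toDual t, fun _ _ _ => le_rfl⟩

lemma Chain.exists_single (c : Chain I 0) : ∃ t, c = Chain.single t :=
  ⟨c.tree 0, OrderHom.ext _ _ (funext fun i => by rw [Fin.fin_one_eq_zero i]; rfl)⟩

lemma Chain.exists_cons {n : ℕ} (c : Chain I (n + 1)) :
    ∃ (t : RTree I) (c' : Chain I n) (h : c'.tree 0 ≤ t), c = Chain.cons t c' h :=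
  ⟨c.tree 0, c.pull (Fin.succOrderEmb (n + 1)).toOrderHom, c.tree_le (Fin.zero_le 1),
    OrderHom.ext _ _ (funext fun i => by induction i using Fin.cases <;> rfl)⟩

lemma Chain.cons_pull_δ_zero {n : ℕ} (t : RTree I) (c : Chain I n) (h : c.tree 0 ≤ t) :
    (Chain.cons t c h).pull (SimplexCategory.δ 0).toOrderHom = c :=
  OrderHom.ext _ _ (funext fun i => congrArg (Chain.cons t c h) (Fin.zero_succAbove i))

lemma Chain.cons_cons_pull_δ_one {n : ℕ} (t t' : RTree I) (c : Chain I n) (h' : c.tree 0 ≤ t')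
    (h : t' ≤ t) :
    (Chain.cons t (Chain.cons t' c h') h).pull (SimplexCategory.δ (Fin.succ 0)).toOrderHom =
      Chain.cons t c (h'.trans h) :=
  OrderHom.ext _ _ (funext fun i => by
    induction i using Fin.cases with
    | zero => exact congrArg (Chain.cons t (Chain.cons t' c h') h) (Fin.succ_succAbove_zero 0)
    | succ i =>
      refine (congrArg (Chain.cons t (Chain.cons t' c h') h) (Fin.succ_succAbove_succ 0 i)).trans ?_
      exact congrArg (Chain.cons t' c h') (Fin.zero_succAbove i))

lemma Chain.cons_single_pull_δ_one (t t' : RTree I) (h : t' ≤ t) :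
    (Chain.cons t (Chain.single t') h).pull (SimplexCategory.δ (Fin.succ 0)).toOrderHom =
      Chain.single t :=
  OrderHom.ext _ _ (funext fun i => by rw [Fin.fin_one_eq_zero i]; rfl)

lemma Chain.cons_pull_δ_succ {n : ℕ} (t : RTree I) (c : Chain I (n + 1)) (h : c.tree 0 ≤ t)
    (i : Fin (n + 2)) (d : Chain I n) (hd : c.pull (SimplexCategory.δ i).toOrderHom = d)
    (h' : d.tree 0 ≤ t) :
    (Chain.cons t c h).pull (SimplexCategory.δ i.succ).toOrderHom = Chain.cons t d h' := by
  subst hd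
  refine OrderHom.ext _ _ (funext fun j => ?_)
  induction j using Fin.cases with
  | zero => exact congrArg (Chain.cons t c h) (Fin.succ_succAbove_zero i)
  | succ j => exact congrArg (Chain.cons t c h) (Fin.succ_succAbove_succ i j)

lemma Chain.pull_σ_zero {n : ℕ} (c : Chain I n) :
    c.pull (SimplexCategory.σ 0).toOrderHom = Chain.cons (c.tree 0) c le_rfl :=
  OrderHom.ext _ _ (funext fun i => by
    induction i using Fin.cases with
    | zero => exact congrArg c (Fin.predAbove_right_zero (i := 0))
    | succ i => exact congrArg c (Fin.predAbove_succ_of_le _ _ (Fin.zero_le i)))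

lemma Chain.cons_pull_σ_succ {n : ℕ} (t : RTree I) (c : Chain I n) (h : c.tree 0 ≤ t)
    (i : Fin (n + 1)) (d : Chain I (n + 1)) (hd : c.pull (SimplexCategory.σ i).toOrderHom = d)
    (h' : d.tree 0 ≤ t) :
    (Chain.cons t c h).pull (SimplexCategory.σ i.succ).toOrderHom = Chain.cons t d h' := by
  subst hd
  refine OrderHom.ext _ _ (funext fun j => ?_)
  induction j using Fin.cases with
  | zero => exact congrArg (Chain.cons t c h) (Fin.predAbove_right_zero (i := i.succ))
  | succ j => exact congrArg (Chain.cons t c h) (Fin.succ_predAbove_succ i j)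

end Chains

/-! ### The comparison of the bar constructions -/

section Compare

variable {I : Type} [Finite I] {Free : ConnSpecies k ⥤ ConnOperad k}
  (adj : Free ⊣ forgetOperad k) (L : ∀ P : ConnOperad k, OperadAction P.toOperad I)
  (P : ConnOperad k)

lemma chainι_cons {n : ℕ} (t : RTree I) (c : Chain I n) (h : c.tree 0 ≤ t) :
    chainι adj L P (n + 1) (Chain.cons t c h) =
      chainι adj L P n c ≫ nestedι adj L (iter (operadAlgebra adj P) n) h := rfl

/-- The tensor product of two complexes, as a definition of its own, which keeps unification from
unfolding the tensor products when it compares the arguments. -/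
def tens (X Y : DGVS k) : DGVS k := X ⊗ Y

/-- The map `f ⊗ Y`, between tensor products in the sense of `tens`. -/
def tensMap {A B : DGVS k} (f : A ⟶ B) (Y : DGVS k) : tens A Y ⟶ tens B Y := f ▷ Y

lemma tensMap_comp_of_eq {A B C Y Z : DGVS k} {f : A ⟶ B} {g : B ⟶ C} {e : A ⟶ C}
    (h : e = f ≫ g) (a : tens C Y ⟶ Z) : tensMap e Y ≫ a = tensMap f Y ≫ tensMap g Y ≫ a := by
  subst h
  exact comp_whiskerRight_assoc f g Y a

lemma tensMap_id_comp {A Y Z : DGVS k} (a : tens A Y ⟶ Z) : tensMap (𝟙 A) Y ≫ a = a := by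
  refine (congrArg (· ≫ a) (id_whiskerRight A Y)).trans ?_
  exact Category.id_comp a

lemma tensMap_nested_ext {M : ConnSpecies k} {t : RTree I} {Y Z : DGVS k}
    {a b : tens (treeTensor ((freeMonad adj).obj M).toSpecies t) Y ⟶ Z}
    (h : ∀ (t' : RTree I) (h : t' ≤ t),
      tensMap (nestedι adj L M h) Y ≫ a = tensMap (nestedι adj L M h) Y ≫ b) : a = b :=
  nested_hom_ext adj L h

lemma exists_tensMap_nested_desc {M : ConnSpecies k} {t : RTree I} {Y Z : DGVS k}
    (a : ∀ t', t' ≤ t → (tens (treeTensor M.toSpecies t') Y ⟶ Z)) :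
    ∃ b : tens (treeTensor ((freeMonad adj).obj M).toSpecies t) Y ⟶ Z,
      ∀ (t' : RTree I) (h : t' ≤ t), tensMap (nestedι adj L M h) Y ≫ b = a t' h :=
  ⟨nestedDesc adj L a, fun _ h => nestedι_desc adj L a h⟩

/-- Maps out of the spaces `(ℱⁿ P)(t) ⊗ Y(t)` are determined by their restrictions to chains. -/
lemma chain_hom_ext {n : ℕ} {Y : RTree I → DGVS k} {Z : DGVS k}
    {a b : ∀ t, tens (treeTensor (iter (operadAlgebra adj P) n).toSpecies t) (Y t) ⟶ Z}
    (h : ∀ c : Chain I n, tensMap (chainι adj L P n c) (Y (c.tree 0)) ≫ a (c.tree 0) =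
      tensMap (chainι adj L P n c) (Y (c.tree 0)) ≫ b (c.tree 0)) : a = b := by
  classical
  induction n generalizing Y with
  | zero =>
    funext t
    exact (tensMap_id_comp (a t)).symm.trans
      ((h (Chain.single t)).trans (tensMap_id_comp (b t)))
  | succ n ih =>
    funext t
    refine tensMap_nested_ext adj L fun t' h' => ?_
    let r : (∀ t, tens (treeTensor (iter (operadAlgebra adj P) (n + 1)).toSpecies t) (Y t) ⟶ Z) →
        ∀ t', tens (treeTensor (iter (operadAlgebra adj P) n).toSpecies t') (Y t) ⟶ Z := fun a t' =>
      if h' : t' ≤ t then tensMap (nestedι adj L (iter (operadAlgebra adj P) n) h') (Y t) ≫ a t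
      else 0
    have hr : r a = r b := ih (Y := fun _ => Y t) fun c => by
      by_cases hc : c.tree 0 ≤ t
      · simp only [r, dif_pos hc]
        exact (tensMap_comp_of_eq (chainι_cons adj L P t c hc) (a t)).symm.trans
          ((h (Chain.cons t c hc)).trans (tensMap_comp_of_eq (chainι_cons adj L P t c hc) (b t)))
      · simp only [r, dif_neg hc]
    have h2 := congrFun hr t'
    simp only [r, dif_pos h'] at h2
    exact h2

/-- Maps out of the spaces `(ℱⁿ P)(t) ⊗ Y(t)` can be prescribed on chains. -/
lemma exists_chain_desc {n : ℕ} {Y : RTree I → DGVS k} {Z : DGVS k}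
    (g : ∀ c : Chain I n,
      tens (treeTensor P.toSpecies (c.tree (Fin.last n))) (Y (c.tree 0)) ⟶ Z) :
    ∃ a : ∀ t, tens (treeTensor (iter (operadAlgebra adj P) n).toSpecies t) (Y t) ⟶ Z,
      ∀ c : Chain I n, tensMap (chainι adj L P n c) (Y (c.tree 0)) ≫ a (c.tree 0) = g c := by
  classical
  induction n generalizing Y with
  | zero =>
    refine ⟨fun t => g (Chain.single t), fun c => ?_⟩
    obtain ⟨t, rfl⟩ := c.exists_single
    exact tensMap_id_comp (g (Chain.single t))
  | succ n ih =>
    choose a ha using fun t => ih (Y := fun _ => Y t) fun c =>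
      if h : c.tree 0 ≤ t then g (Chain.cons t c h) else 0
    choose b hb using fun t => exists_tensMap_nested_desc adj L
      (M := iter (operadAlgebra adj P) n) (t := t) fun t' _ => a t t'
    refine ⟨b, fun c => ?_⟩
    obtain ⟨t, c, h, rfl⟩ := c.exists_cons
    refine (tensMap_comp_of_eq (chainι_cons adj L P t c h) (b t)).trans ?_
    refine (congrArg (tensMap (chainι adj L P n c) (Y t) ≫ ·) (hb t (c.tree 0) h)).trans ?_
    exact (ha t c).trans (dif_pos h)

/-- The maps `m ↦ (t', E, m)` respect the identification of `M(t')` for equal trees. -/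
lemma eqToHom_nestedι {M : ConnSpecies k} {s s' t : RTree I} (e : s = s') (h : s ≤ t)
    (h' : s' ≤ t) :
    eqToHom (congrArg (treeTensor M.toSpecies) e) ≫ nestedι adj L M h' = nestedι adj L M h := by
  subst e
  exact Category.id_comp _

/-- The faces of the bar construction of the monad, other than the one given by `λ`, act on the
elements `(t; E₁, …, E_n, p)` by the faces of the chain. The tree at the beginning of the chain does
not change. -/
lemma chainι_iterFace {n : ℕ} (i : Fin (n + 1)) (c : Chain I (n + 1)) (d : Chain I n)
    (hd : c.pull (SimplexCategory.δ i.succ).toOrderHom = d)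
    (hl : c.tree (Fin.last (n + 1)) ≤ d.tree (Fin.last n)) :
    ∃ e : d.tree 0 = c.tree 0,
      chainι adj L P (n + 1) c ≫
          treeTensorMap (iterFace (operadAlgebra adj P) n i).hom (c.tree 0) =
        (L P).map hl ≫ chainι adj L P n d ≫ eqToHom (congrArg (treeTensor _) e) := by
  induction n with
  | zero =>
    obtain ⟨t, c, h, rfl⟩ := c.exists_cons
    obtain ⟨t', rfl⟩ := c.exists_single
    obtain rfl := (Fin.fin_one_eq_zero i).symm
    obtain rfl := (Chain.cons_single_pull_δ_one t t' h).symm.trans hd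
    refine ⟨rfl, ?_⟩
    replace h : t' ≤ t := h
    change (𝟙 (treeTensor P.toSpecies t') ≫ nestedι adj L ((forgetOperad k).obj P) h) ≫
      treeTensorMap (adj.counit.app P).hom t =
        (L P).map h ≫ 𝟙 (treeTensor P.toSpecies t) ≫ 𝟙 (treeTensor P.toSpecies t)
    refine (congrArg (· ≫ treeTensorMap (adj.counit.app P).hom t) (Category.id_comp _)).trans ?_
    refine (nestedι_counit adj L P h).trans ?_
    rw [Category.comp_id, Category.comp_id]
  | succ n ih =>
    obtain ⟨t, c, h, rfl⟩ := c.exists_cons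
    induction i using Fin.cases with
    | zero =>
      obtain ⟨t', c, h', rfl⟩ := c.exists_cons
      obtain rfl := (Chain.cons_cons_pull_δ_one t t' c h' h).symm.trans hd
      refine ⟨rfl, ?_⟩
      replace h : t' ≤ t := h
      change ((chainι adj L P n c ≫ nestedι adj L (iter (operadAlgebra adj P) n) h') ≫
          nestedι adj L ((freeMonad adj).obj (iter (operadAlgebra adj P) n)) h) ≫
            treeTensorMap ((freeMonad adj).μ.app (iter (operadAlgebra adj P) n)).hom t =
        (L P).map (le_refl (c.tree (Fin.last n))) ≫ (chainι adj L P n c ≫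
          nestedι adj L (iter (operadAlgebra adj P) n) (h'.trans h)) ≫ 𝟙 _
      rw [Category.assoc, Category.assoc, nestedι_mul, OperadAction.map_refl, Category.comp_id]
      exact (Category.id_comp _).symm
    | succ i =>
      obtain ⟨e, he⟩ := ih i c _ rfl (c.le_pull _)
      obtain rfl := (Chain.cons_pull_δ_succ t c h i.succ _ rfl (e.le.trans h)).symm.trans hd
      refine ⟨rfl, ?_⟩
      change (chainι adj L P (n + 1) c ≫ nestedι adj L (iter (operadAlgebra adj P) (n + 1)) h) ≫
          treeTensorMap ((freeMonad adj).map (iterFace (operadAlgebra adj P) n i)).hom t =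
        (L P).map (c.le_pull _) ≫ (chainι adj L P n _ ≫
          nestedι adj L (iter (operadAlgebra adj P) n) (e.le.trans h)) ≫ 𝟙 _
      rw [Category.assoc, nestedι_naturality, Category.comp_id, ← Category.assoc, he,
        ← eqToHom_nestedι adj L e (e.le.trans h) h]
      simp only [Category.assoc]

lemma chainι_unit {n : ℕ} (c : Chain I n) :
    chainι adj L P n c ≫
        treeTensorMap ((freeMonad adj).η.app (iter (operadAlgebra adj P) n)).hom (c.tree 0) =
      (L P).map (le_refl (c.tree (Fin.last n))) ≫
        chainι adj L P (n + 1) (Chain.cons (c.tree 0) c le_rfl) ≫ 𝟙 _ := by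
  rw [chainι_cons, OperadAction.map_refl, nestedι_refl]
  exact (Category.comp_id _).symm.trans (Category.id_comp _).symm

/-- The degeneracies act on the elements `(t; E₁, …, E_n, p)` by the degeneracies of the chain. -/
lemma chainι_iterDegen {n : ℕ} (i : Fin (n + 1)) (c : Chain I n) (d : Chain I (n + 1))
    (hd : c.pull (SimplexCategory.σ i).toOrderHom = d)
    (hl : c.tree (Fin.last n) ≤ d.tree (Fin.last (n + 1))) :
    ∃ e : d.tree 0 = c.tree 0,
      chainι adj L P n c ≫ treeTensorMap (iterDegen (operadAlgebra adj P) n i).hom (c.tree 0) =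
        (L P).map hl ≫ chainι adj L P (n + 1) d ≫ eqToHom (congrArg (treeTensor _) e) := by
  induction n with
  | zero =>
    obtain rfl := (Fin.fin_one_eq_zero i).symm
    obtain rfl := c.pull_σ_zero.symm.trans hd
    refine ⟨rfl, ?_⟩
    exact chainι_unit adj L P c
  | succ n ih =>
    induction i using Fin.cases with
    | zero =>
      obtain rfl := c.pull_σ_zero.symm.trans hd
      refine ⟨rfl, ?_⟩
      exact chainι_unit adj L P c
    | succ i =>
      obtain ⟨t, c, h, rfl⟩ := c.exists_cons
      obtain ⟨e, he⟩ := ih i c _ rfl (c.le_pull _)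
      obtain rfl := (Chain.cons_pull_σ_succ t c h i _ rfl (e.le.trans h)).symm.trans hd
      refine ⟨rfl, ?_⟩
      change (chainι adj L P n c ≫ nestedι adj L (iter (operadAlgebra adj P) n) h) ≫
          treeTensorMap ((freeMonad adj).map (iterDegen (operadAlgebra adj P) n i)).hom t =
        (L P).map (c.le_pull _) ≫ (chainι adj L P (n + 1) _ ≫
          nestedι adj L (iter (operadAlgebra adj P) (n + 1)) (e.le.trans h)) ≫ 𝟙 _
      rw [Category.assoc, nestedι_naturality, Category.comp_id, ← Category.assoc, he,
        ← eqToHom_nestedι adj L e (e.le.trans h) h]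
      simp only [Category.assoc]

end Compare

section BarIso

variable {I : Type} [Finite I] {Free : ConnSpecies k ⥤ ConnOperad k}
  (adj : Free ⊣ forgetOperad k) (L : ∀ P : ConnOperad k, OperadAction P.toOperad I)
  (R : RightModule k I) (P : ConnOperad k)

/-- The restriction of the comparison map to the summand of a chain, with the factors in the order
of `π_I(R)`. -/
def compareι {n : ℕ} (c : Chain I n) :
    treeTensor P.toSpecies (c.tree (Fin.last n)) ⊗ R.obj (op (c.tree 0)) ⟶
      (piFunctor R).obj (iter (operadAlgebra adj P) n) :=
  chainι adj L P n c ▷ R.obj (op (c.tree 0)) ≫ piι R _ (c.tree 0)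

/-- The comparison map of the bar constructions in degree `n`. -/
def compareHom (n : ℕ) : ∐ barTerm R (L P).toLeftModule (n := n) ⟶
    (piFunctor R).obj (iter (operadAlgebra adj P) n) :=
  Sigma.desc fun c => tensorSwap (compareι adj L R P c)

/-- The inclusion of the summand of a chain in the bar construction of the category of trees. -/
def barι {n : ℕ} (c : Chain I n) :
    R.obj (op (c.tree 0)) ⊗ treeTensor P.toSpecies (c.tree (Fin.last n)) ⟶
      ∐ barTerm R (L P).toLeftModule (n := n) := Sigma.ι (barTerm R (L P).toLeftModule) c

variable {L R P} in
lemma bar_hom_ext {n : ℕ} {Z : DGVS k} {a b : ∐ barTerm R (L P).toLeftModule (n := n) ⟶ Z}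
    (h : ∀ c, barι L R P c ≫ a = barι L R P c ≫ b) : a = b := Sigma.hom_ext _ _ h

lemma barι_map {n m : ℕ} (θ : SimplexCategory.mk m ⟶ SimplexCategory.mk n) (c : Chain I n) :
    barι L R P c ≫ (catBar R (L P).toLeftModule).map θ.op =
      (R.map (homOfLE (c.pull_le θ.toOrderHom)).op ⊗ₘ (L P).map (c.le_pull θ.toOrderHom)) ≫
        barι L R P (c.pull θ.toOrderHom) := Sigma.ι_desc _ _

lemma barι_compareHom {n : ℕ} (c : Chain I n) :
    barι L R P c ≫ compareHom adj L R P n = tensorSwap (compareι adj L R P c) := Sigma.ι_desc _ _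

instance (n : ℕ) : IsIso (compareHom adj L R P n) := by
  obtain ⟨a, ha⟩ := exists_chain_desc adj L P (n := n) (Y := fun t => R.obj (op t))
    fun c => tensorSwap (barι L R P c)
  replace ha : ∀ c : Chain I n, chainι adj L P n c ▷ R.obj (op (c.tree 0)) ≫ a (c.tree 0) =
    tensorSwap (barι L R P c) := ha
  let b : (piFunctor R).obj (iter (operadAlgebra adj P) n) ⟶
    ∐ barTerm R (L P).toLeftModule (n := n) := Sigma.desc a
  have hb : ∀ t, piι R (iter (operadAlgebra adj P) n) t ≫ b = a t := fun t => Sigma.ι_desc _ _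
  have hb' : ∀ c : Chain I n, compareι adj L R P c ≫ b = tensorSwap (barι L R P c) := fun c => by
    rw [compareι, Category.assoc, hb, ha]
  refine ⟨b, bar_hom_ext fun c => ?_, pi_hom_ext R fun t => ?_⟩
  · rw [← Category.assoc, barι_compareHom, ← tensorSwap_comp, hb', tensorSwap_tensorSwap,
      Category.comp_id]
  · refine congrFun (chain_hom_ext adj L P (Y := fun t => R.obj (op t))
      (a := fun t => piι R _ t ≫ b ≫ compareHom adj L R P n) (b := fun t => piι R _ t ≫ 𝟙 _)
      fun c => ?_) t
    have h1 : compareι adj L R P c ≫ b ≫ compareHom adj L R P n = compareι adj L R P c ≫ 𝟙 _ := by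
      rw [← Category.assoc, hb', ← tensorSwap_comp, barι_compareHom, tensorSwap_tensorSwap,
        Category.comp_id]
    rw [compareι, Category.assoc, Category.assoc] at h1
    exact h1

/-- The comparison isomorphism of the bar constructions in degree `n`. -/
def compareIso (n : ℕ) : ∐ barTerm R (L P).toLeftModule (n := n) ≅
    (piFunctor R).obj (iter (operadAlgebra adj P) n) := asIso (compareHom adj L R P n)

/-- It suffices to compare faces and degeneracies on the summands, with the factors in the order of
`π_I(R)`. -/
lemma compareHom_comp {n m : ℕ} (θ : SimplexCategory.mk m ⟶ SimplexCategory.mk n)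
    (g : (piFunctor R).obj (iter (operadAlgebra adj P) n) ⟶
      (piFunctor R).obj (iter (operadAlgebra adj P) m))
    (h : ∀ (c : Chain I n), compareι adj L R P c ≫ g =
      ((L P).map (c.le_pull θ.toOrderHom) ⊗ₘ
        R.map (homOfLE (c.pull_le θ.toOrderHom)).op) ≫ compareι adj L R P (c.pull θ.toOrderHom)) :
    compareHom adj L R P n ≫ g =
      (catBar R (L P).toLeftModule).map θ.op ≫ compareHom adj L R P m := by
  refine bar_hom_ext fun c => ?_
  refine Eq.trans ?_ ((congrArg (· ≫ compareHom adj L R P m) (barι_map L R P θ c)).symm.trans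
    (Category.assoc _ _ _))
  rw [← Category.assoc, barι_compareHom, ← tensorSwap_comp, h, tensorSwap_tensorHom, Category.assoc,
    barι_compareHom]

lemma piι_of_eq {M : ConnSpecies k} {s t : RTree I} (e : s = t) :
    eqToHom (congrArg (treeTensor M.toSpecies) e) ▷ R.obj (op t) ≫ piι R M t =
      treeTensor M.toSpecies s ◁ R.map (homOfLE e.le).op ≫ piι R M s := by
  subst e
  have h1 : R.map (homOfLE (le_refl s)).op = 𝟙 _ := R.map_id _
  rw [h1, eqToHom_refl, id_whiskerRight, whiskerLeft_id]

/-- The compatibility of the comparison maps with the maps `π_I(R)(f)`. -/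
lemma compareι_map {n m : ℕ} (c : Chain I n) (d : Chain I m)
    (f : iter (operadAlgebra adj P) n ⟶ iter (operadAlgebra adj P) m)
    (hl : c.tree (Fin.last n) ≤ d.tree (Fin.last m)) (h0 : d.tree 0 ≤ c.tree 0)
    (h : ∃ e : d.tree 0 = c.tree 0, chainι adj L P n c ≫ treeTensorMap f.hom (c.tree 0) =
      (L P).map hl ≫ chainι adj L P m d ≫ eqToHom (congrArg (treeTensor _) e)) :
    compareι adj L R P c ≫ (piFunctor R).map f =
      ((L P).map hl ⊗ₘ R.map (homOfLE h0).op) ≫ compareι adj L R P d := by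
  obtain ⟨e, h⟩ := h
  rw [compareι, compareι, Category.assoc, piι_map, ← comp_whiskerRight_assoc, h,
    comp_whiskerRight, comp_whiskerRight, Category.assoc, Category.assoc, piι_of_eq R e,
    MonoidalCategory.tensorHom_def, Category.assoc, ← whisker_exchange_assoc]

/-- The map `f ⊗ g`, between tensor products in the sense of `tens`. -/
def tensHom {A B Y Z : DGVS k} (f : A ⟶ B) (g : Y ⟶ Z) : tens A Y ⟶ tens B Z := f ⊗ₘ g

/-- The inclusion of a summand of `π_I(R)(M)`, with `tens` in its source. -/
def tensι (M : ConnSpecies k) (t : RTree I) :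
    tens (treeTensor M.toSpecies t) (R.obj (op t)) ⟶ (piFunctor R).obj M := piι R M t

lemma tensMap_comp_eq_tensHom {A B C Y Y' W Z : DGVS k} {f : A ⟶ B} {g : B ⟶ C} {e : A ⟶ C}
    (he : e = f ≫ g) {p : tens C Y ⟶ W} {a : W ⟶ Z} {r : Y ⟶ Y'} {q : tens B Y' ⟶ Z}
    (h : tensMap g Y ≫ p ≫ a = tensHom (𝟙 B) r ≫ q) {l : A ⟶ A} (hl : l = 𝟙 A) :
    tensMap e Y ≫ p ≫ a = tensHom l r ≫ tensMap f Y' ≫ q := by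
  subst he hl
  have h' : g ▷ Y ≫ (p : C ⊗ Y ⟶ W) ≫ a = B ◁ r ≫ (q : B ⊗ Y' ⟶ Z) :=
    Eq.trans h (congrArg (· ≫ (q : B ⊗ Y' ⟶ Z)) (id_tensorHom B r))
  change (f ≫ g) ▷ Y ≫ (p : C ⊗ Y ⟶ W) ≫ a = (𝟙 A ⊗ₘ r) ≫ f ▷ Y' ≫ (q : B ⊗ Y' ⟶ Z)
  rw [comp_whiskerRight, Category.assoc, h', id_tensorHom]
  exact (whisker_exchange_assoc f r (q : B ⊗ Y' ⟶ Z)).symm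

lemma tensMap_nestedι_lambdaApp (M : ConnSpecies k) {t' t : RTree I} (h : t' ≤ t) :
    tensMap (nestedι adj L M h) (R.obj (op t)) ≫ tensι R ((freeMonad adj).obj M) t ≫
      lambdaApp adj L R M = tensHom (𝟙 _) (R.map (homOfLE h).op) ≫ tensι R M t' :=
  (nestedι_lambdaApp adj L R M h).trans
    (congrArg (· ≫ piι R M t') (id_tensorHom (treeTensor M.toSpecies t') _).symm)

lemma tensMap_chainι_lambdaApp {n : ℕ} (c : Chain I (n + 1)) (d : Chain I n)
    (hd : c.pull (SimplexCategory.δ 0).toOrderHom = d)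
    (hl : c.tree (Fin.last (n + 1)) ≤ d.tree (Fin.last n)) (h0 : d.tree 0 ≤ c.tree 0) :
    tensMap (chainι adj L P (n + 1) c) (R.obj (op (c.tree 0))) ≫ tensι R _ (c.tree 0) ≫
        lambdaApp adj L R (iter (operadAlgebra adj P) n) =
      tensHom ((L P).map hl) (R.map (homOfLE h0).op) ≫
        tensMap (chainι adj L P n d) (R.obj (op (d.tree 0))) ≫ tensι R _ (d.tree 0) := by
  obtain ⟨t, c, h, rfl⟩ := c.exists_cons
  obtain rfl := (Chain.cons_pull_δ_zero t c h).symm.trans hd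
  exact tensMap_comp_eq_tensHom (chainι_cons adj L P t c h)
    (tensMap_nestedι_lambdaApp adj L R (iter (operadAlgebra adj P) n) h) ((L P).map_refl _)

/-- The comparison maps are compatible with the face given by `λ`. -/
lemma compareι_lambda {n : ℕ} (c : Chain I (n + 1)) (d : Chain I n)
    (hd : c.pull (SimplexCategory.δ 0).toOrderHom = d)
    (hl : c.tree (Fin.last (n + 1)) ≤ d.tree (Fin.last n)) (h0 : d.tree 0 ≤ c.tree 0) :
    compareι adj L R P c ≫ (lambda adj L R).act.app (iter (operadAlgebra adj P) n) =
      ((L P).map hl ⊗ₘ R.map (homOfLE h0).op) ≫ compareι adj L R P d :=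
  (Category.assoc _ _ _).trans (tensMap_chainι_lambdaApp adj L R P c d hd hl h0)

end BarIso

end TreeBar

end

theorem mainTheorem7 (k : Type*) [Field k] (I : Type) [Finite I] :
    -- every operad has a unique structure of left module that extends its partial compositions
    (∀ P : TreeBar.ConnOperad k, Nonempty (Unique (TreeBar.OperadAction P.toOperad I))) ∧
    -- the forgetful functor from connected operads to connected species has a left adjoint
    (TreeBar.forgetOperad k).IsRightAdjoint ∧
    ∀ (Free : TreeBar.ConnSpecies k ⥤ TreeBar.ConnOperad k) (adj : Free ⊣ TreeBar.forgetOperad k)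
      (L : ∀ P : TreeBar.ConnOperad k, TreeBar.OperadAction P.toOperad I),
      -- `(ℱ M)(t)` is the direct sum of the `M(t')` over the pairs `(t', E)` with `t' / E = t`
      (∀ (M : TreeBar.ConnSpecies k) (t : TreeBar.RTree I),
        IsIso (Sigma.desc fun t' : {t' : TreeBar.RTree I // t' ≤ t} =>
          TreeBar.nestedι adj L M t'.2)) ∧
      ∀ R : TreeBar.RightModule k I,
        -- `π_I(R)` is an `ℱ`-functor, with structural map `(t', E, m) ⊗ r ↦ m ⊗ E^* r`
        ∃ Λ : TreeBar.MonadFunctor (TreeBar.freeMonad adj) (TreeBar.piFunctor R),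
          (∀ (M : TreeBar.ConnSpecies k) (t' t : TreeBar.RTree I) (h : t' ≤ t),
            TreeBar.nestedι adj L M h ▷ R.obj (op t) ≫
                TreeBar.piι R ((TreeBar.freeMonad adj).obj M) t ≫ Λ.act.app M =
              TreeBar.treeTensor M.toSpecies t' ◁ R.map (homOfLE h).op ≫ TreeBar.piι R M t') ∧
          -- `B(R, 𝒯_I, P) = B(π_I(R), ℱ, P)` as simplicial objects, for every operad `P`, by the
          -- isomorphism `r ⊗ (E₁, …, E_n) ⊗ p ↦ ± (t; E₁, …, E_n, p) ⊗ r`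
          ∀ P : TreeBar.ConnOperad k,
            ∃ φ : ∀ n : ℕ, (TreeBar.catBar R (L P).toLeftModule).obj (op (SimplexCategory.mk n)) ≅
                TreeBar.monadBar Λ (TreeBar.operadAlgebra adj P) n,
              (∀ (n : ℕ) (c : TreeBar.Chain I n),
                TreeBar.IsSwapOf
                  (Sigma.ι (TreeBar.barTerm R (L P).toLeftModule) c ≫ (φ n).hom)
                  (TreeBar.chainι adj L P n c ▷ R.obj (op (c.tree 0)) ≫
                    TreeBar.piι R _ (c.tree 0))) ∧
              (∀ (n : ℕ) (i : Fin (n + 2)),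
                (φ (n + 1)).hom ≫ TreeBar.monadBarFace Λ (TreeBar.operadAlgebra adj P) n i =
                  (TreeBar.catBar R (L P).toLeftModule).δ i ≫ (φ n).hom) ∧
              (∀ (n : ℕ) (i : Fin (n + 1)),
                (φ n).hom ≫ TreeBar.monadBarDegen Λ (TreeBar.operadAlgebra adj P) n i =
                  (TreeBar.catBar R (L P).toLeftModule).σ i ≫ (φ (n + 1)).hom) := by
  refine ⟨fun P => ⟨⟨⟨TreeBar.operadAction P.toOperad I⟩, fun L => Subsingleton.elim _ _⟩⟩,
    TreeBar.isRightAdjoint_forgetOperad, fun Free adj L =>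
      ⟨TreeBar.isIso_desc_nestedι adj L, fun R =>
        ⟨TreeBar.lambda adj L R, fun M t' t h => TreeBar.nestedι_lambdaApp adj L R M h, fun P =>
          ⟨TreeBar.compareIso adj L R P, fun n c => ?_, fun n i => ?_,
            fun n i => ?_⟩⟩⟩⟩
  · have h := TreeBar.isSwapOf_tensorSwap (TreeBar.compareι adj L R P c)
    rw [← TreeBar.barι_compareHom] at h
    exact h
  · refine TreeBar.compareHom_comp adj L R P (SimplexCategory.δ i) _ fun c => ?_
    induction i using Fin.cases with
    | zero => exact TreeBar.compareι_lambda adj L R P c _ rfl (c.le_pull _) (c.pull_le _)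
    | succ i =>
      exact TreeBar.compareι_map adj L R P c _ _ (c.le_pull _) (c.pull_le _)
        (TreeBar.chainι_iterFace adj L P i c _ rfl (c.le_pull _))
  · refine TreeBar.compareHom_comp adj L R P (SimplexCategory.σ i) _ fun c => ?_
    exact TreeBar.compareι_map adj L R P c _ _ (c.le_pull _) (c.pull_le _)
      (TreeBar.chainι_iterDegen adj L P i c _ rfl (c.le_pull _))
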